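/- **Conventions.** Manifolds are smooth, Hausdorff, second countable, finite-dimensional and without boundary, and so are Lie groups. $\Omega^k(U)$ denotes the smooth $k$-forms on $U$. A *differential system* on $M$ is a graded ideal of $\Omega^*(M)$ closed under $d$; it is regarded as a sheaf, so that it restricts to open sets. A *Pfaffian system* is a smooth constant rank subbundle $V\subset T^*M$; the calligraphic letter $\mathcal V$ denotes the differential system generated by its sections. A subbundle $F\subset T^*M$ is *integrable* if $d\theta\equiv 0 \bmod F$ for all local sections $\theta$ of $F$. $V^{(\infty)}$ denotes the largest integrable subbundle of $V$, i.e. an integrable subbundle of $V$ that over every open set contains every integrable subbundle of $V$. *Darboux pair.* Pfaffian systems $\hat V,\check V$ on $M$ for which $\hat V^{(\infty)},\check V^{(\infty)}$ exist form a Darboux pair if $\hat V+\check V^{(\infty)}=T^*M=\check V+\hat V^{(\infty)}$, $\hat V^{(\infty)}\cap\check V^{(\infty)}=0$, and $d\omega\in\Omega^2(\hat V)+\Omega^2(\check V)$ for all local sections $\omega$ of $\hat V\cap\check V$, where $\Omega^2(A)$ denotes the sections of $\Lambda^2A$. *Decomposable.* A differential system $\mathcal I$ is decomposable of type $[p,q]$,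 $p,q\ge2$, with singular systems $\hat{\mathcal V},\check{\mathcal V}$, if about each point $x$ there are a coframe $\tilde\theta^1,\dots,\tilde\theta^r,\hat\sigma^1,\dots,\hat\sigma^p,\check\sigma^1,\dots,\check\sigma^q$ and 2-forms $\hat\Omega^1,\dots,\hat\Omega^s\in\Omega^2(\hat\sigma)$, $\check\Omega^1,\dots,\check\Omega^t\in\Omega^2(\check\sigma)$ with $s,t\ge1$, none of which vanishes identically near $x$, such that near $x$ the systems $\mathcal I$, $\hat{\mathcal V}$, $\check{\mathcal V}$ are algebraically generated by $\{\tilde\theta,\hat\Omega,\check\Omega\}$, $\{\tilde\theta,\hat\sigma,\check\Omega\}$ and $\{\tilde\theta,\check\sigma,\hat\Omega\}$ respectively. A decomposable $\mathcal I$ is *Darboux integrable with respect to* $\{\hat V,\check V\}$ if its singular systems are the differential systems generated by the Pfaffian systems $\hat V,\check V$ and $\{\hat V,\check V\}$ is a Darboux pair. *Quotients.* A smooth action of $G$ on $M$ is *regular* if the orbit space $\bar M=M/G$ is a Hausdorff manifold such that the projection $\mathbf q:M\to \bar M$ is a smooth submersion. Then $\mathcal I/G=\{\omega\in\Omega^*(\bar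 M)\mid \mathbf q^*\omega\in\mathcal I\}$ for a differential system $\mathcal I$, and $W/G=\{\omega\in\Lambda^1(\bar M)\mid\mathbf q^*\omega\in W\}$ for a $G$-invariant subbundle $W\subset T^*M$ (fibrewise). $G$ is *transverse* to $W$ if $\Gamma_x\cap\operatorname{ann}W_x=0$ for all $x$, where $\Gamma_x\subset T_xM$ consists of the values at $x$ of the infinitesimal generators. $\mathcal W_1+\mathcal W_2$ is the differential system on $M_1\times M_2$ generated by the pullbacks of $\mathcal W_1$ and $\mathcal W_2$. *The operation $\boxplus$.* An integral element of $\mathcal I$ at $x$ is a subspace of $T_xM$ on which all forms of $\mathcal I$ vanish. $\mathcal A\boxplus\mathcal B$ is the largest differential system vanishing on all integral elements of $\mathcal A$, all integral elements of $\mathcal B$, and all sums of an integral element of $\mathcal A$ and an integral element of $\mathcal B$ at the same point. **Corollary 3.4.** Let $W_1$ and $W_2$ be nonzero Pfaffian systems on manifolds $M_1$ and $M_2$ with $W_1^{(\infty)}=W_2^{(\infty)}=0$. Suppose that a Lie group $G$ acts smoothly and freely on $M_1$ and on $M_2$, by symmetries of $W_1$ and of $W_2$ respectively; that $G$ is transverse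 to both $W_1$ and $W_2$; and that the diagonal action of $G$ on $M_1\times M_2$ is regular. Then the quotient differential system $$\mathcal J=(\mathcal W_1+\mathcal W_2)/G$$ on $(M_1\times M_2)/G$ is a decomposable, Darboux integrable differential system with respect to the Darboux pair $$\hat U=(W_1\oplus\Lambda^1(M_2))/G,\qquad \check U=(\Lambda^1(M_1)\oplus W_2)/G .$$ **Theorem 3.3.** Let $\{\hat W,\check W\}$ be a Darboux pair on a manifold $M$. Suppose that a Lie group $G$ acts regularly on $M$ by symmetries of $\hat W$ and of $\check W$, and that $G$ is transverse to $\hat W^{(\infty)}\cap\check W$ and to $\hat W\cap\check W^{(\infty)}$. Then $$(\hat{\mathcal W}\boxplus\check{\mathcal W})/G=(\hat{\mathcal W}/G)\boxplus(\check{\mathcal W}/G).$$ -/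

import Mathlib

open Set
open scoped Manifold ContDiff

noncomputable section

namespace EDS

section LinearAlgebra

variable {V : Type*} [AddCommGroup V] [Module ℝ V] [TopologicalSpace V]

theorem continuous_domCoprod {k l : ℕ} (α : V [⋀^Fin k]→L[ℝ] ℝ) (β : V [⋀^Fin l]→L[ℝ] ℝ) :
    Continuous fun v : Fin (k + l) → V =>
      LinearMap.mul' ℝ ℝ (α.toAlternatingMap.domCoprod β.toAlternatingMap
        fun i => v (finSumFinEquiv i)) := by
  simp only [AlternatingMap.domCoprod_apply, sum_apply, map_sum]
  refine continuous_finsetSum _ fun σ _ => ?_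
  induction σ using Quotient.inductionOn' with | _ σ
  rw [AlternatingMap.domCoprod.summand_mk'']
  have h : Continuous fun v : Fin (k + l) → V =>
      Equiv.Perm.sign σ • (α (fun i => v (finSumFinEquiv (σ (Sum.inl i)))) *
        β (fun j => v (finSumFinEquiv (σ (Sum.inr j))))) :=
    Continuous.const_smul ((α.cont.comp (continuous_pi fun _ => continuous_apply _)).mul
      (β.cont.comp (continuous_pi fun _ => continuous_apply _))) _
  refine h.congr fun v => ?_
  rcases Int.units_eq_one_or (Equiv.Perm.sign σ) with hs | hs <;> rw [hs] <;> simp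

/-- The wedge product of alternating forms, `(α ∧ β)(v) = ∑ sign(σ) α(v_σ(1), …) β(v_σ(k+1), …)`,
the sum being over `(k,l)`-shuffles. It is the coproduct of alternating maps of Mathlib, followed by
multiplication in `ℝ`. -/
def wedge {k l : ℕ} (α : V [⋀^Fin k]→L[ℝ] ℝ) (β : V [⋀^Fin l]→L[ℝ] ℝ) :
    V [⋀^Fin (k + l)]→L[ℝ] ℝ :=
  { ((LinearMap.mul' ℝ ℝ).compAlternatingMap
      (α.toAlternatingMap.domCoprod β.toAlternatingMap)).domDomCongr finSumFinEquiv with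
    cont := continuous_domCoprod α β }

/-- `Λ²(A)`, for a subspace `A` of the dual space (covectors being alternating 1-forms):
the span of the products `a ∧ b` with `a, b ∈ A`. -/
def Lambda2 (A : Submodule ℝ (V [⋀^Fin 1]→L[ℝ] ℝ)) : Submodule ℝ (V [⋀^Fin 2]→L[ℝ] ℝ) :=
  Submodule.span ℝ {η | ∃ a ∈ A, ∃ b ∈ A, η = wedge a b}

/-- The form `φ` vanishes on the subspace `P`. -/
def VanishesOn {k : ℕ} (φ : V [⋀^Fin k]→L[ℝ] ℝ) (P : Submodule ℝ V) : Prop :=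
  ∀ v : Fin k → V, (∀ i, v i ∈ P) → φ v = 0

end LinearAlgebra

/-! ### Differential forms on a manifold without boundary -/

section Forms

variable {E : Type*} [NormedAddCommGroup E] [NormedSpace ℝ E]
  {H : Type*} [TopologicalSpace H] (I : ModelWithCorners ℝ E H)
  (M : Type*) [TopologicalSpace M] [ChartedSpace H M]

/-- Differential forms of degree `k` (no smoothness required). A form on an open set `U` is
represented by any extension to `M`; its values off `U` are irrelevant. -/
abbrev DForm (k : ℕ) : Type _ := ∀ x : M, (TangentSpace I x) [⋀^Fin k]→L[ℝ] ℝ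

/-- Fields of subspaces of the cotangent spaces. -/
abbrev CoField : Type _ := ∀ x : M, Submodule ℝ ((TangentSpace I x) [⋀^Fin 1]→L[ℝ] ℝ)

/-- Families `𝓘` that assign to a set `U` (only open sets matter) and a degree `k` a set
`𝓘 U k` of `k`-forms on `U`. -/
abbrev FormSystem : Type _ := Set M → ∀ k : ℕ, Set (DForm I M k)

variable {M}

/-- The expression of a form in the chart at `x₀`, i.e. its pullback by the inverse of that chart. -/
def inChart {k : ℕ} (x₀ : M) (φ : DForm I M k) : E → E [⋀^Fin k]→L[ℝ] ℝ := fun y =>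
  (φ ((extChartAt I x₀).symm y)).compContinuousLinearMap
    (mfderiv 𝓘(ℝ, E) I (extChartAt I x₀).symm y)

/-- The form `φ` is smooth on the (open) set `U`. -/
def SmoothOn {k : ℕ} (U : Set M) (φ : DForm I M k) : Prop :=
  ∀ x ∈ U, ContDiffAt ℝ ∞ (inChart I x φ) (extChartAt I x x)

/-- The exterior derivative, computed at `x` in the chart at `x`, through which Mathlib identifies
the tangent space at `x` with `E`. -/
def extd {k : ℕ} (φ : DForm I M k) : DForm I M (k + 1) := fun x =>
  (extDeriv (inChart I x φ) (extChartAt I x x) : E [⋀^Fin (k + 1)]→L[ℝ] ℝ)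

/-! ### Differential systems

Differential systems are graded differential ideals; they are handled as sheaves, so that they can
be restricted to open sets. -/

/-- `𝓘` is a differential system: a sheaf of graded ideals of smooth forms, closed under the exterior
derivative. -/
structure IsDifferentialSystem (𝓘 : FormSystem I M) : Prop where
  smooth : ∀ U, IsOpen U → ∀ k, ∀ φ ∈ 𝓘 U k, SmoothOn I U φ
  congr : ∀ U, IsOpen U → ∀ k, ∀ φ ∈ 𝓘 U k, ∀ η : DForm I M k, (∀ x ∈ U, φ x = η x) → η ∈ 𝓘 U k
  restrict : ∀ U V, IsOpen U → IsOpen V → V ⊆ U → ∀ k, 𝓘 U k ⊆ 𝓘 V k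
  glue : ∀ U, IsOpen U → ∀ k, ∀ φ : DForm I M k,
    (∀ x ∈ U, ∃ V, IsOpen V ∧ x ∈ V ∧ V ⊆ U ∧ φ ∈ 𝓘 V k) → φ ∈ 𝓘 U k
  zero : ∀ U, IsOpen U → ∀ k, (0 : DForm I M k) ∈ 𝓘 U k
  add : ∀ U, IsOpen U → ∀ k, ∀ φ ∈ 𝓘 U k, ∀ η ∈ 𝓘 U k, φ + η ∈ 𝓘 U k
  smul : ∀ U, IsOpen U → ∀ k, ∀ f : M → ℝ, ContMDiffOn I 𝓘(ℝ, ℝ) ∞ f U → ∀ φ ∈ 𝓘 U k,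
    (fun x => f x • φ x) ∈ 𝓘 U k
  wedge_mem : ∀ U, IsOpen U → ∀ k l, ∀ α : DForm I M k, SmoothOn I U α → ∀ φ ∈ 𝓘 U l,
    (fun x => wedge (α x) (φ x)) ∈ 𝓘 U (k + l)
  extd_mem : ∀ U, IsOpen U → ∀ k, ∀ φ ∈ 𝓘 U k, extd I φ ∈ 𝓘 U (k + 1)

/-- `AlgIdeal I U S k φ`: on the open set `U`, the `k`-form `φ` belongs to the homogeneous ideal of
the algebra of smooth forms on `U` that is algebraically generated by the forms in `S`. -/
inductive AlgIdeal (U : Set M) (S : ∀ k : ℕ, Set (DForm I M k)) : ∀ k : ℕ, DForm I M k → Prop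
  | gen (k : ℕ) (φ : DForm I M k) : φ ∈ S k → AlgIdeal U S k φ
  | zero (k : ℕ) : AlgIdeal U S k 0
  | add (k : ℕ) (φ η : DForm I M k) :
      AlgIdeal U S k φ → AlgIdeal U S k η → AlgIdeal U S k (φ + η)
  | smul (k : ℕ) (f : M → ℝ) (φ : DForm I M k) : ContMDiffOn I 𝓘(ℝ, ℝ) ∞ f U →
      AlgIdeal U S k φ → AlgIdeal U S k (fun x => f x • φ x)
  | wedge_mul (k l : ℕ) (α : DForm I M k) (φ : DForm I M l) : SmoothOn I U α →
      AlgIdeal U S l φ → AlgIdeal U S (k + l) (fun x => wedge (α x) (φ x))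
  | congr (k : ℕ) (φ η : DForm I M k) : (∀ x ∈ U, φ x = η x) →
      AlgIdeal U S k φ → AlgIdeal U S k η

/-- The sheaf of ideals algebraically generated by the forms in `S V` (`V` open). -/
def generated (S : FormSystem I M) : FormSystem I M := fun U k =>
  {φ | SmoothOn I U φ ∧ ∀ x ∈ U, ∃ V, IsOpen V ∧ x ∈ V ∧ V ⊆ U ∧ AlgIdeal I V (S V) k φ}

/-- A set of 1-forms and a set of 2-forms, as a graded set of forms. -/
def gens12 (S₁ : Set (DForm I M 1)) (S₂ : Set (DForm I M 2)) : ∀ k : ℕ, Set (DForm I M k)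
  | 1 => S₁
  | 2 => S₂
  | _ => ∅

/-- On the open set `U`, `𝓘` is algebraically generated by the 1-forms `S₁` and the 2-forms `S₂`. -/
def AlgGeneratedOn (U : Set M) (𝓘 : FormSystem I M) (S₁ : Set (DForm I M 1))
    (S₂ : Set (DForm I M 2)) : Prop :=
  ∀ V, IsOpen V → V ⊆ U → ∀ k, 𝓘 V k = generated I (fun _ => gens12 I S₁ S₂) V k

/-! ### Pfaffian systems -/

/-- The sections of `W` over the open set `U`. -/
def sections (W : CoField I M) (U : Set M) : Set (DForm I M 1) :=
  {θ | SmoothOn I U θ ∧ ∀ x ∈ U, θ x ∈ W x}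

/-- `W` is a smooth, constant rank subbundle of the cotangent bundle over the open set `U`. -/
def IsSubbundleOn (U : Set M) (W : CoField I M) : Prop :=
  ∃ r : ℕ, ∀ x ∈ U, ∃ V, IsOpen V ∧ x ∈ V ∧ V ⊆ U ∧ ∃ θ : Fin r → DForm I M 1,
    (∀ i, SmoothOn I V (θ i)) ∧
    ∀ y ∈ V, LinearIndependent ℝ (fun i => θ i y) ∧ Submodule.span ℝ (range fun i => θ i y) = W y

/-- A Pfaffian system, as a constant rank subbundle of the cotangent bundle. -/
def IsPfaffian (W : CoField I M) : Prop := IsSubbundleOn I univ W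

/-- The differential system generated by the sections of `W`: it is generated algebraically by the
sections and their exterior derivatives. -/
def pfaffian (W : CoField I M) : FormSystem I M :=
  generated I fun U => gens12 I (sections I W U) (extd I '' sections I W U)

/-- The annihilator in the tangent space of a space of covectors. -/
def ann {x : M} (A : Submodule ℝ ((TangentSpace I x) [⋀^Fin 1]→L[ℝ] ℝ)) :
    Set (TangentSpace I x) :=
  {v | ∀ a ∈ A, a (fun _ => v) = 0}

/-- Over the open set `U`, `F` is integrable (Frobenius): `dθ ≡ 0 mod F` for all sections `θ` of `F`
over open subsets. -/
def IsIntegrableOn (U : Set M) (F : CoField I M) : Prop :=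
  ∀ V, IsOpen V → V ⊆ U → ∀ θ ∈ sections I F V, ∀ x ∈ V, ∀ u ∈ ann I (F x), ∀ v ∈ ann I (F x),
    extd I θ x ![u, v] = 0

/-- `F = W^(∞)`: `F` is the largest integrable subbundle of `W`, also over every open set. -/
structure IsLargestIntegrable (W F : CoField I M) : Prop where
  subbundle : IsSubbundleOn I univ F
  integrable : IsIntegrableOn I univ F
  le : ∀ x, F x ≤ W x
  largest : ∀ U, IsOpen U → ∀ F' : CoField I M, IsSubbundleOn I U F' → IsIntegrableOn I U F' →
    (∀ x ∈ U, F' x ≤ W x) → ∀ x ∈ U, F' x ≤ F x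

/-- `{V₁, V₂}` is a Darboux pair of Pfaffian systems, `F₁ = V₁^(∞)` and `F₂ = V₂^(∞)`. The forms in
`Ω²(V₁) + Ω²(V₂)` are those with values in the bundle `Λ²(V₁) + Λ²(V₂)`. -/
structure IsDarbouxPair (V₁ F₁ V₂ F₂ : CoField I M) : Prop where
  pfaffian₁ : IsPfaffian I V₁
  pfaffian₂ : IsPfaffian I V₂
  largest₁ : IsLargestIntegrable I V₁ F₁
  largest₂ : IsLargestIntegrable I V₂ F₂
  sup₁ : ∀ x, V₁ x ⊔ F₂ x = ⊤
  sup₂ : ∀ x, V₂ x ⊔ F₁ x = ⊤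
  inf : ∀ x, F₁ x ⊓ F₂ x = ⊥
  structure_eq : ∀ U, IsOpen U → ∀ φ ∈ sections I (fun x => V₁ x ⊓ V₂ x) U, ∀ x ∈ U,
    extd I φ x ∈ Lambda2 (V₁ x) ⊔ Lambda2 (V₂ x)

/-- The differential system `𝓘` is decomposable of type `[p, q]` with associated singular systems
`𝓥₁` and `𝓥₂`. The 2-forms `Ω₁ a` and `Ω₂ b` occurring as generators are nonzero, in the sense that
they do not vanish identically near `x`. -/
def IsDecomposable (p q : ℕ) (𝓘 𝓥₁ 𝓥₂ : FormSystem I M) : Prop :=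
  2 ≤ p ∧ 2 ≤ q ∧ IsDifferentialSystem I 𝓘 ∧
  ∀ x : M, ∃ U, IsOpen U ∧ x ∈ U ∧ ∃ r s t : ℕ, 1 ≤ s ∧ 1 ≤ t ∧
    ∃ (θ : Fin r → DForm I M 1) (σ₁ : Fin p → DForm I M 1) (σ₂ : Fin q → DForm I M 1)
      (Ω₁ : Fin s → DForm I M 2) (Ω₂ : Fin t → DForm I M 2),
      (∀ i, SmoothOn I U (θ i)) ∧ (∀ i, SmoothOn I U (σ₁ i)) ∧ (∀ i, SmoothOn I U (σ₂ i)) ∧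
      (∀ a, SmoothOn I U (Ω₁ a)) ∧ (∀ b, SmoothOn I U (Ω₂ b)) ∧
      -- the 1-forms are a coframe on `U`
      (∀ y ∈ U,
        LinearIndependent ℝ
          (Sum.elim (fun i => θ i y) (Sum.elim (fun i => σ₁ i y) fun i => σ₂ i y)) ∧
        Submodule.span ℝ (range (Sum.elim (fun i => θ i y)
          (Sum.elim (fun i => σ₁ i y) fun i => σ₂ i y))) = ⊤) ∧
      (∀ a, ∀ y ∈ U, Ω₁ a y ∈ Lambda2 (Submodule.span ℝ (range fun i => σ₁ i y))) ∧
      (∀ b, ∀ y ∈ U, Ω₂ b y ∈ Lambda2 (Submodule.span ℝ (range fun i => σ₂ i y))) ∧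
      (∀ a, ∀ V, IsOpen V → x ∈ V → ∃ y ∈ V, Ω₁ a y ≠ 0) ∧
      (∀ b, ∀ V, IsOpen V → x ∈ V → ∃ y ∈ V, Ω₂ b y ≠ 0) ∧
      AlgGeneratedOn I U 𝓘 (range θ) (range Ω₁ ∪ range Ω₂) ∧
      AlgGeneratedOn I U 𝓥₁ (range θ ∪ range σ₁) (range Ω₂) ∧
      AlgGeneratedOn I U 𝓥₂ (range θ ∪ range σ₂) (range Ω₁)

/-- `𝓘` is a decomposable, Darboux integrable differential system with respect to the Darboux pair
of Pfaffian systems `{V₁, V₂}`: it is decomposable, its singular systems are the differential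
systems generated by `V₁` and `V₂`, and these form a Darboux pair. -/
def IsDecomposableDarbouxIntegrable (𝓘 : FormSystem I M) (V₁ V₂ : CoField I M) : Prop :=
  (∃ p q, IsDecomposable I p q 𝓘 (pfaffian I V₁) (pfaffian I V₂)) ∧
  ∃ F₁ F₂, IsDarbouxPair I V₁ F₁ V₂ F₂

/-! ### The superposition `𝓐 ⊞ 𝓑` of differential systems -/

/-- `P` is an integral element of `𝓘` at `x`. -/
def IsIntegralElement (𝓘 : FormSystem I M) (x : M) (P : Submodule ℝ (TangentSpace I x)) : Prop :=
  ∀ U, IsOpen U → x ∈ U → ∀ k, ∀ φ ∈ 𝓘 U k, VanishesOn (φ x) P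

/-- `φ` vanishes on `U` on the integral elements of `𝓐`, those of `𝓑` and on the sums of an integral
element of `𝓐` and an integral element of `𝓑`. -/
def VanishesOnSums (𝓐 𝓑 : FormSystem I M) (U : Set M) {k : ℕ} (φ : DForm I M k) : Prop :=
  ∀ x ∈ U, ∀ P Q : Submodule ℝ (TangentSpace I x),
    (IsIntegralElement I 𝓐 x P → VanishesOn (φ x) P) ∧
    (IsIntegralElement I 𝓑 x Q → VanishesOn (φ x) Q) ∧
    (IsIntegralElement I 𝓐 x P → IsIntegralElement I 𝓑 x Q → VanishesOn (φ x) (P ⊔ Q))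

/-- `𝓐 ⊞ 𝓑`: the differential system defined by the integral elements of `𝓐`, those of `𝓑`, and the
sums of integral elements of `𝓐` with integral elements of `𝓑`; it consists of the forms which
vanish, together with their exterior derivatives, on all these subspaces. -/
def boxSum (𝓐 𝓑 : FormSystem I M) : FormSystem I M := fun U _ =>
  {φ | SmoothOn I U φ ∧ VanishesOnSums I 𝓐 𝓑 U φ ∧ VanishesOnSums I 𝓐 𝓑 U (extd I φ)}

end Forms

/-! ### Pullbacks, quotients and direct sums -/

section Maps

variable {E : Type*} [NormedAddCommGroup E] [NormedSpace ℝ E]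
  {H : Type*} [TopologicalSpace H] (I : ModelWithCorners ℝ E H)
  {M : Type*} [TopologicalSpace M] [ChartedSpace H M]
  {E' : Type*} [NormedAddCommGroup E'] [NormedSpace ℝ E']
  {H' : Type*} [TopologicalSpace H'] (I' : ModelWithCorners ℝ E' H')
  {N : Type*} [TopologicalSpace N] [ChartedSpace H' N]

/-- The pullback of alternating forms on the tangent space at `f x` to the tangent space at `x`. -/
def pullbackAt (f : M → N) (k : ℕ) (x : M) :
    ((TangentSpace I' (f x)) [⋀^Fin k]→L[ℝ] ℝ) →ₗ[ℝ] ((TangentSpace I x) [⋀^Fin k]→L[ℝ] ℝ) :=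
  ContinuousAlternatingMap.compContinuousLinearMapₗ (mfderiv I I' f x)

/-- The pullback `f^* φ`. -/
def pullback (f : M → N) {k : ℕ} (φ : DForm I' N k) : DForm I M k := fun x =>
  pullbackAt I I' f k x (φ (f x))

/-- The quotient `𝓘/G = {φ | q^* φ ∈ 𝓘}`, where `q` is the projection onto the orbit space. -/
def quotientSystem (q : M → N) (𝓘 : FormSystem I M) : FormSystem I' N := fun U k =>
  {φ | SmoothOn I' U φ ∧ pullback I I' q φ ∈ 𝓘 (q ⁻¹' U) k}

/-- The bundle reduction `W/G = {φ | q^* φ ∈ W}`, where `q` is the projection onto the orbit space. -/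
def quotientBundle (q : M → N) (W : CoField I M) : CoField I' N := fun y =>
  { carrier := {φ | ∀ (x : M) (h : q x = y), pullbackAt I I' q 1 x (h.symm ▸ φ) ∈ W x}
    zero_mem' := by
      rintro x rfl
      exact (map_zero (pullbackAt I I' q 1 x)).symm ▸ (W x).zero_mem
    add_mem' := by
      rintro a b ha hb x rfl
      exact (map_add (pullbackAt I I' q 1 x) a b).symm ▸ (W x).add_mem (ha x rfl) (hb x rfl)
    smul_mem' := by
      rintro c a ha x rfl
      exact (map_smul (pullbackAt I I' q 1 x) c a).symm ▸ (W x).smul_mem c (ha x rfl) }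

/-- The direct sum of differential systems on `M` and `N`: the differential system on `M × N`
generated by the pullbacks of the two systems along the projections. (As the pullbacks are closed
under the exterior derivative, they generate it algebraically.) -/
def directSum (𝓦₁ : FormSystem I M) (𝓦₂ : FormSystem I' N) : FormSystem (I.prod I') (M × N) :=
  generated (I.prod I') fun U k =>
    (pullback (I.prod I') I Prod.fst '' 𝓦₁ (Prod.fst '' U) k) ∪
    (pullback (I.prod I') I' Prod.snd '' 𝓦₂ (Prod.snd '' U) k)

/-- The direct sum `W₁ ⊕ W₂` of subbundles of the cotangent bundles of `M` and `N`, as a subbundle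
of the cotangent bundle of `M × N`. -/
def directSumBundle (W₁ : CoField I M) (W₂ : CoField I' N) : CoField (I.prod I') (M × N) := fun x =>
  (W₁ x.1).map (pullbackAt (I.prod I') I Prod.fst 1 x) ⊔
  (W₂ x.2).map (pullbackAt (I.prod I') I' Prod.snd 1 x)

end Maps

/-! ### Group actions -/

section Actions

variable {EG : Type*} [NormedAddCommGroup EG] [NormedSpace ℝ EG]
  {HG : Type*} [TopologicalSpace HG] (IG : ModelWithCorners ℝ EG HG)
  (G : Type*) [TopologicalSpace G] [ChartedSpace HG G] [Group G]
  {E : Type*} [NormedAddCommGroup E] [NormedSpace ℝ E]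
  {H : Type*} [TopologicalSpace H] (I : ModelWithCorners ℝ E H)
  {M : Type*} [TopologicalSpace M] [ChartedSpace H M] [MulAction G M]
  {E' : Type*} [NormedAddCommGroup E'] [NormedSpace ℝ E']
  {H' : Type*} [TopologicalSpace H'] (I' : ModelWithCorners ℝ E' H')
  {N : Type*} [TopologicalSpace N] [ChartedSpace H' N]

variable (M) in
/-- The action of `G` on `M` is smooth. -/
def IsSmoothAction : Prop := ContMDiff (IG.prod I) I ∞ fun p : G × M => p.1 • p.2

variable (M) in
/-- The action of `G` on `M` is free. -/
def IsFreeAction : Prop := ∀ (g : G) (x : M), g • x = x → g = 1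

/-- The smooth action of `G` on `M` is regular, and the manifold `N`, with the projection `q`, is the
orbit space: `q` is a smooth surjective submersion whose fibres are the orbits. (A submersion has
local smooth cross-sections, and these properties determine the manifold `N` up to a unique
diffeomorphism.) -/
structure IsRegularQuotient (q : M → N) : Prop where
  smooth_action : IsSmoothAction IG G I M
  smooth : ContMDiff I I' ∞ q
  surjective : Function.Surjective q
  submersion : ∀ x, Function.Surjective (mfderiv I I' q x)
  orbits : ∀ x y : M, q x = q y ↔ ∃ g : G, g • x = y

/-- `G` acts by symmetries of the Pfaffian system `W`. -/
def Preserves (W : CoField I M) : Prop :=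
  ∀ (g : G) (x : M), ∀ φ ∈ W (g • x), pullbackAt I I (fun y : M => g • y) 1 x φ ∈ W x

/-- The value at `x` of the infinitesimal generator of the action defined by the element `ξ` of the
Lie algebra. -/
def infGen (ξ : TangentSpace IG (1 : G)) (x : M) : TangentSpace I x :=
  (mfderiv IG I (fun g : G => g • x) 1 ξ : E)

/-- `G` is transverse to `W`: at each point `x`, `Γ_x ∩ ann W_x = {0}`. -/
def IsTransverse (W : CoField I M) : Prop :=
  ∀ (x : M) (ξ : TangentSpace IG (1 : G)),
    infGen IG G I ξ x ∈ ann I (W x) → infGen IG G I ξ x = 0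

end Actions

end EDS

end

noncomputable section

set_option linter.unusedSectionVars false

namespace EDS

section Altz

variable {V : Type*}

/-- The signed sum of a function of `n` vectors over all permutations of its arguments. -/
def altz {n : ℕ} (m : (Fin n → V) → ℝ) (v : Fin n → V) : ℝ :=
  ∑ σ : Equiv.Perm (Fin n), ((Equiv.Perm.sign σ : ℤ) : ℝ) * m (v ∘ σ)

theorem altz_comp_perm {n : ℕ} (m : (Fin n → V) → ℝ) (τ : Equiv.Perm (Fin n)) (v : Fin n → V) :
    altz (fun w => m (w ∘ τ)) v = ((Equiv.Perm.sign τ : ℤ) : ℝ) * altz m v := by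
  unfold altz
  rw [Finset.mul_sum, ← Equiv.sum_comp (Equiv.mulRight τ)
    (fun σ => ((Equiv.Perm.sign τ : ℤ) : ℝ) * (((Equiv.Perm.sign σ : ℤ) : ℝ) * m (v ∘ σ)))]
  refine Finset.sum_congr rfl fun σ _ => ?_
  simp only [Equiv.coe_mulRight, Equiv.Perm.sign_mul, Units.val_mul, Int.cast_mul,
    Equiv.Perm.coe_mul, Function.comp_assoc]
  have h : ((Equiv.Perm.sign τ : ℤ) : ℝ) * ((Equiv.Perm.sign τ : ℤ) : ℝ) = 1 := by
    rcases Int.units_eq_one_or (Equiv.Perm.sign τ) with hs | hs <;> rw [hs] <;> simp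
  linear_combination (-((Equiv.Perm.sign σ : ℤ) : ℝ) * m (v ∘ (σ ∘ τ))) * h

theorem altz_add {n : ℕ} (m m' : (Fin n → V) → ℝ) (v : Fin n → V) :
    altz (fun w => m w + m' w) v = altz m v + altz m' v := by
  simp [altz, mul_add, Finset.sum_add_distrib]

theorem altz_sum {n : ℕ} {ι : Type*} (s : Finset ι) (m : ι → (Fin n → V) → ℝ) (v : Fin n → V) :
    altz (fun w => ∑ i ∈ s, m i w) v = ∑ i ∈ s, altz (m i) v := by
  simp only [altz, Finset.mul_sum]
  rw [Finset.sum_comm]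

theorem altz_const_mul {n : ℕ} (c : ℝ) (m : (Fin n → V) → ℝ) (v : Fin n → V) :
    altz (fun w => c * m w) v = c * altz m v := by
  simp only [altz, Finset.mul_sum]
  exact Finset.sum_congr rfl fun σ _ => by ring

theorem altz_cast {n n' : ℕ} (h : n = n') (m : (Fin n → V) → ℝ) (v : Fin n' → V) :
    altz (fun w : Fin n' → V => m (w ∘ Fin.cast h)) v = altz m (v ∘ Fin.cast h) := by
  subst h; rfl

variable [AddCommGroup V] [Module ℝ V] [TopologicalSpace V]

theorem altz_alternating {n : ℕ} (g : V [⋀^Fin n]→L[ℝ] ℝ) (v : Fin n → V) :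
    altz g v = n.factorial * g v := by
  unfold altz
  have : ∀ σ : Equiv.Perm (Fin n), ((Equiv.Perm.sign σ : ℤ) : ℝ) * g (v ∘ σ) = g v := by
    intro σ
    have := g.toAlternatingMap.map_perm v σ
    simp only [ContinuousAlternatingMap.coe_toAlternatingMap] at this
    rw [this]
    rcases Int.units_eq_one_or (Equiv.Perm.sign σ) with hs | hs <;> rw [hs] <;> simp
  simp [this, Fintype.card_perm]

theorem wedge_altz {k l : ℕ} (α : V [⋀^Fin k]→L[ℝ] ℝ) (β : V [⋀^Fin l]→L[ℝ] ℝ)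
    (v : Fin (k + l) → V) :
    (k.factorial * l.factorial : ℝ) * wedge α β v =
      altz (fun w => α (w ∘ Fin.castAdd l) * β (w ∘ Fin.natAdd k)) v := by
  have h := MultilinearMap.domCoprod_alternization_eq α.toAlternatingMap β.toAlternatingMap
  have h2 := congrArg (fun f => LinearMap.mul' ℝ ℝ (f fun i => v (finSumFinEquiv i))) h
  simp only [Fintype.card_fin] at h2
  have h3 : (k.factorial * l.factorial : ℝ) * wedge α β v =
      LinearMap.mul' ℝ ℝ ((k.factorial * l.factorial) •
        (α.toAlternatingMap.domCoprod β.toAlternatingMap fun i => v (finSumFinEquiv i))) := by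
    rw [map_nsmul, nsmul_eq_mul]
    push_cast
    rfl
  rw [h3, ← AlternatingMap.smul_apply] 
  rw [← h2, MultilinearMap.alternatization_apply, map_sum]
  unfold altz
  rw [← Equiv.sum_comp (Equiv.permCongr finSumFinEquiv)]
  refine Finset.sum_congr rfl fun σ _ => ?_
  rw [Equiv.Perm.sign_permCongr]
  have e1 : ∀ z : ℤˣ, ∀ t : TensorProduct ℝ ℝ ℝ, LinearMap.mul' ℝ ℝ (z • t) =
      ((z : ℤ) : ℝ) * LinearMap.mul' ℝ ℝ t := by
    intro z t
    rcases Int.units_eq_one_or z with hs | hs <;> rw [hs] <;> simp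
  rw [e1]
  congr 1
  simp only [MultilinearMap.domDomCongr_apply, MultilinearMap.domCoprod_apply, LinearMap.mul'_apply]
  congr 1 <;> simp [Function.comp_def, Equiv.permCongr_apply]


theorem altz_uncurry {n : ℕ} {W : Type*} (F : W → (Fin n → W) → ℝ) (v : Fin (n + 1) → W) :
    altz (fun w : Fin (n + 1) → W => ∑ p : Fin (n + 1), (-1) ^ (p : ℕ) * F (w p) (p.removeNth w)) v =
      (n + 1) * altz (fun w : Fin (n + 1) → W => F (w 0) (Fin.tail w)) v := by
  rw [altz_sum]
  have : ∀ p : Fin (n + 1), altz (fun w : Fin (n + 1) → W => (-1) ^ (p : ℕ) * F (w p) (p.removeNth w)) v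
      = altz (fun w : Fin (n + 1) → W => F (w 0) (Fin.tail w)) v := by
    intro p
    rw [altz_const_mul]
    have h := altz_comp_perm (fun w : Fin (n + 1) → W => F (w 0) (Fin.tail w)) p.cycleRange.symm v
    have e : ∀ w : Fin (n + 1) → W, (fun w : Fin (n + 1) → W => F (w 0) (Fin.tail w))
        (w ∘ p.cycleRange.symm) = F (w p) (p.removeNth w) := by
      intro w
      rw [← Fin.cons_removeNth_eq_comp_cycleRange_symm]
      simp
    simp only [e] at h
    rw [h, Equiv.Perm.sign_symm, Fin.sign_cycleRange]
    push_cast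
    rw [← mul_assoc, ← pow_add, Even.neg_one_pow ⟨_, rfl⟩, one_mul]
  rw [Finset.sum_congr rfl fun p _ => this p]
  simp

theorem altz_tail {n : ℕ} {W : Type*} (F : W → (Fin n → W) → ℝ) (v : Fin (n + 1) → W) :
    altz (fun w : Fin (n + 1) → W => altz (F (w 0)) (Fin.tail w)) v =
      n.factorial * altz (fun w : Fin (n + 1) → W => F (w 0) (Fin.tail w)) v := by
  have h0 : (fun w : Fin (n + 1) → W => altz (F (w 0)) (Fin.tail w)) = fun w =>
      ∑ σ : Equiv.Perm (Fin n), ((Equiv.Perm.sign σ : ℤ) : ℝ) * F (w 0) (Fin.tail w ∘ σ) := rfl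
  rw [h0, altz_sum]
  have : ∀ σ : Equiv.Perm (Fin n), altz (fun w : Fin (n + 1) → W =>
      ((Equiv.Perm.sign σ : ℤ) : ℝ) * F (w 0) (Fin.tail w ∘ σ)) v
      = altz (fun w : Fin (n + 1) → W => F (w 0) (Fin.tail w)) v := by
    intro σ
    rw [altz_const_mul]
    have h := altz_comp_perm (fun w : Fin (n + 1) → W => F (w 0) (Fin.tail w))
      (Equiv.Perm.decomposeFin.symm (0, σ)) v
    have e : ∀ w : Fin (n + 1) → W, (fun w : Fin (n + 1) → W => F (w 0) (Fin.tail w))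
        (w ∘ Equiv.Perm.decomposeFin.symm (0, σ)) = F (w 0) (Fin.tail w ∘ σ) := by
      intro w
      have : Fin.tail (w ∘ Equiv.Perm.decomposeFin.symm (0, σ)) = Fin.tail w ∘ σ := by
        funext i
        simp [Fin.tail]
      simp [this]
    simp only [e] at h
    rw [h, Equiv.Perm.decomposeFin.symm_sign]
    rcases Int.units_eq_one_or (Equiv.Perm.sign σ) with hs | hs <;> simp [hs]
  rw [Finset.sum_congr rfl fun p _ => this p]
  simp [Fintype.card_perm]

theorem altz_left_perm {k l : ℕ} {W : Type*} (F : (Fin k → W) → (Fin l → W) → ℝ)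
    (ρ : Equiv.Perm (Fin k)) (v : Fin (k + l) → W) :
    altz (fun w => F ((w ∘ Fin.castAdd l) ∘ ρ) (w ∘ Fin.natAdd k)) v =
      ((Equiv.Perm.sign ρ : ℤ) : ℝ) * altz (fun w => F (w ∘ Fin.castAdd l) (w ∘ Fin.natAdd k)) v := by
  have h := altz_comp_perm (fun w : Fin (k + l) → W => F (w ∘ Fin.castAdd l) (w ∘ Fin.natAdd k))
    (finSumFinEquiv.permCongr (Equiv.Perm.sumCongr ρ 1)) v
  rw [Equiv.Perm.sign_permCongr, Equiv.Perm.sign_sumCongr] at h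
  simp only [Equiv.Perm.sign_one, mul_one] at h
  rw [← h]
  congr 1
  funext w
  congr 1 <;> funext i <;> simp [Equiv.permCongr_apply]

theorem altz_right_perm {k l : ℕ} {W : Type*} (F : (Fin k → W) → (Fin l → W) → ℝ)
    (ρ : Equiv.Perm (Fin l)) (v : Fin (k + l) → W) :
    altz (fun w => F (w ∘ Fin.castAdd l) ((w ∘ Fin.natAdd k) ∘ ρ)) v =
      ((Equiv.Perm.sign ρ : ℤ) : ℝ) * altz (fun w => F (w ∘ Fin.castAdd l) (w ∘ Fin.natAdd k)) v := by
  have h := altz_comp_perm (fun w : Fin (k + l) → W => F (w ∘ Fin.castAdd l) (w ∘ Fin.natAdd k))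
    (finSumFinEquiv.permCongr (Equiv.Perm.sumCongr 1 ρ)) v
  rw [Equiv.Perm.sign_permCongr, Equiv.Perm.sign_sumCongr] at h
  simp only [Equiv.Perm.sign_one, one_mul] at h
  rw [← h]
  congr 1
  funext w
  congr 1 <;> funext i <;> simp [Equiv.permCongr_apply]

theorem altz_uncurry_left {k l : ℕ} {W : Type*} (F : W → (Fin k → W) → (Fin l → W) → ℝ)
    (v : Fin (k + 1 + l) → W) :
    altz (fun w : Fin (k + 1 + l) → W => ∑ p : Fin (k + 1), (-1) ^ (p : ℕ) *
      F ((w ∘ Fin.castAdd l) p) (p.removeNth (w ∘ Fin.castAdd l)) (w ∘ Fin.natAdd (k + 1))) v =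
    (k + 1) * altz (fun w : Fin (k + 1 + l) → W =>
      F ((w ∘ Fin.castAdd l) 0) (Fin.tail (w ∘ Fin.castAdd l)) (w ∘ Fin.natAdd (k + 1))) v := by
  rw [altz_sum]
  have : ∀ p : Fin (k + 1), altz (fun w : Fin (k + 1 + l) → W => (-1) ^ (p : ℕ) *
      F ((w ∘ Fin.castAdd l) p) (p.removeNth (w ∘ Fin.castAdd l)) (w ∘ Fin.natAdd (k + 1))) v
      = altz (fun w : Fin (k + 1 + l) → W =>
      F ((w ∘ Fin.castAdd l) 0) (Fin.tail (w ∘ Fin.castAdd l)) (w ∘ Fin.natAdd (k + 1))) v := by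
    intro p
    rw [altz_const_mul]
    have h := altz_left_perm (fun (a : Fin (k + 1) → W) (b : Fin l → W) => F (a 0) (Fin.tail a) b)
      p.cycleRange.symm v
    simp only [← Fin.cons_removeNth_eq_comp_cycleRange_symm, Fin.cons_zero, Fin.tail_cons] at h
    rw [h, Equiv.Perm.sign_symm, Fin.sign_cycleRange]
    push_cast
    rw [← mul_assoc, ← pow_add, Even.neg_one_pow ⟨_, rfl⟩, one_mul]
  rw [Finset.sum_congr rfl fun p _ => this p]
  simp

theorem altz_uncurry_right {k l : ℕ} {W : Type*} (F : W → (Fin k → W) → (Fin l → W) → ℝ)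
    (v : Fin (k + (l + 1)) → W) :
    altz (fun w : Fin (k + (l + 1)) → W => ∑ p : Fin (l + 1), (-1) ^ (p : ℕ) *
      F ((w ∘ Fin.natAdd k) p) (w ∘ Fin.castAdd (l + 1)) (p.removeNth (w ∘ Fin.natAdd k))) v =
    (l + 1) * altz (fun w : Fin (k + (l + 1)) → W =>
      F ((w ∘ Fin.natAdd k) 0) (w ∘ Fin.castAdd (l + 1)) (Fin.tail (w ∘ Fin.natAdd k))) v := by
  rw [altz_sum]
  have : ∀ p : Fin (l + 1), altz (fun w : Fin (k + (l + 1)) → W => (-1) ^ (p : ℕ) *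
      F ((w ∘ Fin.natAdd k) p) (w ∘ Fin.castAdd (l + 1)) (p.removeNth (w ∘ Fin.natAdd k))) v
      = altz (fun w : Fin (k + (l + 1)) → W =>
      F ((w ∘ Fin.natAdd k) 0) (w ∘ Fin.castAdd (l + 1)) (Fin.tail (w ∘ Fin.natAdd k))) v := by
    intro p
    rw [altz_const_mul]
    have h := altz_right_perm (fun (a : Fin k → W) (b : Fin (l + 1) → W) => F (b 0) a (Fin.tail b))
      p.cycleRange.symm v
    simp only [← Fin.cons_removeNth_eq_comp_cycleRange_symm, Fin.cons_zero, Fin.tail_cons] at h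
    rw [h, Equiv.Perm.sign_symm, Fin.sign_cycleRange]
    push_cast
    rw [← mul_assoc, ← pow_add, Even.neg_one_pow ⟨_, rfl⟩, one_mul]
  rw [Finset.sum_congr rfl fun p _ => this p]
  simp

theorem factorial_ne (n : ℕ) : (n.factorial : ℝ) ≠ 0 := by exact_mod_cast n.factorial_ne_zero

theorem wedge_eq {k l : ℕ} (α : V [⋀^Fin k]→L[ℝ] ℝ) (β : V [⋀^Fin l]→L[ℝ] ℝ)
    (v : Fin (k + l) → V) :
    wedge α β v = (k.factorial * l.factorial : ℝ)⁻¹ *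
      altz (fun w => α (w ∘ Fin.castAdd l) * β (w ∘ Fin.natAdd k)) v := by
  rw [← wedge_altz, inv_mul_cancel_left₀ (mul_ne_zero (factorial_ne k) (factorial_ne l))]

theorem wedge_add_left {k l : ℕ} (α α' : V [⋀^Fin k]→L[ℝ] ℝ) (β : V [⋀^Fin l]→L[ℝ] ℝ) :
    wedge (α + α') β = wedge α β + wedge α' β := by
  ext v
  simp only [ContinuousAlternatingMap.add_apply, wedge_eq, add_mul, altz_add, mul_add]

theorem wedge_add_right {k l : ℕ} (α : V [⋀^Fin k]→L[ℝ] ℝ) (β β' : V [⋀^Fin l]→L[ℝ] ℝ) :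
    wedge α (β + β') = wedge α β + wedge α β' := by
  ext v
  simp only [ContinuousAlternatingMap.add_apply, wedge_eq, altz_add, mul_add]

theorem wedge_smul_left {k l : ℕ} (c : ℝ) (α : V [⋀^Fin k]→L[ℝ] ℝ) (β : V [⋀^Fin l]→L[ℝ] ℝ) :
    wedge (c • α) β = c • wedge α β := by
  ext v
  simp only [ContinuousAlternatingMap.smul_apply, wedge_eq, smul_eq_mul, mul_assoc, altz_const_mul]
  ring

theorem wedge_smul_right {k l : ℕ} (c : ℝ) (α : V [⋀^Fin k]→L[ℝ] ℝ) (β : V [⋀^Fin l]→L[ℝ] ℝ) :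
    wedge α (c • β) = c • wedge α β := by
  ext v
  simp only [ContinuousAlternatingMap.smul_apply, wedge_eq, smul_eq_mul, mul_left_comm _ c,
    altz_const_mul]

theorem wedge_comp {V' : Type*} [AddCommGroup V'] [Module ℝ V'] [TopologicalSpace V'] {k l : ℕ}
    (α : V [⋀^Fin k]→L[ℝ] ℝ) (β : V [⋀^Fin l]→L[ℝ] ℝ) (f : V' →L[ℝ] V) :
    (wedge α β).compContinuousLinearMap f =
      wedge (α.compContinuousLinearMap f) (β.compContinuousLinearMap f) := by
  ext v
  rw [ContinuousAlternatingMap.compContinuousLinearMap_apply, wedge_eq, wedge_eq]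
  rfl

theorem wedge_one_one (a b : V [⋀^Fin 1]→L[ℝ] ℝ) (v : Fin 2 → V) :
    wedge a b v = a (fun _ => v 0) * b (fun _ => v 1) - a (fun _ => v 1) * b (fun _ => v 0) := by
  have h : wedge a b v = wedge a b v := rfl
  conv_lhs at h => rw [wedge_eq]
  rw [← h]
  unfold altz
  rw [show (Finset.univ : Finset (Equiv.Perm (Fin (1 + 1)))) = {1, Equiv.swap 0 1} by decide]
  rw [Finset.sum_pair (by decide)]
  have e1 : ∀ f : Fin 1 → V, f = fun _ => f 0 := fun f => by
    funext i; rw [Subsingleton.elim i 0]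
  dsimp only
  rw [e1 ((v ∘ _) ∘ Fin.castAdd 1), e1 ((v ∘ _) ∘ Fin.natAdd 1),
    e1 ((v ∘ (Equiv.swap 0 1)) ∘ Fin.castAdd 1), e1 ((v ∘ (Equiv.swap 0 1)) ∘ Fin.natAdd 1)]
  have h0 : Fin.castAdd 1 (0 : Fin 1) = (0 : Fin 2) := rfl
  have h1 : Fin.natAdd 1 (0 : Fin 1) = (1 : Fin 2) := rfl
  simp only [Function.comp_apply, h0, h1]
  simp
  ring

theorem wedge_zero_form {l : ℕ} (c : ℝ) (β : V [⋀^Fin l]→L[ℝ] ℝ) (v : Fin (0 + l) → V) :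
    wedge (ContinuousAlternatingMap.constOfIsEmpty ℝ V (Fin 0) c) β v =
      c * β (v ∘ Fin.cast (zero_add l).symm) := by
  rw [wedge_eq]
  have e : ∀ w : Fin (0 + l) → V, w ∘ Fin.natAdd 0 = w ∘ Fin.cast (zero_add l).symm := by
    intro w
    funext i
    simp only [Function.comp_apply]
    congr 1
    ext
    simp
  have e0 : ∀ w : Fin 0 → V, ContinuousAlternatingMap.constOfIsEmpty ℝ V (Fin 0) c w = c :=
    fun w => rfl
  simp only [e, e0]
  rw [altz_const_mul, altz_cast (zero_add l).symm (fun w : Fin l → V => β w), altz_alternating]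
  have := factorial_ne l
  simp only [Nat.factorial_zero, Nat.cast_one, one_mul]
  field_simp

theorem VanishesOn.wedge {k l : ℕ} (α : V [⋀^Fin k]→L[ℝ] ℝ) {β : V [⋀^Fin l]→L[ℝ] ℝ}
    {P : Submodule ℝ V} (h : VanishesOn β P) : VanishesOn (EDS.wedge α β) P := by
  intro v hv
  rw [wedge_eq]
  have : ∀ σ : Equiv.Perm (Fin (k + l)), β ((v ∘ σ) ∘ Fin.natAdd k) = 0 :=
    fun σ => h _ fun i => hv _
  simp [altz, this]

end Altz

section Leibniz

variable {E : Type*} [NormedAddCommGroup E] [NormedSpace ℝ E]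

theorem wedge_alternatizeUncurryFin_left {k l : ℕ} (A : E →L[ℝ] E [⋀^Fin k]→L[ℝ] ℝ)
    (b : E [⋀^Fin l]→L[ℝ] ℝ) (L : E →L[ℝ] E [⋀^Fin (k + l)]→L[ℝ] ℝ)
    (hL : ∀ u, L u = wedge (A u) b) (h : k + 1 + l = k + l + 1) (v : Fin (k + l + 1) → E) :
    ContinuousAlternatingMap.alternatizeUncurryFin L v =
      wedge (ContinuousAlternatingMap.alternatizeUncurryFin A) b (v ∘ Fin.cast h) := by
  have hR := wedge_altz (ContinuousAlternatingMap.alternatizeUncurryFin A) b (v ∘ Fin.cast h)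
  have hR' := altz_uncurry_left (fun u a c => A u a * b c) (v ∘ Fin.cast h)
  have e0 : ∀ w : Fin (k + 1 + l) → E,
      ContinuousAlternatingMap.alternatizeUncurryFin A (w ∘ Fin.castAdd l) *
        b (w ∘ Fin.natAdd (k + 1)) =
      ∑ p : Fin (k + 1), (-1) ^ (p : ℕ) * (A ((w ∘ Fin.castAdd l) p)
        (p.removeNth (w ∘ Fin.castAdd l)) * b (w ∘ Fin.natAdd (k + 1))) := by
    intro w
    simp only [ContinuousAlternatingMap.alternatizeUncurryFin_apply, Finset.sum_mul]
    exact Finset.sum_congr rfl fun p _ => by simp; ring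
  simp only [e0] at hR
  rw [hR'] at hR
  have hLa := altz_alternating (ContinuousAlternatingMap.alternatizeUncurryFin L) v
  have e : (⇑(ContinuousAlternatingMap.alternatizeUncurryFin L) : (Fin (k + l + 1) → E) → ℝ) =
      fun w => ∑ p : Fin (k + l + 1), (-1) ^ (p : ℕ) * wedge (A (w p)) b (p.removeNth w) := by
    funext w
    simp [ContinuousAlternatingMap.alternatizeUncurryFin_apply, hL]
  rw [e, altz_uncurry (fun u a => wedge (A u) b a) v, ← e] at hLa
  have h2 := altz_tail (fun u (a : Fin (k + l) → E) =>
    A u (a ∘ Fin.castAdd l) * b (a ∘ Fin.natAdd k)) v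
  simp only [← wedge_altz] at h2
  rw [altz_const_mul] at h2
  have h3 := altz_cast h (fun w : Fin (k + 1 + l) → E =>
    A (w (Fin.castAdd l 0)) (Fin.tail (w ∘ Fin.castAdd l)) * b (w ∘ Fin.natAdd (k + 1))) v
  have e3 : (fun w : Fin (k + l + 1) → E => (fun w : Fin (k + 1 + l) → E =>
      A (w (Fin.castAdd l 0)) (Fin.tail (w ∘ Fin.castAdd l)) * b (w ∘ Fin.natAdd (k + 1)))
      (w ∘ Fin.cast h)) = fun w => A (w 0) (Fin.tail w ∘ Fin.castAdd l) *
        b (Fin.tail w ∘ Fin.natAdd k) := by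
    funext w
    dsimp only
    congr 2
    funext i
    simp only [Function.comp_apply, Fin.tail]
    congr 1
    ext
    simp
    omega
  rw [e3] at h3
  simp only [Function.comp_apply] at hR
  rw [← h3] at hR
  set X := altz (fun w : Fin (k + l + 1) → E => A (w 0) (Fin.tail w ∘ Fin.castAdd l) *
        b (Fin.tail w ∘ Fin.natAdd k)) v
  set Y := altz (fun w : Fin (k + l + 1) → E => wedge (A (w 0)) b (Fin.tail w)) v
  have f1 := factorial_ne k
  have f2 := factorial_ne l
  have f3 := factorial_ne (k + l)
  have f4 : ((k + l : ℕ) : ℝ) + 1 ≠ 0 := by positivity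
  have f5 : ((k : ℕ) : ℝ) + 1 ≠ 0 := by positivity
  rw [Nat.factorial_succ] at hLa
  rw [Nat.factorial_succ] at hR
  push_cast at hLa hR f4
  have g1 : X = k.factorial * (l.factorial *
      wedge (ContinuousAlternatingMap.alternatizeUncurryFin A) b (v ∘ Fin.cast h)) := by
    apply mul_left_cancel₀ f5
    rw [← hR]; ring
  have g2 : Y = (k + l).factorial * ContinuousAlternatingMap.alternatizeUncurryFin L v := by
    apply mul_left_cancel₀ f4
    rw [hLa]; ring
  rw [g1, g2] at h2
  apply mul_left_cancel₀ (mul_ne_zero (mul_ne_zero f1 f2) f3)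
  linear_combination h2

theorem wedge_alternatizeUncurryFin_right {k l : ℕ} (a : E [⋀^Fin k]→L[ℝ] ℝ)
    (B : E →L[ℝ] E [⋀^Fin l]→L[ℝ] ℝ) (L : E →L[ℝ] E [⋀^Fin (k + l)]→L[ℝ] ℝ)
    (hL : ∀ u, L u = wedge a (B u)) (v : Fin (k + l + 1) → E) :
    ContinuousAlternatingMap.alternatizeUncurryFin L v =
      (-1) ^ k * wedge a (ContinuousAlternatingMap.alternatizeUncurryFin B) v := by
  have hR := wedge_altz a (ContinuousAlternatingMap.alternatizeUncurryFin B) v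
  have hR' := altz_uncurry_right (fun u c d => a c * B u d) v
  have e0 : ∀ w : Fin (k + (l + 1)) → E, a (w ∘ Fin.castAdd (l + 1)) *
      ContinuousAlternatingMap.alternatizeUncurryFin B (w ∘ Fin.natAdd k) =
      ∑ p : Fin (l + 1), (-1) ^ (p : ℕ) * (a (w ∘ Fin.castAdd (l + 1)) *
        B ((w ∘ Fin.natAdd k) p) (p.removeNth (w ∘ Fin.natAdd k))) := by
    intro w
    simp only [ContinuousAlternatingMap.alternatizeUncurryFin_apply, Finset.mul_sum]
    exact Finset.sum_congr rfl fun p _ => by ring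
  simp only [e0] at hR
  rw [hR'] at hR
  have hLa := altz_alternating (ContinuousAlternatingMap.alternatizeUncurryFin L) v
  have e : (⇑(ContinuousAlternatingMap.alternatizeUncurryFin L) : (Fin (k + l + 1) → E) → ℝ) =
      fun w => ∑ p : Fin (k + l + 1), (-1) ^ (p : ℕ) * wedge a (B (w p)) (p.removeNth w) := by
    funext w
    simp [ContinuousAlternatingMap.alternatizeUncurryFin_apply, hL]
  rw [e, altz_uncurry (fun u c => wedge a (B u) c) v, ← e] at hLa
  have h2 := altz_tail (fun u (c : Fin (k + l) → E) =>
    a (c ∘ Fin.castAdd l) * B u (c ∘ Fin.natAdd k)) v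
  simp only [← wedge_altz] at h2
  rw [altz_const_mul] at h2
  have h3 := altz_comp_perm (fun w : Fin (k + l + 1) → E => a ((w : Fin (k + (l + 1)) → E) ∘ Fin.castAdd (l + 1)) *
    B (w (Fin.natAdd k (0 : Fin (l + 1)))) (Fin.tail ((w : Fin (k + (l + 1)) → E) ∘ Fin.natAdd k)))
    (Fin.cycleRange (n := k + l + 1) (Fin.natAdd k (0 : Fin (l + 1)))) v
  have e3 : (fun w : Fin (k + l + 1) → E => (fun w : Fin (k + l + 1) → E =>
      a ((w : Fin (k + (l + 1)) → E) ∘ Fin.castAdd (l + 1)) *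
      B (w (Fin.natAdd k (0 : Fin (l + 1)))) (Fin.tail ((w : Fin (k + (l + 1)) → E) ∘ Fin.natAdd k)))
      (w ∘ (Fin.cycleRange (n := k + l + 1) (Fin.natAdd k (0 : Fin (l + 1)))))) =
      fun w => a (Fin.tail w ∘ Fin.castAdd l) * B (w 0) (Fin.tail w ∘ Fin.natAdd k) := by
    funext w
    dsimp only
    congr 1
    · congr 1
      funext i
      simp only [Function.comp_apply, Fin.tail]
      congr 1
      ext
      rw [Fin.coe_cycleRange_of_lt]
      · simp
      · simp [Fin.lt_def]
    · congr 1
      · congr 1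
        simp only [Function.comp_apply]
        rw [Fin.cycleRange_self]
      · funext i
        simp only [Function.comp_apply, Fin.tail]
        congr 1
        rw [Fin.cycleRange_of_gt]
        · ext; simp; omega
        · simp [Fin.lt_def]
  rw [e3, Fin.sign_cycleRange] at h3
  simp only [Function.comp_apply] at hR h3
  set X := altz (fun w : Fin (k + l + 1) → E => a (Fin.tail w ∘ Fin.castAdd l) *
    B (w 0) (Fin.tail w ∘ Fin.natAdd k)) v
  set Y := altz (fun w : Fin (k + l + 1) → E => wedge a (B (w 0)) (Fin.tail w)) v
  change _ = ((l : ℝ) + 1) * altz (n := k + l + 1) _ _ at hR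
  set Z := altz (fun w : Fin (k + l + 1) → E => a ((w : Fin (k + (l + 1)) → E) ∘ Fin.castAdd (l + 1)) *
    B (w (Fin.natAdd k (0 : Fin (l + 1)))) (Fin.tail ((w : Fin (k + (l + 1)) → E) ∘ Fin.natAdd k))) v
  have f1 := factorial_ne k
  have f2 := factorial_ne l
  have f3 := factorial_ne (k + l)
  have f4 : ((k + l : ℕ) : ℝ) + 1 ≠ 0 := by positivity
  have f5 : ((l : ℕ) : ℝ) + 1 ≠ 0 := by positivity
  rw [Nat.factorial_succ] at hLa
  rw [Nat.factorial_succ] at hR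
  push_cast at hLa hR f4 h3
  have g1 : Z = k.factorial * (l.factorial *
      wedge a (ContinuousAlternatingMap.alternatizeUncurryFin B) v) := by
    apply mul_left_cancel₀ f5
    refine hR.symm.trans ?_; ring
  have g2 : Y = (k + l).factorial * ContinuousAlternatingMap.alternatizeUncurryFin L v := by
    apply mul_left_cancel₀ f4
    rw [hLa]; ring
  have h4 : ((Fin.natAdd k (0 : Fin (l + 1)) : Fin (k + (l + 1))) : ℕ) = k := by simp
  replace h3 : X = (-1) ^ k * Z := by rw [h3]; exact congrArg (fun j : ℕ => (-1 : ℝ) ^ j * Z) h4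
  rw [h3, g1, g2] at h2
  apply mul_left_cancel₀ (mul_ne_zero (mul_ne_zero f1 f2) f3)
  linear_combination h2

end Leibniz

section VectorSpace

variable {E : Type*} [NormedAddCommGroup E] [NormedSpace ℝ E]
  {F : Type*} [NormedAddCommGroup F] [NormedSpace ℝ F]

open Filter Topology

theorem _root_.ContDiffAt.alternating_apply {k : ℕ} {n : ℕ∞} {φ : F → E [⋀^Fin k]→L[ℝ] ℝ}
    {v : F → Fin k → E} {x : F} (hφ : ContDiffAt ℝ n φ x) (hv : ∀ i, ContDiffAt ℝ n (fun y => v y i) x) :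
    ContDiffAt ℝ n (fun y => φ y (v y)) x := by
  have h := (ContinuousLinearMap.analyticOnNhd_uncurry_of_multilinear
    (ContinuousAlternatingMap.toContinuousMultilinearMapCLM ℝ :
      (E [⋀^Fin k]→L[ℝ] ℝ) →L[ℝ] _) (s := univ)).contDiffOn (n := n) uniqueDiffOn_univ
  rw [contDiffOn_univ] at h
  have h2 : ContDiffAt ℝ n (fun y => (φ y, v y)) x := hφ.prodMk (contDiffAt_pi.2 hv)
  exact h.contDiffAt.comp x h2

theorem contDiffAt_alternating_of_apply [FiniteDimensional ℝ E] {k : ℕ} {n : ℕ∞}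
    {φ : F → E [⋀^Fin k]→L[ℝ] ℝ} {x : F} (h : ∀ v : Fin k → E, ContDiffAt ℝ n (fun y => φ y v) x) :
    ContDiffAt ℝ n φ x := by
  classical
  let b := Module.finBasis ℝ E
  let ev : (E [⋀^Fin k]→L[ℝ] ℝ) →ₗ[ℝ] ((Fin k → Fin (Module.finrank ℝ E)) → ℝ) :=
    { toFun := fun φ i => φ (b ∘ i)
      map_add' := fun _ _ => rfl
      map_smul' := fun _ _ => rfl }
  have hev : Function.Injective ev := by
    intro φ ψ hh
    apply ContinuousAlternatingMap.toAlternatingMap_injective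
    exact b.ext_alternating fun v _ => congrFun hh v
  obtain ⟨L, hL⟩ := ev.exists_leftInverse_of_injective (LinearMap.ker_eq_bot.2 hev)
  have e : φ = fun y => LinearMap.toContinuousLinearMap L (fun i => φ y (b ∘ i)) := by
    funext y
    exact (LinearMap.congr_fun hL (φ y)).symm
  rw [e]
  exact (LinearMap.toContinuousLinearMap L).contDiff.contDiffAt.comp x
    (contDiffAt_pi.2 fun i => h _)

theorem _root_.ContDiffAt.alternating_comp [FiniteDimensional ℝ E] {E' : Type*}
    [NormedAddCommGroup E'] [NormedSpace ℝ E'] [FiniteDimensional ℝ E']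
    {k : ℕ} {n : ℕ∞} {φ : F → E [⋀^Fin k]→L[ℝ] ℝ}
    {f : F → E' →L[ℝ] E} {x : F} (hφ : ContDiffAt ℝ n φ x) (hf : ContDiffAt ℝ n f x) :
    ContDiffAt ℝ n (fun y => (φ y).compContinuousLinearMap (f y)) x :=
  contDiffAt_alternating_of_apply fun _ =>
    hφ.alternating_apply fun _ => hf.clm_apply contDiffAt_const

variable [FiniteDimensional ℝ E]

instance finiteDimensional_alternating (k : ℕ) : FiniteDimensional ℝ (E [⋀^Fin k]→L[ℝ] ℝ) :=
  Module.Finite.of_injective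
    ((AlternatingMap.toMultilinearMapLM (S := ℝ)).comp
      (ContinuousAlternatingMap.toAlternatingMapLinear (R := ℝ)) :
      (E [⋀^Fin k]→L[ℝ] ℝ) →ₗ[ℝ] MultilinearMap ℝ (fun _ : Fin k => E) ℝ)
    (AlternatingMap.coe_multilinearMap_injective.comp
      ContinuousAlternatingMap.toAlternatingMap_injective)

/-- The wedge product as a continuous bilinear map. -/
def wedgeL (k l : ℕ) : (E [⋀^Fin k]→L[ℝ] ℝ) →L[ℝ] (E [⋀^Fin l]→L[ℝ] ℝ) →L[ℝ]
    (E [⋀^Fin (k + l)]→L[ℝ] ℝ) :=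
  LinearMap.toContinuousLinearMap
    { toFun := fun α => LinearMap.toContinuousLinearMap
        { toFun := fun β => wedge α β
          map_add' := fun β β' => wedge_add_right α β β'
          map_smul' := fun c β => wedge_smul_right c α β }
      map_add' := fun α α' => by ext1 β; exact wedge_add_left α α' β
      map_smul' := fun c α => by ext1 β; exact wedge_smul_left c α β }

theorem _root_.ContDiffAt.wedge {k l : ℕ} {n : ℕ∞} {φ : F → E [⋀^Fin k]→L[ℝ] ℝ}
    {ψ : F → E [⋀^Fin l]→L[ℝ] ℝ} {x : F} (hφ : ContDiffAt ℝ n φ x) (hψ : ContDiffAt ℝ n ψ x) :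
    ContDiffAt ℝ n (fun y => EDS.wedge (φ y) (ψ y)) x := by
  refine contDiffAt_alternating_of_apply fun v => ?_
  simp only [wedge_eq, altz]
  exact contDiffAt_const.mul (ContDiffAt.sum fun σ _ => contDiffAt_const.mul
    ((hφ.alternating_apply (v := fun _ => (v ∘ σ) ∘ Fin.castAdd l) fun _ => contDiffAt_const).mul
      (hψ.alternating_apply (v := fun _ => (v ∘ σ) ∘ Fin.natAdd k) fun _ => contDiffAt_const)))

theorem extDeriv_wedge {k l : ℕ} {α : E → E [⋀^Fin k]→L[ℝ] ℝ} {β : E → E [⋀^Fin l]→L[ℝ] ℝ} {x : E}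
    (hα : DifferentiableAt ℝ α x) (hβ : DifferentiableAt ℝ β x) (h : k + 1 + l = k + l + 1)
    (v : Fin (k + l + 1) → E) :
    extDeriv (fun y => wedge (α y) (β y)) x v =
      wedge (extDeriv α x) (β x) (v ∘ Fin.cast h) + (-1) ^ k * wedge (α x) (extDeriv β x) v := by
  have h1 := (wedgeL (E := E) k l).hasFDerivAt_of_bilinear hα.hasFDerivAt hβ.hasFDerivAt
  have h2 : fderiv ℝ (fun y => wedge (α y) (β y)) x = _ := h1.fderiv
  rw [extDeriv, h2, ContinuousAlternatingMap.alternatizeUncurryFin_add,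
    ContinuousAlternatingMap.add_apply, add_comm (_ : ℝ),
    wedge_alternatizeUncurryFin_left (fderiv ℝ α x) (β x) _ (fun u => rfl) h,
    wedge_alternatizeUncurryFin_right (α x) (fderiv ℝ β x) _ (fun u => rfl)]
  rfl

end VectorSpace

section Manifold

open Filter Topology

variable {E : Type*} [NormedAddCommGroup E] [NormedSpace ℝ E] [FiniteDimensional ℝ E]
  {H : Type*} [TopologicalSpace H] {I : ModelWithCorners ℝ E H} [I.Boundaryless]
  {M : Type*} [TopologicalSpace M] [ChartedSpace H M]
  {E' : Type*} [NormedAddCommGroup E'] [NormedSpace ℝ E'] [FiniteDimensional ℝ E']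
  {H' : Type*} [TopologicalSpace H'] {I' : ModelWithCorners ℝ E' H'} [I'.Boundaryless]
  {N : Type*} [TopologicalSpace N] [ChartedSpace H' N]
  {E'' : Type*} [NormedAddCommGroup E''] [NormedSpace ℝ E''] [FiniteDimensional ℝ E'']
  {H'' : Type*} [TopologicalSpace H''] {I'' : ModelWithCorners ℝ E'' H''} [I''.Boundaryless]
  {P : Type*} [TopologicalSpace P] [ChartedSpace H'' P]

theorem inChart_vectorSpace {k : ℕ} (φ : E → E [⋀^Fin k]→L[ℝ] ℝ) (x : E) :
    inChart 𝓘(ℝ, E) (M := E) x φ = φ := by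
  funext y
  ext v
  have e1 : (extChartAt 𝓘(ℝ, E) x).symm = (id : E → E) := by simp [mfld_simps]; rfl
  simp only [inChart]
  rw [e1]
  simp only [mfderiv_id]
  rfl

theorem extd_vectorSpace {k : ℕ} (φ : E → E [⋀^Fin k]→L[ℝ] ℝ) (x : E) :
    extd 𝓘(ℝ, E) (M := E) φ x = extDeriv φ x := by
  simp only [extd, inChart_vectorSpace]
  rfl

theorem pullback_vectorSpace {k : ℕ} (φ : E' → E' [⋀^Fin k]→L[ℝ] ℝ) (f : E → E') (x : E) :
    pullback 𝓘(ℝ, E) 𝓘(ℝ, E') (M := E) (N := E') f φ x =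
      (φ (f x)).compContinuousLinearMap (fderiv ℝ f x) := by
  simp only [pullback, pullbackAt, mfderiv_eq_fderiv]
  rfl

theorem pullback_apply {k : ℕ} (f : M → N) (φ : DForm I' N k) (x : M)
    (v : Fin k → TangentSpace I x) :
    pullback I I' f φ x v = φ (f x) (fun i => mfderiv I I' f x (v i)) := rfl

theorem pullback_comp_apply {k : ℕ} {f : M → N} {g : N → P} {x : M}
    (hf : MDifferentiableAt I I' f x) (hg : MDifferentiableAt I' I'' g (f x))
    (φ : DForm I'' P k) :
    pullback I I'' (g ∘ f) φ x = pullback I I' f (pullback I' I'' g φ) x := by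
  ext v
  simp only [pullback_apply, mfderiv_comp x hg hf]
  rfl

theorem pullback_congr {k : ℕ} {f g : M → N} {x : M} (h : f =ᶠ[𝓝 x] g) (φ : DForm I' N k) :
    pullback I I' f φ x = pullback I I' g φ x := by
  ext v
  have h1 : mfderiv I I' f x = (mfderiv I I' g x : E →L[ℝ] E') := h.mfderiv_eq
  have h2 := h.eq_of_nhds
  let Φ : N → E' [⋀^Fin k]→L[ℝ] ℝ := φ
  have e1 : pullback I I' f φ x v = Φ (f x) (fun i => (mfderiv I I' f x : E →L[ℝ] E') (v i)) := rfl
  have e2 : pullback I I' g φ x v = Φ (g x) (fun i => (mfderiv I I' g x : E →L[ℝ] E') (v i)) := rfl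
  rw [e1, e2, h1, h2]

theorem pullback_id {k : ℕ} (φ : DForm I M k) (x : M) : pullback I I id φ x = φ x := by
  ext v
  simp only [pullback_apply, mfderiv_id]
  rfl

theorem pullback_congr_form {k : ℕ} {f : M → N} {x : M} {φ ψ : DForm I' N k} (h : φ (f x) = ψ (f x)) :
    pullback I I' f φ x = pullback I I' f ψ x := by
  simp only [pullback, h]

variable [IsManifold I ∞ M] [IsManifold I' ∞ N]

theorem mdifferentiableAt_extChartAt' {x y : M} (h : y ∈ (extChartAt I x).source) :
    MDifferentiableAt I 𝓘(ℝ, E) (extChartAt I x) y :=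
  ((contMDiffAt_extChartAt' (n := ∞) (by simpa using h)).mdifferentiableAt (by simp))

theorem contMDiffAt_extChartAt_symm {x : M} {y : E} (h : y ∈ (extChartAt I x).target) :
    ContMDiffAt 𝓘(ℝ, E) I ∞ (extChartAt I x).symm y :=
  (contMDiffOn_extChartAt_symm x).contMDiffAt ((isOpen_extChartAt_target x).mem_nhds h)

theorem pullback_extChartAt_inChart {k : ℕ} (φ : DForm I M k) {x y : M}
    (h : y ∈ (extChartAt I x).source) :
    pullback I 𝓘(ℝ, E) (extChartAt I x) (inChart I x φ) y = φ y := by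
  have h1 : pullback I 𝓘(ℝ, E) (extChartAt I x) (inChart I x φ) y =
      pullback I I ((extChartAt I x).symm ∘ extChartAt I x) φ y :=
    (pullback_comp_apply (mdifferentiableAt_extChartAt' h)
      ((contMDiffAt_extChartAt_symm ((extChartAt I x).map_source h)).mdifferentiableAt (by simp))
      φ).symm
  rw [h1, ← pullback_id φ y]
  apply pullback_congr
  filter_upwards [(isOpen_extChartAt_source x).mem_nhds h] with z hz
  exact (extChartAt I x).left_inv hz

theorem inChart_pullback_eventuallyEq {k : ℕ} {f : M → N} (φ : DForm I' N k) {x y : M} {z : N}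
    (hf : ContMDiffAt I I' ∞ f y) (hy : y ∈ (extChartAt I x).source)
    (hz : f y ∈ (extChartAt I' z).source) :
    inChart I x (pullback I I' f φ) =ᶠ[𝓝 (extChartAt I x y)] fun w =>
      (inChart I' z φ (extChartAt I' z (f ((extChartAt I x).symm w)))).compContinuousLinearMap
        (fderiv ℝ (fun w => extChartAt I' z (f ((extChartAt I x).symm w))) w) := by
  have hf1 : ∀ᶠ y' in 𝓝 y, ContMDiffAt I I' 1 f y' := (contMDiffAt_iff_contMDiffAt_nhds (by simp)).1 (hf.of_le (by exact_mod_cast le_top))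
  have hf2 : ∀ᶠ y' in 𝓝 y, f y' ∈ (extChartAt I' z).source :=
    hf.continuousAt.eventually ((isOpen_extChartAt_source z).mem_nhds hz)
  have ht : (extChartAt I x) y ∈ (extChartAt I x).target := (extChartAt I x).map_source hy
  have hc : Tendsto (extChartAt I x).symm (𝓝 (extChartAt I x y)) (𝓝 y) := by
    have := (contMDiffAt_extChartAt_symm ht).continuousAt
    rwa [ContinuousAt, (extChartAt I x).left_inv hy] at this
  filter_upwards [hc.eventually hf1, hc.eventually hf2,
    (isOpen_extChartAt_target x).mem_nhds ht] with w h1 h2 h3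
  have hs : MDifferentiableAt 𝓘(ℝ, E) I (extChartAt I x).symm w :=
    (contMDiffAt_extChartAt_symm h3).mdifferentiableAt (by simp)
  have hfw := h1.mdifferentiableAt one_ne_zero
  have s1 : inChart I x (pullback I I' f φ) w =
      pullback 𝓘(ℝ, E) I' (f ∘ (extChartAt I x).symm) φ w := (pullback_comp_apply hs hfw φ).symm
  have s2 : pullback 𝓘(ℝ, E) I' (f ∘ (extChartAt I x).symm) φ w =
      pullback 𝓘(ℝ, E) I' (f ∘ (extChartAt I x).symm)
        (pullback I' 𝓘(ℝ, E') (extChartAt I' z) (inChart I' z φ)) w :=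
    pullback_congr_form (pullback_extChartAt_inChart φ h2).symm
  have s3 : pullback 𝓘(ℝ, E) I' (f ∘ (extChartAt I x).symm)
        (pullback I' 𝓘(ℝ, E') (extChartAt I' z) (inChart I' z φ)) w =
      pullback 𝓘(ℝ, E) 𝓘(ℝ, E') (extChartAt I' z ∘ (f ∘ (extChartAt I x).symm))
          (inChart I' z φ) w :=
    (pullback_comp_apply (hfw.comp w hs) (mdifferentiableAt_extChartAt' h2) _).symm
  exact s1.trans (s2.trans (s3.trans (pullback_vectorSpace _ _ _)))

/-- Smoothness of a form at a point. -/
def SmoothAt (I : ModelWithCorners ℝ E H) {k : ℕ} (φ : DForm I M k) (x : M) : Prop :=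
  ContDiffAt ℝ ∞ (inChart I x φ) (extChartAt I x x)

theorem contDiffAt_writtenInChart {f : M → N} {x y : M} {z : N} (hf : ContMDiffAt I I' ∞ f y)
    (hy : y ∈ (extChartAt I x).source) (hz : f y ∈ (extChartAt I' z).source) :
    ContDiffAt ℝ ∞ (fun w => extChartAt I' z (f ((extChartAt I x).symm w))) (extChartAt I x y) := by
  have ht : (extChartAt I x) y ∈ (extChartAt I x).target := (extChartAt I x).map_source hy
  rw [← contMDiffAt_iff_contDiffAt]
  have h1 := contMDiffAt_extChartAt_symm ht
  have h2 : ContMDiffAt I' 𝓘(ℝ, E') ∞ (extChartAt I' z) (f y) :=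
    contMDiffAt_extChartAt' (by simpa using hz)
  refine ContMDiffAt.comp (extChartAt I x y) (g := fun p => extChartAt I' z (f p)) (I' := I) ?_ h1
  rw [(extChartAt I x).left_inv hy]
  exact h2.comp y hf

theorem contDiffAt_inChart_pullback {k : ℕ} {f : M → N} {φ : DForm I' N k} {x y : M} {z : N}
    (hf : ContMDiffAt I I' ∞ f y) (hy : y ∈ (extChartAt I x).source)
    (hz : f y ∈ (extChartAt I' z).source)
    (hφ : ContDiffAt ℝ ∞ (inChart I' z φ) (extChartAt I' z (f y))) :
    ContDiffAt ℝ ∞ (inChart I x (pullback I I' f φ)) (extChartAt I x y) := by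
  refine ContDiffAt.congr_of_eventuallyEq ?_ (inChart_pullback_eventuallyEq φ hf hy hz)
  have hF := contDiffAt_writtenInChart hf hy hz
  refine ContDiffAt.alternating_comp (n := ⊤)
    (φ := fun w => inChart I' z φ (extChartAt I' z (f ((extChartAt I x).symm w)))) ?_ (hF.fderiv_right (m := ∞) (by simp))
  refine ContDiffAt.comp (g := inChart I' z φ) (extChartAt I x y) ?_ hF
  rwa [(extChartAt I x).left_inv hy]

theorem smoothAt_iff_of_mem_source {k : ℕ} {φ : DForm I M k} {x y : M}
    (h : y ∈ (extChartAt I x).source) :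
    SmoothAt I φ y ↔ ContDiffAt ℝ ∞ (inChart I x φ) (extChartAt I x y) := by
  have e : pullback I I id φ = φ := funext fun x => pullback_id φ x
  constructor
  · intro hh
    have := contDiffAt_inChart_pullback (f := id) (φ := φ) (x := x) contMDiffAt_id h
      (mem_extChartAt_source y) hh
    rwa [e] at this
  · intro hh
    have := contDiffAt_inChart_pullback (f := id) (φ := φ) (x := y) contMDiffAt_id
      (mem_extChartAt_source y) h hh
    rwa [e] at this

theorem SmoothAt.pullback {k : ℕ} {f : M → N} {φ : DForm I' N k} {x : M}
    (hφ : SmoothAt I' φ (f x)) (hf : ContMDiffAt I I' ∞ f x) :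
    SmoothAt I (pullback I I' f φ) x :=
  contDiffAt_inChart_pullback hf (mem_extChartAt_source x) (mem_extChartAt_source (f x)) hφ

theorem SmoothAt.differentiableAt {k : ℕ} {φ : DForm I M k} {x : M} (h : SmoothAt I φ x) :
    DifferentiableAt ℝ (inChart I x φ) (extChartAt I x x) :=
  ContDiffAt.differentiableAt h (by simp)

theorem extd_pullback {k : ℕ} {f : M → N} {φ : DForm I' N k} {x : M}
    (hφ : SmoothAt I' φ (f x)) (hf : ContMDiffAt I I' ∞ f x) :
    extd I (EDS.pullback I I' f φ) x = EDS.pullback I I' f (extd I' φ) x := by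
  have h := inChart_pullback_eventuallyEq φ hf (mem_extChartAt_source x)
    (mem_extChartAt_source (f x))
  have hF := contDiffAt_writtenInChart hf (mem_extChartAt_source x) (mem_extChartAt_source (f x))
  have e1 : extd I (EDS.pullback I I' f φ) x =
    (extDeriv (inChart I x (EDS.pullback I I' f φ)) (extChartAt I x x)) := rfl
  have hFx : extChartAt I' (f x) (f ((extChartAt I x).symm (extChartAt I x x))) =
      extChartAt I' (f x) (f x) := by rw [(extChartAt I x).left_inv (mem_extChartAt_source x)]
  have hφ' := hφ.differentiableAt
  rw [← hFx] at hφ'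
  have e2 := extDeriv_pullback (r := ∞)
    (f := fun w => extChartAt I' (f x) (f ((extChartAt I x).symm w))) hφ' hF
    (by simp only [minSmoothness_of_isRCLikeNormedField]
        exact WithTop.coe_le_coe.2 (le_top : (2 : ℕ∞) ≤ ⊤))
  rw [e1, h.extDeriv_eq]
  refine e2.trans ?_
  rw [hFx]
  have e3 : fderiv ℝ (fun w => extChartAt I' (f x) (f ((extChartAt I x).symm w))) (extChartAt I x x)
      = (mfderiv I I' f x : E →L[ℝ] E') := by
    have e4 : (mfderiv I I' f x : E →L[ℝ] E') = fderivWithin ℝ (writtenInExtChartAt I I' x f)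
      (range I) (extChartAt I x x) := (hf.mdifferentiableAt (by simp)).mfderiv
    rw [e4, I.range_eq_univ, fderivWithin_univ]
    rfl
  rw [e3]
  rfl

theorem inChart_eventuallyEq {k : ℕ} {φ ψ : DForm I M k} {x y : M} (hy : y ∈ (extChartAt I x).source)
    (h : ∀ᶠ z in 𝓝 y, φ z = ψ z) :
    inChart I x φ =ᶠ[𝓝 (extChartAt I x y)] inChart I x ψ := by
  have hc : Tendsto (extChartAt I x).symm (𝓝 (extChartAt I x y)) (𝓝 y) := by
    have := (contMDiffAt_extChartAt_symm ((extChartAt I x).map_source hy)).continuousAt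
    rwa [ContinuousAt, (extChartAt I x).left_inv hy] at this
  filter_upwards [hc.eventually h] with w hw
  simp only [inChart, hw]

theorem SmoothAt.congr {k : ℕ} {φ ψ : DForm I M k} {x : M} (hφ : SmoothAt I φ x)
    (h : ∀ᶠ z in 𝓝 x, φ z = ψ z) : SmoothAt I ψ x :=
  ContDiffAt.congr_of_eventuallyEq hφ
    (inChart_eventuallyEq (mem_extChartAt_source x) h).symm

theorem extd_congr {k : ℕ} {φ ψ : DForm I M k} {x : M} (h : ∀ᶠ z in 𝓝 x, φ z = ψ z) :
    extd I φ x = extd I ψ x :=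
  (inChart_eventuallyEq (mem_extChartAt_source x) h).extDeriv_eq

theorem inChart_extd {k : ℕ} {φ : DForm I M k} {x : M} {w : E} (hw : w ∈ (extChartAt I x).target)
    (hφ : SmoothAt I φ ((extChartAt I x).symm w)) :
    inChart I x (extd I φ) w = extDeriv (inChart I x φ) w := by
  have h := extd_pullback (I := 𝓘(ℝ, E)) hφ (contMDiffAt_extChartAt_symm hw)
  exact h.symm.trans (extd_vectorSpace (inChart I x φ) w)

theorem SmoothAt.extd {k : ℕ} {φ : DForm I M k} {x : M} (h : ∀ᶠ y in 𝓝 x, SmoothAt I φ y) :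
    SmoothAt I (extd I φ) x := by
  have hc : Tendsto (extChartAt I x).symm (𝓝 (extChartAt I x x)) (𝓝 x) := by
    have := (contMDiffAt_extChartAt_symm (I := I) (mem_extChartAt_target x)).continuousAt
    rwa [ContinuousAt, (extChartAt I x).left_inv (mem_extChartAt_source x)] at this
  have e : inChart I x (EDS.extd I φ) =ᶠ[𝓝 (extChartAt I x x)] extDeriv (inChart I x φ) := by
    filter_upwards [hc.eventually h, extChartAt_target_mem_nhds x] with w h1 h2
    exact inChart_extd h2 h1
  refine ContDiffAt.congr_of_eventuallyEq ?_ e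
  have h0 : ContDiffAt ℝ ∞ (inChart I x φ) (extChartAt I x x) := h.self_of_nhds
  exact (ContinuousAlternatingMap.alternatizeUncurryFinCLM ℝ E ℝ).contDiff.contDiffAt.comp _
    (h0.fderiv_right (m := ∞) (by simp))

theorem extd_extd {k : ℕ} {φ : DForm I M k} {x : M} (h : ∀ᶠ y in 𝓝 x, SmoothAt I φ y) :
    extd I (extd I φ) x = 0 := by
  have hc : Tendsto (extChartAt I x).symm (𝓝 (extChartAt I x x)) (𝓝 x) := by
    have := (contMDiffAt_extChartAt_symm (I := I) (mem_extChartAt_target x)).continuousAt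
    rwa [ContinuousAt, (extChartAt I x).left_inv (mem_extChartAt_source x)] at this
  have e : inChart I x (extd I φ) =ᶠ[𝓝 (extChartAt I x x)] extDeriv (inChart I x φ) := by
    filter_upwards [hc.eventually h, extChartAt_target_mem_nhds x] with w h1 h2
    exact inChart_extd h2 h1
  have h0 : ContDiffAt ℝ ∞ (inChart I x φ) (extChartAt I x x) := h.self_of_nhds
  have := extDeriv_extDeriv_apply h0 (by simp only [minSmoothness_of_isRCLikeNormedField]
                                         exact WithTop.coe_le_coe.2 (le_top : (2 : ℕ∞) ≤ ⊤))
  exact e.extDeriv_eq.trans this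

theorem inChart_smul {k : ℕ} (f : M → ℝ) (φ : DForm I M k) (x : M) :
    inChart I x (fun y => f y • φ y) =
      fun w => f ((extChartAt I x).symm w) • inChart I x φ w := rfl

theorem inChart_wedge {k l : ℕ} (α : DForm I M k) (β : DForm I M l) (x : M) :
    inChart I x (fun y => wedge (α y) (β y)) =
      fun w => wedge (inChart I x α w) (inChart I x β w) := by
  funext w
  exact wedge_comp _ _ _

theorem SmoothAt.zero (k : ℕ) (x : M) : SmoothAt I (0 : DForm I M k) x :=
  contDiffAt_const (c := (0 : E [⋀^Fin k]→L[ℝ] ℝ))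

theorem SmoothAt.add {k : ℕ} {φ ψ : DForm I M k} {x : M} (hφ : SmoothAt I φ x)
    (hψ : SmoothAt I ψ x) : SmoothAt I (φ + ψ) x :=
  ContDiffAt.add (f := inChart I x φ) (g := inChart I x ψ) hφ hψ

theorem SmoothAt.sum {k : ℕ} {ι : Type*} {s : Finset ι} {φ : ι → DForm I M k} {x : M}
    (hφ : ∀ i ∈ s, SmoothAt I (φ i) x) : SmoothAt I (∑ i ∈ s, φ i) x := by
  classical
  induction s using Finset.induction_on with
  | empty => exact SmoothAt.zero k x
  | insert a s ha ih =>
    rw [Finset.sum_insert ha]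
    exact (hφ a (by simp)).add (ih fun i hi => hφ i (by simp [hi]))

theorem contDiffAt_comp_extChartAt_symm {f : M → ℝ} {x y : M} (hf : ContMDiffAt I 𝓘(ℝ, ℝ) ∞ f y)
    (hy : y ∈ (extChartAt I x).source) :
    ContDiffAt ℝ ∞ (fun w => f ((extChartAt I x).symm w)) (extChartAt I x y) := by
  rw [← contMDiffAt_iff_contDiffAt]
  refine ContMDiffAt.comp (g := f) (I' := I) _ ?_
    (contMDiffAt_extChartAt_symm ((extChartAt I x).map_source hy))
  rwa [(extChartAt I x).left_inv hy]

theorem contMDiffAt_of_comp_extChartAt_symm {f : M → ℝ} {x y : M}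
    (hy : y ∈ (extChartAt I x).source)
    (h : ContDiffAt ℝ ∞ (fun w => f ((extChartAt I x).symm w)) (extChartAt I x y)) :
    ContMDiffAt I 𝓘(ℝ, ℝ) ∞ f y := by
  have h1 := (contMDiffAt_iff_contDiffAt.2 h).comp y
    (contMDiffAt_extChartAt' (I := I) (n := ∞) (x := x) (x' := y) (by simpa using hy))
  refine h1.congr_of_eventuallyEq ?_
  filter_upwards [(isOpen_extChartAt_source x).mem_nhds hy] with z hz
  exact congrArg f ((extChartAt I x).left_inv hz).symm

theorem SmoothAt.smul {k : ℕ} {f : M → ℝ} {φ : DForm I M k} {x : M}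
    (hf : ContMDiffAt I 𝓘(ℝ, ℝ) ∞ f x) (hφ : SmoothAt I φ x) :
    SmoothAt I (fun y => f y • φ y) x :=
  ContDiffAt.smul (f := fun w => f ((extChartAt I x).symm w)) (g := inChart I x φ)
    (contDiffAt_comp_extChartAt_symm hf (mem_extChartAt_source x)) hφ

theorem SmoothAt.wedge {k l : ℕ} {α : DForm I M k} {β : DForm I M l} {x : M}
    (hα : SmoothAt I α x) (hβ : SmoothAt I β x) :
    SmoothAt I (fun y => EDS.wedge (α y) (β y)) x := by
  unfold SmoothAt
  rw [inChart_wedge]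
  exact ContDiffAt.wedge (n := ⊤) hα hβ

theorem extd_add {k : ℕ} {φ ψ : DForm I M k} {x : M} (hφ : SmoothAt I φ x)
    (hψ : SmoothAt I ψ x) : extd I (φ + ψ) x = extd I φ x + extd I ψ x :=
  extDeriv_add hφ.differentiableAt hψ.differentiableAt

theorem extd_zero {k : ℕ} (x : M) : extd I (0 : DForm I M k) x = 0 := by
  have h := extd_add (SmoothAt.zero (I := I) k x) (SmoothAt.zero k x)
  simpa using h

theorem extd_const_smul {k : ℕ} (c : ℝ) {φ : DForm I M k} {x : M} :
    extd I (fun y => c • φ y) x = c • extd I φ x :=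
  extDeriv_smul c (inChart I x φ)

theorem extd_sum {k : ℕ} {ι : Type*} {s : Finset ι} {φ : ι → DForm I M k} {x : M}
    (hφ : ∀ i ∈ s, SmoothAt I (φ i) x) : extd I (∑ i ∈ s, φ i) x = ∑ i ∈ s, extd I (φ i) x := by
  classical
  induction s using Finset.induction_on with
  | empty => simpa using extd_zero x
  | insert a s ha ih =>
    rw [Finset.sum_insert ha, Finset.sum_insert ha, extd_add (hφ a (by simp)) 
      (SmoothAt.sum fun i hi => hφ i (by simp [hi])), ih fun i hi => hφ i (by simp [hi])]

theorem inChart_self {k : ℕ} (φ : DForm I M k) (x : M) :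
    inChart I x φ (extChartAt I x x) = φ x := by
  have : IsManifold I 1 M := .of_le (n := ∞) (by exact_mod_cast le_top)
  have h := pullback_extChartAt_inChart φ (mem_extChartAt_source (I := I) x)
  rw [← h]
  have h2 : (mfderiv I 𝓘(ℝ, E) (extChartAt I x) x : E →L[ℝ] E) = ContinuousLinearMap.id ℝ E :=
    mfderiv_extChartAt_self
  have h3 : pullback I 𝓘(ℝ, E) (extChartAt I x) (inChart I x φ) x =
    (inChart I x φ (extChartAt I x x)).compContinuousLinearMap
      (mfderiv I 𝓘(ℝ, E) (extChartAt I x) x : E →L[ℝ] E) := rfl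
  rw [h3, h2]
  rfl

theorem extd_wedge_apply {k l : ℕ} {α : DForm I M k} {β : DForm I M l} {x : M}
    (hα : SmoothAt I α x) (hβ : SmoothAt I β x) (h : k + 1 + l = k + l + 1)
    (v : Fin (k + l + 1) → TangentSpace I x) :
    extd I (fun y => wedge (α y) (β y)) x v =
      wedge (extd I α x) (β x) (v ∘ Fin.cast h) + (-1) ^ k * wedge (α x) (extd I β x) v := by
  have h1 := extDeriv_wedge hα.differentiableAt hβ.differentiableAt h v
  rw [← inChart_wedge, inChart_self, inChart_self] at h1
  exact h1

end Manifold


section Covectors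

/-- Covectors, as alternating 1-forms. -/
abbrev Covector (V : Type*) [AddCommGroup V] [Module ℝ V] [TopologicalSpace V] : Type _ :=
  V [⋀^Fin 1]→L[ℝ] ℝ

section Topological

variable {V : Type*} [AddCommGroup V] [Module ℝ V] [TopologicalSpace V]

theorem Covector.map_add (c : Covector V) (u v : V) :
    c (fun _ => u + v) = c (fun _ => u) + c (fun _ => v) := by
  have h := ContinuousAlternatingMap.map_update_add c (fun _ : Fin 1 => u) 0 u v
  have e : ∀ w : V, Function.update (fun _ : Fin 1 => u) 0 w = fun _ => w := fun w => by
    funext i; fin_cases i; simp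
  rwa [e, e, e] at h

theorem Covector.map_smul (c : Covector V) (r : ℝ) (v : V) :
    c (fun _ => r • v) = r * c (fun _ => v) := by
  have h := ContinuousAlternatingMap.map_update_smul c (fun _ : Fin 1 => v) 0 r v
  have e : ∀ w : V, Function.update (fun _ : Fin 1 => v) 0 w = fun _ => w := fun w => by
    funext i; fin_cases i; simp
  rwa [e, e] at h

/-- A covector, as a linear form. -/
def Covector.toDual : Covector V →ₗ[ℝ] Module.Dual ℝ V where
  toFun c :=
    { toFun := fun v => c fun _ => v
      map_add' := c.map_add
      map_smul' := c.map_smul }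
  map_add' _ _ := rfl
  map_smul' _ _ := rfl

@[simp]
theorem Covector.toDual_apply (c : Covector V) (v : V) : Covector.toDual c v = c fun _ => v := rfl

theorem Covector.map_zero (c : Covector V) : c (fun _ => (0 : V)) = 0 :=
  (Covector.toDual c).map_zero

theorem Covector.map_sub (c : Covector V) (u v : V) :
    c (fun _ => u - v) = c (fun _ => u) - c (fun _ => v) :=
  (Covector.toDual c).map_sub u v

theorem Covector.map_sum (c : Covector V) {ι : Type*} (s : Finset ι) (v : ι → V) :
    c (fun _ => ∑ i ∈ s, v i) = ∑ i ∈ s, c (fun _ => v i) :=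
  _root_.map_sum (Covector.toDual c) v s

theorem Covector.sum_apply {ι : Type*} (s : Finset ι) (c : ι → Covector V) (v : V) :
    (∑ i ∈ s, c i) (fun _ => v) = ∑ i ∈ s, c i (fun _ => v) := by
  have h := congrArg (fun f => f v) (_root_.map_sum (Covector.toDual (V := V)) c s)
  simp

theorem Covector.apply_eq (c : Covector V) (v : Fin 1 → V) : c v = c fun _ => v 0 := by
  congr 1
  funext i
  rw [Subsingleton.elim i 0]

theorem Covector.ext' {c d : Covector V} (h : ∀ v : V, c (fun _ => v) = d fun _ => v) : c = d := by
  ext v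
  rw [c.apply_eq, d.apply_eq, h]

theorem Covector.toDual_injective : Function.Injective (Covector.toDual (V := V)) := by
  intro c d h
  exact Covector.ext' fun v => by simpa using congrArg (fun f => f v) h

/-- The subspace annihilated by a space of covectors. -/
def annSub (A : Submodule ℝ (Covector V)) : Submodule ℝ V where
  carrier := {v | ∀ a ∈ A, a (fun _ => v) = 0}
  zero_mem' a _ := a.map_zero
  add_mem' {u v} hu hv a ha := by
    rw [Covector.map_add, hu a ha, hv a ha, add_zero]
  smul_mem' r v hv a ha := by
    rw [Covector.map_smul, hv a ha, mul_zero]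

/-- The covectors annihilating a subspace. -/
def coann (K : Submodule ℝ V) : Submodule ℝ (Covector V) where
  carrier := {c | ∀ v ∈ K, c (fun _ => v) = 0}
  zero_mem' _ _ := rfl
  add_mem' {a b} ha hb v hv := by
    rw [ContinuousAlternatingMap.add_apply, ha v hv, hb v hv, add_zero]
  smul_mem' r a ha v hv := by
    rw [ContinuousAlternatingMap.smul_apply, ha v hv, smul_zero]

theorem mem_coann {K : Submodule ℝ V} {c : Covector V} :
    c ∈ coann K ↔ ∀ v ∈ K, c (fun _ => v) = 0 := Iff.rfl

theorem annSub_anti {A B : Submodule ℝ (Covector V)} (h : A ≤ B) : annSub B ≤ annSub A :=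
  fun _ hv a ha => hv a (h ha)

theorem mem_annSub_sup {A B : Submodule ℝ (Covector V)} {v : V} :
    v ∈ annSub (A ⊔ B) ↔ v ∈ annSub A ∧ v ∈ annSub B := by
  refine ⟨fun h => ⟨annSub_anti le_sup_left h, annSub_anti le_sup_right h⟩, fun h a ha => ?_⟩
  obtain ⟨a', ha', b, hb, rfl⟩ := Submodule.mem_sup.1 ha
  rw [ContinuousAlternatingMap.add_apply, h.1 a' ha', h.2 b hb, add_zero]

theorem mem_annSub_span {s : Set (Covector V)} {v : V} :
    v ∈ annSub (Submodule.span ℝ s) ↔ ∀ a ∈ s, a (fun _ => v) = 0 := by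
  refine ⟨fun h a ha => h a (Submodule.subset_span ha), fun h a ha => ?_⟩
  induction ha using Submodule.span_induction with
  | mem a ha => exact h a ha
  | zero => rfl
  | add a b _ _ ha hb => rw [ContinuousAlternatingMap.add_apply, ha, hb, add_zero]
  | smul r a _ ha => rw [ContinuousAlternatingMap.smul_apply, ha, smul_zero]

end Topological

variable {E : Type*} [NormedAddCommGroup E] [NormedSpace ℝ E] [FiniteDimensional ℝ E]
  {E' : Type*} [NormedAddCommGroup E'] [NormedSpace ℝ E'] [FiniteDimensional ℝ E']

theorem Covector.exists_toDual_eq (f : Module.Dual ℝ E) :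
    ∃ c : Covector E, ∀ v, c (fun _ => v) = f v :=
  ⟨ContinuousAlternatingMap.ofSubsingleton ℝ E ℝ (0 : Fin 1) (LinearMap.toContinuousLinearMap f),
    fun _ => rfl⟩

variable (E) in
/-- The identification of covectors with linear forms. -/
def Covector.equivDual : Covector E ≃ₗ[ℝ] Module.Dual ℝ E :=
  LinearEquiv.ofBijective Covector.toDual ⟨Covector.toDual_injective, fun f => by
    obtain ⟨c, hc⟩ := Covector.exists_toDual_eq f
    exact ⟨c, LinearMap.ext hc⟩⟩

theorem Covector.finrank_eq : Module.finrank ℝ (Covector E) = Module.finrank ℝ E := by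
  rw [(Covector.equivDual E).finrank_eq, Subspace.dual_finrank_eq]

theorem mem_of_annSub {A : Submodule ℝ (Covector E)} {c : Covector E}
    (h : ∀ v ∈ annSub A, c (fun _ => v) = 0) : c ∈ A := by
  have h1 : Covector.equivDual E c ∈ (A.map (Covector.equivDual E).toLinearMap) := by
    rw [← Subspace.dualCoannihilator_dualAnnihilator_eq (W := A.map (Covector.equivDual E).toLinearMap),
      Submodule.mem_dualAnnihilator]
    intro v hv
    refine h v fun a ha => ?_
    exact (Submodule.mem_dualCoannihilator _).1 hv (Covector.equivDual E a)
      (Submodule.mem_map_of_mem ha)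
  obtain ⟨d, hd, e⟩ := h1
  rwa [← (Covector.equivDual E).injective e]

theorem mem_of_coann {K : Submodule ℝ E} {v : E}
    (h : ∀ c ∈ coann K, c (fun _ => v) = 0) : v ∈ K := by
  by_contra hv
  obtain ⟨f, hf, hK⟩ := Submodule.exists_le_ker_of_notMem hv
  obtain ⟨c, hc⟩ := Covector.exists_toDual_eq f
  exact hf ((hc v).symm.trans (h c fun w hw => (hc w).trans (LinearMap.mem_ker.1 (hK hw))))

theorem sup_coann_eq_top {W : Submodule ℝ (Covector E)} {K : Submodule ℝ E}
    (h : ∀ v ∈ K, v ∈ annSub W → v = 0) : W ⊔ coann K = ⊤ := by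
  refine eq_top_iff.2 fun c _ => mem_of_annSub fun v hv => ?_
  rw [mem_annSub_sup] at hv
  rw [h v (mem_of_coann hv.2) hv.1, c.map_zero]

theorem exists_dual_vectors {ι : Type*} [Finite ι] [DecidableEq ι] {c : ι → Covector E}
    (h : LinearIndependent ℝ c) : ∃ v : ι → E, ∀ i j, c i (fun _ => v j) = if i = j then 1 else 0 := by
  have h1 : LinearIndependent ℝ (fun i => Covector.equivDual E (c i)) :=
    h.map' (Covector.equivDual E).toLinearMap (LinearEquiv.ker _)
  have h2 : ∀ j, ∃ v : E, ∀ i, c i (fun _ => v) = if i = j then 1 else 0 := by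
    intro j
    let b := Module.Basis.span h1
    obtain ⟨f, hf⟩ := (b.coord j).exists_extend
    refine ⟨(Module.evalEquiv ℝ E).symm f, fun i => ?_⟩
    have h3 : f (Covector.equivDual E (c i)) = if i = j then 1 else 0 := by
      have h4 : b i = (⟨Covector.equivDual E (c i), Submodule.subset_span ⟨i, rfl⟩⟩ :
        Submodule.span ℝ (range fun i => Covector.equivDual E (c i))) := Module.Basis.span_apply h1 i
      have h5 := congrArg (fun g => g (b i)) hf
      simp only [LinearMap.comp_apply, Module.Basis.coord_apply, Module.Basis.repr_self,
        Finsupp.single_apply] at h5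
      rw [h4] at h5
      exact h5
    rw [← h3, ← Module.apply_evalEquiv_symm_apply]
    rfl
  choose v hv using h2
  exact ⟨v, fun i j => hv j i⟩

/-- The pullback of covectors along a linear map. -/
abbrev Covector.comapL (L : E →L[ℝ] E') : Covector E' →ₗ[ℝ] Covector E :=
  ContinuousAlternatingMap.compContinuousLinearMapₗ L

theorem Covector.comapL_apply (L : E →L[ℝ] E') (c : Covector E') (v : E) :
    Covector.comapL L c (fun _ => v) = c fun _ => L v := rfl

theorem Covector.comapL_injective {L : E →L[ℝ] E'} (hL : Function.Surjective L) :
    Function.Injective (Covector.comapL L) := fun c d h => Covector.ext' fun w => by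
  obtain ⟨v, rfl⟩ := hL w
  exact congrArg (fun f : Covector E => f fun _ => v) h

theorem Covector.range_comapL {L : E →L[ℝ] E'} (hL : Function.Surjective L) :
    LinearMap.range (Covector.comapL L) = coann (LinearMap.ker L.toLinearMap) := by
  refine le_antisymm ?_ fun c hc => ?_
  · rintro _ ⟨c, rfl⟩ v hv
    rw [Covector.comapL_apply, show L v = 0 from hv, c.map_zero]
  · have h1 : LinearMap.ker L.toLinearMap ≤ LinearMap.ker (Covector.toDual c) := fun v hv => hc v hv
    obtain ⟨g, hg⟩ := L.toLinearMap.exists_rightInverse_of_surjective (LinearMap.range_eq_top.2 hL)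
    obtain ⟨d, hd⟩ := Covector.exists_toDual_eq (Covector.toDual c ∘ₗ g)
    refine ⟨d, Covector.ext' fun v => ?_⟩
    rw [Covector.comapL_apply, hd]
    have h2 : g (L v) - v ∈ LinearMap.ker L.toLinearMap := by
      have h4 := congrArg (fun f => f (L v)) hg
      simp only [LinearMap.comp_apply, LinearMap.id_apply] at h4
      rw [LinearMap.mem_ker, LinearMap.map_sub, h4]
      simp
    have h3 := hc _ h2
    rw [Covector.map_sub, sub_eq_zero] at h3
    exact h3

theorem exists_mem_annSub_of_comap {L : E →L[ℝ] E'} {W : Submodule ℝ (Covector E)} {v' : E'}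
    (h : v' ∈ annSub (W.comap (Covector.comapL L))) : ∃ v ∈ annSub W, L v = v' := by
  have h1 : v' ∈ (annSub W).map L.toLinearMap := by
    refine mem_of_coann fun c hc => h c ?_
    change Covector.comapL L c ∈ W
    exact mem_of_annSub fun v hv => hc (L v) ⟨v, hv, rfl⟩
  exact h1

theorem finrank_comap_add {L : E →L[ℝ] E'} (hL : Function.Surjective L)
    {W : Submodule ℝ (Covector E)}
    (h : ∀ v, L v = 0 → v ∈ annSub W → v = 0) :
    Module.finrank ℝ (W.comap (Covector.comapL L)) + Module.finrank ℝ E =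
      Module.finrank ℝ W + Module.finrank ℝ E' := by
  have h1 := Submodule.finrank_sup_add_finrank_inf_eq W (LinearMap.range (Covector.comapL L))
  have h2 : W ⊔ LinearMap.range (Covector.comapL L) = ⊤ := by
    rw [Covector.range_comapL hL]
    exact sup_coann_eq_top fun v hv => h v hv
  rw [h2, finrank_top, Covector.finrank_eq, LinearMap.finrank_range_of_inj (Covector.comapL_injective hL),
    Covector.finrank_eq] at h1
  have h3 : Module.finrank ℝ (W.comap (Covector.comapL L)) =
      Module.finrank ℝ ↥(W ⊓ LinearMap.range (Covector.comapL L)) := by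
    rw [inf_comm, ← Submodule.map_comap_eq]
    exact (LinearEquiv.finrank_eq (Submodule.equivMapOfInjective _ (Covector.comapL_injective hL) _))
  omega

end Covectors

theorem exists_extension_of_sup_eq {V : Type*} [AddCommGroup V] [Module ℝ V] (_ : FiniteDimensional ℝ V)
    {ι : Type*} {u : ι → V} (hu : LinearIndependent ℝ u) {S T : Submodule ℝ V}
    (h : Submodule.span ℝ (range u) ⊔ S = T) :
    ∃ w : Fin (Module.finrank ℝ T - Module.finrank ℝ (Submodule.span ℝ (range u))) → V,
      (∀ j, w j ∈ S) ∧ LinearIndependent ℝ (Sum.elim u w) ∧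
      Submodule.span ℝ (range (Sum.elim u w)) = T := by
  set A := Submodule.span ℝ (range u) with hA
  obtain ⟨C, hC⟩ := (A.comap S.subtype).exists_isCompl
  let C' := C.map S.subtype
  have hC' : C' ≤ S := Submodule.map_subtype_le S C
  have h1 : A ⊔ C' = T := by
    rw [← h]
    refine le_antisymm (sup_le_sup_left hC' A) (sup_le le_sup_left ?_)
    have h2 : (A.comap S.subtype ⊔ C).map S.subtype = S := by rw [hC.sup_eq_top]; simp
    rw [Submodule.map_sup] at h2
    rw [← h2]
    exact sup_le_sup_right (Submodule.map_comap_le _ _) _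
  have h2 : Disjoint A C' := by
    rw [Submodule.disjoint_def]
    rintro _ hx ⟨y, hy, rfl⟩
    have : y ∈ A.comap S.subtype ⊓ C := ⟨hx, hy⟩
    rw [hC.inf_eq_bot, Submodule.mem_bot] at this
    rw [this]; simp
  have h3 : Module.finrank ℝ C' = Module.finrank ℝ T - Module.finrank ℝ A := by
    have := Submodule.finrank_sup_add_finrank_inf_eq A C'
    rw [h1, h2.eq_bot, finrank_bot] at this
    omega
  let b := Module.finBasisOfFinrankEq ℝ C' h3
  have hs : Submodule.span ℝ (range fun j => (b j : V)) = C' := by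
    have h4 : (range fun j => (b j : V)) = C'.subtype '' range b := by
      rw [← range_comp]; rfl
    rw [h4, ← Submodule.map_span, b.span_eq]; simp
  refine ⟨fun j => b j, fun j => hC' (b j).2, ?_, ?_⟩
  · refine LinearIndependent.sum_type hu (b.linearIndependent.map' C'.subtype (by simp)) ?_
    rw [hs]
    exact h2
  · rw [Sum.elim_range, Submodule.span_union, hs]
    exact h1


section Frames

open Filter Topology

variable {E : Type*} [NormedAddCommGroup E] [NormedSpace ℝ E] [FiniteDimensional ℝ E]
  {H : Type*} [TopologicalSpace H] {I : ModelWithCorners ℝ E H} [I.Boundaryless]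
  {M : Type*} [TopologicalSpace M] [ChartedSpace H M] [IsManifold I ∞ M]

/-- The derivative at `y` of the chart at `x₀`. -/
def dChart (I : ModelWithCorners ℝ E H) {M : Type*} [TopologicalSpace M] [ChartedSpace H M]
    (x₀ y : M) : TangentSpace I y →L[ℝ] E :=
  mfderiv I 𝓘(ℝ, E) (extChartAt I x₀) y

theorem isInvertible_dChart {x₀ y : M} (hy : y ∈ (extChartAt I x₀).source) :
    (dChart I x₀ y).IsInvertible :=
  isInvertible_mfderiv_extChartAt (I := I) hy

theorem apply_eq_inChart {k : ℕ} (φ : DForm I M k) {x₀ y : M} (hy : y ∈ (extChartAt I x₀).source)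
    (v : Fin k → TangentSpace I y) :
    φ y v = inChart I x₀ φ (extChartAt I x₀ y) (fun i => dChart I x₀ y (v i)) :=
  (congrArg (fun ψ => ψ v) (pullback_extChartAt_inChart φ hy)).symm

/-- The expression of a vector field in the chart at `x₀`. -/
def vecInChart (I : ModelWithCorners ℝ E H) {M : Type*} [TopologicalSpace M] [ChartedSpace H M]
    (x₀ : M) (X : ∀ y : M, TangentSpace I y) : E → E := fun w =>
  dChart I x₀ ((extChartAt I x₀).symm w) (X ((extChartAt I x₀).symm w))

/-- Smoothness at `y` of a vector field, in the chart at `x₀`. -/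
def VecSmoothAt (I : ModelWithCorners ℝ E H) {M : Type*} [TopologicalSpace M] [ChartedSpace H M]
    (x₀ : M) (X : ∀ y : M, TangentSpace I y) (y : M) : Prop :=
  ContDiffAt ℝ ∞ (vecInChart I x₀ X) (extChartAt I x₀ y)

/-- The vector field with a given expression in the chart at `x₀`. -/
def vecOfChart (I : ModelWithCorners ℝ E H) {M : Type*} [TopologicalSpace M] [ChartedSpace H M]
    (x₀ : M) (v : E → E) (y : M) : TangentSpace I y :=
  (dChart I x₀ y).inverse (v (extChartAt I x₀ y))

theorem inChart_apply_vecInChart {k : ℕ} (φ : DForm I M k) (x₀ : M)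
    (X : Fin k → ∀ y : M, TangentSpace I y) {w : E} (hw : w ∈ (extChartAt I x₀).target) :
    inChart I x₀ φ w (fun i => vecInChart I x₀ (X i) w) =
      φ ((extChartAt I x₀).symm w) (fun i => X i ((extChartAt I x₀).symm w)) := by
  rw [apply_eq_inChart φ ((extChartAt I x₀).map_target hw), (extChartAt I x₀).right_inv hw]
  rfl

theorem SmoothAt.apply_vec {k : ℕ} {φ : DForm I M k} {x₀ y : M}
    {X : Fin k → ∀ y : M, TangentSpace I y} (hφ : SmoothAt I φ y)
    (hX : ∀ i, VecSmoothAt I x₀ (X i) y) (hy : y ∈ (extChartAt I x₀).source) :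
    ContMDiffAt I 𝓘(ℝ, ℝ) ∞ (fun z => φ z (fun i => X i z)) y := by
  refine contMDiffAt_of_comp_extChartAt_symm hy ?_
  have h := ContDiffAt.alternating_apply (n := ⊤) ((smoothAt_iff_of_mem_source hy).1 hφ) hX
  refine h.congr_of_eventuallyEq ?_
  filter_upwards [(isOpen_extChartAt_target x₀).mem_nhds ((extChartAt I x₀).map_source hy)] with w hw
  exact (inChart_apply_vecInChart φ x₀ X hw).symm

theorem apply_vecOfChart {k : ℕ} (φ : DForm I M k) (x₀ : M) {y : M}
    (hy : y ∈ (extChartAt I x₀).source) (v : Fin k → E → E) :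
    φ y (fun i => vecOfChart I x₀ (v i) y) =
      inChart I x₀ φ (extChartAt I x₀ y) (fun i => v i (extChartAt I x₀ y)) := by
  rw [apply_eq_inChart φ hy]
  simp only [vecOfChart, (isInvertible_dChart hy).self_apply_inverse]

theorem VecSmoothAt.ofChart {x₀ y : M} {v : E → E} (hy : y ∈ (extChartAt I x₀).source)
    (hv : ContDiffAt ℝ ∞ v (extChartAt I x₀ y)) : VecSmoothAt I x₀ (vecOfChart I x₀ v) y := by
  refine ContDiffAt.congr_of_eventuallyEq hv ?_
  filter_upwards [(isOpen_extChartAt_target x₀).mem_nhds ((extChartAt I x₀).map_source hy)] with w hw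
  simp only [vecInChart, vecOfChart]
  rw [(isInvertible_dChart ((extChartAt I x₀).map_target hw)).self_apply_inverse,
    (extChartAt I x₀).right_inv hw]

theorem exists_open_forall_smooth {ι : Type*} [Finite ι] {k : ℕ} {θ : ι → DForm I M k} {x₀ : M}
    (hs : ∀ i, ∀ᶠ y in 𝓝 x₀, SmoothAt I (θ i) y) :
    ∃ V, IsOpen V ∧ x₀ ∈ V ∧ ∀ i, ∀ y ∈ V, SmoothAt I (θ i) y := by
  obtain ⟨V, h1, h2, h3⟩ := eventually_nhds_iff.1 (eventually_all.2 hs)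
  exact ⟨V, h2, h3, fun i y hy => h1 y hy i⟩

/-- Local vector fields dual to linearly independent 1-forms. -/
theorem exists_dual_fields {ι : Type*} [Fintype ι] [DecidableEq ι] {θ : ι → DForm I M 1} {x₀ : M}
    (hs : ∀ i, ∀ᶠ y in 𝓝 x₀, SmoothAt I (θ i) y)
    (hli : LinearIndependent ℝ (fun i => θ i x₀)) :
    ∃ V, IsOpen V ∧ x₀ ∈ V ∧ V ⊆ (extChartAt I x₀).source ∧ (∀ i, ∀ y ∈ V, SmoothAt I (θ i) y) ∧
    ∃ e : ι → ∀ y : M, TangentSpace I y, (∀ j, ∀ y ∈ V, VecSmoothAt I x₀ (e j) y) ∧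
      ∀ y ∈ V, ∀ i j, θ i y (fun _ => e j y) = if i = j then 1 else 0 := by
  obtain ⟨v, hv⟩ := exists_dual_vectors (E := E) (c := fun i => θ i x₀) hli
  obtain ⟨V₀, hV₀, hxV₀, hsm⟩ := exists_open_forall_smooth hs
  let A : E → (ι → ℝ) →L[ℝ] (ι → ℝ) := fun w =>
    ∑ i, ∑ j, (inChart I x₀ (θ i) w (fun _ => v j)) •
      ((ContinuousLinearMap.proj (R := ℝ) (φ := fun _ : ι => ℝ) j).smulRight (Pi.single i (1 : ℝ)))
  have hA : ∀ w a i, A w a i = ∑ j, a j * inChart I x₀ (θ i) w (fun _ => v j) := by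
    intro w a i
    simp only [A, sum_apply, Finset.sum_apply, smul_apply, ContinuousLinearMap.smulRight_apply,
      ContinuousLinearMap.proj_apply, Pi.smul_apply, smul_eq_mul]
    rw [Finset.sum_eq_single i]
    · exact Finset.sum_congr rfl fun j _ => by simp; ring
    · intro b _ hb
      exact Finset.sum_eq_zero fun j _ => by simp [Pi.single_eq_of_ne (Ne.symm hb)]
    · simp
  have hA0 : A (extChartAt I x₀ x₀) = (ContinuousLinearEquiv.refl ℝ (ι → ℝ) : (ι → ℝ) →L[ℝ] (ι → ℝ)) := by
    ext1 a
    funext i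
    rw [hA]
    have : ∀ j, inChart I x₀ (θ i) (extChartAt I x₀ x₀) (fun _ => v j) = if i = j then 1 else 0 := by
      intro j
      rw [inChart_self]
      exact hv i j
    simp only [this]
    simp
  have hAs : ∀ y ∈ V₀ ∩ (extChartAt I x₀).source, ContDiffAt ℝ ∞ A (extChartAt I x₀ y) := by
    rintro y ⟨h1, h2⟩
    refine ContDiffAt.sum fun i _ => ContDiffAt.sum fun j _ => ?_
    have h3 : ContDiffAt ℝ ∞ (fun w => inChart I x₀ (θ i) w (fun _ => v j)) (extChartAt I x₀ y) :=
      ContDiffAt.alternating_apply (n := ⊤) ((smoothAt_iff_of_mem_source h2).1 (hsm i y h1))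
        (fun _ => contDiffAt_const)
    exact h3.smul contDiffAt_const
  have hx0 := mem_extChartAt_source (I := I) x₀
  have hcont : Tendsto (fun y => A (extChartAt I x₀ y)) (𝓝 x₀)
      (𝓝 (ContinuousLinearEquiv.refl ℝ (ι → ℝ) : (ι → ℝ) →L[ℝ] (ι → ℝ))) := by
    rw [← hA0]
    exact (hAs x₀ ⟨hxV₀, hx0⟩).continuousAt.comp (continuousAt_extChartAt x₀)
  have hinv : ∀ᶠ y in 𝓝 x₀, A (extChartAt I x₀ y) ∈
      range ((↑) : ((ι → ℝ) ≃L[ℝ] (ι → ℝ)) → (ι → ℝ) →L[ℝ] (ι → ℝ)) :=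
    hcont (ContinuousLinearEquiv.nhds _)
  have hev := (hinv.and (hV₀.mem_nhds hxV₀)).and ((isOpen_extChartAt_source (I := I) x₀).mem_nhds hx0)
  obtain ⟨V, h1, h2, h3⟩ := eventually_nhds_iff.1 hev
  refine ⟨V, h2, h3, fun y hy => (h1 y hy).2, fun i y hy => hsm i y (h1 y hy).1.2,
    fun j => vecOfChart I x₀ (fun w => ∑ k, ((A w).inverse (Pi.single j 1)) k • v k), ?_, ?_⟩
  · intro j y hy
    refine VecSmoothAt.ofChart (h1 y hy).2 (ContDiffAt.sum fun k _ => ContDiffAt.smul ?_ contDiffAt_const)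
    obtain ⟨⟨⟨e, he⟩, hy2⟩, hy3⟩ := h1 y hy
    have h4 : ContDiffAt ℝ ∞ ContinuousLinearMap.inverse (A (extChartAt I x₀ y)) := by
      rw [← he]; exact contDiffAt_map_inverse e
    have h5 : ContDiffAt ℝ ∞ (fun w => (A w).inverse) (extChartAt I x₀ y) :=
      h4.comp (extChartAt I x₀ y) (hAs y ⟨hy2, hy3⟩)
    have h6 : ContDiffAt ℝ ∞ (fun w => (A w).inverse (Pi.single j 1)) (extChartAt I x₀ y) :=
      h5.clm_apply contDiffAt_const
    exact (contDiffAt_pi.1 h6) k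
  · intro y hy i j
    obtain ⟨⟨⟨e, he⟩, hy2⟩, hy3⟩ := h1 y hy
    rw [apply_vecOfChart _ _ hy3 (fun _ => _)]
    have h4 := Covector.map_sum (inChart I x₀ (θ i) (extChartAt I x₀ y)) Finset.univ
      (fun k => ((A (extChartAt I x₀ y)).inverse (Pi.single j 1)) k • v k)
    rw [h4]
    simp only [Covector.map_smul]
    rw [← hA, ← he, ContinuousLinearMap.inverse_equiv]
    simp [Pi.single_apply]

end Frames

section Bilinear

variable {V : Type*} [AddCommGroup V] [Module ℝ V] [TopologicalSpace V]

theorem update_zero_pair {V : Type*} (u v x : V) : Function.update ![u, v] 0 x = ![x, v] := by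
  funext i; fin_cases i <;> rfl

theorem update_one_pair {V : Type*} (u v x : V) : Function.update ![u, v] 1 x = ![u, x] := by
  funext i; fin_cases i <;> rfl

/-- A 2-form, as a bilinear map. -/
def bil (ρ : V [⋀^Fin 2]→L[ℝ] ℝ) : V →ₗ[ℝ] V →ₗ[ℝ] ℝ :=
  LinearMap.mk₂ ℝ (fun u v => ρ ![u, v])
    (fun u u' v => by
      have h := ContinuousAlternatingMap.map_update_add ρ ![u, v] 0 u u'
      rwa [update_zero_pair, update_zero_pair, update_zero_pair] at h)
    (fun c u v => by
      have h := ContinuousAlternatingMap.map_update_smul ρ ![u, v] 0 c u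
      rwa [update_zero_pair, update_zero_pair] at h)
    (fun u v v' => by
      have h := ContinuousAlternatingMap.map_update_add ρ ![u, v] 1 v v'
      rwa [update_one_pair, update_one_pair, update_one_pair] at h)
    (fun c u v => by
      have h := ContinuousAlternatingMap.map_update_smul ρ ![u, v] 1 c v
      rwa [update_one_pair, update_one_pair] at h)

theorem bil_apply (ρ : V [⋀^Fin 2]→L[ℝ] ℝ) (u v : V) : bil ρ u v = ρ ![u, v] := rfl

theorem bil_self (ρ : V [⋀^Fin 2]→L[ℝ] ℝ) (u : V) : bil ρ u u = 0 :=
  ρ.map_eq_zero_of_eq ![u, u] (i := 0) (j := 1) rfl (by decide)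

theorem bil_swap (ρ : V [⋀^Fin 2]→L[ℝ] ℝ) (u v : V) : bil ρ u v = - bil ρ v u := by
  have h := bil_self ρ (u + v)
  simp only [map_add, LinearMap.add_apply, bil_self] at h
  linarith

theorem bil_add_left (ρ η : V [⋀^Fin 2]→L[ℝ] ℝ) (u v : V) :
    bil (ρ + η) u v = bil ρ u v + bil η u v := rfl

theorem bil_smul_left (c : ℝ) (ρ : V [⋀^Fin 2]→L[ℝ] ℝ) (u v : V) :
    bil (c • ρ) u v = c * bil ρ u v := rfl

theorem bil_zero_left (u v : V) : bil (0 : V [⋀^Fin 2]→L[ℝ] ℝ) u v = 0 := rfl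

theorem bil_sum_left {ι : Type*} (s : Finset ι) (ρ : ι → V [⋀^Fin 2]→L[ℝ] ℝ) (u v : V) :
    bil (∑ i ∈ s, ρ i) u v = ∑ i ∈ s, bil (ρ i) u v := by
  classical
  induction s using Finset.induction_on with
  | empty => simp [bil_zero_left]
  | insert a s ha ih => rw [Finset.sum_insert ha, Finset.sum_insert ha, bil_add_left, ih]

theorem bil_ext {ρ η : V [⋀^Fin 2]→L[ℝ] ℝ} (h : ∀ u v, bil ρ u v = bil η u v) : ρ = η := by
  ext v
  have e : v = ![v 0, v 1] := by funext i; fin_cases i <;> rfl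
  rw [e]
  exact h _ _

theorem vanishesOn_two_iff {ρ : V [⋀^Fin 2]→L[ℝ] ℝ} {P : Submodule ℝ V} :
    VanishesOn ρ P ↔ ∀ u ∈ P, ∀ v ∈ P, bil ρ u v = 0 := by
  refine ⟨fun h u hu v hv => h ![u, v] fun i => by fin_cases i; exacts [hu, hv], fun h v hv => ?_⟩
  have e : v = ![v 0, v 1] := by funext i; fin_cases i <;> rfl
  rw [e]
  exact h _ (hv 0) _ (hv 1)

theorem bil_smul_wedge (c : ℝ) (a b : V [⋀^Fin 1]→L[ℝ] ℝ) (u v : V) :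
    bil (c • wedge a b) u v =
      c * (a (fun _ => u) * b (fun _ => v) - a (fun _ => v) * b (fun _ => u)) := by
  have h := wedge_one_one a b ![u, v]
  change c * wedge a b ![u, v] = _
  rw [h]
  rfl

theorem bil_wedge (a b : V [⋀^Fin 1]→L[ℝ] ℝ) (u v : V) :
    bil (wedge a b) u v = a (fun _ => u) * b (fun _ => v) - a (fun _ => v) * b (fun _ => u) :=
  wedge_one_one a b ![u, v]

/-- The 2-form `ρ` precomposed with the map `u ↦ ∑ σ a (u) e a`. -/
def project {ι : Type*} [Fintype ι] (ρ : V [⋀^Fin 2]→L[ℝ] ℝ) (σ : ι → Covector V) (e : ι → V) :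
    V [⋀^Fin 2]→L[ℝ] ℝ :=
  ∑ a, ∑ b, (bil ρ (e a) (e b) / 2) • wedge (σ a) (σ b)

theorem bil_project {ι : Type*} [Fintype ι] (ρ : V [⋀^Fin 2]→L[ℝ] ℝ) (σ : ι → Covector V)
    (e : ι → V) (u v : V) :
    bil (project ρ σ e) u v = bil ρ (∑ a, σ a (fun _ => u) • e a) (∑ b, σ b (fun _ => v) • e b) := by
  simp only [project, bil_sum_left, bil_smul_wedge]
  have h : ∀ x y : V, bil ρ (∑ a, σ a (fun _ => x) • e a) (∑ b, σ b (fun _ => y) • e b) =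
      ∑ a, ∑ b, bil ρ (e a) (e b) * (σ a (fun _ => x) * σ b (fun _ => y)) := by
    intro x y
    simp only [map_sum, LinearMap.sum_apply, map_smul, LinearMap.smul_apply, smul_eq_mul]
    rw [Finset.sum_comm]
    refine Finset.sum_congr rfl fun b _ => ?_
    rw [Finset.mul_sum]
    exact Finset.sum_congr rfl fun a _ => by ring
  have h1 := h u v
  have h2 := h v u
  rw [bil_swap] at h2
  have h3 : bil ρ (∑ a, σ a (fun _ => u) • e a) (∑ b, σ b (fun _ => v) • e b) =
      (∑ a, ∑ b, bil ρ (e a) (e b) * (σ a (fun _ => u) * σ b (fun _ => v)) -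
        ∑ a, ∑ b, bil ρ (e a) (e b) * (σ a (fun _ => v) * σ b (fun _ => u))) / 2 := by
    rw [← h1, ← h2]; ring
  rw [h3, ← Finset.sum_sub_distrib, Finset.sum_div]
  refine Finset.sum_congr rfl fun a _ => ?_
  rw [← Finset.sum_sub_distrib, Finset.sum_div]
  exact Finset.sum_congr rfl fun b _ => by ring

theorem project_mem_Lambda2 {ι : Type*} [Fintype ι] (ρ : V [⋀^Fin 2]→L[ℝ] ℝ) (σ : ι → Covector V)
    (e : ι → V) : project ρ σ e ∈ Lambda2 (Submodule.span ℝ (range σ)) :=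
  Submodule.sum_mem _ fun a _ => Submodule.sum_mem _ fun b _ => Submodule.smul_mem _ _
    (Submodule.subset_span ⟨σ a, Submodule.subset_span ⟨a, rfl⟩, σ b,
      Submodule.subset_span ⟨b, rfl⟩, rfl⟩)

theorem bil_eq_zero_of_mem_Lambda2 {A : Submodule ℝ (Covector V)} {ρ : V [⋀^Fin 2]→L[ℝ] ℝ}
    (h : ρ ∈ Lambda2 A) {u : V} (hu : u ∈ annSub A) (v : V) : bil ρ u v = 0 := by
  induction h using Submodule.span_induction with
  | mem ρ h =>
    obtain ⟨a, ha, b, hb, rfl⟩ := h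
    rw [bil_wedge, hu a ha, hu b hb]; ring
  | zero => rfl
  | add a b _ _ ha hb => rw [bil_add_left, ha, hb, add_zero]
  | smul r a _ ha => rw [bil_smul_left, ha, mul_zero]

/-- The expansion of a covector in a frame with dual vectors. -/
theorem Covector.eq_sum_of_mem_span {ι : Type*} [Fintype ι] [DecidableEq ι] {θ : ι → Covector V}
    {e : ι → V} (h : ∀ i j, θ i (fun _ => e j) = if i = j then 1 else 0) {c : Covector V}
    (hc : c ∈ Submodule.span ℝ (range θ)) : c = ∑ i, c (fun _ => e i) • θ i := by
  obtain ⟨a, rfl⟩ := (Submodule.mem_span_range_iff_exists_fun ℝ).1 hc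
  refine Finset.sum_congr rfl fun i _ => ?_
  rw [Covector.sum_apply]
  simp only [ContinuousAlternatingMap.smul_apply, h]
  simp

theorem linearIndependent_of_dual {ι : Type*} [Fintype ι] [DecidableEq ι] {θ : ι → Covector V}
    {e : ι → V} (h : ∀ i j, θ i (fun _ => e j) = if i = j then 1 else 0) :
    LinearIndependent ℝ θ := by
  rw [Fintype.linearIndependent_iff]
  intro g hg i
  have h1 := congrArg (fun c : Covector V => c fun _ => e i) hg
  simp only [Covector.sum_apply, ContinuousAlternatingMap.smul_apply, h] at h1
  simpa using h1

end Bilinear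

section LA

variable {E : Type*} [NormedAddCommGroup E] [NormedSpace ℝ E] [FiniteDimensional ℝ E]

/-- The expansion of a vector in the frame dual to a coframe. -/
theorem eq_sum_of_coframe {ι : Type*} [Fintype ι] [DecidableEq ι] {θ : ι → Covector E} {e : ι → E}
    (h : ∀ i j, θ i (fun _ => e j) = if i = j then 1 else 0)
    (ht : Submodule.span ℝ (range θ) = ⊤) (v : E) : v = ∑ i, θ i (fun _ => v) • e i := by
  rw [← sub_eq_zero]
  have : v - ∑ i, θ i (fun _ => v) • e i ∈ (⊥ : Submodule ℝ E) := by
    refine mem_of_coann fun c _ => ?_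
    have hc : c ∈ Submodule.span ℝ (range θ) := ht ▸ Submodule.mem_top
    rw [Covector.map_sub, Covector.map_sum]
    conv_lhs => enter [1]; rw [Covector.eq_sum_of_mem_span h hc, Covector.sum_apply]
    rw [sub_eq_zero]
    refine Finset.sum_congr rfl fun i _ => ?_
    rw [Covector.map_smul, ContinuousAlternatingMap.smul_apply, smul_eq_mul, mul_comm]
  simpa using this

theorem span_eq_of_linearIndependent {ι : Type*} [Fintype ι] {θ : ι → Covector E}
    {W : Submodule ℝ (Covector E)} (hli : LinearIndependent ℝ θ) (hW : ∀ i, θ i ∈ W)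
    (hc : Module.finrank ℝ W ≤ Fintype.card ι) : Submodule.span ℝ (range θ) = W := by
  refine Submodule.eq_of_le_of_finrank_le (Submodule.span_le.2 (range_subset_iff.2 hW)) ?_
  rwa [finrank_span_eq_card hli]

end LA


theorem exists_linearIndependent_mem {V : Type*} [AddCommGroup V] [Module ℝ V]
    (_ : FiniteDimensional ℝ V) (W : Submodule ℝ V) :
    ∃ b : Fin (Module.finrank ℝ W) → V, (∀ i, b i ∈ W) ∧ LinearIndependent ℝ b :=
  ⟨fun i => Module.finBasis ℝ W i, fun i => (Module.finBasis ℝ W i).2,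
    (Module.finBasis ℝ W).linearIndependent.map' W.subtype (by simp)⟩

section Sections

open Filter Topology

variable {E : Type*} [NormedAddCommGroup E] [NormedSpace ℝ E] [FiniteDimensional ℝ E]
  {H : Type*} [TopologicalSpace H] {I : ModelWithCorners ℝ E H} [I.Boundaryless]
  {M : Type*} [TopologicalSpace M] [ChartedSpace H M] [IsManifold I ∞ M]

theorem extd_smul_apply_of_eq_zero {k : ℕ} {f : M → ℝ} {φ : DForm I M k} {x : M}
    (hf : ContMDiffAt I 𝓘(ℝ, ℝ) ∞ f x) (hφ : SmoothAt I φ x) (v : Fin (k + 1) → TangentSpace I x)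
    (h : ∀ i : Fin (k + 1), φ x (i.removeNth v) = 0) :
    extd I (fun y => f y • φ y) x v = f x * extd I φ x v := by
  have h1 := (contDiffAt_comp_extChartAt_symm hf (mem_extChartAt_source x)).differentiableAt
    (by simp)
  have h2 := hφ.differentiableAt
  have h3 := fderiv_fun_smul h1 h2
  rw [← inChart_smul] at h3
  let w : Fin (k + 1) → E := v
  obtain ⟨c, hc⟩ : ∃ c : E [⋀^Fin k]→L[ℝ] ℝ, c = φ x := ⟨φ x, rfl⟩
  have hc' : inChart I x φ (extChartAt I x x) = c := (inChart_self φ x).trans hc.symm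
  change ContinuousAlternatingMap.alternatizeUncurryFin
    (fderiv ℝ (inChart I x (fun y => f y • φ y)) (extChartAt I x x)) w =
    f x * ContinuousAlternatingMap.alternatizeUncurryFin
    (fderiv ℝ (inChart I x φ) (extChartAt I x x)) w
  rw [ContinuousAlternatingMap.alternatizeUncurryFin_apply,
    ContinuousAlternatingMap.alternatizeUncurryFin_apply, h3, Finset.mul_sum, hc',
    extChartAt_to_inv]
  refine Finset.sum_congr rfl fun i _ => ?_
  have h4 : c (i.removeNth w) = 0 := by rw [hc]; exact h i
  simp only [add_apply, smul_apply, ContinuousLinearMap.smulRight_apply,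
    ContinuousAlternatingMap.add_apply, ContinuousAlternatingMap.smul_apply, smul_eq_mul]
  rw [h4]
  simp only [zsmul_eq_mul]
  ring

theorem SmoothAt.fun_sum {k : ℕ} {ι : Type*} {s : Finset ι} {φ : ι → DForm I M k} {x : M}
    (hφ : ∀ i ∈ s, SmoothAt I (φ i) x) : SmoothAt I (fun y => ∑ i ∈ s, φ i y) x := by
  have h := SmoothAt.sum hφ
  rwa [show (∑ i ∈ s, φ i) = fun y => ∑ i ∈ s, φ i y from funext fun y => Finset.sum_apply y s φ] at h

theorem extd_fun_sum {k : ℕ} {ι : Type*} {s : Finset ι} {φ : ι → DForm I M k} {x : M}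
    (hφ : ∀ i ∈ s, SmoothAt I (φ i) x) :
    extd I (fun y => ∑ i ∈ s, φ i y) x = ∑ i ∈ s, extd I (φ i) x := by
  have h := extd_sum hφ
  rwa [show (∑ i ∈ s, φ i) = fun y => ∑ i ∈ s, φ i y from funext fun y => Finset.sum_apply y s φ] at h

theorem bil_extd_smul {f : M → ℝ} {φ : DForm I M 1} {x : M}
    (hf : ContMDiffAt I 𝓘(ℝ, ℝ) ∞ f x) (hφ : SmoothAt I φ x) {u v : TangentSpace I x}
    (hu : φ x (fun _ => u) = 0) (hv : φ x (fun _ => v) = 0) :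
    bil (extd I (fun y => f y • φ y) x) u v = f x * bil (extd I φ x) u v := by
  refine extd_smul_apply_of_eq_zero hf hφ ![u, v] fun i => ?_
  rw [Covector.apply_eq]
  fin_cases i
  · exact hv
  · exact hu

/-- A form with a prescribed value at a point. -/
theorem exists_smooth_eq {k : ℕ} (x₀ : M) (c : (TangentSpace I x₀) [⋀^Fin k]→L[ℝ] ℝ) :
    ∃ φ : DForm I M k, (∀ᶠ y in 𝓝 x₀, SmoothAt I φ y) ∧ φ x₀ = c := by
  have : IsManifold I 1 M := .of_le (n := ∞) (by exact_mod_cast le_top)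
  let c' : E [⋀^Fin k]→L[ℝ] ℝ := c
  let C : DForm 𝓘(ℝ, E) E k := fun _ => c'
  refine ⟨pullback I 𝓘(ℝ, E) (extChartAt I x₀) C, ?_, ?_⟩
  · filter_upwards [(isOpen_extChartAt_source (I := I) x₀).mem_nhds (mem_extChartAt_source x₀)] with y hy
    refine SmoothAt.pullback ?_ (contMDiffAt_extChartAt' (by simpa using hy))
    unfold SmoothAt
    rw [inChart_vectorSpace]
    exact contDiffAt_const
  · have h2 : (mfderiv I 𝓘(ℝ, E) (extChartAt I x₀) x₀ : E →L[ℝ] E) = ContinuousLinearMap.id ℝ E :=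
      mfderiv_extChartAt_self
    change c'.compContinuousLinearMap (mfderiv I 𝓘(ℝ, E) (extChartAt I x₀) x₀ : E →L[ℝ] E) = c'
    rw [h2]
    rfl

/-- Near `x`, the form `θ` is a smooth section of `W`. -/
def IsSectionAt (I : ModelWithCorners ℝ E H) (W : CoField I M) (x : M) (θ : DForm I M 1) : Prop :=
  ∀ᶠ y in 𝓝 x, SmoothAt I θ y ∧ θ y ∈ W y

theorem IsSectionAt.smoothAt {W : CoField I M} {x : M} {θ : DForm I M 1} (h : IsSectionAt I W x θ) :
    SmoothAt I θ x := h.self_of_nhds.1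

theorem IsSectionAt.mem {W : CoField I M} {x : M} {θ : DForm I M 1} (h : IsSectionAt I W x θ) :
    θ x ∈ W x := h.self_of_nhds.2

theorem IsSectionAt.eventually {W : CoField I M} {x : M} {θ : DForm I M 1}
    (h : IsSectionAt I W x θ) : ∀ᶠ y in 𝓝 x, IsSectionAt I W y θ := h.eventually_nhds

theorem IsSectionAt.mono {W W' : CoField I M} {x : M} {θ : DForm I M 1} (h : IsSectionAt I W x θ)
    (hW : ∀ y, W y ≤ W' y) : IsSectionAt I W' x θ :=
  Filter.Eventually.mono h fun y hy => ⟨hy.1, hW y hy.2⟩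

theorem IsSectionAt.sub {W : CoField I M} {x : M} {θ θ' : DForm I M 1} (h : IsSectionAt I W x θ)
    (h' : IsSectionAt I W x θ') : IsSectionAt I W x (fun y => θ y + (-1 : ℝ) • θ' y) := by
  filter_upwards [h, h'] with y hy hy'
  exact ⟨SmoothAt.add hy.1 (SmoothAt.smul contMDiffAt_const hy'.1),
    (W y).add_mem hy.2 ((W y).smul_mem _ hy'.2)⟩

theorem IsSectionAt.sum_smul {ι : Type*} [Fintype ι] {W : CoField I M} {x : M} {θ : ι → DForm I M 1}
    {a : ι → M → ℝ} (h : ∀ i, IsSectionAt I W x (θ i))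
    (ha : ∀ᶠ y in 𝓝 x, ∀ i, ContMDiffAt I 𝓘(ℝ, ℝ) ∞ (a i) y) :
    IsSectionAt I W x (fun y => ∑ i, a i y • θ i y) := by
  filter_upwards [eventually_all.2 h, ha] with y hy hy'
  exact ⟨SmoothAt.fun_sum fun i _ => SmoothAt.smul (hy' i) (hy i).1,
    (W y).sum_mem fun i _ => (W y).smul_mem _ (hy i).2⟩

theorem isSectionAt_of_mem_sections {W : CoField I M} {U : Set M} (hU : IsOpen U) {x : M} (hx : x ∈ U)
    {θ : DForm I M 1} (h : θ ∈ sections I W U) : IsSectionAt I W x θ := by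
  filter_upwards [hU.mem_nhds hx] with y hy
  exact ⟨h.1 y hy, h.2 y hy⟩

theorem IsSectionAt.exists_mem_sections {ι : Type*} [Finite ι] {W : CoField I M} {x : M}
    {θ : ι → DForm I M 1} (h : ∀ i, IsSectionAt I W x (θ i)) {U : Set M} (hU : U ∈ 𝓝 x) :
    ∃ V, IsOpen V ∧ x ∈ V ∧ V ⊆ U ∧ ∀ i, θ i ∈ sections I W V := by
  obtain ⟨V, h1, h2, h3⟩ := eventually_nhds_iff.1 ((eventually_all.2 h).and hU)
  exact ⟨V, h2, h3, fun y hy => (h1 y hy).2, fun i => ⟨fun y hy => ((h1 y hy).1 i).1,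
    fun y hy => ((h1 y hy).1 i).2⟩⟩

/-- Near `x`, the forms `θ i` are a smooth frame of `W`. -/
def IsFrameAt (I : ModelWithCorners ℝ E H) {ι : Type*} (W : CoField I M) (x : M)
    (θ : ι → DForm I M 1) : Prop :=
  ∀ᶠ y in 𝓝 x, (∀ i, SmoothAt I (θ i) y) ∧ LinearIndependent ℝ (fun i => θ i y) ∧
    Submodule.span ℝ (range fun i => θ i y) = W y

/-- `W` is a smooth, constant rank subbundle near `x`. -/
def IsSubbundleAt (I : ModelWithCorners ℝ E H) (W : CoField I M) (x : M) : Prop :=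
  ∃ (r : ℕ) (θ : Fin r → DForm I M 1), IsFrameAt I W x θ

theorem IsSubbundleOn.isSubbundleAt {U : Set M} {W : CoField I M} (h : IsSubbundleOn I U W) {x : M}
    (hx : x ∈ U) : IsSubbundleAt I W x := by
  obtain ⟨r, h⟩ := h
  obtain ⟨V, hV, hxV, _, θ, h1, h2⟩ := h x hx
  refine ⟨r, θ, ?_⟩
  filter_upwards [hV.mem_nhds hxV] with y hy
  exact ⟨fun i => h1 i y hy, h2 y hy⟩

theorem IsFrameAt.isSectionAt {ι : Type*} {W : CoField I M} {x : M} {θ : ι → DForm I M 1}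
    (h : IsFrameAt I W x θ) (i : ι) : IsSectionAt I W x (θ i) := by
  filter_upwards [h] with y hy
  exact ⟨hy.1 i, hy.2.2 ▸ Submodule.subset_span ⟨i, rfl⟩⟩

theorem IsFrameAt.eventually {ι : Type*} {W : CoField I M} {x : M} {θ : ι → DForm I M 1}
    (h : IsFrameAt I W x θ) : ∀ᶠ y in 𝓝 x, IsFrameAt I W y θ := h.eventually_nhds

theorem finrank_span_range {V : Type*} [AddCommGroup V] [Module ℝ V] {ι : Type*} [Fintype ι] {θ : ι → V}
    (h : LinearIndependent ℝ θ) {W : Submodule ℝ V} (hW : Submodule.span ℝ (range θ) = W) :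
    Module.finrank ℝ W = Fintype.card ι := by
  rw [← hW]; exact finrank_span_eq_card h

theorem IsFrameAt.finrank_eq {ι : Type*} [Fintype ι] {W : CoField I M} {x : M} {θ : ι → DForm I M 1}
    (h : IsFrameAt I W x θ) : ∀ᶠ y in 𝓝 x, Module.finrank ℝ (W y) = Fintype.card ι := by
  filter_upwards [h] with y hy
  exact finrank_span_range hy.2.1 hy.2.2

theorem IsFrameAt.exists_section {ι : Type*} [Fintype ι] {W : CoField I M} {x : M} {θ : ι → DForm I M 1}
    (h : IsFrameAt I W x θ) {c : Covector (TangentSpace I x)} (hc : c ∈ W x) :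
    ∃ φ, IsSectionAt I W x φ ∧ φ x = c := by
  rw [← h.self_of_nhds.2.2] at hc
  obtain ⟨a, rfl⟩ := (Submodule.mem_span_range_iff_exists_fun ℝ).1 hc
  exact ⟨fun y => ∑ i, a i • θ i y, IsSectionAt.sum_smul (a := fun i _ => a i) h.isSectionAt
    (Eventually.of_forall fun y i => contMDiffAt_const), rfl⟩

theorem IsSubbundleAt.exists_section {W : CoField I M} {x : M} (h : IsSubbundleAt I W x)
    {c : Covector (TangentSpace I x)} (hc : c ∈ W x) : ∃ φ, IsSectionAt I W x φ ∧ φ x = c := by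
  obtain ⟨r, θ, hθ⟩ := h
  exact hθ.exists_section hc

theorem IsSubbundleAt.finrank_eq {W : CoField I M} {x : M} (h : IsSubbundleAt I W x) :
    ∀ᶠ y in 𝓝 x, Module.finrank ℝ (W y) = Module.finrank ℝ (W x) := by
  obtain ⟨r, θ, hθ⟩ := h
  have h1 := hθ.finrank_eq
  filter_upwards [h1] with y hy
  rw [hy, h1.self_of_nhds]

theorem finiteDimensional_covector (x : M) (k : ℕ) :
    FiniteDimensional ℝ ((TangentSpace I x) [⋀^Fin k]→L[ℝ] ℝ) :=
  finiteDimensional_alternating (E := E) k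

theorem eventually_linearIndependent {ι : Type*} [Finite ι] {θ : ι → DForm I M 1} {x : M}
    (hs : ∀ i, ∀ᶠ y in 𝓝 x, SmoothAt I (θ i) y) (hli : LinearIndependent ℝ (fun i => θ i x)) :
    ∀ᶠ y in 𝓝 x, LinearIndependent ℝ (fun i => θ i y) := by
  classical
  have := Fintype.ofFinite ι
  obtain ⟨V, hV, hx, -, -, e, -, he⟩ := exists_dual_fields hs hli
  filter_upwards [hV.mem_nhds hx] with y hy
  exact linearIndependent_of_dual (he y hy)

/-- Sections that are a basis at `x` of a field of constant rank are a frame near `x`. -/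
theorem isFrameAt_of_linearIndependent {ι : Type*} [Fintype ι] {W : CoField I M} {x : M}
    {θ : ι → DForm I M 1} (hs : ∀ i, IsSectionAt I W x (θ i))
    (hli : LinearIndependent ℝ (fun i => θ i x))
    (hr : ∀ᶠ y in 𝓝 x, Module.finrank ℝ (W y) ≤ Fintype.card ι) : IsFrameAt I W x θ := by
  have h1 := eventually_linearIndependent
    (fun i => Filter.Eventually.mono (hs i) fun y hy => hy.1) hli
  filter_upwards [h1, hr, eventually_all.2 hs] with y hy h2 h3
  exact ⟨fun i => (h3 i).1, hy, span_eq_of_linearIndependent (E := E) hy (fun i => (h3 i).2) h2⟩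

theorem isSubbundleAt_of_extends {W : CoField I M} {x : M}
    (hr : ∀ᶠ y in 𝓝 x, Module.finrank ℝ (W y) = Module.finrank ℝ (W x))
    (h : ∀ c ∈ W x, ∃ φ, IsSectionAt I W x φ ∧ φ x = c) :
    ∃ θ : Fin (Module.finrank ℝ (W x)) → DForm I M 1, IsFrameAt I W x θ := by
  obtain ⟨b, hb, hb'⟩ := exists_linearIndependent_mem (finiteDimensional_covector x 1) (W x)
  choose θ hθ hθ' using fun i => h (b i) (hb i)
  refine ⟨θ, isFrameAt_of_linearIndependent hθ ?_ ?_⟩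
  · rwa [show (fun i => θ i x) = b from funext hθ']
  · filter_upwards [hr] with y hy
    rw [hy, Fintype.card_fin]

theorem isSubbundleOn_of_extends {U : Set M} (hU : IsOpen U) {W : CoField I M} (r : ℕ)
    (hr : ∀ x ∈ U, Module.finrank ℝ (W x) = r)
    (h : ∀ x ∈ U, ∀ c ∈ W x, ∃ φ, IsSectionAt I W x φ ∧ φ x = c) : IsSubbundleOn I U W := by
  refine ⟨r, fun x hx => ?_⟩
  have h1 : ∀ᶠ y in 𝓝 x, Module.finrank ℝ (W y) = Module.finrank ℝ (W x) := by
    filter_upwards [hU.mem_nhds hx] with y hy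
    rw [hr y hy, hr x hx]
  obtain ⟨θ, hθ⟩ := isSubbundleAt_of_extends h1 (h x hx)
  obtain ⟨V, h1, h2, h3⟩ := eventually_nhds_iff.1 (hθ.and (hU.mem_nhds hx))
  have e := hr x hx
  subst e
  exact ⟨V, h2, h3, fun y hy => (h1 y hy).2, θ, fun i y hy => (h1 y hy).1.1 i,
    fun y hy => (h1 y hy).1.2⟩

theorem IsSubbundleOn.exists_finrank {U : Set M} {W : CoField I M} (h : IsSubbundleOn I U W) :
    ∃ r, ∀ x ∈ U, Module.finrank ℝ (W x) = r := by
  obtain ⟨r, h⟩ := h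
  refine ⟨r, fun x hx => ?_⟩
  obtain ⟨V, hV, hxV, _, θ, h1, h2⟩ := h x hx
  simpa using finrank_span_range (h2 x hxV).1 (h2 x hxV).2

end Sections

section Coefficients

open Filter Topology

variable {E : Type*} [NormedAddCommGroup E] [NormedSpace ℝ E] [FiniteDimensional ℝ E]
  {H : Type*} [TopologicalSpace H] {I : ModelWithCorners ℝ E H} [I.Boundaryless]
  {M : Type*} [TopologicalSpace M] [ChartedSpace H M] [IsManifold I ∞ M]

theorem add_neg_one_smul {V : Type*} [AddCommGroup V] [Module ℝ V] (c : V) :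
    c + (-1 : ℝ) • c = 0 := by module

theorem bil_smul_left' {V : Type*} [AddCommGroup V] [Module ℝ V] [TopologicalSpace V] (c : ℝ)
    (ρ : V [⋀^Fin (1 + 1)]→L[ℝ] ℝ) (u v : V) : bil (c • ρ) u v = c * bil ρ u v := rfl

theorem exists_open_of_eventually {x : M} {p : M → Prop} (h : ∀ᶠ y in 𝓝 x, p y) :
    ∃ V, IsOpen V ∧ x ∈ V ∧ ∀ y ∈ V, p y := by
  obtain ⟨V, h1, h2, h3⟩ := eventually_nhds_iff.1 h
  exact ⟨V, h2, h3, h1⟩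

/-- A family of sections spanning `W` at `x` contains a frame of `W` near `x`. -/
theorem exists_subframe {κ : Type*} [Finite κ] {W : CoField I M} {x : M}
    (hW : IsSubbundleAt I W x) {β : κ → DForm I M 1} (hβ : ∀ k, IsSectionAt I W x (β k))
    (hsp : Submodule.span ℝ (range fun k => β k x) = W x) :
    ∃ (n : ℕ) (a : Fin n → κ), Function.Injective a ∧ IsFrameAt I W x (fun j => β (a j)) := by
  classical
  obtain ⟨ι, a, hs1, hs2, hs3⟩ := exists_linearIndependent' ℝ (fun k => β k x)
  have : Finite ι := Finite.of_injective a hs1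
  have := Fintype.ofFinite ι
  let e := Fintype.equivFin ι
  have h1 : LinearIndependent ℝ (fun j => β (a (e.symm j)) x) := hs3.comp e.symm e.symm.injective
  refine ⟨Fintype.card ι, a ∘ e.symm, hs1.comp e.symm.injective, ?_⟩
  refine isFrameAt_of_linearIndependent (fun j => hβ _) h1 ?_
  filter_upwards [hW.finrank_eq] with y hy
  rw [hy, ← hsp, ← hs2, finrank_span_eq_card hs3, Fintype.card_fin]

theorem IsFrameAt.exists_coeff {ι : Type*} [Fintype ι] {W : CoField I M} {x : M} {θ : ι → DForm I M 1}
    (h : IsFrameAt I W x θ) {φ : DForm I M 1} (hφ : IsSectionAt I W x φ) :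
    ∃ a : ι → M → ℝ, ∀ᶠ y in 𝓝 x, (∀ i, ContMDiffAt I 𝓘(ℝ, ℝ) ∞ (a i) y) ∧
      φ y = ∑ i, a i y • θ i y := by
  classical
  obtain ⟨V, hV, hx, hsub, -, e, he1, he2⟩ :=
    exists_dual_fields (fun i => Filter.Eventually.mono h fun y hy => hy.1 i) h.self_of_nhds.2.1
  refine ⟨fun i y => φ y (fun _ => e i y), ?_⟩
  filter_upwards [hV.mem_nhds hx, h, hφ] with y hy h1 h2
  refine ⟨fun i => SmoothAt.apply_vec h2.1 (fun _ => he1 i y hy) (hsub hy), ?_⟩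
  exact Covector.eq_sum_of_mem_span (he2 y hy) (h1.2.2 ▸ h2.2)

theorem exists_coeff_of_span {κ : Type*} [Fintype κ] {W : CoField I M} {x : M}
    (hW : IsSubbundleAt I W x) {β : κ → DForm I M 1} (hβ : ∀ k, IsSectionAt I W x (β k))
    (hsp : Submodule.span ℝ (range fun k => β k x) = W x) {φ : DForm I M 1}
    (hφ : IsSectionAt I W x φ) :
    ∃ a : κ → M → ℝ, ∀ᶠ y in 𝓝 x, (∀ i, ContMDiffAt I 𝓘(ℝ, ℝ) ∞ (a i) y) ∧
      φ y = ∑ i, a i y • β i y := by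
  classical
  obtain ⟨n, s, hs, hf⟩ := exists_subframe hW hβ hsp
  obtain ⟨a, ha⟩ := hf.exists_coeff hφ
  refine ⟨fun k y => ∑ j, if s j = k then a j y else 0, ?_⟩
  filter_upwards [ha] with y hy
  refine ⟨fun k => ?_, ?_⟩
  · refine contMDiffAt_finsetSum fun j _ => ?_
    by_cases h : s j = k
    · simp only [h, if_true]; exact hy.1 j
    · simp only [h, if_false]; exact contMDiffAt_const
  · rw [hy.2]
    simp only [Finset.sum_smul]
    rw [Finset.sum_comm]
    refine Finset.sum_congr rfl fun j _ => ?_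
    rw [Finset.sum_eq_single (s j)]
    · simp
    · intro k _ hk
      rw [if_neg (Ne.symm hk), zero_smul]
    · simp

/-- On the annihilator of `W`, the exterior derivative at `x` of a section of `W` depends only on the
value of the section at `x`. -/
theorem bil_extd_eq_zero_of_eq_zero {W : CoField I M} {x : M} (hW : IsSubbundleAt I W x)
    {φ : DForm I M 1} (hφ : IsSectionAt I W x φ) (h0 : φ x = 0) {u v : TangentSpace I x}
    (hu : u ∈ annSub (W x)) (hv : v ∈ annSub (W x)) : bil (extd I φ x) u v = 0 := by
  obtain ⟨r, θ, hθ⟩ := hW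
  obtain ⟨a, ha⟩ := hθ.exists_coeff hφ
  have h1 : ∀ i, a i x = 0 := by
    have h2 := ha.self_of_nhds.2
    rw [h0] at h2
    exact Fintype.linearIndependent_iff.1 hθ.self_of_nhds.2.1 (fun i => a i x) h2.symm
  rw [extd_congr (ha.mono fun y hy => hy.2), extd_fun_sum fun i _ =>
    SmoothAt.smul (ha.self_of_nhds.1 i) (hθ.self_of_nhds.1 i), bil_sum_left]
  refine Finset.sum_eq_zero fun i _ => ?_
  rw [bil_extd_smul (ha.self_of_nhds.1 i) (hθ.self_of_nhds.1 i) (hu _ (hθ.isSectionAt i).mem)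
    (hv _ (hθ.isSectionAt i).mem), h1, zero_mul]

theorem bil_extd_eq_sum {κ : Type*} [Fintype κ] {W : CoField I M} {x : M} (hW : IsSubbundleAt I W x)
    {φ : DForm I M 1} (hφ : IsSectionAt I W x φ) {β : κ → DForm I M 1}
    (hβ : ∀ k, IsSectionAt I W x (β k)) {c : κ → ℝ} (h : φ x = ∑ k, c k • β k x)
    {u v : TangentSpace I x} (hu : u ∈ annSub (W x)) (hv : v ∈ annSub (W x)) :
    bil (extd I φ x) u v = ∑ k, c k * bil (extd I (β k) x) u v := by
  have h1 := IsSectionAt.sum_smul (a := fun k _ => c k) hβ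
    (Eventually.of_forall fun y i => contMDiffAt_const)
  have h2 := bil_extd_eq_zero_of_eq_zero hW (hφ.sub h1)
    (by rw [h]; exact add_neg_one_smul _) hu hv
  have h3 : extd I (fun y => φ y + (-1 : ℝ) • ∑ k, c k • β k y) x =
      extd I φ x + (-1 : ℝ) • ∑ k, c k • extd I (β k) x := by
    have h4 := extd_add hφ.smoothAt (SmoothAt.smul (f := fun _ => (-1 : ℝ)) contMDiffAt_const h1.smoothAt)
    refine h4.trans ?_
    rw [extd_const_smul, extd_fun_sum fun k _ => SmoothAt.smul contMDiffAt_const (hβ k).smoothAt]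
    simp only [extd_const_smul]
  rw [h3, bil_add_left, bil_smul_left, bil_sum_left] at h2
  simp only [bil_smul_left'] at h2
  linarith

theorem bil_extd_eq_of_eq {W : CoField I M} {x : M} (hW : IsSubbundleAt I W x)
    {φ ψ : DForm I M 1} (hφ : IsSectionAt I W x φ) (hψ : IsSectionAt I W x ψ) (h : φ x = ψ x)
    {u v : TangentSpace I x} (hu : u ∈ annSub (W x)) (hv : v ∈ annSub (W x)) :
    bil (extd I φ x) u v = bil (extd I ψ x) u v := by
  have := bil_extd_eq_sum (κ := Unit) (c := fun _ => 1) hW hφ (fun _ => hψ) (by simp [h]) hu hv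
  simpa using this

/-- Frames extend to frames of larger bundles. -/
theorem IsFrameAt.exists_extension {ι : Type*} [Fintype ι] {W S T : CoField I M} {x : M}
    {θ : ι → DForm I M 1} (h : IsFrameAt I W x θ)
    (hS : ∀ c ∈ S x, ∃ φ, IsSectionAt I S x φ ∧ φ x = c)
    (hT : ∀ᶠ y in 𝓝 x, Module.finrank ℝ (T y) = Module.finrank ℝ (T x))
    (hWT : ∀ y, W y ≤ T y) (hST : ∀ y, S y ≤ T y) (hsup : W x ⊔ S x = T x) :
    ∃ κ : Fin (Module.finrank ℝ (T x) - Module.finrank ℝ (W x)) → DForm I M 1,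
      (∀ j, IsSectionAt I S x (κ j)) ∧ IsFrameAt I T x (Sum.elim θ κ) := by
  have h0 := h.self_of_nhds
  have key := exists_extension_of_sup_eq (finiteDimensional_covector x 1) (S := S x) (T := T x)
    h0.2.1 (by rw [h0.2.2, hsup])
  rw [h0.2.2] at key
  obtain ⟨w, hw1, hw2, hw3⟩ := key
  choose κ hκ hκ' using fun j => hS (w j) (hw1 j)
  have e : (fun i => (Sum.elim θ κ) i x) = Sum.elim (fun i => θ i x) w := by
    funext i
    cases i with
    | inl i => rfl
    | inr i => exact hκ' i
  refine ⟨κ, hκ, isFrameAt_of_linearIndependent (fun i => ?_) (e ▸ hw2) ?_⟩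
  · cases i with
    | inl i => exact (h.isSectionAt i).mono hWT
    | inr i => exact (hκ i).mono hST
  · filter_upwards [hT] with y hy
    exact (hy.trans (finrank_span_range hw2 hw3)).le

/-- The whole cotangent bundle is a subbundle. -/
theorem isSubbundleAt_top (x : M) : IsSubbundleAt I (fun _ => ⊤) x := by
  have h1 : ∀ y : M, Module.finrank ℝ (⊤ : Submodule ℝ (Covector (TangentSpace I y))) =
      Module.finrank ℝ E := fun y => by
    rw [finrank_top]; exact Covector.finrank_eq (E := E)
  obtain ⟨θ, hθ⟩ := isSubbundleAt_of_extends (I := I) (W := fun _ => ⊤) (x := x)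
    (Eventually.of_forall fun y => by rw [h1, h1]) fun c _ => by
      obtain ⟨φ, h2, h3⟩ := exists_smooth_eq x c
      exact ⟨φ, h2.mono fun y hy => ⟨hy, Submodule.mem_top⟩, h3⟩
  exact ⟨_, θ, hθ⟩

theorem IsFrameAt.exists_coframe {ι : Type*} [Fintype ι] {W : CoField I M} {x : M}
    {θ : ι → DForm I M 1} (h : IsFrameAt I W x θ) :
    ∃ (n : ℕ) (κ : Fin n → DForm I M 1), IsFrameAt I (fun _ => ⊤) x (Sum.elim θ κ) := by
  obtain ⟨κ, -, hκ⟩ := h.exists_extension (S := fun _ => ⊤) (T := fun _ => ⊤)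
    (fun c hc => (isSubbundleAt_top x).exists_section hc) (isSubbundleAt_top x).finrank_eq
    (fun _ => le_top) (fun _ => le_top) (by simp)
  exact ⟨_, κ, hκ⟩

theorem contMDiffAt_bil {ρ : DForm I M 2} {x₀ y : M} {X Y : ∀ y : M, TangentSpace I y}
    (hρ : SmoothAt I ρ y) (hX : VecSmoothAt I x₀ X y) (hY : VecSmoothAt I x₀ Y y)
    (hy : y ∈ (extChartAt I x₀).source) :
    ContMDiffAt I 𝓘(ℝ, ℝ) ∞ (fun z => bil (ρ z) (X z) (Y z)) y := by
  have h := SmoothAt.apply_vec (X := ![X, Y]) hρ (fun i => by fin_cases i; exacts [hX, hY]) hy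
  refine h.congr_of_eventuallyEq (Eventually.of_forall fun z => ?_)
  change ρ z ![X z, Y z] = ρ z (fun i => ![X, Y] i z)
  congr 1
  funext i
  fin_cases i <;> rfl

/-- A 2-form vanishing on the annihilator of `W` belongs to the ideal generated by a frame of `W`. -/
theorem IsFrameAt.exists_wedge {ι : Type*} [Fintype ι] {W : CoField I M} {x : M}
    {θ : ι → DForm I M 1} (h : IsFrameAt I W x θ) {ρ : DForm I M 2}
    (hρ : ∀ᶠ y in 𝓝 x, SmoothAt I ρ y ∧ ∀ u ∈ annSub (W y), ∀ v ∈ annSub (W y), bil (ρ y) u v = 0) :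
    ∃ α : ι → DForm I M 1, ∀ᶠ y in 𝓝 x, (∀ i, SmoothAt I (α i) y) ∧
      ρ y = ∑ i, wedge (α i y) (θ i y) := by
  classical
  obtain ⟨n, κ, hκ⟩ := h.exists_coframe
  obtain ⟨V, hV, hx, hsub, -, e, he1, he2⟩ :=
    exists_dual_fields (fun i => Filter.Eventually.mono hκ fun y hy => hy.1 i) hκ.self_of_nhds.2.1
  refine ⟨fun i y => (∑ j, (bil (ρ y) (e (.inl j) y) (e (.inl i) y) / 2) • θ j y) +
    ∑ b, bil (ρ y) (e (.inr b) y) (e (.inl i) y) • κ b y, ?_⟩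
  filter_upwards [hV.mem_nhds hx, h, hκ, hρ] with y hy h1 h2 h3
  refine ⟨fun i => ?_, bil_ext fun u v => ?_⟩
  · have hb : ∀ a, ContMDiffAt I 𝓘(ℝ, ℝ) ∞ (fun z => bil (ρ z) (e a z) (e (.inl i) z)) y :=
      fun a => contMDiffAt_bil h3.1 (he1 a y hy) (he1 _ y hy) (hsub hy)
    refine SmoothAt.add (SmoothAt.fun_sum fun j _ => ?_)
      (SmoothAt.fun_sum fun b _ => SmoothAt.smul (hb _) (h2.1 (.inr b)))
    refine SmoothAt.smul ?_ (h1.1 j)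
    exact (hb (.inl j)).div_const 2
  · have hs : ∀ w : TangentSpace I y, w = (∑ i, θ i y (fun _ => w) • e (.inl i) y) +
        ∑ b, κ b y (fun _ => w) • e (.inr b) y := by
      intro w
      have := eq_sum_of_coframe (E := E) (he2 y hy) h2.2.2 w
      rw [Fintype.sum_sum_type] at this
      exact this
    have hR : ∀ w : TangentSpace I y, ∑ b, κ b y (fun _ => w) • e (.inr b) y ∈ annSub (W y) := by
      intro w
      rw [← h1.2.2, mem_annSub_span]
      rintro _ ⟨i, rfl⟩
      rw [Covector.map_sum]
      refine Finset.sum_eq_zero fun b _ => ?_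
      have h4 := he2 y hy (.inl i) (.inr b)
      rw [if_neg (by simp)] at h4
      rw [Covector.map_smul]
      exact mul_eq_zero_of_right _ h4
    have hsum : ∀ i (w : TangentSpace I y),
        ((∑ j, (bil (ρ y) (e (.inl j) y) (e (.inl i) y) / 2) • θ j y) +
          ∑ b, bil (ρ y) (e (.inr b) y) (e (.inl i) y) • κ b y) (fun _ => w) =
        bil (ρ y) (∑ j, θ j y (fun _ => w) • e (.inl j) y) (e (.inl i) y) / 2 +
        bil (ρ y) (∑ b, κ b y (fun _ => w) • e (.inr b) y) (e (.inl i) y) := by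
      intro i w
      rw [ContinuousAlternatingMap.add_apply, Covector.sum_apply, Covector.sum_apply]
      simp only [map_sum, LinearMap.sum_apply, map_smul, LinearMap.smul_apply, smul_eq_mul,
        ContinuousAlternatingMap.smul_apply, Finset.sum_div]
      congr 1
      · exact Finset.sum_congr rfl fun j _ => by ring
      · exact Finset.sum_congr rfl fun j _ => by ring
    rw [bil_sum_left]
    have h5 : ∀ i, ∀ a : Covector (TangentSpace I y), bil (wedge a (θ i y)) u v =
        a (fun _ => u) * θ i y (fun _ => v) - a (fun _ => v) * θ i y (fun _ => u) :=
      fun i a => bil_wedge _ _ _ _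
    have h6 : ∀ (z w : TangentSpace I y), ∑ i, bil (ρ y) z (e (.inl i) y) * θ i y (fun _ => w) =
        bil (ρ y) z (∑ i, θ i y (fun _ => w) • e (.inl i) y) := by
      intro z w
      simp only [map_sum, map_smul, smul_eq_mul]
      exact Finset.sum_congr rfl fun j _ => by ring
    have h7 : ∑ i, bil (wedge ((∑ j, (bil (ρ y) (e (.inl j) y) (e (.inl i) y) / 2) • θ j y) +
          ∑ b, bil (ρ y) (e (.inr b) y) (e (.inl i) y) • κ b y) (θ i y)) u v =
        (bil (ρ y) (∑ j, θ j y (fun _ => u) • e (.inl j) y) (∑ j, θ j y (fun _ => v) • e (.inl j) y) / 2 +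
        bil (ρ y) (∑ b, κ b y (fun _ => u) • e (.inr b) y) (∑ j, θ j y (fun _ => v) • e (.inl j) y)) -
        (bil (ρ y) (∑ j, θ j y (fun _ => v) • e (.inl j) y) (∑ j, θ j y (fun _ => u) • e (.inl j) y) / 2 +
        bil (ρ y) (∑ b, κ b y (fun _ => v) • e (.inr b) y) (∑ j, θ j y (fun _ => u) • e (.inl j) y)) := by
      rw [← h6, ← h6, ← h6, ← h6, Finset.sum_div, Finset.sum_div, ← Finset.sum_add_distrib,
        ← Finset.sum_add_distrib, ← Finset.sum_sub_distrib]
      refine Finset.sum_congr rfl fun i _ => ?_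
      rw [h5, hsum, hsum]
      ring
    rw [h7]
    conv_lhs => rw [hs u, hs v]
    simp only [map_add, LinearMap.add_apply]
    rw [h3.2 _ (hR u) _ (hR v), bil_swap _ (∑ j, θ j y (fun _ => v) • e (.inl j) y)
      (∑ j, θ j y (fun _ => u) • e (.inl j) y), bil_swap _ (∑ j, θ j y (fun _ => u) • e (.inl j) y)
      (∑ b, κ b y (fun _ => v) • e (.inr b) y)]
    ring

end Coefficients

section Ideals

open Filter Topology

variable {E : Type*} [NormedAddCommGroup E] [NormedSpace ℝ E] [FiniteDimensional ℝ E]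
  {H : Type*} [TopologicalSpace H] {I : ModelWithCorners ℝ E H} [I.Boundaryless]
  {M : Type*} [TopologicalSpace M] [ChartedSpace H M] [IsManifold I ∞ M]
  {E' : Type*} [NormedAddCommGroup E'] [NormedSpace ℝ E'] [FiniteDimensional ℝ E']
  {H' : Type*} [TopologicalSpace H'] {I' : ModelWithCorners ℝ E' H'} [I'.Boundaryless]
  {N : Type*} [TopologicalSpace N] [ChartedSpace H' N] [IsManifold I' ∞ N]

theorem AlgIdeal.mono {U V : Set M} (h : V ⊆ U) {S T : ∀ k : ℕ, Set (DForm I M k)}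
    (hST : ∀ k, S k ⊆ T k) {k : ℕ} {φ : DForm I M k} (hφ : AlgIdeal I U S k φ) :
    AlgIdeal I V T k φ := by
  induction hφ with
  | gen k φ hφ => exact .gen k φ (hST k hφ)
  | zero k => exact .zero k
  | add k φ η _ _ h1 h2 => exact .add k φ η h1 h2
  | smul k f φ hf _ h1 => exact .smul k f φ (hf.mono h) h1
  | wedge_mul k l α φ hα _ h1 => exact .wedge_mul k l α φ (fun x hx => hα x (h hx)) h1
  | congr k φ η he _ h1 => exact .congr k φ η (fun x hx => he x (h hx)) h1

/-- A form, with its degree rewritten. -/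
def castForm {k l : ℕ} (h : k = l) (φ : DForm I M k) : DForm I M l := h ▸ φ

theorem castForm_apply {k l : ℕ} (h : k = l) (φ : DForm I M k) (x : M) (v : Fin l → TangentSpace I x) :
    castForm h φ x v = φ x (v ∘ Fin.cast h) := by
  subst h; rfl

theorem castForm_rfl {k : ℕ} (φ : DForm I M k) : castForm rfl φ = φ := rfl

theorem AlgIdeal.castForm {U : Set M} {S : ∀ k : ℕ, Set (DForm I M k)} {k l : ℕ} (h : k = l)
    {φ : DForm I M k} (hφ : AlgIdeal I U S k φ) : AlgIdeal I U S l (castForm h φ) := by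
  subst h; rwa [castForm_rfl]

theorem extd_castForm {k l : ℕ} (h : k = l) (φ : DForm I M k) :
    extd I (castForm h φ) = castForm (congrArg (· + 1) h) (extd I φ) := by
  subst h; rw [castForm_rfl, castForm_rfl]

/-- A function, as a 0-form. -/
def zeroForm (f : M → ℝ) : DForm I M 0 := fun x =>
  ContinuousAlternatingMap.constOfIsEmpty ℝ (TangentSpace I x) (Fin 0) (f x)

theorem smul_eq_castForm {l : ℕ} (f : M → ℝ) (φ : DForm I M l) :
    (fun x => f x • φ x) = castForm (zero_add l) (fun x => wedge (zeroForm (I := I) f x) (φ x)) := by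
  funext x
  ext v
  rw [castForm_apply]
  change _ = wedge (ContinuousAlternatingMap.constOfIsEmpty ℝ (TangentSpace I x) (Fin 0) (f x))
    (φ x) _
  rw [wedge_zero_form]
  rfl

theorem smoothAt_zeroForm {f : M → ℝ} {x : M} (hf : ContMDiffAt I 𝓘(ℝ, ℝ) ∞ f x) :
    SmoothAt I (zeroForm (I := I) f) x := by
  refine contDiffAt_alternating_of_apply (n := ⊤) fun v => ?_
  exact contDiffAt_comp_extChartAt_symm hf (mem_extChartAt_source x)

theorem AlgIdeal.smoothAt {U : Set M} (hU : IsOpen U) {S : ∀ k : ℕ, Set (DForm I M k)}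
    (hS : ∀ k, ∀ φ ∈ S k, ∀ x ∈ U, SmoothAt I φ x) {k : ℕ} {φ : DForm I M k}
    (hφ : AlgIdeal I U S k φ) : ∀ x ∈ U, SmoothAt I φ x := by
  induction hφ with
  | gen k φ hφ => exact hS k φ hφ
  | zero k => exact fun x _ => SmoothAt.zero k x
  | add k φ η _ _ h1 h2 => exact fun x hx => (h1 x hx).add (h2 x hx)
  | smul k f φ hf _ h1 => exact fun x hx => (h1 x hx).smul (hf.contMDiffAt (hU.mem_nhds hx))
  | wedge_mul k l α φ hα _ h1 => exact fun x hx => SmoothAt.wedge (hα x hx) (h1 x hx)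
  | congr k φ η he _ h1 =>
    exact fun x hx => (h1 x hx).congr (Filter.mem_of_superset (hU.mem_nhds hx) he)

theorem AlgIdeal.neg_one_pow {U : Set M} {S : ∀ k : ℕ, Set (DForm I M k)} {k : ℕ} {φ : DForm I M k}
    (c : ℝ) (hφ : AlgIdeal I U S k φ) : AlgIdeal I U S k (fun x => c • φ x) :=
  .smul k _ φ contMDiffOn_const hφ

theorem AlgIdeal.extd {U : Set M} (hU : IsOpen U) {S : ∀ k : ℕ, Set (DForm I M k)}
    (hS : ∀ k, ∀ φ ∈ S k, ∀ x ∈ U, SmoothAt I φ x)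
    (hd : ∀ k, ∀ φ ∈ S k, AlgIdeal I U S (k + 1) (extd I φ)) {k : ℕ} {φ : DForm I M k}
    (hφ : AlgIdeal I U S k φ) : AlgIdeal I U S (k + 1) (EDS.extd I φ) := by
  have hw : ∀ (k l : ℕ) (α : DForm I M k) (φ : DForm I M l), SmoothOn I U α →
      AlgIdeal I U S l φ → AlgIdeal I U S (l + 1) (EDS.extd I φ) →
      AlgIdeal I U S (k + l + 1) (EDS.extd I (fun x => wedge (α x) (φ x))) := by
    intro k l α φ hα hφ hdφ
    have e : k + 1 + l = k + l + 1 := by ring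
    have h1 : AlgIdeal I U S (k + l + 1)
        (EDS.castForm e (fun x => wedge (EDS.extd I α x) (φ x))) := by
      refine AlgIdeal.castForm e (.wedge_mul (k + 1) l _ φ (fun x hx => ?_) hφ)
      exact SmoothAt.extd (Filter.mem_of_superset (hU.mem_nhds hx) hα)
    have h2 : AlgIdeal I U S (k + l + 1)
        (fun x => ((-1 : ℝ) ^ k) • (wedge (α x) (EDS.extd I φ x))) :=
      AlgIdeal.neg_one_pow _ (.wedge_mul k (l + 1) α _ hα hdφ)
    refine .congr _ _ _ (fun x hx => ?_) (.add _ _ _ h1 h2)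
    ext v
    rw [extd_wedge_apply (hα x hx) (hφ.smoothAt hU hS x hx) e,
      ← castForm_apply e (fun x => wedge (EDS.extd I α x) (φ x))]
    rfl
  induction hφ with
  | gen k φ hφ => exact hd k φ hφ
  | zero k => 
    refine .congr _ _ _ (fun x _ => ?_) (.zero _)
    rw [extd_zero]; rfl
  | add k φ η h1 h2 ih1 ih2 =>
    refine .congr _ _ _ (fun x hx => ?_) (.add _ _ _ ih1 ih2)
    rw [extd_add (h1.smoothAt hU hS x hx) (h2.smoothAt hU hS x hx)]; rfl
  | smul k f φ hf h1 ih =>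
    rw [smul_eq_castForm, extd_castForm]
    exact AlgIdeal.castForm _ (hw 0 k _ φ
      (fun x hx => smoothAt_zeroForm (hf.contMDiffAt (hU.mem_nhds hx))) h1 ih)
  | wedge_mul k l α φ hα h1 ih => exact hw k l α φ hα h1 ih
  | congr k φ η he h1 ih =>
    refine .congr _ _ _ (fun x hx => ?_) ih
    exact extd_congr (Filter.mem_of_superset (hU.mem_nhds hx) he)

theorem AlgIdeal.vanishesOn {U : Set M} {S : ∀ k : ℕ, Set (DForm I M k)} {x : M} (hx : x ∈ U)
    {P : Submodule ℝ (TangentSpace I x)} (hS : ∀ k, ∀ φ ∈ S k, VanishesOn (φ x) P) {k : ℕ}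
    {φ : DForm I M k} (hφ : AlgIdeal I U S k φ) : VanishesOn (φ x) P := by
  induction hφ with
  | gen k φ hφ => exact hS k φ hφ
  | zero k => exact fun v _ => rfl
  | add k φ η _ _ h1 h2 =>
    intro v hv
    rw [Pi.add_apply, ContinuousAlternatingMap.add_apply, h1 v hv, h2 v hv, add_zero]
  | smul k f φ hf _ h1 =>
    intro v hv
    rw [ContinuousAlternatingMap.smul_apply, h1 v hv, smul_zero]
  | wedge_mul k l α φ hα _ h1 => exact VanishesOn.wedge _ h1
  | congr k φ η he _ h1 => rw [← he x hx]; exact h1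

/-- The families of generators that restrict to smaller sets. -/
def Restricts (S : FormSystem I M) : Prop := ∀ U V, V ⊆ U → ∀ k, S U k ⊆ S V k

/-- Near `x`, the form `φ` belongs to the ideal generated by `S`. -/
def InGerm (S : FormSystem I M) (x : M) (k : ℕ) (φ : DForm I M k) : Prop :=
  ∃ V, IsOpen V ∧ x ∈ V ∧ AlgIdeal I V (S V) k φ

namespace InGerm

variable {S T : FormSystem I M} {x : M}

theorem gen {k : ℕ} {φ : DForm I M k} {U : Set M} (hU : IsOpen U) (hx : x ∈ U) (h : φ ∈ S U k) :
    InGerm S x k φ := ⟨U, hU, hx, .gen k φ h⟩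

theorem zero (k : ℕ) : InGerm S x k 0 := ⟨univ, isOpen_univ, mem_univ x, .zero k⟩

theorem add (hS : Restricts S) {k : ℕ} {φ η : DForm I M k} (h1 : InGerm S x k φ)
    (h2 : InGerm S x k η) : InGerm S x k (φ + η) := by
  obtain ⟨U, hU, hxU, h1⟩ := h1
  obtain ⟨V, hV, hxV, h2⟩ := h2
  exact ⟨U ∩ V, hU.inter hV, ⟨hxU, hxV⟩,
    .add k φ η (h1.mono inter_subset_left fun k => hS _ _ inter_subset_left k)
      (h2.mono inter_subset_right fun k => hS _ _ inter_subset_right k)⟩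

theorem sum (hS : Restricts S) {ι : Type*} {s : Finset ι} {k : ℕ} {φ : ι → DForm I M k}
    (h : ∀ i ∈ s, InGerm S x k (φ i)) : InGerm S x k (∑ i ∈ s, φ i) := by
  classical
  induction s using Finset.induction_on with
  | empty => exact zero k
  | insert a s ha ih =>
    rw [Finset.sum_insert ha]
    exact add hS (h a (by simp)) (ih fun i hi => h i (by simp [hi]))

theorem congr (hS : Restricts S) {k : ℕ} {φ η : DForm I M k} (he : ∀ᶠ y in 𝓝 x, φ y = η y)
    (h1 : InGerm S x k φ) : InGerm S x k η := by
  obtain ⟨U, hU, hxU, h1⟩ := h1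
  obtain ⟨V, hV, hxV, h2⟩ := exists_open_of_eventually he
  exact ⟨U ∩ V, hU.inter hV, ⟨hxU, hxV⟩, .congr k φ η (fun y hy => h2 y hy.2)
    (h1.mono inter_subset_left fun k => hS _ _ inter_subset_left k)⟩

theorem fun_sum (hS : Restricts S) {ι : Type*} {s : Finset ι} {k : ℕ} {φ : ι → DForm I M k}
    (h : ∀ i ∈ s, InGerm S x k (φ i)) : InGerm S x k (fun y => ∑ i ∈ s, φ i y) :=
  congr hS (Eventually.of_forall fun y => Finset.sum_apply y s φ) (sum hS h)

theorem smul (hS : Restricts S) {k : ℕ} {f : M → ℝ} {φ : DForm I M k}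
    (hf : ∀ᶠ y in 𝓝 x, ContMDiffAt I 𝓘(ℝ, ℝ) ∞ f y) (h1 : InGerm S x k φ) :
    InGerm S x k (fun y => f y • φ y) := by
  obtain ⟨U, hU, hxU, h1⟩ := h1
  obtain ⟨V, hV, hxV, h2⟩ := exists_open_of_eventually hf
  exact ⟨U ∩ V, hU.inter hV, ⟨hxU, hxV⟩, .smul k f φ (fun y hy => (h2 y hy.2).contMDiffWithinAt)
    (h1.mono inter_subset_left fun k => hS _ _ inter_subset_left k)⟩

theorem wedge_mul (hS : Restricts S) {k l : ℕ} {α : DForm I M k} {φ : DForm I M l}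
    (hα : ∀ᶠ y in 𝓝 x, SmoothAt I α y) (h1 : InGerm S x l φ) :
    InGerm S x (k + l) (fun y => wedge (α y) (φ y)) := by
  obtain ⟨U, hU, hxU, h1⟩ := h1
  obtain ⟨V, hV, hxV, h2⟩ := exists_open_of_eventually hα
  exact ⟨U ∩ V, hU.inter hV, ⟨hxU, hxV⟩, .wedge_mul k l α φ (fun y hy => h2 y hy.2)
    (h1.mono inter_subset_left fun k => hS _ _ inter_subset_left k)⟩

end InGerm

/-- The pullback of forms along a map `h` of tangent bundles over `s`. -/
def bundlePullback (s : N → M) (h : ∀ y : N, TangentSpace I' y →L[ℝ] TangentSpace I (s y)) {k : ℕ}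
    (φ : DForm I M k) : DForm I' N k := fun y => (φ (s y)).compContinuousLinearMap (h y)

/-- Near `y`, pulling back along the bundle map `h` preserves smoothness. -/
def SmoothBundleMapAt (s : N → M) (h : ∀ y : N, TangentSpace I' y →L[ℝ] TangentSpace I (s y))
    (y : N) : Prop :=
  ∀ᶠ z in 𝓝 y, ContMDiffAt I' I ∞ s z ∧ ∀ (k : ℕ) (α : DForm I M k), SmoothAt I α (s z) →
    SmoothAt I' (bundlePullback s h α) z

theorem smoothBundleMapAt_mfderiv {f : N → M} {y : N} (h : ∀ᶠ z in 𝓝 y, ContMDiffAt I' I ∞ f z) :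
    SmoothBundleMapAt (I := I) (I' := I') f (fun y => mfderiv I' I f y) y := by
  filter_upwards [h] with z hz
  exact ⟨hz, fun k α hα => hα.pullback hz⟩

theorem AlgIdeal.inGerm_bundlePullback {s : N → M}
    {h : ∀ y : N, TangentSpace I' y →L[ℝ] TangentSpace I (s y)} {y : N} (hh : SmoothBundleMapAt s h y)
    {U : Set M} (hU : IsOpen U) (hy : s y ∈ U) {S : ∀ k : ℕ, Set (DForm I M k)}
    {T : FormSystem I' N} (hT : Restricts T)
    (hST : ∀ k, ∀ φ ∈ S k, InGerm T y k (bundlePullback s h φ)) {k : ℕ} {φ : DForm I M k}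
    (hφ : AlgIdeal I U S k φ) : InGerm T y k (bundlePullback s h φ) := by
  have hev : ∀ᶠ z in 𝓝 y, s z ∈ U := hh.self_of_nhds.1.continuousAt.eventually (hU.mem_nhds hy)
  induction hφ with
  | gen k φ hφ => exact hST k φ hφ
  | zero k => exact InGerm.congr hT (Eventually.of_forall fun z => rfl) (InGerm.zero k)
  | add k φ η _ _ h1 h2 =>
    exact InGerm.congr hT (Eventually.of_forall fun z => rfl) (InGerm.add hT h1 h2)
  | smul k f φ hf _ h1 =>
    refine InGerm.congr hT (Eventually.of_forall fun z => rfl)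
      (InGerm.smul hT (f := f ∘ s) ?_ h1)
    filter_upwards [hh, hev] with z hz hz'
    exact ContMDiffAt.comp z (hf.contMDiffAt (hU.mem_nhds hz')) hz.1
  | wedge_mul k l α φ hα _ h1 =>
    refine InGerm.congr hT (Eventually.of_forall fun z => ?_)
      (InGerm.wedge_mul hT (α := bundlePullback s h α) ?_ h1)
    · exact (wedge_comp _ _ _).symm
    · filter_upwards [hh, hev] with z hz hz'
      exact hz.2 k α (hα _ hz')
  | congr k φ η he _ h1 =>
    refine InGerm.congr hT ?_ h1
    filter_upwards [hev] with z hz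
    simp only [bundlePullback, he _ hz]

theorem AlgIdeal.inGerm {x : M} {U : Set M} (hU : IsOpen U) (hx : x ∈ U)
    {S : ∀ k : ℕ, Set (DForm I M k)} {T : FormSystem I M} (hT : Restricts T)
    (hST : ∀ k, ∀ φ ∈ S k, InGerm T x k φ) {k : ℕ} {φ : DForm I M k}
    (hφ : AlgIdeal I U S k φ) : InGerm T x k φ := by
  have h := AlgIdeal.inGerm_bundlePullback (s := id) (h := fun y => ContinuousLinearMap.id ℝ _)
    (y := x) (Eventually.of_forall fun z => ⟨contMDiffAt_id, fun k α hα => hα⟩) hU hx hT hST hφ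
  exact h

theorem InGerm.pullback {S : FormSystem I M} {T : FormSystem I' N} (hT : Restricts T) {f : N → M} {y : N}
    (hf : ∀ᶠ z in 𝓝 y, ContMDiffAt I' I ∞ f z)
    (hST : ∀ U, IsOpen U → f y ∈ U → ∀ k, ∀ φ ∈ S U k, InGerm T y k (pullback I' I f φ)) {k : ℕ}
    {φ : DForm I M k} (hφ : InGerm S (f y) k φ) : InGerm T y k (EDS.pullback I' I f φ) := by
  obtain ⟨U, hU, hy, hφ⟩ := hφ
  exact AlgIdeal.inGerm_bundlePullback (smoothBundleMapAt_mfderiv hf) hU hy hT (hST U hU hy) hφ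

theorem mem_generated {S : FormSystem I M} (hS : Restricts S) {U : Set M} (hU : IsOpen U) {k : ℕ}
    {φ : DForm I M k} :
    φ ∈ generated I S U k ↔ (∀ x ∈ U, SmoothAt I φ x) ∧ ∀ x ∈ U, InGerm S x k φ := by
  refine ⟨fun h => ⟨h.1, fun x hx => ?_⟩, fun h => ⟨h.1, fun x hx => ?_⟩⟩
  · obtain ⟨V, hV, hxV, -, h⟩ := h.2 x hx
    exact ⟨V, hV, hxV, h⟩
  · obtain ⟨V, hV, hxV, h⟩ := h.2 x hx
    exact ⟨V ∩ U, hV.inter hU, ⟨hxV, hx⟩, inter_subset_right,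
      h.mono inter_subset_left fun k => hS _ _ inter_subset_left k⟩

/-- A system generated by smooth forms whose differentials lie in the ideal is a differential
system. -/
theorem isDifferentialSystem_generated {S : FormSystem I M} (hS : Restricts S)
    (hs : ∀ U, IsOpen U → ∀ k, ∀ φ ∈ S U k, ∀ x ∈ U, SmoothAt I φ x)
    (hd : ∀ U, IsOpen U → ∀ k, ∀ φ ∈ S U k, AlgIdeal I U (S U) (k + 1) (extd I φ)) :
    IsDifferentialSystem I (generated I S) where
  smooth U hU k φ hφ := hφ.1
  congr U hU k φ hφ η he := by
    rw [mem_generated hS hU] at hφ ⊢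
    exact ⟨fun x hx => (hφ.1 x hx).congr (Filter.mem_of_superset (hU.mem_nhds hx) he),
      fun x hx => InGerm.congr hS (Filter.mem_of_superset (hU.mem_nhds hx) he) (hφ.2 x hx)⟩
  restrict U V hU hV hVU k φ hφ := by
    rw [mem_generated hS hU] at hφ
    rw [mem_generated hS hV]
    exact ⟨fun x hx => hφ.1 x (hVU hx), fun x hx => hφ.2 x (hVU hx)⟩
  glue U hU k φ h := by
    rw [mem_generated hS hU]
    refine ⟨fun x hx => ?_, fun x hx => ?_⟩
    · obtain ⟨V, hV, hxV, -, h⟩ := h x hx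
      exact h.1 x hxV
    · obtain ⟨V, hV, hxV, -, h⟩ := h x hx
      exact ((mem_generated hS hV).1 h).2 x hxV
  zero U hU k := (mem_generated hS hU).2 ⟨fun x _ => SmoothAt.zero k x, fun x _ => InGerm.zero k⟩
  add U hU k φ hφ η hη := by
    rw [mem_generated hS hU] at hφ hη ⊢
    exact ⟨fun x hx => (hφ.1 x hx).add (hη.1 x hx), fun x hx => InGerm.add hS (hφ.2 x hx) (hη.2 x hx)⟩
  smul U hU k f hf φ hφ := by
    rw [mem_generated hS hU] at hφ ⊢
    have h : ∀ x ∈ U, ContMDiffAt I 𝓘(ℝ, ℝ) ∞ f x := fun x hx => hf.contMDiffAt (hU.mem_nhds hx)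
    exact ⟨fun x hx => (hφ.1 x hx).smul (h x hx),
      fun x hx => InGerm.smul hS (Filter.mem_of_superset (hU.mem_nhds hx) h) (hφ.2 x hx)⟩
  wedge_mem U hU k l α hα φ hφ := by
    rw [mem_generated hS hU] at hφ ⊢
    exact ⟨fun x hx => SmoothAt.wedge (hα x hx) (hφ.1 x hx),
      fun x hx => InGerm.wedge_mul hS (Filter.mem_of_superset (hU.mem_nhds hx) hα) (hφ.2 x hx)⟩
  extd_mem U hU k φ hφ := by
    rw [mem_generated hS hU] at hφ ⊢
    refine ⟨fun x hx => SmoothAt.extd (Filter.mem_of_superset (hU.mem_nhds hx) hφ.1), fun x hx => ?_⟩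
    obtain ⟨V, hV, hxV, h⟩ := hφ.2 x hx
    exact ⟨V, hV, hxV, h.extd hV (hs V hV) (hd V hV)⟩

theorem gens12_cases {S₁ : Set (DForm I M 1)} {S₂ : Set (DForm I M 2)}
    {p : ∀ k, DForm I M k → Prop} (h1 : ∀ φ ∈ S₁, p 1 φ) (h2 : ∀ φ ∈ S₂, p 2 φ) :
    ∀ k, ∀ φ ∈ gens12 I S₁ S₂ k, p k φ
  | 0, _, h => h.elim
  | 1, φ, h => h1 φ h
  | 2, φ, h => h2 φ h
  | _ + 3, _, h => h.elim

theorem restricts_gens12 {S₁ : Set M → Set (DForm I M 1)} {S₂ : Set M → Set (DForm I M 2)}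
    (h1 : ∀ U V, V ⊆ U → S₁ U ⊆ S₁ V) (h2 : ∀ U V, V ⊆ U → S₂ U ⊆ S₂ V) :
    Restricts (fun U => gens12 I (S₁ U) (S₂ U)) := fun U V h =>
  gens12_cases (p := fun k φ => φ ∈ gens12 I (S₁ V) (S₂ V) k) (h1 U V h) (h2 U V h)

theorem sections_mono {W : CoField I M} {U V : Set M} (h : V ⊆ U) :
    sections I W U ⊆ sections I W V := fun _ hφ =>
  ⟨fun x hx => hφ.1 x (h hx), fun x hx => hφ.2 x (h hx)⟩

/-- The generators of the differential system of a Pfaffian system. -/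
def pfaffianGens (I : ModelWithCorners ℝ E H) (W : CoField I M) : FormSystem I M := fun U =>
  gens12 I (sections I W U) (extd I '' sections I W U)

theorem restricts_pfaffianGens (W : CoField I M) : Restricts (pfaffianGens I W) :=
  restricts_gens12 (fun _ _ h => sections_mono h) fun _ _ h => image_mono (sections_mono h)

theorem pfaffian_eq (W : CoField I M) : pfaffian I W = generated I (pfaffianGens I W) := rfl

theorem isDifferentialSystem_pfaffian (W : CoField I M) : IsDifferentialSystem I (pfaffian I W) := by
  refine isDifferentialSystem_generated (restricts_pfaffianGens W) (fun U hU => ?_) fun U hU => ?_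
  · refine gens12_cases (p := fun k φ => ∀ x ∈ U, SmoothAt I φ x) (fun φ hφ => hφ.1) ?_
    rintro _ ⟨φ, hφ, rfl⟩ x hx
    exact SmoothAt.extd (Filter.mem_of_superset (hU.mem_nhds hx) hφ.1)
  · refine gens12_cases (p := fun k φ => AlgIdeal I U (pfaffianGens I W U) (k + 1) (extd I φ))
      (fun φ hφ => ?_) ?_
    · exact .gen 2 _ ⟨φ, hφ, rfl⟩
    · rintro _ ⟨φ, hφ, rfl⟩
      refine .congr _ _ _ (fun x hx => ?_) (.zero _)
      rw [extd_extd (Filter.mem_of_superset (hU.mem_nhds hx) hφ.1)]; rfl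

theorem mem_pfaffian_of_mem_sections {W : CoField I M} {U : Set M} (hU : IsOpen U) {φ : DForm I M 1}
    (h : φ ∈ sections I W U) : φ ∈ pfaffian I W U 1 :=
  (mem_generated (restricts_pfaffianGens W) hU).2
    ⟨h.1, fun x hx => InGerm.gen (S := pfaffianGens I W) hU hx h⟩

end Ideals

section LocalInverse

open Filter Topology

variable {E : Type*} [NormedAddCommGroup E] [NormedSpace ℝ E] [FiniteDimensional ℝ E]
  {E' : Type*} [NormedAddCommGroup E'] [NormedSpace ℝ E'] [FiniteDimensional ℝ E']

theorem exists_local_inverse {g : E → E'} {a : E} (hg : ∀ᶠ x in 𝓝 a, ContDiffAt ℝ ∞ g x)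
    {e : E ≃L[ℝ] E'} (he : fderiv ℝ g a = e) :
    ∃ G : E' → E, G (g a) = a ∧ (∀ᶠ t in 𝓝 (g a), ContDiffAt ℝ ∞ G t ∧ g (G t) = t) ∧
      ∀ᶠ x in 𝓝 a, G (g x) = x := by
  have : CompleteSpace E := FiniteDimensional.complete ℝ E
  have h0 := hg.self_of_nhds
  have h1 : HasFDerivAt g (e : E →L[ℝ] E') a := he ▸ (h0.differentiableAt (by simp)).hasFDerivAt
  let f := h0.toOpenPartialHomeomorph g h1 (by simp)
  have hf : ⇑f = g := h0.toOpenPartialHomeomorph_coe h1 (by simp)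
  have ha : a ∈ f.source := h0.mem_toOpenPartialHomeomorph_source h1 (by simp)
  have hfa : g a ∈ f.target := h0.image_mem_toOpenPartialHomeomorph_target h1 (by simp)
  have hs : f.symm (g a) = a := by rw [← hf]; exact f.left_inv ha
  refine ⟨f.symm, hs, ?_, ?_⟩
  · have h2 : ContinuousAt (fderiv ℝ g) a := (h0.fderiv_right (m := 0) (by simp)).continuousAt
    have h3 : ∀ᶠ x in 𝓝 a, fderiv ℝ g x ∈ range ((↑) : (E ≃L[ℝ] E') → E →L[ℝ] E') :=
      h2 (he ▸ ContinuousLinearEquiv.nhds e)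
    have h4 : Tendsto f.symm (𝓝 (g a)) (𝓝 a) := by
      have := f.continuousAt_symm hfa
      rwa [ContinuousAt, hs] at this
    filter_upwards [h4.eventually (hg.and h3), f.open_target.mem_nhds hfa] with t ⟨ht1, ⟨e', he'⟩⟩ ht2
    refine ⟨f.contDiffAt_symm ht2 (f₀' := e') ?_ (by rwa [hf]), ?_⟩
    · rw [he', hf]
      exact (ht1.differentiableAt (by simp)).hasFDerivAt
    · have := f.right_inv ht2
      rwa [hf] at this
  · filter_upwards [f.open_source.mem_nhds ha] with x hx
    have := f.left_inv hx
    rwa [hf] at this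

end LocalInverse

section Submersions

open Filter Topology

variable {E : Type*} [NormedAddCommGroup E] [NormedSpace ℝ E] [FiniteDimensional ℝ E]
  {H : Type*} [TopologicalSpace H] {I : ModelWithCorners ℝ E H} [I.Boundaryless]
  {M : Type*} [TopologicalSpace M] [ChartedSpace H M] [IsManifold I ∞ M]
  {E' : Type*} [NormedAddCommGroup E'] [NormedSpace ℝ E'] [FiniteDimensional ℝ E']
  {H' : Type*} [TopologicalSpace H'] {I' : ModelWithCorners ℝ E' H'} [I'.Boundaryless]
  {N : Type*} [TopologicalSpace N] [ChartedSpace H' N] [IsManifold I' ∞ N]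

/-- The derivative, as a linear map between the model spaces. -/
def mfd (I : ModelWithCorners ℝ E H) (I' : ModelWithCorners ℝ E' H') (f : M → N) (x : M) :
    E →L[ℝ] E' := mfderiv I I' f x

theorem hasFDerivAt_writtenInChart {f : M → N} {x : M} (hf : ContMDiffAt I I' ∞ f x) :
    HasFDerivAt (fun w => extChartAt I' (f x) (f ((extChartAt I x).symm w))) (mfd I I' f x)
      (extChartAt I x x) := by
  have h : HasFDerivWithinAt (fun w => extChartAt I' (f x) (f ((extChartAt I x).symm w)))
      (mfd I I' f x) (range I) (extChartAt I x x) :=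
    (hf.mdifferentiableAt (by simp)).hasMFDerivAt.2
  rwa [ModelWithCorners.Boundaryless.range_eq_univ, hasFDerivWithinAt_univ] at h

/-- Submersions have local sections. -/
theorem exists_local_section {q : M → N} (hq : ContMDiff I I' ∞ q) {x : M}
    (hs : Function.Surjective (mfderiv I I' q x)) :
    ∃ s : N → M, s (q x) = x ∧ ∀ᶠ y in 𝓝 (q x), ContMDiffAt I' I ∞ s y ∧ q (s y) = y := by
  obtain ⟨R, hR⟩ := (mfd I I' q x).toLinearMap.exists_rightInverse_of_surjective
    (LinearMap.range_eq_top.2 hs)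
  let R' : E' →L[ℝ] E := LinearMap.toContinuousLinearMap R
  have hR' : ∀ v, mfd I I' q x (R' v) = v := fun v => congrArg (fun f => f v) hR
  set a := extChartAt I x x with ha
  set b := extChartAt I' (q x) (q x) with hb
  let k : E' → E := fun t => a + R' (t - b)
  have hk : ∀ t, ContDiffAt ℝ ∞ k t := fun t => by fun_prop
  have hkb : k b = a := by simp [k]
  let qh : E → E' := fun w => extChartAt I' (q x) (q ((extChartAt I x).symm w))
  have hqh : ∀ᶠ y in 𝓝 x, ContDiffAt ℝ ∞ qh (extChartAt I x y) := by
    filter_upwards [(isOpen_extChartAt_source (I := I) x).mem_nhds (mem_extChartAt_source x),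
      hq.continuous.continuousAt.eventually ((isOpen_extChartAt_source (I := I') (q x)).mem_nhds
        (mem_extChartAt_source (q x)))] with y h1 h2
    exact contDiffAt_writtenInChart (hq y) h1 h2
  have hsymm : Tendsto (extChartAt I x).symm (𝓝 a) (𝓝 x) := by
    have := (contMDiffAt_extChartAt_symm (I := I) (mem_extChartAt_target x)).continuousAt
    rwa [ContinuousAt, (extChartAt I x).left_inv (mem_extChartAt_source x)] at this
  have hqh' : ∀ᶠ w in 𝓝 a, ContDiffAt ℝ ∞ qh w := by
    filter_upwards [hsymm.eventually hqh, (isOpen_extChartAt_target (I := I) x).mem_nhds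
      (mem_extChartAt_target x)] with w h1 h2
    rwa [(extChartAt I x).right_inv h2] at h1
  have hkt : Tendsto k (𝓝 b) (𝓝 a) := by
    have := (hk b).continuousAt
    rwa [ContinuousAt, hkb] at this
  have hg : ∀ᶠ t in 𝓝 b, ContDiffAt ℝ ∞ (fun t => qh (k t)) t := by
    filter_upwards [hkt.eventually hqh'] with t ht
    exact ht.comp t (hk t)
  have hkd : HasFDerivAt k R' b := by
    have h1 : HasFDerivAt (fun t : E' => t - b) (ContinuousLinearMap.id ℝ E') b :=
      (hasFDerivAt_id b).sub_const b
    exact (R'.hasFDerivAt.comp b h1).const_add a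
  have hd : fderiv ℝ (fun t => qh (k t)) b = (ContinuousLinearEquiv.refl ℝ E' : E' →L[ℝ] E') := by
    have h1 : HasFDerivAt qh (mfd I I' q x) (k b) := by
      rw [hkb]; exact hasFDerivAt_writtenInChart (hq x)
    refine (show fderiv ℝ (fun t => qh (k t)) b = _ from (h1.comp b hkd).fderiv).trans ?_
    ext v
    exact hR' v
  obtain ⟨G, h1, h2, -⟩ := exists_local_inverse hg hd
  have hgb : qh (k b) = b := by
    rw [hkb]
    simp only [qh, ha, hb, (extChartAt I x).left_inv (mem_extChartAt_source x)]
  simp only [hgb] at h1 h2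
  have hc : Tendsto (fun y => extChartAt I' (q x) y) (𝓝 (q x)) (𝓝 b) := continuousAt_extChartAt (q x)
  have hGt : Tendsto G (𝓝 b) (𝓝 b) := by
    have := h2.self_of_nhds.1.continuousAt
    rwa [ContinuousAt, h1] at this
  refine ⟨fun y => (extChartAt I x).symm (k (G (extChartAt I' (q x) y))), ?_, ?_⟩
  · change (extChartAt I x).symm (k (G b)) = x
    rw [h1, hkb, ha, (extChartAt I x).left_inv (mem_extChartAt_source x)]
  · have h3 : Tendsto (fun y => k (G (extChartAt I' (q x) y))) (𝓝 (q x)) (𝓝 a) :=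
      hkt.comp (hGt.comp hc)
    have h4 : ∀ᶠ y in 𝓝 (q x), q ((extChartAt I x).symm (k (G (extChartAt I' (q x) y)))) ∈
        (extChartAt I' (q x)).source := by
      have h5 : Tendsto (fun y => q ((extChartAt I x).symm (k (G (extChartAt I' (q x) y)))))
          (𝓝 (q x)) (𝓝 (q x)) := hq.continuous.continuousAt.tendsto.comp (hsymm.comp h3)
      exact h5.eventually ((isOpen_extChartAt_source (I := I') (q x)).mem_nhds
        (mem_extChartAt_source (q x)))
    filter_upwards [hc.eventually h2, h4, (isOpen_extChartAt_source (I := I') (q x)).mem_nhds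
      (mem_extChartAt_source (q x)), h3.eventually ((isOpen_extChartAt_target (I := I) x).mem_nhds
      (mem_extChartAt_target x))] with y ⟨hy1, hy2⟩ hy3 hy4 hy5
    constructor
    · have h6 : ContMDiffAt I' 𝓘(ℝ, E') ∞ (extChartAt I' (q x)) y :=
        contMDiffAt_extChartAt' (by simpa using hy4)
      have h7 : ContMDiffAt I' 𝓘(ℝ, E) ∞ (fun y => k (G (extChartAt I' (q x) y))) y :=
        ((hk _).contMDiffAt.comp _ hy1.contMDiffAt).comp y h6
      exact (contMDiffAt_extChartAt_symm hy5).comp y h7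
    · exact (extChartAt I' (q x)).injOn hy3 hy4 hy2

end Submersions

section Linear

theorem coeff_eq_of_linearIndependent {V : Type*} [AddCommGroup V] [Module ℝ V] {κ : Type*} [Fintype κ]
    {b : κ → V} (hb : LinearIndependent ℝ b) {a a' : κ → ℝ} (h : ∑ k, a k • b k = ∑ k, a' k • b k)
    (k : κ) : a k = a' k := by
  have h1 : ∑ k, (a k - a' k) • b k = 0 := by
    simp only [sub_smul, Finset.sum_sub_distrib, h, sub_self]
  exact sub_eq_zero.1 (Fintype.linearIndependent_iff.1 hb _ h1 k)

variable {E : Type*} [NormedAddCommGroup E] [NormedSpace ℝ E]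
  {E' : Type*} [NormedAddCommGroup E'] [NormedSpace ℝ E'] [FiniteDimensional ℝ E']

/-- The linear map `v ↦ ∑ t_i(v) e_i`. -/
def liftMap {n : ℕ} (t : Fin n → Covector E') (e : Fin n → E) : E' →L[ℝ] E :=
  LinearMap.toContinuousLinearMap (∑ i, (Covector.toDual (t i)).smulRight (e i))

theorem liftMap_apply {n : ℕ} (t : Fin n → Covector E') (e : Fin n → E) (v : E') :
    liftMap t e v = ∑ i, t i (fun _ => v) • e i := by
  simp [liftMap]

end Linear

section Quotients

open Filter Topology

variable {E : Type*} [NormedAddCommGroup E] [NormedSpace ℝ E] [FiniteDimensional ℝ E]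
  {H : Type*} [TopologicalSpace H] {I : ModelWithCorners ℝ E H} [I.Boundaryless]
  {M : Type*} [TopologicalSpace M] [ChartedSpace H M] [IsManifold I ∞ M]
  {E' : Type*} [NormedAddCommGroup E'] [NormedSpace ℝ E'] [FiniteDimensional ℝ E']
  {H' : Type*} [TopologicalSpace H'] {I' : ModelWithCorners ℝ E' H'} [I'.Boundaryless]
  {N : Type*} [TopologicalSpace N] [ChartedSpace H' N] [IsManifold I' ∞ N]

/-- The covectors of `W` on the fibres of `q` are invariant along the fibres. -/
def Descends (I : ModelWithCorners ℝ E H) (I' : ModelWithCorners ℝ E' H') (q : M → N)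
    (W : CoField I M) : Prop :=
  ∀ (y : N) (c : Covector (TangentSpace I' y)) (x x' : M) (h : q x = y) (h' : q x' = y),
    pullbackAt I I' q 1 x (h.symm ▸ c) ∈ W x → pullbackAt I I' q 1 x' (h'.symm ▸ c) ∈ W x'

theorem mem_quotientBundle {q : M → N} {W : CoField I M} (hW : Descends I I' q W) {x : M}
    {c : Covector (TangentSpace I' (q x))} :
    c ∈ quotientBundle I I' q W (q x) ↔ pullbackAt I I' q 1 x c ∈ W x :=
  ⟨fun h => h x rfl, fun h x' h' => hW (q x) c x x' rfl h' h⟩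

theorem cast_covector_apply {a b : N} (h : a = b) (c : Covector (TangentSpace I' a)) (v : E') :
    (h ▸ c : Covector (TangentSpace I' b)) (fun _ => v) = c (fun _ => v) := by
  subst h; rfl

theorem pullbackAt_apply (q : M → N) (x : M) (c : Covector (TangentSpace I' (q x)))
    (v : TangentSpace I x) :
    pullbackAt I I' q 1 x c (fun _ => v) = c (fun _ => mfderiv I I' q x v) := rfl

theorem bil_pullback (q : M → N) (φ : DForm I' N 2) (x : M) (u v : TangentSpace I x) :
    bil (pullback I I' q φ x) u v = bil (φ (q x)) (mfderiv I I' q x u) (mfderiv I I' q x v) := by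
  rw [bil_apply, bil_apply, pullback_apply]
  congr 1
  funext i
  fin_cases i <;> rfl

theorem pullbackAt_injective {q : M → N} {x : M} (hs : Function.Surjective (mfderiv I I' q x)) :
    Function.Injective (pullbackAt I I' q 1 x) :=
  Covector.comapL_injective (E := E) (E' := E') (L := mfd I I' q x) hs

theorem exists_mem_annSub_of_quotientBundle {q : M → N} {W : CoField I M} (hW : Descends I I' q W)
    {x : M} {v' : TangentSpace I' (q x)} (h : v' ∈ annSub (quotientBundle I I' q W (q x))) :
    ∃ v ∈ annSub (W x), mfderiv I I' q x v = v' := by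
  have h1 : quotientBundle I I' q W (q x) = (W x).comap (pullbackAt I I' q 1 x) :=
    Submodule.ext fun c => mem_quotientBundle hW
  rw [h1] at h
  exact exists_mem_annSub_of_comap (E := E) (E' := E') (L := mfd I I' q x) h

theorem mfderiv_mem_annSub {q : M → N} {W : CoField I M} {x : M} {v : TangentSpace I x}
    (h : v ∈ annSub (W x)) : mfderiv I I' q x v ∈ annSub (quotientBundle I I' q W (q x)) :=
  fun c hc => h _ (hc x rfl)

theorem finrank_quotientBundle {q : M → N} {W : CoField I M} (hW : Descends I I' q W) {x : M}
    (hs : Function.Surjective (mfderiv I I' q x))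
    (hK : ∀ v, mfderiv I I' q x v = 0 → v ∈ annSub (W x) → v = 0) :
    Module.finrank ℝ (quotientBundle I I' q W (q x)) + Module.finrank ℝ E =
      Module.finrank ℝ (W x) + Module.finrank ℝ E' := by
  have h1 : quotientBundle I I' q W (q x) = (W x).comap (pullbackAt I I' q 1 x) :=
    Submodule.ext fun c => mem_quotientBundle hW
  rw [h1]
  exact finrank_comap_add (E := E) (E' := E') (L := mfd I I' q x) hs hK

/-- A coframe consisting of pulled back 1-forms and sections of `W`. -/
theorem exists_adapted_coframe {q : M → N} (hq : ContMDiff I I' ∞ q)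
    (hs : ∀ x, Function.Surjective (mfderiv I I' q x)) {W : CoField I M} {x : M}
    (hW : IsSubbundleAt I W x) (hK : ∀ v, mfderiv I I' q x v = 0 → v ∈ annSub (W x) → v = 0)
    {n : ℕ} {τ : Fin n → DForm I' N 1} (hτ : IsFrameAt I' (fun _ => ⊤) (q x) τ) :
    ∃ (m : ℕ) (w : Fin m → DForm I M 1), (∀ j, IsSectionAt I W x (w j)) ∧
      IsFrameAt I (fun _ => ⊤) x (Sum.elim (fun i => pullback I I' q (τ i)) w) := by
  let C : CoField I M := fun x => coann (LinearMap.ker (mfderiv I I' q x).toLinearMap)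
  have hC : IsFrameAt I C x (fun i => pullback I I' q (τ i)) := by
    filter_upwards [hq.continuous.continuousAt.eventually hτ] with y hy
    refine ⟨fun i => (hy.1 i).pullback (hq y), ?_, ?_⟩
    · exact hy.2.1.map' (pullbackAt I I' q 1 y) (LinearMap.ker_eq_bot.2 (pullbackAt_injective (hs y)))
    · have h1 : range (fun i => pullback I I' q (τ i) y) =
          (pullbackAt I I' q 1 y) '' (range fun i => τ i (q y)) := by
        rw [← range_comp]; rfl
      rw [h1, Submodule.span_image, hy.2.2, Submodule.map_top]
      exact Covector.range_comapL (E := E) (E' := E') (L := mfd I I' q y) (hs y)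
  have hsup : C x ⊔ W x = ⊤ := by
    rw [sup_comm]
    exact sup_coann_eq_top (E := E) fun v hv hv' => hK v hv hv'
  obtain ⟨w, hw1, hw2⟩ := hC.exists_extension (S := W) (T := fun _ => ⊤)
    (fun _ hc => hW.exists_section hc) (Eventually.of_forall fun y => by
      change Module.finrank ℝ (⊤ : Submodule ℝ (Covector E)) = Module.finrank ℝ (⊤ : Submodule ℝ (Covector E))
      rfl) (fun _ => le_top) (fun _ => le_top) hsup
  exact ⟨_, w, hw1, hw2⟩

theorem pullback_sum_smul (q : M → N) {ι : Type*} [Fintype ι] {k : ℕ} (a : ι → N → ℝ)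
    (τ : ι → DForm I' N k) (x : M) :
    pullback I I' q (fun y => ∑ i, a i y • τ i y) x = ∑ i, a i (q x) • pullback I I' q (τ i) x := by
  simp only [pullback, map_sum, map_smul]

/-- Covectors of the quotient bundle extend to sections. -/
theorem exists_section_quotientBundle {q : M → N} (hq : ContMDiff I I' ∞ q)
    (hs : ∀ x, Function.Surjective (mfderiv I I' q x)) {W : CoField I M} (hD : Descends I I' q W)
    {x : M} (hW : IsSubbundleAt I W x)
    (hK : ∀ v, mfderiv I I' q x v = 0 → v ∈ annSub (W x) → v = 0)
    {c : Covector (TangentSpace I' (q x))} (hc : c ∈ quotientBundle I I' q W (q x)) :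
    ∃ φ, IsSectionAt I' (quotientBundle I I' q W) (q x) φ ∧ φ (q x) = c := by
  obtain ⟨n, τ, hτ⟩ := isSubbundleAt_top (I := I') (q x)
  obtain ⟨m, w, hw1, hw2⟩ := exists_adapted_coframe hq hs hW hK hτ
  obtain ⟨s, hs1, hs2⟩ := exists_local_section hq (hs x)
  obtain ⟨θ, hθ1, hθ2⟩ := hW.exists_section ((mem_quotientBundle hD).1 hc)
  obtain ⟨a, ha⟩ := hw2.exists_coeff (hθ1.mono (W' := fun _ => ⊤) fun _ => le_top)
  have hst : Tendsto s (𝓝 (q x)) (𝓝 x) := by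
    have := hs2.self_of_nhds.1.continuousAt
    rwa [ContinuousAt, hs1] at this
  have hw1' : ∀ᶠ z in 𝓝 x, ∀ j, w j z ∈ W z := by
    rw [eventually_all]
    exact fun j => (hw1 j).eventually.mono fun z hz => hz.mem
  refine ⟨fun y => ∑ i, a (Sum.inl i) (s y) • τ i y, ?_, ?_⟩
  · filter_upwards [hs2, hst.eventually ha, hst.eventually (hθ1.and hw1'), hτ]
      with y ⟨hy1, hy2⟩ hy3 ⟨hy4, hy5⟩ hy6
    refine ⟨SmoothAt.fun_sum fun i _ => SmoothAt.smul ((hy3.1 (Sum.inl i)).comp y hy1) (hy6.1 i), ?_⟩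
    have h1 : pullback I I' q (fun y => ∑ i, a (Sum.inl i) (s y) • τ i y) (s y) ∈ W (s y) := by
      rw [pullback_sum_smul]
      have h2 := hy3.2
      rw [Fintype.sum_sum_type] at h2
      simp only [Sum.elim_inl, Sum.elim_inr] at h2
      simp only [hy2]
      rw [← sub_eq_iff_eq_add] at h2
      rw [← h2]
      exact Submodule.sub_mem _ hy4.2 (Submodule.sum_mem _ fun j _ => Submodule.smul_mem _ _ (hy5 j))
    have h3 := (mem_quotientBundle hD).2 h1
    rwa [hy2] at h3
  · have h0 := hw2.self_of_nhds
    have h1 : c ∈ Submodule.span ℝ (range fun i => τ i (q x)) := by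
      rw [hτ.self_of_nhds.2.2]; trivial
    obtain ⟨b, hb⟩ := (Submodule.mem_span_range_iff_exists_fun ℝ).1 h1
    have h2 : ∑ k, a k x • Sum.elim (fun i => pullback I I' q (τ i)) w k x =
        ∑ k, (Sum.elim b (fun _ => 0) k : ℝ) • Sum.elim (fun i => pullback I I' q (τ i)) w k x := by
      rw [← ha.self_of_nhds.2, hθ2, ← hb, Fintype.sum_sum_type]
      simp only [Sum.elim_inl, Sum.elim_inr, zero_smul, Finset.sum_const_zero, add_zero, map_sum,
        map_smul]
      rfl
    have h3 := coeff_eq_of_linearIndependent h0.2.1 h2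
    change ∑ i, a (Sum.inl i) (s (q x)) • τ i (q x) = c
    rw [← hb, hs1]
    refine Finset.sum_congr rfl fun i _ => ?_
    have := h3 (Sum.inl i)
    rw [this, Sum.elim_inl]

theorem isSubbundleOn_quotientBundle {q : M → N} (hq : ContMDiff I I' ∞ q)
    (hs : ∀ x, Function.Surjective (mfderiv I I' q x)) (hqs : Function.Surjective q)
    {W : CoField I M} (hD : Descends I I' q W) {r : ℕ} (hr : ∀ x, Module.finrank ℝ (W x) = r)
    (hW : ∀ x, IsSubbundleAt I W x)
    (hK : ∀ x v, mfderiv I I' q x v = 0 → v ∈ annSub (W x) → v = 0) :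
    IsSubbundleOn I' univ (quotientBundle I I' q W) := by
  refine isSubbundleOn_of_extends isOpen_univ (r + Module.finrank ℝ E' - Module.finrank ℝ E) ?_ ?_
  · intro y _
    obtain ⟨x, rfl⟩ := hqs y
    have h1 := finrank_quotientBundle hD (hs x) (hK x)
    rw [hr x] at h1
    omega
  · intro y _ c hc
    obtain ⟨x, rfl⟩ := hqs y
    exact exists_section_quotientBundle hq hs hD (hW x) (hK x) hc

/-- Pulling back along the horizontal lift `v ↦ ∑ τ_a(v) e_a` over a map `s`. -/
theorem smoothBundleMapAt_lift {n : ℕ} {τ : Fin n → DForm I' N 1} {s : N → M} {y₀ : N} {x : M}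
    (hsx : s y₀ = x)
    (hτ : ∀ i, ∀ᶠ y in 𝓝 y₀, SmoothAt I' (τ i) y) (hs : ∀ᶠ y in 𝓝 y₀, ContMDiffAt I' I ∞ s y)
    {e : Fin n → ∀ z : M, TangentSpace I z} (he : ∀ i, ∀ᶠ z in 𝓝 x, VecSmoothAt I x (e i) z)
    (h : ∀ y : N, TangentSpace I' y →L[ℝ] TangentSpace I (s y))
    (hh : ∀ y v, h y v = ∑ i, τ i y (fun _ => v) • e i (s y)) :
    SmoothBundleMapAt (I := I) (I' := I') s h y₀ := by
  have hst : Tendsto s (𝓝 y₀) (𝓝 x) := by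
    have := hs.self_of_nhds.continuousAt
    rwa [ContinuousAt, hsx] at this
  have hgood : ∀ᶠ y in 𝓝 y₀, (∀ i, SmoothAt I' (τ i) y) ∧ ContMDiffAt I' I ∞ s y ∧
      (∀ i, VecSmoothAt I x (e i) (s y)) ∧ s y ∈ (extChartAt I x).source ∧
      y ∈ (extChartAt I' y₀).source := by
    filter_upwards [eventually_all.2 hτ, hs, hst.eventually (eventually_all.2 he),
      hst.eventually ((isOpen_extChartAt_source (I := I) x).mem_nhds (mem_extChartAt_source x)),
      (isOpen_extChartAt_source (I := I') y₀).mem_nhds (mem_extChartAt_source y₀)] with y h1 h2 h3 h4 h5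
    exact ⟨h1, h2, h3, h4, h5⟩
  filter_upwards [hgood.eventually_nhds] with z hz
  obtain ⟨hz1, hz2, hz3, hz4, hz5⟩ := hz.self_of_nhds
  refine ⟨hz2, fun k α hα => ?_⟩
  rw [smoothAt_iff_of_mem_source hz5]
  refine contDiffAt_alternating_of_apply (n := ⊤) fun V => ?_
  let g : E' → E := fun w => extChartAt I x (s ((extChartAt I' y₀).symm w))
  have hg : ContDiffAt ℝ ∞ g (extChartAt I' y₀ z) := contDiffAt_writtenInChart hz2 hz5 hz4
  have hgz : g (extChartAt I' y₀ z) = extChartAt I x (s z) := by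
    simp only [g, (extChartAt I' y₀).left_inv hz5]
  have hα' : ContDiffAt ℝ ∞ (fun w => inChart I x α (g w)) (extChartAt I' y₀ z) := by
    have := (smoothAt_iff_of_mem_source hz4).1 hα
    rw [← hgz] at this
    exact this.comp _ hg
  have hv : ∀ i : Fin k, ContDiffAt ℝ ∞ (fun w => ∑ a, (inChart I' y₀ (τ a) w (fun _ => V i)) •
      vecInChart I x (e a) (g w)) (extChartAt I' y₀ z) := by
    intro i
    refine ContDiffAt.sum fun a _ => ?_
    have h1 : ContDiffAt ℝ ∞ (fun w => inChart I' y₀ (τ a) w (fun _ => V i)) (extChartAt I' y₀ z) :=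
      ContDiffAt.alternating_apply (n := ⊤) ((smoothAt_iff_of_mem_source hz5).1 (hz1 a))
        (fun _ => contDiffAt_const)
    have h2 : ContDiffAt ℝ ∞ (fun w => vecInChart I x (e a) (g w)) (extChartAt I' y₀ z) := by
      have : ContDiffAt ℝ ∞ (vecInChart I x (e a)) (extChartAt I x (s z)) := hz3 a
      rw [← hgz] at this
      exact this.comp _ hg
    exact h1.smul h2
  refine (ContDiffAt.alternating_apply (n := ⊤) hα' hv).congr_of_eventuallyEq ?_
  have hsymm : Tendsto (extChartAt I' y₀).symm (𝓝 (extChartAt I' y₀ z)) (𝓝 z) := by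
    have := (contMDiffAt_extChartAt_symm (I := I') ((extChartAt I' y₀).map_source hz5)).continuousAt
    rwa [ContinuousAt, (extChartAt I' y₀).left_inv hz5] at this
  filter_upwards [hsymm.eventually hz] with w hw
  have hd : ∀ a, vecInChart I x (e a) (g w) =
      dChart I x (s ((extChartAt I' y₀).symm w)) (e a (s ((extChartAt I' y₀).symm w))) := by
    intro a
    simp only [vecInChart, g]
    rw [(extChartAt I x).left_inv hw.2.2.2.1]
  refine (apply_eq_inChart α hw.2.2.2.1 _).trans ?_
  refine congrArg (inChart I x α (g w)) ?_
  funext i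
  refine (congrArg (dChart I x (s ((extChartAt I' y₀).symm w))) (hh _ _)).trans ?_
  rw [map_sum]
  refine Finset.sum_congr rfl fun a _ => ?_
  rw [hd, map_smul]
  rfl

/-- Lifts of tangent vectors, compatible with `W`. -/
theorem exists_lift {q : M → N} (hq : ContMDiff I I' ∞ q)
    (hs : ∀ x, Function.Surjective (mfderiv I I' q x)) {W : CoField I M} (hD : Descends I I' q W)
    {x : M} (hW : IsSubbundleAt I W x)
    (hK : ∀ v, mfderiv I I' q x v = 0 → v ∈ annSub (W x) → v = 0) :
    ∃ (s : N → M) (h : ∀ y : N, TangentSpace I' y →L[ℝ] TangentSpace I (s y)),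
      s (q x) = x ∧ SmoothBundleMapAt (I := I) (I' := I') s h (q x) ∧
      ∀ᶠ y in 𝓝 (q x), q (s y) = y ∧
        (∀ v : E', mfd I I' q (s y) (h y v) = v) ∧
        ∀ u ∈ annSub (quotientBundle I I' q W y), h y u ∈ annSub (W (s y)) := by
  obtain ⟨n, τ, hτ⟩ := isSubbundleAt_top (I := I') (q x)
  obtain ⟨m, w, hw1, hw2⟩ := exists_adapted_coframe hq hs hW hK hτ
  obtain ⟨s, hs1, hs2⟩ := exists_local_section hq (hs x)
  have hst : Tendsto s (𝓝 (q x)) (𝓝 x) := by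
    have := hs2.self_of_nhds.1.continuousAt
    rwa [ContinuousAt, hs1] at this
  have hτs : ∀ i, ∀ᶠ y in 𝓝 (q x), SmoothAt I' (τ i) y := fun i => hτ.mono fun y hy => hy.1 i
  obtain ⟨V, hV, hxV, hVs, hsm, e, he1, he2⟩ := exists_dual_fields
    (θ := Sum.elim (fun i => pullback I I' q (τ i)) w) (x₀ := x)
    (fun i => hw2.mono fun y hy => hy.1 i) hw2.self_of_nhds.2.1
  let h : ∀ y : N, TangentSpace I' y →L[ℝ] TangentSpace I (s y) := fun y =>
    liftMap (E := E) (E' := E') (fun i => τ i y) (fun i => e (Sum.inl i) (s y))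
  have hh : ∀ y v, h y v = ∑ i, τ i y (fun _ => v) • e (Sum.inl i) (s y) := by
    intro y v
    exact liftMap_apply (E := E) (E' := E') _ _ _
  have hw1' : ∀ᶠ z in 𝓝 x, ∀ j, w j z ∈ W z := by
    rw [eventually_all]
    exact fun j => (hw1 j).eventually.mono fun z hz => hz.mem
  refine ⟨s, h, hs1, smoothBundleMapAt_lift hs1 hτs (hs2.mono fun y hy => hy.1)
    (e := fun i => e (Sum.inl i)) (fun i => ?_) h hh, ?_⟩
  · filter_upwards [hV.mem_nhds hxV] with z hz using he1 _ z hz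
  · filter_upwards [hs2, hst.eventually (hV.mem_nhds hxV), hst.eventually (hw2.and hw1'), hτ]
      with y ⟨hy1, hy2⟩ hy3 ⟨hy4, hy5⟩ hy6
    have hτe : ∀ i j, τ i y (fun _ => (mfd I I' q (s y) (e (Sum.inl j) (s y)) : E')) =
        if i = j then 1 else 0 := by
      intro i j
      have h1 := he2 (s y) hy3 (Sum.inl i) (Sum.inl j)
      simp only [Sum.elim_inl, Sum.inl.injEq] at h1
      rw [← h1]
      have h2 : pullback I I' q (τ i) (s y) (fun _ => e (Sum.inl j) (s y)) =
        (τ i (q (s y)) : Covector E') (fun _ => (mfd I I' q (s y) (e (Sum.inl j) (s y)) : E')) := rfl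
      rw [h2, hy2]
    have hqh : ∀ v : E', mfd I I' q (s y) (h y v) = v := by
      intro v
      have h1 := eq_sum_of_coframe (E := E') (θ := fun i => τ i y)
        (e := fun j => mfd I I' q (s y) (e (Sum.inl j) (s y))) hτe hy6.2.2 v
      refine Eq.trans ?_ h1.symm
      refine (congrArg (mfd I I' q (s y)) (hh y v)).trans ?_
      refine (map_sum (mfd I I' q (s y)) _ _).trans ?_
      exact Finset.sum_congr rfl fun i _ => map_smul (mfd I I' q (s y)) _ _
    refine ⟨hy2, hqh, fun u hu c hc => ?_⟩
    have hcs := Covector.eq_sum_of_mem_span (he2 (s y) hy3) (c := c)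
      (by rw [hy4.2.2]; trivial)
    rw [Fintype.sum_sum_type] at hcs
    simp only [Sum.elim_inl, Sum.elim_inr] at hcs
    have h1 : pullback I I' q (fun z => ∑ i, c (fun _ => e (Sum.inl i) (s y)) • τ i z) (s y) ∈ W (s y) := by
      rw [pullback_sum_smul q (fun i _ => c (fun _ => e (Sum.inl i) (s y)))]
      rw [← sub_eq_iff_eq_add] at hcs
      rw [← hcs]
      exact Submodule.sub_mem _ hc (Submodule.sum_mem _ fun j _ => Submodule.smul_mem _ _ (hy5 j))
    have h3 := (mem_quotientBundle hD).2 h1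
    rw [hy2] at h3
    have h4 := hu _ h3
    rw [hh, Covector.map_sum]
    rw [Covector.sum_apply] at h4
    rw [← h4]
    refine Finset.sum_congr rfl fun i _ => ?_
    rw [Covector.map_smul, mul_comm]
    rfl

end Quotients

section ConstantRank

open Filter Topology Module

variable {E : Type*} [NormedAddCommGroup E] [NormedSpace ℝ E] [FiniteDimensional ℝ E]
  {E' : Type*} [NormedAddCommGroup E'] [NormedSpace ℝ E'] [FiniteDimensional ℝ E']

theorem exists_projection (K : Submodule ℝ E) : ∃ p : E →L[ℝ] K, ∀ v : K, p v = v := by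
  obtain ⟨p, hp⟩ := K.subtype.exists_leftInverse_of_injective K.ker_subtype
  exact ⟨LinearMap.toContinuousLinearMap p, fun v => congrArg (fun L => L v) hp⟩

/-- A continuous linear map with injective, hence bijective, derivative. -/
theorem exists_equiv_of_injective {L : E →L[ℝ] E'} (hL : Function.Injective L)
    (h : finrank ℝ E = finrank ℝ E') : ∃ e : E ≃L[ℝ] E', (e : E →L[ℝ] E') = L :=
  ⟨(LinearEquiv.ofInjectiveOfFinrankEq L.toLinearMap hL h).toContinuousLinearEquiv, by ext v; rfl⟩

/-- The image of a smooth map of constant rank `r` has dimension at most `r`. -/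
theorem exists_nhds_dimH_image_le {f : E → E'} {a : E} {r : ℕ}
    (hf : ∀ᶠ x in 𝓝 a, ContDiffAt ℝ ∞ f x)
    (hr : ∀ᶠ x in 𝓝 a, finrank ℝ (LinearMap.range (fderiv ℝ f x).toLinearMap) = r) :
    ∃ U ∈ 𝓝 a, dimH (f '' U) ≤ r := by
  let R := LinearMap.range (fderiv ℝ f a).toLinearMap
  let Z := LinearMap.ker (fderiv ℝ f a).toLinearMap
  obtain ⟨P, hP⟩ := exists_projection R
  obtain ⟨κ, hκ⟩ := exists_projection Z
  let g : E → R × Z := fun x => (P (f x), κ x)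
  have hgs : ∀ x, ContDiffAt ℝ ∞ f x → ContDiffAt ℝ ∞ g x := fun x hx =>
    (P.contDiff.contDiffAt.comp x hx).prodMk κ.contDiff.contDiffAt
  have hgd : ∀ x, ContDiffAt ℝ ∞ f x → HasFDerivAt g ((P.comp (fderiv ℝ f x)).prod κ) x :=
    fun x hx => (P.hasFDerivAt.comp x (hx.differentiableAt (by simp)).hasFDerivAt).prodMk
      κ.hasFDerivAt
  have hinj : Function.Injective ((P.comp (fderiv ℝ f a)).prod κ) := by
    rw [injective_iff_map_eq_zero]
    intro v hv
    have h1 : P (fderiv ℝ f a v) = 0 := congrArg Prod.fst hv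
    have h2 : κ v = 0 := congrArg Prod.snd hv
    have h3 := hP ⟨fderiv ℝ f a v, v, rfl⟩
    have h4 : fderiv ℝ f a v = 0 := congrArg Subtype.val (h3.symm.trans h1)
    have h5 := hκ ⟨v, h4⟩
    exact congrArg Subtype.val (h5.symm.trans h2)
  have hfin : finrank ℝ E = finrank ℝ (R × Z) := by
    rw [finrank_prod]
    exact (LinearMap.finrank_range_add_finrank_ker (fderiv ℝ f a).toLinearMap).symm
  obtain ⟨e, he⟩ := exists_equiv_of_injective hinj hfin
  obtain ⟨G, hG1, hG2, hG3⟩ := exists_local_inverse (hf.mono hgs)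
    ((hgd a hf.self_of_nhds).fderiv.trans he.symm)
  have hGt : Tendsto G (𝓝 (g a)) (𝓝 a) := by
    have := hG2.self_of_nhds.1.continuousAt
    rwa [ContinuousAt, hG1] at this
  let F : R × Z → E' := fun t => f (G t)
  have hF : ∀ᶠ t in 𝓝 (g a), ContDiffAt ℝ ∞ F t ∧ ∀ z : Z, fderiv ℝ F t (0, z) = 0 := by
    filter_upwards [hG2.eventually_nhds, hGt.eventually (hf.and hr)] with t ht1 ⟨ht2, ht3⟩
    have ht0 := ht1.self_of_nhds
    have hFs : ContDiffAt ℝ ∞ F t := ht2.comp t ht0.1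
    refine ⟨hFs, fun z => ?_⟩
    have hd : fderiv ℝ F t = (fderiv ℝ f (G t)).comp (fderiv ℝ G t) :=
      ((ht2.differentiableAt (by simp)).hasFDerivAt.comp t
        (ht0.1.differentiableAt (by simp)).hasFDerivAt).fderiv
    have hPF : ∀ v : R × Z, P (fderiv ℝ F t v) = v.1 := by
      have h1 : HasFDerivAt (fun t => P (F t)) (P.comp (fderiv ℝ F t)) t :=
        P.hasFDerivAt.comp t (hFs.differentiableAt (by simp)).hasFDerivAt
      have h2 : (fun t => P (F t)) =ᶠ[𝓝 t] fun t => t.1 := by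
        filter_upwards [ht1] with t' ht'
        exact congrArg Prod.fst ht'.2
      have h3 := (h1.congr_of_eventuallyEq h2.symm).unique hasFDerivAt_fst
      exact fun v => congrArg (fun L => L v) h3
    let S := LinearMap.range (fderiv ℝ f (G t)).toLinearMap
    have hmem : ∀ v, fderiv ℝ F t v ∈ S := fun v => by rw [hd]; exact ⟨_, rfl⟩
    let PS : S →ₗ[ℝ] R := P.toLinearMap.comp S.subtype
    have hsurj : Function.Surjective PS := fun u => ⟨⟨fderiv ℝ F t (u, 0), hmem _⟩, hPF (u, 0)⟩
    have hSR : finrank ℝ S = finrank ℝ R := ht3.trans hr.self_of_nhds.symm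
    have hPSinj := (LinearMap.injective_iff_surjective_of_finrank_eq_finrank hSR).2 hsurj
    have h5 : (⟨fderiv ℝ F t (0, z), hmem _⟩ : S) = 0 := by
      apply hPSinj
      rw [map_zero]
      exact hPF (0, z)
    exact congrArg Subtype.val h5
  obtain ⟨ε, hε, hball⟩ := Metric.eventually_nhds_iff_ball.1 hF
  have hconst : ∀ t ∈ Metric.ball (g a) ε, F t = F (t.1, (g a).2) := by
    rintro ⟨u, z⟩ ht
    rw [← ball_prod_same] at ht
    have hmemb : ∀ z' ∈ Metric.ball (g a).2 ε, ((u, z') : R × Z) ∈ Metric.ball (g a) ε := by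
      intro z' hz'
      rw [← ball_prod_same]
      exact ⟨ht.1, hz'⟩
    have hder : ∀ z' ∈ Metric.ball (g a).2 ε, HasFDerivWithinAt (fun z' => F (u, z')) (0 : Z →L[ℝ] E')
        (Metric.ball (g a).2 ε) z' := by
      intro z' hz'
      obtain ⟨h1, h2⟩ := hball _ (hmemb z' hz')
      have h3 := (h1.differentiableAt (by simp)).hasFDerivAt.comp z' (hasFDerivAt_prodMk_right u z')
      have h4 : (fderiv ℝ F (u, z')).comp (ContinuousLinearMap.inr ℝ R Z) = 0 := by
        ext v
        exact h2 v
      rw [h4] at h3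
      exact h3.hasFDerivWithinAt
    have := (convex_ball (g a).2 ε).norm_image_sub_le_of_norm_hasFDerivWithin_le (C := 0) hder
      (fun _ _ => by simp) (Metric.mem_ball_self hε) ht.2
    rw [zero_mul] at this
    exact sub_eq_zero.1 (norm_le_zero_iff.1 this)
  have hgc : ContinuousAt g a := (hgs a hf.self_of_nhds).continuousAt
  refine ⟨{x | g x ∈ Metric.ball (g a) ε ∧ G (g x) = x},
    (hgc.eventually (Metric.ball_mem_nhds _ hε)).and hG3, ?_⟩
  let F' : R → E' := fun u => F (u, (g a).2)
  have hF' : ContDiffOn ℝ 1 F' (Metric.ball (g a).1 ε) := by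
    intro u hu
    have h1 : ((u, (g a).2) : R × Z) ∈ Metric.ball (g a) ε := by
      rw [← ball_prod_same]
      exact ⟨hu, Metric.mem_ball_self hε⟩
    have h2 : ContDiffAt ℝ ∞ F (u, (g a).2) := (hball _ h1).1
    have h3 : ContDiffAt ℝ ∞ F' u := 
      ContDiffAt.comp u (f := fun u : R => ((u, (g a).2) : R × Z)) h2
        (contDiffAt_id.prodMk contDiffAt_const)
    exact (h3.of_le (by simp)).contDiffWithinAt
  have hsub : f '' {x | g x ∈ Metric.ball (g a) ε ∧ G (g x) = x} ⊆ F' '' (Metric.ball (g a).1 ε) := by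
    rintro _ ⟨x, ⟨hx1, hx2⟩, rfl⟩
    refine ⟨(g x).1, ?_, ?_⟩
    · rw [← ball_prod_same] at hx1
      exact hx1.1
    · have := hconst _ hx1
      change F ((g x).1, (g a).2) = f x
      rw [← this]
      change f (G (g x)) = f x
      rw [hx2]
  calc dimH _ ≤ dimH (F' '' (Metric.ball (g a).1 ε)) := dimH_mono hsub
    _ ≤ dimH (Metric.ball (g a).1 ε) :=
      hF'.dimH_image_le (convex_ball _ _) Subset.rfl
    _ ≤ dimH (univ : Set R) := dimH_mono (subset_univ _)
    _ = finrank ℝ R := Real.dimH_univ_eq_finrank R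
    _ = r := by rw [← hr.self_of_nhds]

end ConstantRank

section Orbits

open Filter Topology Module

variable {EG : Type*} [NormedAddCommGroup EG] [NormedSpace ℝ EG] [FiniteDimensional ℝ EG]
  {G : Type*} [TopologicalSpace G] [ChartedSpace EG G] [Group G] [LieGroup 𝓘(ℝ, EG) ∞ G]
  {E : Type*} [NormedAddCommGroup E] [NormedSpace ℝ E] [FiniteDimensional ℝ E]
  {H : Type*} [TopologicalSpace H] {I : ModelWithCorners ℝ E H} [I.Boundaryless]
  {M : Type*} [TopologicalSpace M] [ChartedSpace H M] [IsManifold I ∞ M] [MulAction G M]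
  {E' : Type*} [NormedAddCommGroup E'] [NormedSpace ℝ E'] [FiniteDimensional ℝ E']
  {H' : Type*} [TopologicalSpace H'] {I' : ModelWithCorners ℝ E' H'} [I'.Boundaryless]
  {N : Type*} [TopologicalSpace N] [ChartedSpace H' N] [IsManifold I' ∞ N]

theorem mfd_comp {E'' : Type*} [NormedAddCommGroup E''] [NormedSpace ℝ E''] [FiniteDimensional ℝ E'']
    {H'' : Type*} [TopologicalSpace H''] {I'' : ModelWithCorners ℝ E'' H''} [I''.Boundaryless]
    {P : Type*} [TopologicalSpace P] [ChartedSpace H'' P] [IsManifold I'' ∞ P]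
    {f : M → N} {g : N → P} {x : M} (hg : MDifferentiableAt I' I'' g (f x))
    (hf : MDifferentiableAt I I' f x) :
    mfd I I'' (fun y => g (f y)) x = (mfd I' I'' g (f x)).comp (mfd I I' f x) :=
  mfderiv_comp x hg hf

theorem mfd_id (x : M) : mfd I I (fun y => y) x = ContinuousLinearMap.id ℝ E := mfderiv_id

theorem IsSmoothAction.smul (h : IsSmoothAction 𝓘(ℝ, EG) G I M) (g : G) :
    ContMDiff I I ∞ fun x : M => g • x :=
  h.comp (contMDiff_const.prodMk contMDiff_id)

theorem IsSmoothAction.orbit (h : IsSmoothAction 𝓘(ℝ, EG) G I M) (x : M) :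
    ContMDiff 𝓘(ℝ, EG) I ∞ fun g : G => g • x :=
  h.comp (contMDiff_id.prodMk contMDiff_const)

theorem injective_of_mfd_comp_eq_id {A : E →L[ℝ] E'} {B : E' →L[ℝ] E}
    (h : B.comp A = ContinuousLinearMap.id ℝ E) : Function.Injective A :=
  Function.LeftInverse.injective (g := B) fun v => congrArg (fun L => L v) h

theorem bijective_mfd_of_inverse {f : M → N} {g : N → M} (hf : ContMDiff I I' ∞ f)
    (hg : ContMDiff I' I ∞ g) (h1 : ∀ x, g (f x) = x) (h2 : ∀ y, f (g y) = y) (x : M) :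
    Function.Bijective (mfd I I' f x) := by
  constructor
  · refine injective_of_mfd_comp_eq_id (B := mfd I' I g (f x)) ?_
    rw [← mfd_comp ((hg _).mdifferentiableAt (by simp)) ((hf _).mdifferentiableAt (by simp)),
      show (fun y => g (f y)) = fun y => y from funext h1, mfd_id]
  · refine Function.RightInverse.surjective (g := mfd I' I g (f x)) fun v => ?_
    have h3 := mfd_comp (I := I') (I' := I) (I'' := I') (f := g) (g := f) (x := f x)
      ((hf _).mdifferentiableAt (by simp)) ((hg _).mdifferentiableAt (by simp))
    rw [show (fun y => f (g y)) = fun y => y from funext h2, mfd_id, h1] at h3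
    exact (congrArg (fun L => L v) h3).symm

theorem finrank_range_comp_of_bijective {E₁ E₂ E₃ E₄ : Type*} [NormedAddCommGroup E₁] [NormedSpace ℝ E₁]
    [NormedAddCommGroup E₂] [NormedSpace ℝ E₂] [NormedAddCommGroup E₃] [NormedSpace ℝ E₃]
    [NormedAddCommGroup E₄] [NormedSpace ℝ E₄]
    {A : E₁ →L[ℝ] E₂} {B : E₂ →L[ℝ] E₃} {C : E₃ →L[ℝ] E₄}
    (hA : Function.Surjective A) (hC : Function.Injective C) :
    finrank ℝ (LinearMap.range (C.comp (B.comp A)).toLinearMap) =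
      finrank ℝ (LinearMap.range B.toLinearMap) := by
  have h1 : LinearMap.range (C.comp (B.comp A)).toLinearMap =
      (LinearMap.range B.toLinearMap).map C.toLinearMap := by
    ext v
    simp only [LinearMap.mem_range, Submodule.mem_map]
    constructor
    · rintro ⟨u, rfl⟩
      exact ⟨B (A u), ⟨A u, rfl⟩, rfl⟩
    · rintro ⟨_, ⟨u, rfl⟩, rfl⟩
      obtain ⟨w, rfl⟩ := hA u
      exact ⟨w, rfl⟩
  rw [h1]
  exact (Submodule.equivMapOfInjective C.toLinearMap hC _).finrank_eq.symm

/-- The orbit maps have constant rank. -/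
theorem finrank_range_mfd_orbit (h : IsSmoothAction 𝓘(ℝ, EG) G I M) (x : M) (g : G) :
    finrank ℝ (LinearMap.range (mfd 𝓘(ℝ, EG) I (fun g : G => g • x) g).toLinearMap) =
      finrank ℝ (LinearMap.range (mfd 𝓘(ℝ, EG) I (fun g : G => g • x) 1).toLinearMap) := by
  let L : G → G := fun k => g⁻¹ * k
  have hL : ContMDiff 𝓘(ℝ, EG) 𝓘(ℝ, EG) ∞ L := contMDiff_mul_left
  have hL' : ContMDiff 𝓘(ℝ, EG) 𝓘(ℝ, EG) ∞ (fun k : G => g * k) := contMDiff_mul_left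
  have h1 : (fun k : G => k • x) = fun k => g • ((L k) • x) := by
    funext k
    rw [← mul_smul, mul_inv_cancel_left]
  have hLg : L g = 1 := inv_mul_cancel g
  have h2 := mfd_comp (I := 𝓘(ℝ, EG)) (I' := I) (I'' := I) (f := fun k => (L k) • x)
    (g := fun y => g • y) (x := g) ((h.smul g _).mdifferentiableAt (by simp))
    ((((h.orbit x).comp hL) g).mdifferentiableAt (by simp))
  have h3 := mfd_comp (I := 𝓘(ℝ, EG)) (I' := 𝓘(ℝ, EG)) (I'' := I) (f := L)
    (g := fun k : G => k • x) (x := g) ((h.orbit x _).mdifferentiableAt (by simp))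
    ((hL g).mdifferentiableAt (by simp))
  rw [← h1, h3, hLg] at h2
  rw [h2]
  refine finrank_range_comp_of_bijective ?_ ?_
  · exact (bijective_mfd_of_inverse hL hL' (fun k => mul_inv_cancel_left g k)
      (fun k => inv_mul_cancel_left g k) g).2
  · exact (bijective_mfd_of_inverse (h.smul g) (h.smul g⁻¹) (fun y => inv_smul_smul g y)
      (fun y => smul_inv_smul g y) _).1

/-- In a chart, the orbits have dimension at most the rank of the orbit map. -/
theorem dimH_orbit_le [SecondCountableTopology G] (h : IsSmoothAction 𝓘(ℝ, EG) G I M) (x : M) :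
    dimH (extChartAt I x '' {y | y ∈ (extChartAt I x).source ∧ ∃ g : G, g • x = y}) ≤
      finrank ℝ (LinearMap.range (mfd 𝓘(ℝ, EG) I (fun g : G => g • x) 1).toLinearMap) := by
  let o : G → M := fun g => g • x
  have ho : ContMDiff 𝓘(ℝ, EG) I ∞ o := h.orbit x
  let S : Set G := o ⁻¹' (extChartAt I x).source
  have hS : IsOpen S := (isOpen_extChartAt_source x).preimage ho.continuous
  have key : ∀ g ∈ S, ∃ V ∈ 𝓝[S] g, dimH ((fun k => extChartAt I x (o k)) '' V) ≤
      finrank ℝ (LinearMap.range (mfd 𝓘(ℝ, EG) I o 1).toLinearMap) := by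
    intro g hg
    let f : EG → E := fun w => extChartAt I x (o ((extChartAt 𝓘(ℝ, EG) g).symm w))
    let a := extChartAt 𝓘(ℝ, EG) g g
    have hsymm : Tendsto (extChartAt 𝓘(ℝ, EG) g).symm (𝓝 a) (𝓝 g) := by
      have := (contMDiffAt_extChartAt_symm (I := 𝓘(ℝ, EG)) (mem_extChartAt_target g)).continuousAt
      rwa [ContinuousAt, (extChartAt 𝓘(ℝ, EG) g).left_inv (mem_extChartAt_source g)] at this
    have hgood : ∀ᶠ w in 𝓝 a, w ∈ (extChartAt 𝓘(ℝ, EG) g).target ∧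
        (extChartAt 𝓘(ℝ, EG) g).symm w ∈ S := by
      filter_upwards [(isOpen_extChartAt_target (I := 𝓘(ℝ, EG)) g).mem_nhds (mem_extChartAt_target g),
        hsymm.eventually (hS.mem_nhds hg)] with w h1 h2
      exact ⟨h1, h2⟩
    obtain ⟨U, hU, hdim⟩ := exists_nhds_dimH_image_le (f := f) (a := a)
      (r := finrank ℝ (LinearMap.range (mfd 𝓘(ℝ, EG) I o 1).toLinearMap)) (by
        filter_upwards [hgood] with w ⟨h1, h2⟩
        have := contDiffAt_writtenInChart (I := 𝓘(ℝ, EG)) (I' := I) (ho ((extChartAt 𝓘(ℝ, EG) g).symm w))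
          ((extChartAt 𝓘(ℝ, EG) g).map_target h1) (z := x) h2
        rwa [(extChartAt 𝓘(ℝ, EG) g).right_inv h1] at this) (by
        filter_upwards [hgood] with w ⟨h1, h2⟩
        have hs := (contMDiffAt_extChartAt_symm (I := 𝓘(ℝ, EG)) h1).mdifferentiableAt (by simp)
        have hc := mdifferentiableAt_extChartAt' (I := I) (x := x) (y := o ((extChartAt 𝓘(ℝ, EG) g).symm w)) h2
        have ho' := (ho ((extChartAt 𝓘(ℝ, EG) g).symm w)).mdifferentiableAt (n := ∞) (by simp)
        have h4 := mfd_comp (I := 𝓘(ℝ, EG)) (I' := 𝓘(ℝ, EG)) (I'' := I)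
          (f := (extChartAt 𝓘(ℝ, EG) g).symm) (g := o) (x := w) ho' hs
        have h3 := mfd_comp (I := 𝓘(ℝ, EG)) (I' := I) (I'' := 𝓘(ℝ, E))
          (f := fun w => o ((extChartAt 𝓘(ℝ, EG) g).symm w)) (g := extChartAt I x) (x := w)
          hc (ho'.comp w hs)
        rw [h4] at h3
        have h5 : mfd 𝓘(ℝ, EG) 𝓘(ℝ, E) f w = fderiv ℝ f w := mfderiv_eq_fderiv
        rw [← h5]
        refine (congrArg (fun L : EG →L[ℝ] E => finrank ℝ (LinearMap.range L.toLinearMap)) h3).trans ?_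
        rw [← finrank_range_mfd_orbit h x ((extChartAt 𝓘(ℝ, EG) g).symm w)]
        refine finrank_range_comp_of_bijective ?_ ?_
        · have h6 := isInvertible_mfderivWithin_extChartAt_symm (I := 𝓘(ℝ, EG)) h1
          rw [ModelWithCorners.Boundaryless.range_eq_univ, mfderivWithin_univ] at h6
          exact h6.bijective.surjective
        · exact (isInvertible_dChart (I := I) h2).injective)
    refine ⟨(extChartAt 𝓘(ℝ, EG) g) ⁻¹' U ∩ (extChartAt 𝓘(ℝ, EG) g).source, ?_, ?_⟩
    · refine mem_nhdsWithin_of_mem_nhds (inter_mem ?_ ?_)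
      · exact (continuousAt_extChartAt (I := 𝓘(ℝ, EG)) g).preimage_mem_nhds hU
      · exact (isOpen_extChartAt_source (I := 𝓘(ℝ, EG)) g).mem_nhds (mem_extChartAt_source g)
    · refine le_trans (dimH_mono ?_) hdim
      rintro _ ⟨k, ⟨hk1, hk2⟩, rfl⟩
      exact ⟨_, hk1, by simp only [f, (extChartAt 𝓘(ℝ, EG) g).left_inv hk2]⟩
  choose! V hV1 hV2 using key
  obtain ⟨t, htS, htc, ht⟩ := TopologicalSpace.countable_cover_nhdsWithin hV1
  refine le_trans (dimH_mono (t := ⋃ g ∈ t, (fun k => extChartAt I x (o k)) '' (V g)) ?_) ?_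
  · rintro _ ⟨y, ⟨hy, k, rfl⟩, rfl⟩
    obtain ⟨g, hg, hk⟩ := mem_iUnion₂.1 (ht (show k ∈ S from hy))
    exact mem_iUnion₂.2 ⟨g, hg, k, hk, rfl⟩
  · rw [dimH_bUnion htc]
    exact iSup₂_le fun g hg => hV2 g (htS hg)

/-- The fibres of a submersion, in a chart and projected to the kernel of its derivative, contain
open sets. -/
theorem exists_nhds_fibre {q : M → N} (hq : ContMDiff I I' ∞ q) {x : M}
    (hs : Function.Surjective (mfderiv I I' q x)) {p : E →L[ℝ] LinearMap.ker (mfd I I' q x).toLinearMap}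
    (hp : ∀ v : LinearMap.ker (mfd I I' q x).toLinearMap, p v = v) :
    p '' (extChartAt I x '' {y | y ∈ (extChartAt I x).source ∧ q x = q y}) ∈
      𝓝 (p (extChartAt I x x)) := by
  set a := extChartAt I x x with ha
  set b := extChartAt I' (q x) (q x) with hb
  let qh : E → E' := fun w => extChartAt I' (q x) (q ((extChartAt I x).symm w))
  have hsymm : Tendsto (extChartAt I x).symm (𝓝 a) (𝓝 x) := by
    have := (contMDiffAt_extChartAt_symm (I := I) (mem_extChartAt_target x)).continuousAt
    rwa [ContinuousAt, (extChartAt I x).left_inv (mem_extChartAt_source x)] at this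
  have hgood : ∀ᶠ w in 𝓝 a, w ∈ (extChartAt I x).target ∧
      q ((extChartAt I x).symm w) ∈ (extChartAt I' (q x)).source := by
    filter_upwards [(isOpen_extChartAt_target (I := I) x).mem_nhds (mem_extChartAt_target x),
      (hq.continuous.continuousAt.tendsto.comp hsymm).eventually
        ((isOpen_extChartAt_source (I := I') (q x)).mem_nhds (mem_extChartAt_source (q x)))] with w h1 h2
    exact ⟨h1, h2⟩
  have hqh : ∀ᶠ w in 𝓝 a, ContDiffAt ℝ ∞ qh w := by
    filter_upwards [hgood] with w ⟨h1, h2⟩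
    have := contDiffAt_writtenInChart (hq _) ((extChartAt I x).map_target h1) h2
    rwa [(extChartAt I x).right_inv h1] at this
  let g : E → E' × LinearMap.ker (mfd I I' q x).toLinearMap := fun w => (qh w, p w)
  have hd : HasFDerivAt g ((mfd I I' q x).prod p) a :=
    (hasFDerivAt_writtenInChart (hq x)).prodMk p.hasFDerivAt
  have hinj : Function.Injective ((mfd I I' q x).prod p) := by
    rw [injective_iff_map_eq_zero]
    intro v hv
    have h1 : mfd I I' q x v = 0 := congrArg Prod.fst hv
    have h2 : p v = 0 := congrArg Prod.snd hv
    exact congrArg Subtype.val ((hp ⟨v, h1⟩).symm.trans h2)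
  have hfin : finrank ℝ E = finrank ℝ (E' × LinearMap.ker (mfd I I' q x).toLinearMap) := by
    rw [finrank_prod, ← LinearMap.finrank_range_add_finrank_ker (mfd I I' q x).toLinearMap,
      LinearMap.range_eq_top.2 (show Function.Surjective (mfd I I' q x).toLinearMap from hs), finrank_top]
  obtain ⟨e, he⟩ := exists_equiv_of_injective hinj hfin
  obtain ⟨G, h1, h2, -⟩ := exists_local_inverse (hqh.mono fun w hw => hw.prodMk p.contDiff.contDiffAt)
    (hd.fderiv.trans he.symm)
  have hga : qh a = b := by
    simp only [qh, ha, hb, (extChartAt I x).left_inv (mem_extChartAt_source x)]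
  rw [hga] at h1 h2
  have hGt : Tendsto G (𝓝 (b, p a)) (𝓝 a) := by
    have := h2.self_of_nhds.1.continuousAt
    rwa [ContinuousAt, h1] at this
  have hc : Tendsto (fun z => ((b, z) : E' × LinearMap.ker (mfd I I' q x).toLinearMap)) (𝓝 (p a))
      (𝓝 (b, p a)) := (Continuous.prodMk_right b).continuousAt
  filter_upwards [hc.eventually (h2.and (hGt.eventually hgood))] with z ⟨⟨_, hz1⟩, hz2, hz3⟩
  have hz4 : qh (G (b, z)) = b := congrArg Prod.fst hz1
  have hz5 : p (G (b, z)) = z := congrArg Prod.snd hz1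
  refine ⟨G (b, z), ⟨(extChartAt I x).symm (G (b, z)), ⟨(extChartAt I x).map_target hz2, ?_⟩,
    (extChartAt I x).right_inv hz2⟩, hz5⟩
  exact (extChartAt I' (q x)).injOn (mem_extChartAt_source (q x)) hz3 hz4.symm

/-- The tangent spaces of the fibres of the projection onto the orbit space are spanned by the
infinitesimal generators. -/
theorem exists_infGen_eq [SecondCountableTopology G] {q : M → N}
    (h : IsRegularQuotient 𝓘(ℝ, EG) G I I' q) (x : M) {v : TangentSpace I x}
    (hv : mfderiv I I' q x v = 0) : ∃ ξ, infGen 𝓘(ℝ, EG) G I ξ x = v := by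
  let K := LinearMap.ker (mfd I I' q x).toLinearMap
  let o : G → M := fun g => g • x
  let A : EG →L[ℝ] E := mfd 𝓘(ℝ, EG) I o 1
  obtain ⟨p, hp⟩ := exists_projection K
  have h1 := exists_nhds_fibre h.smooth (h.submersion x) hp
  have h2 : {y | y ∈ (extChartAt I x).source ∧ q x = q y} =
      {y | y ∈ (extChartAt I x).source ∧ ∃ g : G, g • x = y} := by
    ext y
    exact and_congr_right fun _ => h.orbits x y
  rw [h2] at h1
  have h3 : finrank ℝ K ≤ finrank ℝ (LinearMap.range A.toLinearMap) := by
    have h4 := (p.lipschitz.dimH_image_le _).trans (dimH_orbit_le h.smooth_action x)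
    rw [Real.dimH_of_mem_nhds h1] at h4
    exact_mod_cast h4
  have h5 : LinearMap.range A.toLinearMap ≤ K := by
    rintro _ ⟨ξ, rfl⟩
    have h6 := mfd_comp (I := 𝓘(ℝ, EG)) (I' := I) (I'' := I') (f := o) (g := q) (x := 1)
      ((h.smooth _).mdifferentiableAt (by simp)) ((h.smooth_action.orbit x 1).mdifferentiableAt (by simp))
    have h7 : (fun g : G => q (o g)) = fun _ => q x := by
      funext g
      exact ((h.orbits x (o g)).2 ⟨g, rfl⟩).symm
    have h8 : mfd 𝓘(ℝ, EG) I' (fun g : G => q (o g)) 1 = 0 := by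
      rw [h7]
      exact mfderiv_const
    rw [h6] at h8
    have h9 : o 1 = x := one_smul G x
    rw [h9] at h8
    exact congrArg (fun L => L ξ) h8
  have h6 := Submodule.eq_of_le_of_finrank_le h5 h3
  have h7 : v ∈ LinearMap.range A.toLinearMap := by
    rw [h6]
    exact hv
  obtain ⟨ξ, hξ⟩ := h7
  exact ⟨ξ, hξ⟩

end Orbits

section FreeActions

open Filter Topology

variable {EG : Type*} [NormedAddCommGroup EG] [NormedSpace ℝ EG] [FiniteDimensional ℝ EG]
  {G : Type*} [TopologicalSpace G] [ChartedSpace EG G] [Group G] [LieGroup 𝓘(ℝ, EG) ∞ G]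
  {E : Type*} [NormedAddCommGroup E] [NormedSpace ℝ E] [FiniteDimensional ℝ E]
  {H : Type*} [TopologicalSpace H] {I : ModelWithCorners ℝ E H} [I.Boundaryless]
  {M : Type*} [TopologicalSpace M] [ChartedSpace H M] [IsManifold I ∞ M] [MulAction G M]
  {E' : Type*} [NormedAddCommGroup E'] [NormedSpace ℝ E'] [FiniteDimensional ℝ E']
  {H' : Type*} [TopologicalSpace H'] {I' : ModelWithCorners ℝ E' H'} [I'.Boundaryless]
  {N : Type*} [TopologicalSpace N] [ChartedSpace H' N] [IsManifold I' ∞ N]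

theorem eventually_eq_of_mfd_eq_zero {γ : ℝ → M} {t₀ : ℝ}
    (h : ∀ᶠ t in 𝓝 t₀, HasMFDerivAt 𝓘(ℝ, ℝ) I γ t (0 : ℝ →L[ℝ] E)) : ∀ᶠ t in 𝓝 t₀, γ t = γ t₀ := by
  have hc : ContinuousAt γ t₀ := h.self_of_nhds.1
  have h1 : ∀ᶠ t in 𝓝 t₀, γ t ∈ (extChartAt I (γ t₀)).source ∧
      HasDerivAt (fun t => extChartAt I (γ t₀) (γ t)) 0 t := by
    filter_upwards [h, hc.eventually ((isOpen_extChartAt_source (I := I) (γ t₀)).mem_nhds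
      (mem_extChartAt_source (γ t₀)))] with t ht hs
    refine ⟨hs, ?_⟩
    have h2 := (mdifferentiableAt_extChartAt' (I := I) hs).hasMFDerivAt.comp t ht
    have h3 : HasFDerivAt (fun t => extChartAt I (γ t₀) (γ t))
      ((dChart I (γ t₀) (γ t) : E →L[ℝ] E).comp (0 : ℝ →L[ℝ] E)) t := h2.hasFDerivAt
    have h4 := h3.hasDerivAt
    have h5 : ((dChart I (γ t₀) (γ t) : E →L[ℝ] E).comp (0 : ℝ →L[ℝ] E)) 1 = 0 :=
      (dChart I (γ t₀) (γ t)).map_zero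
    rwa [h5] at h4
  obtain ⟨ε, hε, hb⟩ := Metric.eventually_nhds_iff_ball.1 h1
  filter_upwards [Metric.ball_mem_nhds t₀ hε] with t ht
  have h2 := (convex_ball t₀ ε).norm_image_sub_le_of_norm_hasDerivWithin_le (C := 0)
    (fun s hs => (hb s hs).2.hasDerivWithinAt) (fun _ _ => by simp) (Metric.mem_ball_self hε) ht
  rw [zero_mul] at h2
  exact (extChartAt I (γ t₀)).injOn (hb t ht).1 (mem_extChartAt_source _)
    (sub_eq_zero.1 (norm_le_zero_iff.1 h2))

/-- The infinitesimal generators of a free action do not vanish. -/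
theorem eq_zero_of_infGen_eq_zero [T2Space G] (h : IsSmoothAction 𝓘(ℝ, EG) G I M) (hfree : IsFreeAction G M)
    {x : M} {ξ : TangentSpace 𝓘(ℝ, EG) (1 : G)} (hξ : infGen 𝓘(ℝ, EG) G I ξ x = 0) : ξ = 0 := by
  have : CompleteSpace EG := FiniteDimensional.complete ℝ EG
  have : LieGroup 𝓘(ℝ, EG) (minSmoothness ℝ 3) G := by
    rw [minSmoothness_of_isRCLikeNormedField]
    exact LieGroup.of_le (n := ∞) (by norm_cast)
  have hX : ContMDiffAt 𝓘(ℝ, EG) (𝓘(ℝ, EG).prod 𝓘(ℝ, EG)) 1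
      (fun g : G => (mulInvariantVectorField (I := 𝓘(ℝ, EG)) ξ g : TangentBundle 𝓘(ℝ, EG) G)) 1 := by
    refine ((contMDiff_mulInvariantVectorField (I := 𝓘(ℝ, EG)) (G := G) ξ) 1).of_le ?_
    rw [minSmoothness_of_isRCLikeNormedField]
    exact one_le_two
  have : IsManifold 𝓘(ℝ, EG) 1 G := IsManifold.of_le (n := ∞) (by simp)
  obtain ⟨γ, hγ0, hγ⟩ := exists_isMIntegralCurveAt_of_contMDiffAt_boundaryless (t₀ := 0) hX
  have key : ∀ᶠ t in 𝓝 (0 : ℝ), HasMFDerivAt 𝓘(ℝ, ℝ) I (fun t => γ t • x) t (0 : ℝ →L[ℝ] E) := by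
    filter_upwards [hγ] with t ht
    have h1 := ((h.orbit x (γ t)).mdifferentiableAt (by simp)).hasMFDerivAt.comp t ht
    have h2 : (mfd 𝓘(ℝ, EG) I (fun g : G => g • x) (γ t)).comp
        (mfd 𝓘(ℝ, EG) 𝓘(ℝ, EG) (fun g : G => γ t * g) 1) =
        (mfd I I (fun y : M => γ t • y) x).comp (mfd 𝓘(ℝ, EG) I (fun g : G => g • x) 1) := by
      have h3 := mfd_comp (I := 𝓘(ℝ, EG)) (I' := 𝓘(ℝ, EG)) (I'' := I) (f := fun g : G => γ t * g)
        (g := fun g : G => g • x) (x := 1) ((h.orbit x _).mdifferentiableAt (by simp))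
        ((contMDiff_mul_left (n := ∞) (a := γ t) 1).mdifferentiableAt (by simp))
      have h4 := mfd_comp (I := 𝓘(ℝ, EG)) (I' := I) (I'' := I) (f := fun g : G => g • x)
        (g := fun y : M => γ t • y) (x := 1) ((h.smul (γ t) _).mdifferentiableAt (by simp))
        ((h.orbit x _).mdifferentiableAt (by simp))
      simp only [mul_smul] at h3
      rw [h3] at h4
      simpa only [mul_one, one_smul] using h4
    have h5 : mfd 𝓘(ℝ, EG) I (fun g : G => g • x) (γ t)
        (mulInvariantVectorField (I := 𝓘(ℝ, EG)) ξ (γ t)) = 0 := by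
      have h6 := congrArg (fun L => L ξ) h2
      refine h6.trans ?_
      have h7 : mfd 𝓘(ℝ, EG) I (fun g : G => g • x) 1 ξ = 0 := hξ
      exact (congrArg (mfd I I (fun y : M => γ t • y) x) h7).trans (map_zero _)
    refine h1.congr_mfderiv ?_
    ext1
    change mfd 𝓘(ℝ, EG) I (fun g : G => g • x) (γ t)
      ((1 : ℝ) • (mulInvariantVectorField (I := 𝓘(ℝ, EG)) ξ (γ t) : EG)) = 0
    rw [one_smul]
    exact h5
  have h1 := eventually_eq_of_mfd_eq_zero key
  have h2 : ∀ᶠ t in 𝓝 (0 : ℝ), γ t = 1 := by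
    filter_upwards [h1] with t ht
    rw [hγ0, one_smul] at ht
    exact hfree _ _ ht
  have h3 : HasMFDerivAt 𝓘(ℝ, ℝ) 𝓘(ℝ, EG) γ 0
      ((1 : ℝ →L[ℝ] ℝ).smulRight (mulInvariantVectorField (I := 𝓘(ℝ, EG)) ξ (γ 0))) := hγ.self_of_nhds
  have h4 : HasMFDerivAt 𝓘(ℝ, ℝ) 𝓘(ℝ, EG) γ 0 (0 : ℝ →L[ℝ] EG) := by
    have := (hasMFDerivAt_const (I := 𝓘(ℝ, ℝ)) (I' := 𝓘(ℝ, EG)) (1 : G) (0 : ℝ))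
    rw [← hγ0] at this
    exact this.congr_of_eventuallyEq (by filter_upwards [h2] with t ht; rw [ht, hγ0])
  have h5 := hasMFDerivAt_unique h3 h4
  have h6 := congrArg (fun L : ℝ →L[ℝ] EG => L 1) h5
  have h7 : (1 : ℝ) • (mulInvariantVectorField (I := 𝓘(ℝ, EG)) ξ (γ 0) : EG) = 0 := h6
  rw [one_smul, hγ0] at h7
  have h8 : mfd 𝓘(ℝ, EG) 𝓘(ℝ, EG) (fun g : G => 1 * g) 1 ξ = 0 := h7
  simp only [one_mul] at h8
  rw [mfd_id] at h8
  exact h8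

/-- The infinitesimal generators of a diagonal action. -/
theorem infGen_prod [MulAction G N] (h : IsSmoothAction 𝓘(ℝ, EG) G I M) (h' : IsSmoothAction 𝓘(ℝ, EG) G I' N)
    (ξ : TangentSpace 𝓘(ℝ, EG) (1 : G)) (x : M × N) :
    infGen 𝓘(ℝ, EG) G (I.prod I') ξ x =
      ((infGen 𝓘(ℝ, EG) G I ξ x.1, infGen 𝓘(ℝ, EG) G I' ξ x.2) : E × E') := by
  have h1 := (((h.orbit x.1) 1).mdifferentiableAt (n := ∞) (by simp)).hasMFDerivAt.prodMk
    (((h'.orbit x.2) 1).mdifferentiableAt (n := ∞) (by simp)).hasMFDerivAt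
  exact congrArg (fun L : EG →L[ℝ] E × E' => L ξ) h1.mfderiv

theorem Preserves.descends {q : M → N} (h : IsRegularQuotient 𝓘(ℝ, EG) G I I' q) {W : CoField I M}
    (hW : Preserves G I W) : Descends I I' q W := by
  intro y c x x' hx hx' hc
  obtain ⟨g, rfl⟩ := (h.orbits x' x).1 (hx'.trans hx.symm)
  subst hx
  have h1 := hW g x' _ hc
  have h2 : pullbackAt I I' q 1 x' (hx'.symm ▸ c) =
      pullbackAt I I (fun y : M => g • y) 1 x' (pullbackAt I I' q 1 (g • x') c) := by
    refine Covector.ext' fun v => ?_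
    have h3 : (fun y : M => q (g • y)) = q := funext fun y => ((h.orbits y (g • y)).2 ⟨g, rfl⟩).symm
    have h4 := mfd_comp (I := I) (I' := I) (I'' := I') (f := fun y : M => g • y) (g := q) (x := x')
      ((h.smooth _).mdifferentiableAt (by simp)) ((h.smooth_action.smul g _).mdifferentiableAt (by simp))
    rw [h3] at h4
    refine (cast_covector_apply (I' := I') hx'.symm c (mfd I I' q x' v)).trans ?_
    rw [h4]
    rfl
  rw [h2]
  exact h1

end FreeActions

section QuotientSystems

open Filter Topology

variable {E : Type*} [NormedAddCommGroup E] [NormedSpace ℝ E] [FiniteDimensional ℝ E]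
  {H : Type*} [TopologicalSpace H] {I : ModelWithCorners ℝ E H} [I.Boundaryless]
  {M : Type*} [TopologicalSpace M] [ChartedSpace H M] [IsManifold I ∞ M]
  {E' : Type*} [NormedAddCommGroup E'] [NormedSpace ℝ E'] [FiniteDimensional ℝ E']
  {H' : Type*} [TopologicalSpace H'] {I' : ModelWithCorners ℝ E' H'} [I'.Boundaryless]
  {N : Type*} [TopologicalSpace N] [ChartedSpace H' N] [IsManifold I' ∞ N]

theorem isDifferentialSystem_quotientSystem {q : M → N} (hq : ContMDiff I I' ∞ q)
    {𝓘 : FormSystem I M} (h : IsDifferentialSystem I 𝓘) :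
    IsDifferentialSystem I' (quotientSystem I I' q 𝓘) where
  smooth U _ k φ hφ := hφ.1
  congr U hU k φ hφ η he := by
    refine ⟨fun y hy => SmoothAt.congr (hφ.1 y hy) ?_, ?_⟩
    · filter_upwards [hU.mem_nhds hy] with z hz using he z hz
    · exact h.congr _ (hU.preimage hq.continuous) k _ hφ.2 _
        fun x hx => congrArg (pullbackAt I I' q k x) (he (q x) hx)
  restrict U V hU hV hVU k φ hφ := ⟨fun y hy => hφ.1 y (hVU hy),
    h.restrict _ _ (hU.preimage hq.continuous) (hV.preimage hq.continuous) (preimage_mono hVU) k hφ.2⟩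
  glue U hU k φ hφ := by
    refine ⟨fun y hy => ?_, ?_⟩
    · obtain ⟨V, _, hyV, _, h1⟩ := hφ y hy
      exact h1.1 y hyV
    · refine h.glue _ (hU.preimage hq.continuous) k _ fun x hx => ?_
      obtain ⟨V, hV, hyV, hVU, h1⟩ := hφ (q x) hx
      exact ⟨q ⁻¹' V, hV.preimage hq.continuous, hyV, preimage_mono hVU, h1.2⟩
  zero U hU k := by
    refine ⟨fun y _ => SmoothAt.zero k y, ?_⟩
    refine h.congr _ (hU.preimage hq.continuous) k _ (h.zero _ (hU.preimage hq.continuous) k) _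
      fun x _ => (map_zero (pullbackAt I I' q k x)).symm
  add U hU k φ hφ η hη := by
    refine ⟨fun y hy => SmoothAt.add (hφ.1 y hy) (hη.1 y hy), ?_⟩
    refine h.congr _ (hU.preimage hq.continuous) k _
      (h.add _ (hU.preimage hq.continuous) k _ hφ.2 _ hη.2) _
      fun x _ => (map_add (pullbackAt I I' q k x) _ _).symm
  smul U hU k f hf φ hφ := by
    refine ⟨fun y hy => SmoothAt.smul (hf.contMDiffAt (hU.mem_nhds hy)) (hφ.1 y hy), ?_⟩
    refine h.congr _ (hU.preimage hq.continuous) k _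
      (h.smul _ (hU.preimage hq.continuous) k (fun x => f (q x))
        (hf.comp hq.contMDiffOn Subset.rfl) _ hφ.2) _
      fun x _ => (map_smul (pullbackAt I I' q k x) _ _).symm
  wedge_mem U hU k l α hα φ hφ := by
    refine ⟨fun y hy => SmoothAt.wedge (hα y hy) (hφ.1 y hy), ?_⟩
    refine h.congr _ (hU.preimage hq.continuous) _ _
      (h.wedge_mem _ (hU.preimage hq.continuous) k l (pullback I I' q α)
        (fun x hx => SmoothAt.pullback (hα (q x) hx) (hq x)) _ hφ.2) _
      fun x _ => (wedge_comp _ _ _).symm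
  extd_mem U hU k φ hφ := by
    refine ⟨fun y hy => SmoothAt.extd ?_, ?_⟩
    · filter_upwards [hU.mem_nhds hy] with z hz using hφ.1 z hz
    · exact h.congr _ (hU.preimage hq.continuous) _ _
        (h.extd_mem _ (hU.preimage hq.continuous) k _ hφ.2) _
        fun x hx => extd_pullback (hφ.1 (q x) hx) (hq x)

theorem mem_quotientSystem_of_mem_sections {q : M → N} (hq : ContMDiff I I' ∞ q) {W : CoField I M}
    {U : Set N} (hU : IsOpen U) {η : DForm I' N 1}
    (hη : η ∈ sections I' (quotientBundle I I' q W) U) :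
    η ∈ quotientSystem I I' q (pfaffian I W) U 1 := by
  refine ⟨hη.1, mem_pfaffian_of_mem_sections (hU.preimage hq.continuous) ⟨fun x hx => ?_, fun x hx => ?_⟩⟩
  · exact SmoothAt.pullback (hη.1 (q x) hx) (hq x)
  · exact hη.2 (q x) hx x rfl

theorem vanishesOn_pullback_iff {q : M → N} {k : ℕ} {φ : DForm I' N k} {x : M}
    {P : Submodule ℝ (TangentSpace I x)} :
    VanishesOn (pullback I I' q φ x) P ↔ VanishesOn (φ (q x)) (P.map (mfderiv I I' q x).toLinearMap) := by
  constructor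
  · intro h v hv
    choose u hu1 hu2 using hv
    have := h u hu1
    rw [pullback_apply] at this
    rw [← this]
    exact congrArg _ (funext fun i => (hu2 i).symm)
  · intro h v hv
    rw [pullback_apply]
    exact h _ fun i => ⟨v i, hv i, rfl⟩

theorem IsIntegralElement.map {q : M → N} (hq : ContMDiff I I' ∞ q) {𝓘 : FormSystem I M} {x : M}
    {P : Submodule ℝ (TangentSpace I x)} (h : IsIntegralElement I 𝓘 x P) :
    IsIntegralElement I' (quotientSystem I I' q 𝓘) (q x) (P.map (mfderiv I I' q x).toLinearMap) :=
  fun U hU hx k _ hφ => vanishesOn_pullback_iff.1 (h _ (hU.preimage hq.continuous) hx k _ hφ.2)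

/-- Integral elements of the quotient lift, if `W` contains an integrable bundle to which the fibres
are transverse. -/
theorem exists_integralElement_lift {q : M → N} (hq : ContMDiff I I' ∞ q)
    (hs : ∀ x, Function.Surjective (mfderiv I I' q x)) {W F : CoField I M} (hD : Descends I I' q W)
    {x : M} (hW : IsSubbundleAt I W x) (hF : IsSubbundleAt I F x) (hFi : IsIntegrableOn I univ F)
    (hFW : ∀ y, F y ≤ W y) (hK : ∀ v, mfderiv I I' q x v = 0 → v ∈ annSub (F x) → v = 0)
    {P' : Submodule ℝ (TangentSpace I' (q x))}
    (hP' : IsIntegralElement I' (quotientSystem I I' q (pfaffian I W)) (q x) P') :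
    ∃ P, IsIntegralElement I (pfaffian I W) x P ∧ P.map (mfderiv I I' q x).toLinearMap = P' := by
  have hKW : ∀ v, mfderiv I I' q x v = 0 → v ∈ annSub (W x) → v = 0 := fun v hv hv' =>
    hK v hv (annSub_anti (hFW x) hv')
  have hdiff := isDifferentialSystem_quotientSystem hq (isDifferentialSystem_pfaffian W)
  have hsec : ∀ η, IsSectionAt I' (quotientBundle I I' q W) (q x) η →
      VanishesOn (η (q x)) P' ∧ VanishesOn (extd I' η (q x)) P' := by
    intro η hη
    obtain ⟨V, hV, hxV, -, h1⟩ := IsSectionAt.exists_mem_sections (ι := Unit) (fun _ => hη) univ_mem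
    have h2 := mem_quotientSystem_of_mem_sections hq hV (h1 ())
    exact ⟨hP' V hV hxV 1 η h2, hP' V hV hxV 2 _ (hdiff.extd_mem V hV 1 η h2)⟩
  have hP'a : P' ≤ annSub (quotientBundle I I' q W (q x)) := by
    intro v hv c hc
    obtain ⟨η, hη1, rfl⟩ := exists_section_quotientBundle hq hs hD hW hKW hc
    exact (hsec η hη1).1 _ fun _ => hv
  refine ⟨annSub (W x) ⊓ P'.comap (mfderiv I I' q x).toLinearMap, ?_, ?_⟩
  · intro _ hU hxU k φ hφ
    rw [pfaffian_eq, mem_generated (restricts_pfaffianGens W) hU] at hφ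
    obtain ⟨V, hV, hxV, h1⟩ := hφ.2 x hxU
    refine h1.vanishesOn hxV (gens12_cases (fun θ hθ => ?_) ?_)
    · intro v hv
      rw [Covector.apply_eq]
      exact (hv 0).1 _ (hθ.2 x hxV)
    · rintro _ ⟨θ, hθ, rfl⟩
      have hθ' := isSectionAt_of_mem_sections hV hxV hθ
      rw [vanishesOn_two_iff]
      intro u hu v hv
      have h2 : F x ⊔ coann (LinearMap.ker (mfderiv I I' q x).toLinearMap) = ⊤ :=
        sup_coann_eq_top (E := E) fun v hv hv' => hK v hv hv'
      obtain ⟨f, hf, c', hc', hfc⟩ := Submodule.mem_sup.1 (h2.symm ▸ Submodule.mem_top : θ x ∈ F x ⊔ _)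
      have h3 : c' ∈ LinearMap.range (pullbackAt I I' q 1 x) := by
        have := Covector.range_comapL (E := E) (E' := E') (L := mfd I I' q x) (hs x)
        exact this.symm ▸ hc'
      obtain ⟨c, rfl⟩ := h3
      have hc : c ∈ quotientBundle I I' q W (q x) := by
        rw [mem_quotientBundle hD]
        rw [← eq_sub_iff_add_eq'] at hfc
        rw [hfc]
        exact Submodule.sub_mem _ hθ'.mem (hFW x hf)
      obtain ⟨η, hη, rfl⟩ := exists_section_quotientBundle hq hs hD hW hKW hc
      obtain ⟨ψ, hψ, rfl⟩ := hF.exists_section hf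
      have hpη : IsSectionAt I W x (pullback I I' q η) := by
        filter_upwards [hq.continuous.continuousAt.eventually hη] with y hy
        exact ⟨hy.1.pullback (hq y), hy.2 y rfl⟩
      have hsum : IsSectionAt I W x (ψ + pullback I I' q η) := by
        filter_upwards [hψ, hpη] with y hy1 hy2
        exact ⟨hy1.1.add hy2.1, Submodule.add_mem _ (hFW y hy1.2) hy2.2⟩
      refine (bil_extd_eq_of_eq hW hθ' hsum hfc.symm hu.1 hv.1).trans ?_
      rw [extd_add hψ.smoothAt hpη.smoothAt]
      refine (bil_add_left _ _ _ _).trans ?_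
      have h4 : bil (extd I ψ x) u v = 0 := by
        obtain ⟨V', hV', hxV', -, h5⟩ := IsSectionAt.exists_mem_sections (ι := Unit) (fun _ => hψ) univ_mem
        exact hFi V' hV' (subset_univ _) ψ (h5 ()) x hxV' u (annSub_anti (hFW x) hu.1) v
          (annSub_anti (hFW x) hv.1)
      have h5 : bil (extd I (pullback I I' q η) x) u v = 0 := by
        rw [extd_pullback hη.smoothAt (hq x)]
        refine (bil_pullback q (extd I' η) x u v).trans ?_
        exact vanishesOn_two_iff.1 (hsec η hη).2 _ hu.2 _ hv.2
      rw [h4, h5, add_zero]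
  · apply le_antisymm
    · rw [Submodule.map_le_iff_le_comap]
      exact inf_le_right
    · intro v' hv'
      obtain ⟨v, hv1, hv2⟩ := exists_mem_annSub_of_quotientBundle hD (hP'a hv')
      exact ⟨v, ⟨hv1, show mfderiv I I' q x v ∈ P' from hv2 ▸ hv'⟩, hv2⟩

theorem vanishesOnSums_pullback_iff {q : M → N} (hq : ContMDiff I I' ∞ q)
    (hqs : Function.Surjective q) {𝓐 𝓑 : FormSystem I M}
    (hA : ∀ x P', IsIntegralElement I' (quotientSystem I I' q 𝓐) (q x) P' →
      ∃ P, IsIntegralElement I 𝓐 x P ∧ P.map (mfderiv I I' q x).toLinearMap = P')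
    (hB : ∀ x P', IsIntegralElement I' (quotientSystem I I' q 𝓑) (q x) P' →
      ∃ P, IsIntegralElement I 𝓑 x P ∧ P.map (mfderiv I I' q x).toLinearMap = P')
    {U : Set N} {k : ℕ} {φ : DForm I' N k} :
    VanishesOnSums I 𝓐 𝓑 (q ⁻¹' U) (pullback I I' q φ) ↔
      VanishesOnSums I' (quotientSystem I I' q 𝓐) (quotientSystem I I' q 𝓑) U φ := by
  constructor
  · intro h y hy P' Q'
    obtain ⟨x, rfl⟩ := hqs y
    refine ⟨fun hP' => ?_, fun hQ' => ?_, fun hP' hQ' => ?_⟩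
    · obtain ⟨P, hP, rfl⟩ := hA x P' hP'
      exact vanishesOn_pullback_iff.1 ((h x hy P P).1 hP)
    · obtain ⟨Q, hQ, rfl⟩ := hB x Q' hQ'
      exact vanishesOn_pullback_iff.1 ((h x hy Q Q).2.1 hQ)
    · obtain ⟨P, hP, rfl⟩ := hA x P' hP'
      obtain ⟨Q, hQ, rfl⟩ := hB x Q' hQ'
      rw [← Submodule.map_sup]
      exact vanishesOn_pullback_iff.1 ((h x hy P Q).2.2 hP hQ)
  · intro h x hx P Q
    refine ⟨fun hP => ?_, fun hQ => ?_, fun hP hQ => ?_⟩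
    · exact vanishesOn_pullback_iff.2 ((h (q x) hx _ ⊥).1 (hP.map hq))
    · exact vanishesOn_pullback_iff.2 ((h (q x) hx ⊥ _).2.1 (hQ.map hq))
    · have h1 := (h (q x) hx _ _).2.2 (hP.map hq) (hQ.map hq)
      rw [← Submodule.map_sup] at h1
      exact vanishesOn_pullback_iff.2 h1

/-- Quotients commute with the superposition of differential systems, provided integral elements
lift. -/
theorem quotientSystem_boxSum {q : M → N} (hq : ContMDiff I I' ∞ q)
    (hqs : Function.Surjective q) {𝓐 𝓑 : FormSystem I M}
    (hA : ∀ x P', IsIntegralElement I' (quotientSystem I I' q 𝓐) (q x) P' →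
      ∃ P, IsIntegralElement I 𝓐 x P ∧ P.map (mfderiv I I' q x).toLinearMap = P')
    (hB : ∀ x P', IsIntegralElement I' (quotientSystem I I' q 𝓑) (q x) P' →
      ∃ P, IsIntegralElement I 𝓑 x P ∧ P.map (mfderiv I I' q x).toLinearMap = P')
    (U : Set N) :
    quotientSystem I I' q (boxSum I 𝓐 𝓑) U =
      boxSum I' (quotientSystem I I' q 𝓐) (quotientSystem I I' q 𝓑) U := by
  funext k
  ext φ
  have h1 : SmoothOn I' U φ → (VanishesOnSums I 𝓐 𝓑 (q ⁻¹' U) (extd I (pullback I I' q φ)) ↔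
      VanishesOnSums I' (quotientSystem I I' q 𝓐) (quotientSystem I I' q 𝓑) U (extd I' φ)) := by
    intro hφ
    rw [← vanishesOnSums_pullback_iff hq hqs hA hB]
    refine forall₂_congr fun x hx => ?_
    rw [extd_pullback (hφ (q x) hx) (hq x)]
  constructor
  · rintro ⟨h2, -, h3, h4⟩
    exact ⟨h2, (vanishesOnSums_pullback_iff hq hqs hA hB).1 h3, (h1 h2).1 h4⟩
  · rintro ⟨h2, h3, h4⟩
    exact ⟨h2, fun x hx => SmoothAt.pullback (h2 (q x) hx) (hq x),
      (vanishesOnSums_pullback_iff hq hqs hA hB).2 h3, (h1 h2).2 h4⟩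

end QuotientSystems

section DarbouxPairs

variable {EG : Type*} [NormedAddCommGroup EG] [NormedSpace ℝ EG] [FiniteDimensional ℝ EG]
  {G : Type*} [TopologicalSpace G] [ChartedSpace EG G] [Group G] [LieGroup 𝓘(ℝ, EG) ∞ G]
  [SecondCountableTopology G]
  {E : Type*} [NormedAddCommGroup E] [NormedSpace ℝ E] [FiniteDimensional ℝ E]
  {H : Type*} [TopologicalSpace H] {I : ModelWithCorners ℝ E H} [I.Boundaryless]
  {M : Type*} [TopologicalSpace M] [ChartedSpace H M] [IsManifold I ∞ M] [MulAction G M]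
  {E' : Type*} [NormedAddCommGroup E'] [NormedSpace ℝ E'] [FiniteDimensional ℝ E']
  {H' : Type*} [TopologicalSpace H'] {I' : ModelWithCorners ℝ E' H'} [I'.Boundaryless]
  {N : Type*} [TopologicalSpace N] [ChartedSpace H' N] [IsManifold I' ∞ N]

theorem IsTransverse.eq_zero {q : M → N} (h : IsRegularQuotient 𝓘(ℝ, EG) G I I' q) {W : CoField I M}
    (hW : IsTransverse 𝓘(ℝ, EG) G I W) {x : M} {v : TangentSpace I x} (hv : mfderiv I I' q x v = 0)
    (hv' : v ∈ annSub (W x)) : v = 0 := by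
  obtain ⟨ξ, rfl⟩ := exists_infGen_eq h x hv
  exact hW x ξ hv'

theorem IsDarbouxPair.quotientSystem_boxSum {W₁ F₁ W₂ F₂ : CoField I M} {q : M → N}
    (hW : IsDarbouxPair I W₁ F₁ W₂ F₂) (h : IsRegularQuotient 𝓘(ℝ, EG) G I I' q)
    (h₁ : Preserves G I W₁) (h₂ : Preserves G I W₂)
    (ht₁ : IsTransverse 𝓘(ℝ, EG) G I (fun x => F₁ x ⊓ W₂ x))
    (ht₂ : IsTransverse 𝓘(ℝ, EG) G I (fun x => W₁ x ⊓ F₂ x)) (U : Set N) :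
    quotientSystem I I' q (boxSum I (pfaffian I W₁) (pfaffian I W₂)) U =
      boxSum I' (quotientSystem I I' q (pfaffian I W₁)) (quotientSystem I I' q (pfaffian I W₂)) U := by
  refine EDS.quotientSystem_boxSum h.smooth h.surjective (fun x P' hP' => ?_) (fun x P' hP' => ?_) U
  · exact exists_integralElement_lift h.smooth h.submersion (h₁.descends h)
      (hW.pfaffian₁.isSubbundleAt (mem_univ x)) (hW.largest₁.subbundle.isSubbundleAt (mem_univ x))
      hW.largest₁.integrable hW.largest₁.le
      (fun v hv hv' => ht₁.eq_zero h hv (annSub_anti inf_le_left hv')) hP'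
  · exact exists_integralElement_lift h.smooth h.submersion (h₂.descends h)
      (hW.pfaffian₂.isSubbundleAt (mem_univ x)) (hW.largest₂.subbundle.isSubbundleAt (mem_univ x))
      hW.largest₂.integrable hW.largest₂.le
      (fun v hv hv' => ht₂.eq_zero h hv (annSub_anti inf_le_right hv')) hP'

end DarbouxPairs

section Splittings

open Filter Topology Module

variable {E : Type*} [NormedAddCommGroup E] [NormedSpace ℝ E] [FiniteDimensional ℝ E]
  {H : Type*} [TopologicalSpace H] {I : ModelWithCorners ℝ E H} [I.Boundaryless]
  {M : Type*} [TopologicalSpace M] [ChartedSpace H M] [IsManifold I ∞ M]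
  {E₁ : Type*} [NormedAddCommGroup E₁] [NormedSpace ℝ E₁] [FiniteDimensional ℝ E₁]
  {H₁ : Type*} [TopologicalSpace H₁] {I₁ : ModelWithCorners ℝ E₁ H₁} [I₁.Boundaryless]
  {M₁ : Type*} [TopologicalSpace M₁] [ChartedSpace H₁ M₁] [IsManifold I₁ ∞ M₁]
  {E₂ : Type*} [NormedAddCommGroup E₂] [NormedSpace ℝ E₂] [FiniteDimensional ℝ E₂]
  {H₂ : Type*} [TopologicalSpace H₂] {I₂ : ModelWithCorners ℝ E₂ H₂} [I₂.Boundaryless]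
  {M₂ : Type*} [TopologicalSpace M₂] [ChartedSpace H₂ M₂] [IsManifold I₂ ∞ M₂]

/-- `M` is, through `p₁` and `p₂`, the product of `M₁` and `M₂`. -/
structure IsSplitting (I : ModelWithCorners ℝ E H) (I₁ : ModelWithCorners ℝ E₁ H₁)
    (I₂ : ModelWithCorners ℝ E₂ H₂) (p₁ : M → M₁) (p₂ : M → M₂) : Prop where
  smooth₁ : ContMDiff I I₁ ∞ p₁
  smooth₂ : ContMDiff I I₂ ∞ p₂
  isOpenMap₁ : IsOpenMap p₁
  isOpenMap₂ : IsOpenMap p₂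
  eq_zero : ∀ (x : M) (v : TangentSpace I x), mfderiv I I₁ p₁ x v = 0 → mfderiv I I₂ p₂ x v = 0 → v = 0
  slice₁ : ∀ x, ∃ ι : M₁ → M, ContMDiff I₁ I ∞ ι ∧ ι (p₁ x) = x ∧ (∀ z, p₁ (ι z) = z) ∧
    ∀ z, p₂ (ι z) = p₂ x
  slice₂ : ∀ x, ∃ ι : M₂ → M, ContMDiff I₂ I ∞ ι ∧ ι (p₂ x) = x ∧ (∀ z, p₂ (ι z) = z) ∧
    ∀ z, p₁ (ι z) = p₁ x

/-- The sum of the pullbacks of two bundles. -/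
def sumBundle (I : ModelWithCorners ℝ E H) (I₁ : ModelWithCorners ℝ E₁ H₁)
    (I₂ : ModelWithCorners ℝ E₂ H₂) (p₁ : M → M₁) (p₂ : M → M₂) (A : CoField I₁ M₁) (B : CoField I₂ M₂) :
    CoField I M := fun x =>
  (A (p₁ x)).map (pullbackAt I I₁ p₁ 1 x) ⊔ (B (p₂ x)).map (pullbackAt I I₂ p₂ 1 x)

theorem sumBundle_symm (p₁ : M → M₁) (p₂ : M → M₂) (A : CoField I₁ M₁) (B : CoField I₂ M₂) :
    sumBundle I I₂ I₁ p₂ p₁ B A = sumBundle I I₁ I₂ p₁ p₂ A B := funext fun _ => sup_comm _ _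

theorem sumBundle_mono {p₁ : M → M₁} {p₂ : M → M₂} {A A' : CoField I₁ M₁} {B B' : CoField I₂ M₂}
    (hA : ∀ z, A z ≤ A' z) (hB : ∀ z, B z ≤ B' z) (x : M) :
    sumBundle I I₁ I₂ p₁ p₂ A B x ≤ sumBundle I I₁ I₂ p₁ p₂ A' B' x :=
  sup_le_sup (Submodule.map_mono (hA _)) (Submodule.map_mono (hB _))

theorem mem_sumBundle {p₁ : M → M₁} {p₂ : M → M₂} {A : CoField I₁ M₁} {B : CoField I₂ M₂} {x : M}
    {c : Covector (TangentSpace I x)} : c ∈ sumBundle I I₁ I₂ p₁ p₂ A B x ↔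
      ∃ a ∈ A (p₁ x), ∃ b ∈ B (p₂ x), pullbackAt I I₁ p₁ 1 x a + pullbackAt I I₂ p₂ 1 x b = c := by
  simp only [sumBundle, Submodule.mem_sup, Submodule.mem_map]
  constructor
  · rintro ⟨_, ⟨a, ha, rfl⟩, _, ⟨b, hb, rfl⟩, h⟩
    exact ⟨a, ha, b, hb, h⟩
  · rintro ⟨a, ha, b, hb, h⟩
    exact ⟨_, ⟨a, ha, rfl⟩, _, ⟨b, hb, rfl⟩, h⟩

theorem pullback_left_mem_sumBundle {p₁ : M → M₁} {p₂ : M → M₂} {A : CoField I₁ M₁} {B : CoField I₂ M₂}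
    {x : M} {a : Covector (TangentSpace I₁ (p₁ x))} (ha : a ∈ A (p₁ x)) :
    pullbackAt I I₁ p₁ 1 x a ∈ sumBundle I I₁ I₂ p₁ p₂ A B x :=
  Submodule.mem_sup_left ⟨a, ha, rfl⟩

theorem mem_annSub_sumBundle {p₁ : M → M₁} {p₂ : M → M₂} {A : CoField I₁ M₁} {B : CoField I₂ M₂} {x : M}
    {v : TangentSpace I x} : v ∈ annSub (sumBundle I I₁ I₂ p₁ p₂ A B x) ↔
      mfderiv I I₁ p₁ x v ∈ annSub (A (p₁ x)) ∧ mfderiv I I₂ p₂ x v ∈ annSub (B (p₂ x)) := by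
  rw [sumBundle, mem_annSub_sup]
  constructor
  · exact fun h => ⟨fun a ha => h.1 _ ⟨a, ha, rfl⟩, fun b hb => h.2 _ ⟨b, hb, rfl⟩⟩
  · rintro ⟨h1, h2⟩
    constructor
    · rintro _ ⟨a, ha, rfl⟩
      exact h1 a ha
    · rintro _ ⟨b, hb, rfl⟩
      exact h2 b hb

theorem eq_zero_of_mem_annSub_top {v : E} (h : v ∈ annSub (⊤ : Submodule ℝ (Covector E))) : v = 0 := by
  have h1 : v ∈ (⊥ : Submodule ℝ E) := mem_of_coann fun c _ => h c trivial
  exact (Submodule.mem_bot ℝ).1 h1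

theorem pullbackAt_comp {f : M → M₁} {g : M₁ → M₂} {x : M} (hg : MDifferentiableAt I₁ I₂ g (f x))
    (hf : MDifferentiableAt I I₁ f x) {k : ℕ} (c : (TangentSpace I₂ (g (f x))) [⋀^Fin k]→L[ℝ] ℝ) :
    pullbackAt I I₂ (fun y => g (f y)) k x c = pullbackAt I I₁ f k x (pullbackAt I₁ I₂ g k (f x) c) := by
  ext v
  have h := mfd_comp (I := I) (I' := I₁) (I'' := I₂) hg hf
  exact congrArg (fun L : E →L[ℝ] E₂ => (c : E₂ [⋀^Fin k]→L[ℝ] ℝ) fun i => L (v i)) h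

theorem cast_mem {A : CoField I M} {x y : M} (h : x = y) {a : Covector (TangentSpace I x)} (ha : a ∈ A x) :
    (h ▸ a : Covector (TangentSpace I y)) ∈ A y := by
  subst h; exact ha

theorem IsFrameAt.comp_equiv {κ κ' : Type*} (e : κ' ≃ κ) {W : CoField I M} {x : M} {θ : κ → DForm I M 1}
    (h : IsFrameAt I W x θ) : IsFrameAt I W x (fun i => θ (e i)) := by
  filter_upwards [h] with y hy
  refine ⟨fun i => hy.1 _, hy.2.1.comp _ e.injective, ?_⟩
  rw [← hy.2.2]
  exact congrArg _ (e.surjective.range_comp fun i => θ i y)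

theorem isSubbundleAt_bot (x : M) : IsSubbundleAt I (fun _ => ⊥) x :=
  ⟨0, fun i => i.elim0, Eventually.of_forall fun y => ⟨fun i => i.elim0, linearIndependent_empty_type,
    by rw [range_eq_empty, Submodule.span_empty]⟩⟩

namespace IsSplitting

variable {p₁ : M → M₁} {p₂ : M → M₂}

theorem symm (h : IsSplitting I I₁ I₂ p₁ p₂) : IsSplitting I I₂ I₁ p₂ p₁ where
  smooth₁ := h.smooth₂
  smooth₂ := h.smooth₁
  isOpenMap₁ := h.isOpenMap₂
  isOpenMap₂ := h.isOpenMap₁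
  eq_zero x v h1 h2 := h.eq_zero x v h2 h1
  slice₁ := h.slice₂
  slice₂ := h.slice₁

theorem mdifferentiableAt₁ (h : IsSplitting I I₁ I₂ p₁ p₂) (x : M) : MDifferentiableAt I I₁ p₁ x :=
  (h.smooth₁ x).mdifferentiableAt (by simp)

theorem mdifferentiableAt₂ (h : IsSplitting I I₁ I₂ p₁ p₂) (x : M) : MDifferentiableAt I I₂ p₂ x :=
  (h.smooth₂ x).mdifferentiableAt (by simp)

theorem mfd_slice (h : IsSplitting I I₁ I₂ p₁ p₂) {ι : M₁ → M} (hι : ContMDiff I₁ I ∞ ι) {x : M}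
    (h1 : ∀ z, p₁ (ι z) = z) (h2 : ∀ z, p₂ (ι z) = p₂ x) (z : M₁) (u : E₁) :
    mfd I I₁ p₁ (ι z) (mfd I₁ I ι z u) = u ∧ mfd I I₂ p₂ (ι z) (mfd I₁ I ι z u) = 0 := by
  have hι' := (hι z).mdifferentiableAt (n := ∞) (by simp)
  have h3 := mfd_comp (I := I₁) (I' := I) (I'' := I₁) (h.mdifferentiableAt₁ (ι z)) hι'
  have h4 := mfd_comp (I := I₁) (I' := I) (I'' := I₂) (h.mdifferentiableAt₂ (ι z)) hι'
  rw [show (fun z => p₁ (ι z)) = fun z => z from funext h1, mfd_id] at h3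
  have h5 : mfd I₁ I₂ (fun z => p₂ (ι z)) z = 0 := by
    rw [show (fun z => p₂ (ι z)) = fun _ => p₂ x from funext h2]
    exact mfderiv_const
  rw [h4] at h5
  exact ⟨(congrArg (fun L => L u) h3).symm, congrArg (fun L => L u) h5⟩

theorem exists_vec₁ (h : IsSplitting I I₁ I₂ p₁ p₂) (x : M) (u : TangentSpace I₁ (p₁ x)) :
    ∃ v : TangentSpace I x, mfderiv I I₁ p₁ x v = u ∧ mfderiv I I₂ p₂ x v = 0 := by
  obtain ⟨ι, hι, hx, h1, h2⟩ := h.slice₁ x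
  have h3 := h.mfd_slice hι h1 h2 (p₁ x) u
  rw [hx] at h3
  exact ⟨_, h3⟩

theorem exists_vec₂ (h : IsSplitting I I₁ I₂ p₁ p₂) (x : M) (u : TangentSpace I₂ (p₂ x)) :
    ∃ v : TangentSpace I x, mfderiv I I₁ p₁ x v = 0 ∧ mfderiv I I₂ p₂ x v = u := by
  obtain ⟨v, h1, h2⟩ := h.symm.exists_vec₁ x u
  exact ⟨v, h2, h1⟩

theorem pullback_add_eq_zero (h : IsSplitting I I₁ I₂ p₁ p₂) {x : M} {a : Covector (TangentSpace I₁ (p₁ x))}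
    {b : Covector (TangentSpace I₂ (p₂ x))}
    (hab : pullbackAt I I₁ p₁ 1 x a + pullbackAt I I₂ p₂ 1 x b = 0) : a = 0 ∧ b = 0 := by
  have key : ∀ v : TangentSpace I x,
      a (fun _ => mfderiv I I₁ p₁ x v) + b (fun _ => mfderiv I I₂ p₂ x v) = 0 := fun v =>
    congrArg (fun c : Covector (TangentSpace I x) => c fun _ => v) hab
  constructor
  · refine Covector.ext' fun u => ?_
    obtain ⟨v, h1, h2⟩ := h.exists_vec₁ x u
    have := key v
    rw [h1, h2, Covector.map_zero, add_zero] at this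
    exact this
  · refine Covector.ext' fun u => ?_
    obtain ⟨v, h1, h2⟩ := h.exists_vec₂ x u
    have := key v
    rw [h1, h2, Covector.map_zero, zero_add] at this
    exact this

theorem pullback_add_eq (h : IsSplitting I I₁ I₂ p₁ p₂) {x : M} {a a' : Covector (TangentSpace I₁ (p₁ x))}
    {b b' : Covector (TangentSpace I₂ (p₂ x))}
    (hab : pullbackAt I I₁ p₁ 1 x a + pullbackAt I I₂ p₂ 1 x b =
      pullbackAt I I₁ p₁ 1 x a' + pullbackAt I I₂ p₂ 1 x b') : a = a' ∧ b = b' := by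
  have h1 : pullbackAt I I₁ p₁ 1 x (a - a') + pullbackAt I I₂ p₂ 1 x (b - b') = 0 := by
    rw [map_sub, map_sub, sub_add_sub_comm, hab, sub_self]
  have h2 := h.pullback_add_eq_zero h1
  exact ⟨sub_eq_zero.1 h2.1, sub_eq_zero.1 h2.2⟩

theorem sumBundle_top (h : IsSplitting I I₁ I₂ p₁ p₂) (x : M) :
    sumBundle I I₁ I₂ p₁ p₂ (fun _ => ⊤) (fun _ => ⊤) x = ⊤ := by
  rw [eq_top_iff]
  intro c _
  refine mem_of_annSub (E := E) fun v hv => ?_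
  obtain ⟨h1, h2⟩ := mem_annSub_sumBundle.1 hv
  have h3 : v = 0 := h.eq_zero x v (eq_zero_of_mem_annSub_top (E := E₁) h1)
    (eq_zero_of_mem_annSub_top (E := E₂) h2)
  rw [h3]
  exact Covector.map_zero _

theorem pullback_slice_mem (h : IsSplitting I I₁ I₂ p₁ p₂) {ι : M₁ → M} (hι : ContMDiff I₁ I ∞ ι) {x : M}
    (h1 : ∀ z, p₁ (ι z) = z) (h2 : ∀ z, p₂ (ι z) = p₂ x) {A : CoField I₁ M₁} {B : CoField I₂ M₂} {z : M₁}
    {c : Covector (TangentSpace I (ι z))} (hc : c ∈ sumBundle I I₁ I₂ p₁ p₂ A B (ι z)) :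
    pullbackAt I₁ I ι 1 z c ∈ A z := by
  obtain ⟨a, ha, b, hb, rfl⟩ := mem_sumBundle.1 hc
  have h3 : pullbackAt I₁ I ι 1 z (pullbackAt I I₁ p₁ 1 (ι z) a + pullbackAt I I₂ p₂ 1 (ι z) b) =
      (h1 z ▸ a : Covector (TangentSpace I₁ z)) := by
    refine Covector.ext' fun v => ?_
    obtain ⟨h4, h5⟩ := h.mfd_slice hι h1 h2 z v
    refine Eq.trans ?_ (cast_covector_apply (I' := I₁) (h1 z) a v).symm
    change (a : Covector E₁) (fun _ => mfd I I₁ p₁ (ι z) (mfd I₁ I ι z v)) +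
      (b : Covector E₂) (fun _ => mfd I I₂ p₂ (ι z) (mfd I₁ I ι z v)) = _
    rw [h4, h5]
    exact (congrArg (_ + ·) (Covector.map_zero (V := E₂) b)).trans (add_zero _)
  rw [h3]
  exact cast_mem (h1 z) ha

theorem isFrameAt_sumBundle (h : IsSplitting I I₁ I₂ p₁ p₂) {κ₁ κ₂ : Type*} {A : CoField I₁ M₁}
    {B : CoField I₂ M₂} {x : M} {θ₁ : κ₁ → DForm I₁ M₁ 1} {θ₂ : κ₂ → DForm I₂ M₂ 1}
    (hA : IsFrameAt I₁ A (p₁ x) θ₁) (hB : IsFrameAt I₂ B (p₂ x) θ₂) :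
    IsFrameAt I (sumBundle I I₁ I₂ p₁ p₂ A B) x
      (Sum.elim (fun i => pullback I I₁ p₁ (θ₁ i)) (fun j => pullback I I₂ p₂ (θ₂ j))) := by
  filter_upwards [h.smooth₁.continuous.continuousAt.eventually hA,
    h.smooth₂.continuous.continuousAt.eventually hB] with y hy1 hy2
  have e1 : range (fun i => pullback I I₁ p₁ (θ₁ i) y) =
      (pullbackAt I I₁ p₁ 1 y) '' (range fun i => θ₁ i (p₁ y)) := by
    rw [← range_comp]; rfl
  have e2 : range (fun i => pullback I I₂ p₂ (θ₂ i) y) =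
      (pullbackAt I I₂ p₂ 1 y) '' (range fun i => θ₂ i (p₂ y)) := by
    rw [← range_comp]; rfl
  have e3 : (fun i => Sum.elim (fun i => pullback I I₁ p₁ (θ₁ i)) (fun j => pullback I I₂ p₂ (θ₂ j)) i y) =
      Sum.elim (fun i => pullback I I₁ p₁ (θ₁ i) y) (fun j => pullback I I₂ p₂ (θ₂ j) y) := by
    funext i
    cases i <;> rfl
  refine ⟨?_, ?_, ?_⟩
  · rintro (i | j)
    · exact (hy1.1 i).pullback (h.smooth₁ y)
    · exact (hy2.1 j).pullback (h.smooth₂ y)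
  · rw [e3]
    refine LinearIndependent.sum_type ?_ ?_ ?_
    · refine hy1.2.1.map' (pullbackAt I I₁ p₁ 1 y) (LinearMap.ker_eq_bot'.2 fun a ha => ?_)
      exact (h.pullback_add_eq_zero (a := a) (b := 0) (by rw [ha, map_zero, add_zero])).1
    · refine hy2.2.1.map' (pullbackAt I I₂ p₂ 1 y) (LinearMap.ker_eq_bot'.2 fun b hb => ?_)
      exact (h.pullback_add_eq_zero (a := 0) (b := b) (by rw [hb, map_zero, add_zero])).2
    · rw [e1, e2, Submodule.span_image, Submodule.span_image, Submodule.disjoint_def]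
      rintro _ ⟨a, ha, rfl⟩ ⟨b, hb, hab⟩
      have h0 := (h.pullback_add_eq_zero (a := a) (b := -b) (by rw [map_neg, ← hab, add_neg_cancel])).1
      rw [h0, map_zero]
  · rw [e3, Sum.elim_range, Submodule.span_union, e1, e2, Submodule.span_image, Submodule.span_image,
      hy1.2.2, hy2.2.2]
    rfl

theorem isSubbundleAt_sumBundle (h : IsSplitting I I₁ I₂ p₁ p₂) {A : CoField I₁ M₁}
    {B : CoField I₂ M₂} {x : M} (hA : IsSubbundleAt I₁ A (p₁ x)) (hB : IsSubbundleAt I₂ B (p₂ x)) :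
    IsSubbundleAt I (sumBundle I I₁ I₂ p₁ p₂ A B) x := by
  obtain ⟨r, θ₁, h1⟩ := hA
  obtain ⟨s, θ₂, h2⟩ := hB
  refine ⟨r + s, _, IsFrameAt.comp_equiv finSumFinEquiv.symm (h.isFrameAt_sumBundle h1 h2)⟩

theorem finrank_sumBundle (h : IsSplitting I I₁ I₂ p₁ p₂) {A : CoField I₁ M₁}
    {B : CoField I₂ M₂} {x : M} (hA : IsSubbundleAt I₁ A (p₁ x)) (hB : IsSubbundleAt I₂ B (p₂ x)) :
    finrank ℝ (sumBundle I I₁ I₂ p₁ p₂ A B x) = finrank ℝ (A (p₁ x)) + finrank ℝ (B (p₂ x)) := by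
  obtain ⟨r, θ₁, h1⟩ := hA
  obtain ⟨s, θ₂, h2⟩ := hB
  rw [h1.finrank_eq.self_of_nhds, h2.finrank_eq.self_of_nhds,
    (h.isFrameAt_sumBundle h1 h2).finrank_eq.self_of_nhds, Fintype.card_sum]

end IsSplitting

end Splittings

section SplitQuotients

open Filter Topology Module

variable {E : Type*} [NormedAddCommGroup E] [NormedSpace ℝ E] [FiniteDimensional ℝ E]
  {H : Type*} [TopologicalSpace H] {I : ModelWithCorners ℝ E H} [I.Boundaryless]
  {M : Type*} [TopologicalSpace M] [ChartedSpace H M] [IsManifold I ∞ M]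
  {E₁ : Type*} [NormedAddCommGroup E₁] [NormedSpace ℝ E₁] [FiniteDimensional ℝ E₁]
  {H₁ : Type*} [TopologicalSpace H₁] {I₁ : ModelWithCorners ℝ E₁ H₁} [I₁.Boundaryless]
  {M₁ : Type*} [TopologicalSpace M₁] [ChartedSpace H₁ M₁] [IsManifold I₁ ∞ M₁]
  {E₂ : Type*} [NormedAddCommGroup E₂] [NormedSpace ℝ E₂] [FiniteDimensional ℝ E₂]
  {H₂ : Type*} [TopologicalSpace H₂] {I₂ : ModelWithCorners ℝ E₂ H₂} [I₂.Boundaryless]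
  {M₂ : Type*} [TopologicalSpace M₂] [ChartedSpace H₂ M₂] [IsManifold I₂ ∞ M₂]
  {E' : Type*} [NormedAddCommGroup E'] [NormedSpace ℝ E'] [FiniteDimensional ℝ E']
  {H' : Type*} [TopologicalSpace H'] {I' : ModelWithCorners ℝ E' H'} [I'.Boundaryless]
  {N : Type*} [TopologicalSpace N] [ChartedSpace H' N] [IsManifold I' ∞ N]

/-- The quotient of the sum of two bundles. -/
abbrev quotientSum (I : ModelWithCorners ℝ E H) (I₁ : ModelWithCorners ℝ E₁ H₁)
    (I₂ : ModelWithCorners ℝ E₂ H₂) (I' : ModelWithCorners ℝ E' H') (p₁ : M → M₁) (p₂ : M → M₂)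
    (q : M → N) (A : CoField I₁ M₁) (B : CoField I₂ M₂) : CoField I' N :=
  quotientBundle I I' q (sumBundle I I₁ I₂ p₁ p₂ A B)

theorem quotientSum_symm (p₁ : M → M₁) (p₂ : M → M₂) (q : M → N) (A : CoField I₁ M₁) (B : CoField I₂ M₂) :
    quotientSum I I₂ I₁ I' p₂ p₁ q B A = quotientSum I I₁ I₂ I' p₁ p₂ q A B := by
  rw [quotientSum, quotientSum, sumBundle_symm]

/-- A submersion `q` of the product of `M₁` and `M₂` whose fibres are transverse to the Pfaffian systems
`W₁` and `W₂`, and along which the sums of these systems are invariant. -/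
structure IsSplitQuotient (I : ModelWithCorners ℝ E H) (I₁ : ModelWithCorners ℝ E₁ H₁)
    (I₂ : ModelWithCorners ℝ E₂ H₂) (I' : ModelWithCorners ℝ E' H') (p₁ : M → M₁) (p₂ : M → M₂)
    (q : M → N) (W₁ : CoField I₁ M₁) (W₂ : CoField I₂ M₂) : Prop where
  split : IsSplitting I I₁ I₂ p₁ p₂
  smooth : ContMDiff I I' ∞ q
  submersion : ∀ x, Function.Surjective (mfderiv I I' q x)
  surjective : Function.Surjective q
  pfaffian₁ : IsPfaffian I₁ W₁
  pfaffian₂ : IsPfaffian I₂ W₂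
  ne_bot₁ : ∀ z, W₁ z ≠ ⊥
  ne_bot₂ : ∀ z, W₂ z ≠ ⊥
  largest₁ : IsLargestIntegrable I₁ W₁ (fun _ => ⊥)
  largest₂ : IsLargestIntegrable I₂ W₂ (fun _ => ⊥)
  descends : Descends I I' q (sumBundle I I₁ I₂ p₁ p₂ W₁ W₂)
  descends_top₁ : Descends I I' q (sumBundle I I₁ I₂ p₁ p₂ (fun _ => ⊤) W₂)
  descends_top₂ : Descends I I' q (sumBundle I I₁ I₂ p₁ p₂ W₁ (fun _ => ⊤))
  descends₁ : Descends I I' q (sumBundle I I₁ I₂ p₁ p₂ (fun _ => ⊤) (fun _ => ⊥))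
  descends₂ : Descends I I' q (sumBundle I I₁ I₂ p₁ p₂ (fun _ => ⊥) (fun _ => ⊤))
  transverse₁ : ∀ (x : M) (v : TangentSpace I x), mfderiv I I' q x v = 0 →
    mfderiv I I₁ p₁ x v ∈ annSub (W₁ (p₁ x)) → v = 0
  transverse₂ : ∀ (x : M) (v : TangentSpace I x), mfderiv I I' q x v = 0 →
    mfderiv I I₂ p₂ x v ∈ annSub (W₂ (p₂ x)) → v = 0

namespace IsSplitQuotient

variable {p₁ : M → M₁} {p₂ : M → M₂} {q : M → N} {W₁ : CoField I₁ M₁} {W₂ : CoField I₂ M₂}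

theorem symm (h : IsSplitQuotient I I₁ I₂ I' p₁ p₂ q W₁ W₂) :
    IsSplitQuotient I I₂ I₁ I' p₂ p₁ q W₂ W₁ where
  split := h.split.symm
  smooth := h.smooth
  submersion := h.submersion
  surjective := h.surjective
  pfaffian₁ := h.pfaffian₂
  pfaffian₂ := h.pfaffian₁
  ne_bot₁ := h.ne_bot₂
  ne_bot₂ := h.ne_bot₁
  largest₁ := h.largest₂
  largest₂ := h.largest₁
  descends := by rw [sumBundle_symm]; exact h.descends
  descends_top₁ := by rw [sumBundle_symm]; exact h.descends_top₂
  descends_top₂ := by rw [sumBundle_symm]; exact h.descends_top₁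
  descends₁ := by rw [sumBundle_symm]; exact h.descends₂
  descends₂ := by rw [sumBundle_symm]; exact h.descends₁
  transverse₁ := h.transverse₂
  transverse₂ := h.transverse₁

theorem eq_zero_of_le₁ (h : IsSplitQuotient I I₁ I₂ I' p₁ p₂ q W₁ W₂) {A : CoField I₁ M₁}
    {B : CoField I₂ M₂} (hA : ∀ z, W₁ z ≤ A z) (x : M) (v : TangentSpace I x)
    (hv : mfderiv I I' q x v = 0) (hv' : v ∈ annSub (sumBundle I I₁ I₂ p₁ p₂ A B x)) : v = 0 :=
  h.transverse₁ x v hv (annSub_anti (hA _) (mem_annSub_sumBundle.1 hv').1)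

theorem eq_zero_of_le₂ (h : IsSplitQuotient I I₁ I₂ I' p₁ p₂ q W₁ W₂) {A : CoField I₁ M₁}
    {B : CoField I₂ M₂} (hB : ∀ z, W₂ z ≤ B z) (x : M) (v : TangentSpace I x)
    (hv : mfderiv I I' q x v = 0) (hv' : v ∈ annSub (sumBundle I I₁ I₂ p₁ p₂ A B x)) : v = 0 :=
  h.transverse₂ x v hv (annSub_anti (hB _) (mem_annSub_sumBundle.1 hv').2)

theorem isSubbundleOn_quotientSum (h : IsSplitQuotient I I₁ I₂ I' p₁ p₂ q W₁ W₂) {A : CoField I₁ M₁}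
    {B : CoField I₂ M₂} (hA : ∀ z, IsSubbundleAt I₁ A z) {r : ℕ} (hr : ∀ z, finrank ℝ (A z) = r)
    (hB : ∀ z, IsSubbundleAt I₂ B z) {s : ℕ} (hs : ∀ z, finrank ℝ (B z) = s)
    (hD : Descends I I' q (sumBundle I I₁ I₂ p₁ p₂ A B))
    (hK : ∀ (x : M) (v : TangentSpace I x), mfderiv I I' q x v = 0 →
      v ∈ annSub (sumBundle I I₁ I₂ p₁ p₂ A B x) → v = 0) :
    IsSubbundleOn I' univ (quotientSum I I₁ I₂ I' p₁ p₂ q A B) := by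
  refine isSubbundleOn_quotientBundle h.smooth h.submersion h.surjective hD (r := r + s) ?_ ?_ hK
  · intro x
    rw [h.split.finrank_sumBundle (hA _) (hB _), hr, hs]
  · exact fun x => h.split.isSubbundleAt_sumBundle (hA _) (hB _)

theorem isSubbundleAt₁ (h : IsSplitQuotient I I₁ I₂ I' p₁ p₂ q W₁ W₂) (z : M₁) : IsSubbundleAt I₁ W₁ z :=
  h.pfaffian₁.isSubbundleAt (mem_univ z)

theorem isSubbundleAt₂ (h : IsSplitQuotient I I₁ I₂ I' p₁ p₂ q W₁ W₂) (z : M₂) : IsSubbundleAt I₂ W₂ z :=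
  h.pfaffian₂.isSubbundleAt (mem_univ z)

theorem finrank_top (z : M₁) : finrank ℝ (⊤ : Submodule ℝ (Covector (TangentSpace I₁ z))) =
    finrank ℝ (⊤ : Submodule ℝ (Covector E₁)) := rfl

theorem finrank_bot (z : M₁) : finrank ℝ (⊥ : Submodule ℝ (Covector (TangentSpace I₁ z))) =
    finrank ℝ (⊥ : Submodule ℝ (Covector E₁)) := rfl

theorem isPfaffian (h : IsSplitQuotient I I₁ I₂ I' p₁ p₂ q W₁ W₂) :
    IsPfaffian I' (quotientSum I I₁ I₂ I' p₁ p₂ q W₁ W₂) := by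
  obtain ⟨r, hr⟩ := h.pfaffian₁.exists_finrank
  obtain ⟨s, hs⟩ := h.pfaffian₂.exists_finrank
  exact h.isSubbundleOn_quotientSum h.isSubbundleAt₁ (fun z => hr z (mem_univ z)) h.isSubbundleAt₂
    (fun z => hs z (mem_univ z)) h.descends (h.eq_zero_of_le₁ fun _ => le_rfl)

theorem isPfaffian_top₂ (h : IsSplitQuotient I I₁ I₂ I' p₁ p₂ q W₁ W₂) :
    IsPfaffian I' (quotientSum I I₁ I₂ I' p₁ p₂ q W₁ (fun _ => ⊤)) := by
  obtain ⟨r, hr⟩ := h.pfaffian₁.exists_finrank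
  exact h.isSubbundleOn_quotientSum h.isSubbundleAt₁ (fun z => hr z (mem_univ z)) isSubbundleAt_top
    finrank_top h.descends_top₂ (h.eq_zero_of_le₁ fun _ => le_rfl)

theorem isPfaffian₂ (h : IsSplitQuotient I I₁ I₂ I' p₁ p₂ q W₁ W₂) :
    IsPfaffian I' (quotientSum I I₁ I₂ I' p₁ p₂ q (fun _ => ⊥) (fun _ => ⊤)) :=
  h.isSubbundleOn_quotientSum isSubbundleAt_bot finrank_bot isSubbundleAt_top
    finrank_top h.descends₂ (h.eq_zero_of_le₂ fun _ => le_top)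

/-- The sums of covectors that vanish on vectors with the same image under `q`. -/
theorem sup_eq_of_annSub {A₁ B₁ C₁ : CoField I₁ M₁} {A₂ B₂ C₂ : CoField I₂ M₂} {x : M}
    (hA : Descends I I' q (sumBundle I I₁ I₂ p₁ p₂ A₁ A₂))
    (hB : Descends I I' q (sumBundle I I₁ I₂ p₁ p₂ B₁ B₂))
    (hAC : ∀ x, sumBundle I I₁ I₂ p₁ p₂ A₁ A₂ x ≤ sumBundle I I₁ I₂ p₁ p₂ C₁ C₂ x)
    (hBC : ∀ x, sumBundle I I₁ I₂ p₁ p₂ B₁ B₂ x ≤ sumBundle I I₁ I₂ p₁ p₂ C₁ C₂ x)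
    (h : ∀ u ∈ annSub (sumBundle I I₁ I₂ p₁ p₂ A₁ A₂ x), ∀ v ∈ annSub (sumBundle I I₁ I₂ p₁ p₂ B₁ B₂ x),
      mfderiv I I' q x u = mfderiv I I' q x v → u ∈ annSub (sumBundle I I₁ I₂ p₁ p₂ C₁ C₂ x)) :
    quotientSum I I₁ I₂ I' p₁ p₂ q A₁ A₂ (q x) ⊔ quotientSum I I₁ I₂ I' p₁ p₂ q B₁ B₂ (q x) =
      quotientSum I I₁ I₂ I' p₁ p₂ q C₁ C₂ (q x) := by
  apply le_antisymm
  · exact sup_le (fun c hc x hx => hAC x (hc x hx)) (fun c hc x hx => hBC x (hc x hx))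
  · intro c hc
    refine mem_of_annSub (E := E') fun w hw => ?_
    have hw' := mem_annSub_sup.1 hw
    obtain ⟨u, hu, huw⟩ := exists_mem_annSub_of_quotientBundle hA hw'.1
    obtain ⟨v, hv, hvw⟩ := exists_mem_annSub_of_quotientBundle hB hw'.2
    have h1 := hc x rfl
    rw [← huw]
    exact h u hu v hv (huw.trans hvw.symm) _ h1

theorem mfderiv_sub_eq_zero {f : M → N} {x : M} {u v : TangentSpace I x}
    (h : mfderiv I I' f x u = mfderiv I I' f x v) : mfderiv I I' f x (u - v) = 0 := by
  rw [map_sub, h, sub_self]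

theorem sup_eq_top₂ (h : IsSplitQuotient I I₁ I₂ I' p₁ p₂ q W₁ W₂) (y : N) :
    quotientSum I I₁ I₂ I' p₁ p₂ q W₁ W₂ y ⊔
      quotientSum I I₁ I₂ I' p₁ p₂ q (fun _ => ⊥) (fun _ => ⊤) y =
      quotientSum I I₁ I₂ I' p₁ p₂ q W₁ (fun _ => ⊤) y := by
  obtain ⟨x, rfl⟩ := h.surjective y
  refine sup_eq_of_annSub h.descends h.descends₂
    (sumBundle_mono (fun _ => le_rfl) fun _ => le_top)
    (sumBundle_mono (fun _ => bot_le) fun _ => le_rfl) fun u hu v hv huv => ?_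
  rw [mem_annSub_sumBundle] at hu hv
  have h1 := h.transverse₂ x (u - v) (mfderiv_sub_eq_zero huv) (by
    rw [map_sub]
    exact Submodule.sub_mem _ hu.2 (annSub_anti le_top hv.2))
  rw [sub_eq_zero.1 h1, mem_annSub_sumBundle]
  rw [sub_eq_zero.1 h1] at hu
  exact ⟨hu.1, hv.2⟩

theorem sup_eq_top (h : IsSplitQuotient I I₁ I₂ I' p₁ p₂ q W₁ W₂) (y : N) :
    quotientSum I I₁ I₂ I' p₁ p₂ q W₁ (fun _ => ⊤) y ⊔
      quotientSum I I₁ I₂ I' p₁ p₂ q (fun _ => ⊤) (fun _ => ⊥) y = ⊤ := by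
  obtain ⟨x, rfl⟩ := h.surjective y
  have h0 : quotientSum I I₁ I₂ I' p₁ p₂ q (fun _ => ⊤) (fun _ => ⊤) (q x) = ⊤ := by
    rw [eq_top_iff]
    intro c _ x' hx'
    rw [h.split.sumBundle_top]
    trivial
  rw [← h0]
  refine sup_eq_of_annSub h.descends_top₂ h.descends₁
    (sumBundle_mono (fun _ => le_top) fun _ => le_rfl)
    (sumBundle_mono (fun _ => le_rfl) fun _ => bot_le) fun u hu v hv huv => ?_
  rw [mem_annSub_sumBundle] at hu hv
  have h1 := h.transverse₁ x (u - v) (mfderiv_sub_eq_zero huv) (by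
    rw [map_sub]
    exact Submodule.sub_mem _ hu.1 (annSub_anti le_top hv.1))
  rw [mem_annSub_sumBundle]
  refine ⟨?_, hu.2⟩
  rw [sub_eq_zero.1 h1]
  exact hv.1

theorem inf_eq_bot (h : IsSplitQuotient I I₁ I₂ I' p₁ p₂ q W₁ W₂) (y : N) :
    quotientSum I I₁ I₂ I' p₁ p₂ q (fun _ => ⊥) (fun _ => ⊤) y ⊓
      quotientSum I I₁ I₂ I' p₁ p₂ q (fun _ => ⊤) (fun _ => ⊥) y = ⊥ := by
  obtain ⟨x, rfl⟩ := h.surjective y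
  rw [eq_bot_iff]
  rintro c ⟨h1, h2⟩
  obtain ⟨a, ha, b, hb, hab⟩ := mem_sumBundle.1 (h1 x rfl)
  obtain ⟨a', ha', b', hb', hab'⟩ := mem_sumBundle.1 (h2 x rfl)
  obtain ⟨h3, h4⟩ := h.split.pullback_add_eq (hab.trans hab'.symm)
  rw [(Submodule.mem_bot ℝ).1 ha, h4, (Submodule.mem_bot ℝ).1 hb', map_zero, map_zero, add_zero] at hab
  exact (Submodule.mem_bot ℝ).2 (pullbackAt_injective (h.submersion x) (hab.symm.trans (map_zero _).symm))

theorem inf_eq (h : IsSplitQuotient I I₁ I₂ I' p₁ p₂ q W₁ W₂) (y : N) :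
    quotientSum I I₁ I₂ I' p₁ p₂ q W₁ (fun _ => ⊤) y ⊓
      quotientSum I I₁ I₂ I' p₁ p₂ q (fun _ => ⊤) W₂ y = quotientSum I I₁ I₂ I' p₁ p₂ q W₁ W₂ y := by
  apply le_antisymm
  · rintro c ⟨h1, h2⟩ x hx
    obtain ⟨a, ha, b, hb, hab⟩ := mem_sumBundle.1 (h1 x hx)
    obtain ⟨a', ha', b', hb', hab'⟩ := mem_sumBundle.1 (h2 x hx)
    obtain ⟨h3, h4⟩ := h.split.pullback_add_eq (hab.trans hab'.symm)
    exact mem_sumBundle.2 ⟨a, ha, b, h4 ▸ hb', hab⟩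
  · exact le_inf (fun c hc x hx => sumBundle_mono (fun _ => le_rfl) (fun _ => le_top) x (hc x hx))
      (fun c hc x hx => sumBundle_mono (fun _ => le_top) (fun _ => le_rfl) x (hc x hx))

/-- The covectors in `W₁` are the components of the covectors in the quotient bundle. -/
theorem exists_covector (h : IsSplitQuotient I I₁ I₂ I' p₁ p₂ q W₁ W₂) (x : M)
    {a : Covector (TangentSpace I₁ (p₁ x))} (ha : a ∈ W₁ (p₁ x)) :
    ∃ c ∈ quotientSum I I₁ I₂ I' p₁ p₂ q W₁ W₂ (q x), ∃ b ∈ W₂ (p₂ x),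
      pullbackAt I I' q 1 x c = pullbackAt I I₁ p₁ 1 x a + pullbackAt I I₂ p₂ 1 x b := by
  have h1 : sumBundle I I₁ I₂ p₁ p₂ (fun _ => ⊥) W₂ x ⊔
      coann (LinearMap.ker (mfderiv I I' q x).toLinearMap) = ⊤ :=
    sup_coann_eq_top (E := E) fun v hv hv' => h.eq_zero_of_le₂ (fun _ => le_rfl) x v hv hv'
  obtain ⟨s, hs, c', hc', hsc⟩ := Submodule.mem_sup.1
    (h1.symm ▸ Submodule.mem_top : pullbackAt I I₁ p₁ 1 x a ∈ sumBundle I I₁ I₂ p₁ p₂ (fun _ => ⊥) W₂ x ⊔ _)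
  have h3 : c' ∈ LinearMap.range (pullbackAt I I' q 1 x) := by
    have := Covector.range_comapL (E := E) (E' := E') (L := mfd I I' q x) (h.submersion x)
    exact this.symm ▸ hc'
  obtain ⟨c, rfl⟩ := h3
  obtain ⟨a', ha', b, hb, rfl⟩ := mem_sumBundle.1 hs
  rw [(Submodule.mem_bot ℝ).1 ha', map_zero, zero_add] at hsc
  have h4 : pullbackAt I I' q 1 x c = pullbackAt I I₁ p₁ 1 x a + pullbackAt I I₂ p₂ 1 x (-b) := by
    rw [map_neg, ← hsc]
    abel
  refine ⟨c, ?_, -b, Submodule.neg_mem _ hb, h4⟩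
  rw [mem_quotientBundle h.descends, h4]
  exact mem_sumBundle.2 ⟨a, ha, -b, Submodule.neg_mem _ hb, rfl⟩

/-- The curvature of a section of the quotient bundle is the sum of the curvatures of its components. -/
theorem bil_extd_eq_add (h : IsSplitQuotient I I₁ I₂ I' p₁ p₂ q W₁ W₂) {x : M} {η : DForm I' N 1}
    (hη : IsSectionAt I' (quotientSum I I₁ I₂ I' p₁ p₂ q W₁ W₂) (q x) η)
    {θ₁ : DForm I₁ M₁ 1} (h₁ : IsSectionAt I₁ W₁ (p₁ x) θ₁)
    {θ₂ : DForm I₂ M₂ 1} (h₂ : IsSectionAt I₂ W₂ (p₂ x) θ₂)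
    (heq : pullback I I' q η x = pullback I I₁ p₁ θ₁ x + pullback I I₂ p₂ θ₂ x) {u v : TangentSpace I x}
    (hu : u ∈ annSub (sumBundle I I₁ I₂ p₁ p₂ W₁ W₂ x))
    (hv : v ∈ annSub (sumBundle I I₁ I₂ p₁ p₂ W₁ W₂ x)) :
    bil (extd I' η (q x)) (mfderiv I I' q x u) (mfderiv I I' q x v) =
      bil (extd I₁ θ₁ (p₁ x)) (mfderiv I I₁ p₁ x u) (mfderiv I I₁ p₁ x v) +
      bil (extd I₂ θ₂ (p₂ x)) (mfderiv I I₂ p₂ x u) (mfderiv I I₂ p₂ x v) := by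
  have hqη : IsSectionAt I (sumBundle I I₁ I₂ p₁ p₂ W₁ W₂) x (pullback I I' q η) := by
    filter_upwards [h.smooth.continuous.continuousAt.eventually hη] with y hy
    exact ⟨hy.1.pullback (h.smooth y), hy.2 y rfl⟩
  have hsum : IsSectionAt I (sumBundle I I₁ I₂ p₁ p₂ W₁ W₂) x
      (pullback I I₁ p₁ θ₁ + pullback I I₂ p₂ θ₂) := by
    filter_upwards [h.split.smooth₁.continuous.continuousAt.eventually h₁,
      h.split.smooth₂.continuous.continuousAt.eventually h₂] with y hy1 hy2
    exact ⟨(hy1.1.pullback (h.split.smooth₁ y)).add (hy2.1.pullback (h.split.smooth₂ y)),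
      mem_sumBundle.2 ⟨_, hy1.2, _, hy2.2, rfl⟩⟩
  have hW := h.split.isSubbundleAt_sumBundle (h.isSubbundleAt₁ (p₁ x)) (h.isSubbundleAt₂ (p₂ x))
  have h3 := bil_extd_eq_of_eq hW hqη hsum heq hu hv
  rw [extd_pullback hη.smoothAt (h.smooth x), extd_add (h₁.smoothAt.pullback (h.split.smooth₁ x))
    (h₂.smoothAt.pullback (h.split.smooth₂ x)), extd_pullback h₁.smoothAt (h.split.smooth₁ x),
    extd_pullback h₂.smoothAt (h.split.smooth₂ x)] at h3
  refine (bil_pullback q (extd I' η) x u v).symm.trans (h3.trans ?_)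
  exact (bil_add_left _ _ _ _).trans (congrArg₂ (· + ·) (bil_pullback p₁ (extd I₁ θ₁) x u v)
    (bil_pullback p₂ (extd I₂ θ₂) x u v))

end IsSplitQuotient

end SplitQuotients

section Lambda2

open Module

variable {E : Type*} [NormedAddCommGroup E] [NormedSpace ℝ E] [FiniteDimensional ℝ E]

theorem project_eq_self {ι : Type*} [Fintype ι] [DecidableEq ι] {θ : ι → Covector E} {e : ι → E}
    (h : ∀ i j, θ i (fun _ => e j) = if i = j then 1 else 0)
    (ht : Submodule.span ℝ (range θ) = ⊤) (ρ : E [⋀^Fin 2]→L[ℝ] ℝ) : project ρ θ e = ρ := by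
  refine bil_ext fun u v => ?_
  rw [bil_project, ← eq_sum_of_coframe h ht u, ← eq_sum_of_coframe h ht v]

theorem mem_Lambda2_sup {A B : Submodule ℝ (Covector E)} (hAB : A ⊔ B = ⊤) {ρ : E [⋀^Fin 2]→L[ℝ] ℝ}
    (h : ∀ u ∈ annSub A, ∀ v ∈ annSub B, bil ρ u v = 0) : ρ ∈ Lambda2 A ⊔ Lambda2 B := by
  have hfd : FiniteDimensional ℝ (Covector E) := inferInstance
  obtain ⟨u₀, h0, h0'⟩ := exists_linearIndependent_mem hfd (A ⊓ B)
  have hsp0 := span_eq_of_linearIndependent h0' h0 (by simp)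
  obtain ⟨u₁, h1, h1', hsp1⟩ := exists_extension_of_sup_eq hfd h0' (S := A) (T := A)
    (by rw [hsp0]; exact sup_eq_right.2 inf_le_left)
  obtain ⟨u₂, h2, h2', hsp2⟩ := exists_extension_of_sup_eq hfd h1' (S := B) (T := ⊤)
    (by rw [hsp1, hAB])
  obtain ⟨e, he⟩ := exists_dual_vectors h2'
  have hB : Submodule.span ℝ (range (Sum.elim u₀ u₂)) = B := by
    refine span_eq_of_linearIndependent (linearIndependent_of_dual
      (e := Sum.elim (fun i => e (Sum.inl (Sum.inl i))) fun j => e (Sum.inr j)) ?_) ?_ ?_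
    · rintro (i | i) (j | j)
      · have := he (Sum.inl (Sum.inl i)) (Sum.inl (Sum.inl j))
        simpa using this
      · have := he (Sum.inl (Sum.inl i)) (Sum.inr j)
        simpa using this
      · have := he (Sum.inr i) (Sum.inl (Sum.inl j))
        simpa using this
      · have := he (Sum.inr i) (Sum.inr j)
        simpa using this
    · rintro (i | i)
      · exact (h0 i).2
      · exact h2 i
    · have h3 := Submodule.finrank_sup_add_finrank_inf_eq A B
      rw [hAB] at h3
      have h4 : finrank ℝ (Submodule.span ℝ (range (Sum.elim u₀ u₁))) = finrank ℝ A := by rw [hsp1]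
      simp only [Fintype.card_sum, Fintype.card_fin]
      have h5 : finrank ℝ A ≤ finrank ℝ (⊤ : Submodule ℝ (Covector E)) :=
        Submodule.finrank_mono le_top
      omega
  have heA : ∀ j, e (Sum.inr j) ∈ annSub A := by
    refine fun j => (congrArg annSub hsp1).le (mem_annSub_span.2 ?_)
    rintro _ ⟨i, rfl⟩
    simpa using he (Sum.inl i) (Sum.inr j)
  have heB : ∀ j, e (Sum.inl (Sum.inr j)) ∈ annSub B := by
    refine fun j => (congrArg annSub hB).le (mem_annSub_span.2 ?_)
    rintro _ ⟨i | i, rfl⟩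
    · simpa using he (Sum.inl (Sum.inl i)) (Sum.inl (Sum.inr j))
    · simpa using he (Sum.inr i) (Sum.inl (Sum.inr j))
  have hA : ∀ i, Sum.elim (Sum.elim u₀ u₁) u₂ (Sum.inl i) ∈ A := by
    rintro (i | i)
    · exact (h0 i).1
    · exact h1 i
  rw [← project_eq_self he hsp2 ρ]
  unfold project
  refine Submodule.sum_mem _ fun a _ => Submodule.sum_mem _ fun b _ => ?_
  rcases a with a | a
  · rcases b with b | b
    · exact Submodule.mem_sup_left (Submodule.smul_mem _ _ (Submodule.subset_span
        ⟨_, hA a, _, hA b, rfl⟩))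
    · rcases a with a | a
      · exact Submodule.mem_sup_right (Submodule.smul_mem _ _ (Submodule.subset_span
          ⟨_, (h0 a).2, _, h2 b, rfl⟩))
      · rw [bil_swap, h _ (heA b) _ (heB a), neg_zero, zero_div, zero_smul]
        exact Submodule.zero_mem _
  · rcases b with b | b
    · rcases b with b | b
      · exact Submodule.mem_sup_right (Submodule.smul_mem _ _ (Submodule.subset_span
          ⟨_, h2 a, _, (h0 b).2, rfl⟩))
      · rw [h _ (heA a) _ (heB b), zero_div, zero_smul]
        exact Submodule.zero_mem _
    · exact Submodule.mem_sup_right (Submodule.smul_mem _ _ (Submodule.subset_span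
        ⟨_, h2 a, _, h2 b, rfl⟩))

end Lambda2

section MaximalRank

open Filter Topology Module

theorem finrank_le_of_finiteDimensional {V : Type*} [AddCommGroup V] [Module ℝ V]
    (_ : FiniteDimensional ℝ V) (A : Submodule ℝ V) : finrank ℝ A ≤ finrank ℝ V :=
  Submodule.finrank_le A

theorem finrank_pos_of_ne_bot {V : Type*} [AddCommGroup V] [Module ℝ V]
    (_ : FiniteDimensional ℝ V) {A : Submodule ℝ V} (hA : A ≠ ⊥) : 0 < finrank ℝ A := by
  rw [Module.finrank_pos_iff, Submodule.nontrivial_iff_ne_bot]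
  exact hA

theorem card_le_finrank_of_linearIndependent {V : Type*} [AddCommGroup V] [Module ℝ V]
    (_ : FiniteDimensional ℝ V) {A : Submodule ℝ V} {ι : Type*} [Fintype ι] {b : ι → V}
    (hb : LinearIndependent ℝ b) (hA : ∀ i, b i ∈ A) : Fintype.card ι ≤ finrank ℝ A := by
  have h : LinearIndependent ℝ (fun i => (⟨b i, hA i⟩ : A)) := LinearIndependent.of_comp A.subtype hb
  exact h.fintype_card_le_finrank

variable {E : Type*} [NormedAddCommGroup E] [NormedSpace ℝ E] [FiniteDimensional ℝ E]
  {H : Type*} [TopologicalSpace H] {I : ModelWithCorners ℝ E H} [I.Boundaryless]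
  {M : Type*} [TopologicalSpace M] [ChartedSpace H M] [IsManifold I ∞ M]
  {E' : Type*} [NormedAddCommGroup E'] [NormedSpace ℝ E'] [FiniteDimensional ℝ E']
  {H' : Type*} [TopologicalSpace H'] {I' : ModelWithCorners ℝ E' H'} [I'.Boundaryless]
  {N : Type*} [TopologicalSpace N] [ChartedSpace H' N] [IsManifold I' ∞ N]

/-- If `W` contains no integrable subbundle, then the pullbacks to `M` of integrable bundles are either
zero or not contained in `W`. -/
theorem pullback_eq_zero_of_integrable {j : M → N} (hj : ContMDiff I I' ∞ j) {W : CoField I M}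
    (hW : IsLargestIntegrable I W (fun _ => ⊥)) {U : Set N} (hU : IsOpen U) {F : CoField I' N}
    (hF : IsSubbundleOn I' U F) (hFi : IsIntegrableOn I' U F)
    (hFW : ∀ z, j z ∈ U → ∀ c ∈ F (j z), pullbackAt I I' j 1 z c ∈ W z) :
    ∀ z, j z ∈ U → ∀ c ∈ F (j z), pullbackAt I I' j 1 z c = 0 := by
  let A : CoField I M := fun z => (F (j z)).map (pullbackAt I I' j 1 z)
  have hAfin : ∀ z, finrank ℝ (A z) ≤ finrank ℝ (Covector E) := fun z =>
    finrank_le_of_finiteDimensional (V := Covector E) inferInstance (A z)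
  have hext : ∀ z, j z ∈ U → ∀ c ∈ A z, ∃ φ : DForm I' N 1, IsSectionAt I' F (j z) φ ∧
      IsSectionAt I A z (pullback I I' j φ) ∧ pullback I I' j φ z = c := by
    rintro z hz _ ⟨c, hc, rfl⟩
    obtain ⟨φ, hφ, rfl⟩ := (hF.isSubbundleAt hz).exists_section hc
    refine ⟨φ, hφ, ?_, rfl⟩
    filter_upwards [hj.continuous.continuousAt.eventually hφ] with y hy
    exact ⟨hy.1.pullback (hj y), φ (j y), hy.2, rfl⟩
  by_contra! hne
  obtain ⟨z₀, hz₀, c₀, hc₀, hne⟩ := hne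
  obtain ⟨r, ⟨⟨z, hz, hzr⟩, hmax⟩⟩ : ∃ r, (∃ z, j z ∈ U ∧ finrank ℝ (A z) = r) ∧
      ∀ z, j z ∈ U → finrank ℝ (A z) ≤ r := by
    let S : Set ℕ := {r | ∃ z, j z ∈ U ∧ finrank ℝ (A z) = r}
    have hS : BddAbove S := ⟨finrank ℝ (Covector E), by rintro _ ⟨z, _, rfl⟩; exact hAfin z⟩
    have hS' : S.Nonempty := ⟨_, z₀, hz₀, rfl⟩
    exact ⟨sSup S, Nat.sSup_mem hS' hS, fun z hz => le_csSup hS ⟨z, hz, rfl⟩⟩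
  have hpos : 0 < r := by
    refine lt_of_lt_of_le ?_ (hmax z₀ hz₀)
    refine finrank_pos_of_ne_bot (finiteDimensional_covector (I := I) z₀ 1) fun h => ?_
    exact hne ((Submodule.mem_bot ℝ).1 (h ▸ (⟨c₀, hc₀, rfl⟩ : pullbackAt I I' j 1 z₀ c₀ ∈ A z₀)))
  have hlow : ∀ᶠ y in 𝓝 z, finrank ℝ (A y) = r ∧ j y ∈ U := by
    obtain ⟨b, hb1, hb2⟩ := exists_linearIndependent_mem (finiteDimensional_covector (I := I) z 1) (A z)
    choose φ hφ1 hφ2 hφ3 using fun i => hext z hz (b i) (hb1 i)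
    have h1 : LinearIndependent ℝ (fun i => pullback I I' j (φ i) z) := by
      have : (fun i => pullback I I' j (φ i) z) = b := funext hφ3
      rw [this]
      exact hb2
    filter_upwards [eventually_linearIndependent (fun i => (hφ2 i).eventually.mono fun y hy => hy.smoothAt) h1,
      eventually_all.2 hφ2, hj.continuous.continuousAt.eventually (hU.mem_nhds hz)] with y hy1 hy2 hy3
    refine ⟨le_antisymm (hmax y hy3) ?_, hy3⟩
    have h3 := card_le_finrank_of_linearIndependent (finiteDimensional_covector (I := I) y 1) hy1
      fun i => (hy2 i).2
    rw [Fintype.card_fin, hzr] at h3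
    exact h3
  obtain ⟨V, hV, hzV, hVr⟩ := exists_open_of_eventually hlow
  have hAsub : IsSubbundleOn I V A := isSubbundleOn_of_extends hV r (fun y hy => (hVr y hy).1)
    fun y hy c hc => by
      obtain ⟨φ, -, h1, h2⟩ := hext y (hVr y hy).2 c hc
      exact ⟨_, h1, h2⟩
  have hAint : IsIntegrableOn I V A := by
    intro V' hV' hV'V θ hθ y hy u hu v hv
    have hθ' := isSectionAt_of_mem_sections hV' hy hθ
    obtain ⟨φ, hφ1, hφ2, hφ3⟩ := hext y (hVr y (hV'V hy)).2 _ hθ'.mem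
    have h1 := bil_extd_eq_of_eq (hAsub.isSubbundleAt (hV'V hy)) hθ' hφ2 hφ3.symm hu hv
    refine h1.trans ?_
    rw [extd_pullback hφ1.smoothAt (hj y)]
    refine (bil_pullback j (extd I' φ) y u v).trans ?_
    obtain ⟨V'', hV'', hyV'', hsub, h5⟩ := IsSectionAt.exists_mem_sections (ι := Unit) (fun _ => hφ1)
      (hU.mem_nhds (hVr y (hV'V hy)).2)
    exact hFi V'' hV'' hsub φ (h5 ()) (j y) hyV'' _ (fun c hc => hu _ ⟨c, hc, rfl⟩) _
      (fun c hc => hv _ ⟨c, hc, rfl⟩)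
  have hle := hW.largest V hV A hAsub hAint (fun y hy => by
    rintro _ ⟨c, hc, rfl⟩
    exact hFW y (hVr y hy).2 c hc) z hzV
  rw [le_bot_iff.1 hle, finrank_bot] at hzr
  omega

end MaximalRank

section DarbouxPairs

open Filter Topology Module

variable {E : Type*} [NormedAddCommGroup E] [NormedSpace ℝ E] [FiniteDimensional ℝ E]
  {H : Type*} [TopologicalSpace H] {I : ModelWithCorners ℝ E H} [I.Boundaryless]
  {M : Type*} [TopologicalSpace M] [ChartedSpace H M] [IsManifold I ∞ M]
  {E₁ : Type*} [NormedAddCommGroup E₁] [NormedSpace ℝ E₁] [FiniteDimensional ℝ E₁]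
  {H₁ : Type*} [TopologicalSpace H₁] {I₁ : ModelWithCorners ℝ E₁ H₁} [I₁.Boundaryless]
  {M₁ : Type*} [TopologicalSpace M₁] [ChartedSpace H₁ M₁] [IsManifold I₁ ∞ M₁]
  {E₂ : Type*} [NormedAddCommGroup E₂] [NormedSpace ℝ E₂] [FiniteDimensional ℝ E₂]
  {H₂ : Type*} [TopologicalSpace H₂] {I₂ : ModelWithCorners ℝ E₂ H₂} [I₂.Boundaryless]
  {M₂ : Type*} [TopologicalSpace M₂] [ChartedSpace H₂ M₂] [IsManifold I₂ ∞ M₂]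
  {E' : Type*} [NormedAddCommGroup E'] [NormedSpace ℝ E'] [FiniteDimensional ℝ E']
  {H' : Type*} [TopologicalSpace H'] {I' : ModelWithCorners ℝ E' H'} [I'.Boundaryless]
  {N : Type*} [TopologicalSpace N] [ChartedSpace H' N] [IsManifold I' ∞ N]

namespace IsSplitQuotient

variable {p₁ : M → M₁} {p₂ : M → M₂} {q : M → N} {W₁ : CoField I₁ M₁} {W₂ : CoField I₂ M₂}

theorem sup_eq_top₁ (h : IsSplitQuotient I I₁ I₂ I' p₁ p₂ q W₁ W₂) (y : N) :
    quotientSum I I₁ I₂ I' p₁ p₂ q W₁ W₂ y ⊔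
      quotientSum I I₁ I₂ I' p₁ p₂ q (fun _ => ⊤) (fun _ => ⊥) y =
      quotientSum I I₁ I₂ I' p₁ p₂ q (fun _ => ⊤) W₂ y := by
  have := h.symm.sup_eq_top₂ y
  simpa only [quotientSum_symm p₁ p₂ q] using this

theorem sup_eq_top' (h : IsSplitQuotient I I₁ I₂ I' p₁ p₂ q W₁ W₂) (y : N) :
    quotientSum I I₁ I₂ I' p₁ p₂ q (fun _ => ⊤) W₂ y ⊔
      quotientSum I I₁ I₂ I' p₁ p₂ q (fun _ => ⊥) (fun _ => ⊤) y = ⊤ := by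
  have := h.symm.sup_eq_top y
  simpa only [quotientSum_symm p₁ p₂ q] using this

theorem quotientSum_top₂_sup_top₁ (h : IsSplitQuotient I I₁ I₂ I' p₁ p₂ q W₁ W₂) (y : N) :
    quotientSum I I₁ I₂ I' p₁ p₂ q W₁ (fun _ => ⊤) y ⊔
      quotientSum I I₁ I₂ I' p₁ p₂ q (fun _ => ⊤) W₂ y = ⊤ := by
  rw [eq_top_iff, ← h.sup_eq_top y]
  refine sup_le_sup le_rfl ?_
  rw [← h.sup_eq_top₁ y]
  exact le_sup_right

theorem exists_components (h : IsSplitQuotient I I₁ I₂ I' p₁ p₂ q W₁ W₂) {x : M} {η : DForm I' N 1}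
    (hη : IsSectionAt I' (quotientSum I I₁ I₂ I' p₁ p₂ q W₁ W₂) (q x) η) :
    ∃ (θ₁ : DForm I₁ M₁ 1) (θ₂ : DForm I₂ M₂ 1), IsSectionAt I₁ W₁ (p₁ x) θ₁ ∧
      IsSectionAt I₂ W₂ (p₂ x) θ₂ ∧
      pullback I I' q η x = pullback I I₁ p₁ θ₁ x + pullback I I₂ p₂ θ₂ x := by
  obtain ⟨a, ha, b, hb, hab⟩ := mem_sumBundle.1 (hη.mem x rfl)
  obtain ⟨θ₁, h1, rfl⟩ := (h.isSubbundleAt₁ _).exists_section ha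
  obtain ⟨θ₂, h2, rfl⟩ := (h.isSubbundleAt₂ _).exists_section hb
  exact ⟨θ₁, θ₂, h1, h2, hab.symm⟩

theorem bil_extd_eq_zero (h : IsSplitQuotient I I₁ I₂ I' p₁ p₂ q W₁ W₂) {y : N} {η : DForm I' N 1}
    (hη : IsSectionAt I' (quotientSum I I₁ I₂ I' p₁ p₂ q W₁ W₂) y η) {u v : TangentSpace I' y}
    (hu : u ∈ annSub (quotientSum I I₁ I₂ I' p₁ p₂ q W₁ (fun _ => ⊤) y))
    (hv : v ∈ annSub (quotientSum I I₁ I₂ I' p₁ p₂ q (fun _ => ⊤) W₂ y)) :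
    bil (extd I' η y) u v = 0 := by
  obtain ⟨x, rfl⟩ := h.surjective y
  obtain ⟨u', hu', rfl⟩ := exists_mem_annSub_of_quotientBundle h.descends_top₂ hu
  obtain ⟨v', hv', rfl⟩ := exists_mem_annSub_of_quotientBundle h.descends_top₁ hv
  obtain ⟨θ₁, θ₂, h1, h2, heq⟩ := h.exists_components hη
  rw [h.bil_extd_eq_add hη h1 h2 heq
    (annSub_anti (sumBundle_mono (fun _ => le_rfl) (fun _ => le_top) x) hu')
    (annSub_anti (sumBundle_mono (fun _ => le_top) (fun _ => le_rfl) x) hv')]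
  have h3 : mfderiv I I₂ p₂ x u' = 0 :=
    eq_zero_of_mem_annSub_top (E := E₂) (mem_annSub_sumBundle.1 hu').2
  have h4 : mfderiv I I₁ p₁ x v' = 0 :=
    eq_zero_of_mem_annSub_top (E := E₁) (mem_annSub_sumBundle.1 hv').1
  rw [h3, h4, map_zero, map_zero, LinearMap.zero_apply, add_zero]

theorem isLargestIntegrable (h : IsSplitQuotient I I₁ I₂ I' p₁ p₂ q W₁ W₂) :
    IsLargestIntegrable I' (quotientSum I I₁ I₂ I' p₁ p₂ q W₁ (fun _ => ⊤))
      (quotientSum I I₁ I₂ I' p₁ p₂ q (fun _ => ⊥) (fun _ => ⊤)) where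
  subbundle := h.isPfaffian₂
  integrable := by
    intro V hV _ θ hθ y hy u hu v hv
    obtain ⟨x, rfl⟩ := h.surjective y
    obtain ⟨u', hu', rfl⟩ := exists_mem_annSub_of_quotientBundle h.descends₂ hu
    obtain ⟨v', hv', rfl⟩ := exists_mem_annSub_of_quotientBundle h.descends₂ hv
    obtain ⟨ι, hι, hx, h1, h2⟩ := h.split.slice₁ x
    have hqd : ∀ z, MDifferentiableAt I I' q (ι z) := fun z => (h.smooth _).mdifferentiableAt (by simp)
    have hιd : ∀ z, MDifferentiableAt I₁ I ι z := fun z => (hι z).mdifferentiableAt (by simp)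
    have hz : q (ι (p₁ x)) = q x := by rw [hx]
    have h3 : ∀ᶠ z in 𝓝 (p₁ x), pullback I₁ I' (fun z => q (ι z)) θ z = 0 := by
      have hc : ContinuousAt (fun z => q (ι z)) (p₁ x) := (h.smooth.continuous.comp hι.continuous).continuousAt
      filter_upwards [hc.eventually (hV.mem_nhds (by change q (ι (p₁ x)) ∈ V; rw [hz]; exact hy))] with z hz'
      have h4 := h.split.pullback_slice_mem hι h1 h2 (hθ.2 _ hz' (ι z) rfl)
      exact (pullbackAt_comp (hqd z) (hιd z) _).trans ((Submodule.mem_bot ℝ).1 h4)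
    have hθs : SmoothAt I' θ (q (ι (p₁ x))) := by rw [hz]; exact hθ.1 _ hy
    have h4 : extd I₁ (pullback I₁ I' (fun z => q (ι z)) θ) (p₁ x) = 0 :=
      (extd_congr (h3.mono fun z hz => hz.trans (Pi.zero_apply (M := fun z =>
        Covector (TangentSpace I₁ z)) z).symm)).trans (extd_zero _)
    rw [extd_pullback (f := fun z => q (ι z)) hθs ((h.smooth.comp hι) (p₁ x))] at h4
    have h5 : ∀ w : TangentSpace I x, w ∈ annSub (sumBundle I I₁ I₂ p₁ p₂ (fun _ => ⊥) (fun _ => ⊤) x) →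
        mfd I₁ I' (fun z => q (ι z)) (p₁ x) (mfd I I₁ p₁ x w) = mfd I I' q x w := by
      intro w hw
      have h6 := mfd_comp (I := I₁) (I' := I) (I'' := I') (hqd (p₁ x)) (hιd (p₁ x))
      rw [h6]
      have h7 : mfd I₁ I ι (p₁ x) (mfd I I₁ p₁ x w) = w := by
        have h8 := h.split.mfd_slice hι h1 h2 (p₁ x) (mfd I I₁ p₁ x w)
        rw [hx] at h8
        have h9 : mfd I I₂ p₂ x w = 0 := eq_zero_of_mem_annSub_top (E := E₂) (mem_annSub_sumBundle.1 hw).2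
        refine sub_eq_zero.1 (h.split.eq_zero x _ ?_ ?_)
        · exact ((mfd I I₁ p₁ x).map_sub _ _).trans (sub_eq_zero.2 h8.1)
        · exact ((mfd I I₂ p₂ x).map_sub _ _).trans ((congrArg₂ (· - ·) h8.2 h9).trans (sub_zero _))
      change mfd I I' q (ι (p₁ x)) (mfd I₁ I ι (p₁ x) (mfd I I₁ p₁ x w)) = _
      rw [h7, hx]
    have h6 : bil (pullback I₁ I' (fun z => q (ι z)) (extd I' θ) (p₁ x)) (mfd I I₁ p₁ x u')
        (mfd I I₁ p₁ x v') = 0 := by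
      rw [h4]
      exact bil_zero_left _ _
    have h7 : (bil (extd I' θ (q (ι (p₁ x))) : E' [⋀^Fin 2]→L[ℝ] ℝ) : E' →ₗ[ℝ] E' →ₗ[ℝ] ℝ)
        (mfd I₁ I' (fun z => q (ι z)) (p₁ x) (mfd I I₁ p₁ x u'))
        (mfd I₁ I' (fun z => q (ι z)) (p₁ x) (mfd I I₁ p₁ x v')) = 0 :=
      (bil_pullback (fun z => q (ι z)) (extd I' θ) (p₁ x) _ _).symm.trans h6
    rw [h5 u' hu', h5 v' hv', hz] at h7
    exact h7
  le y c hc x hx := sumBundle_mono (fun _ => bot_le) (fun _ => le_rfl) x (hc x hx)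
  largest := by
    intro U hU F hF hFi hFU y hy c hc
    obtain ⟨x, rfl⟩ := h.surjective y
    obtain ⟨ι, hι, hx, h1, h2⟩ := h.split.slice₁ x
    have hqd : ∀ z, MDifferentiableAt I I' q (ι z) := fun z => (h.smooth _).mdifferentiableAt (by simp)
    have hιd : ∀ z, MDifferentiableAt I₁ I ι z := fun z => (hι z).mdifferentiableAt (by simp)
    have key := pullback_eq_zero_of_integrable (h.smooth.comp hι) h.largest₁ hU hF hFi
      (fun z hz c hc => by
        have h3 := h.split.pullback_slice_mem hι h1 h2 (hFU _ hz hc (ι z) rfl)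
        exact (pullbackAt_comp (hqd z) (hιd z) c).symm ▸ h3)
    have hz : q (ι (p₁ x)) = q x := by rw [hx]
    have h3 := key (p₁ x) (by change q (ι (p₁ x)) ∈ U; rw [hz]; exact hy)
      (hz.symm ▸ c : Covector (TangentSpace I' (q (ι (p₁ x))))) (cast_mem hz.symm hc)
    rw [mem_quotientBundle h.descends₂]
    obtain ⟨a, ha, b, hb, hab⟩ := mem_sumBundle.1 (hFU _ hy hc x rfl)
    have ha0 : a = 0 := by
      refine Covector.ext' fun u => ?_
      have h4 : (hz.symm ▸ c : Covector (TangentSpace I' (q (ι (p₁ x)))))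
          (fun _ => mfd I₁ I' (fun z => q (ι z)) (p₁ x) u) = 0 :=
        congrArg (fun c : Covector (TangentSpace I₁ (p₁ x)) => c fun _ => u) h3
      have h5 := (cast_covector_apply (I' := I') hz.symm c _).symm.trans h4
      have h6 := mfd_comp (I := I₁) (I' := I) (I'' := I') (hqd (p₁ x)) (hιd (p₁ x))
      rw [h6] at h5
      have h7 : pullbackAt I I' q 1 x c (fun _ => mfd I₁ I ι (p₁ x) u) = 0 := by
        refine Eq.trans ?_ h5
        exact congrArg (fun L : E →L[ℝ] E' => (c : Covector E') fun _ => L (mfd I₁ I ι (p₁ x) u))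
          (congrArg (fun x' => (mfd I I' q x' : E →L[ℝ] E')) hx.symm)
      rw [← hab] at h7
      have h8 := h.split.mfd_slice hι h1 h2 (p₁ x) u
      rw [hx] at h8
      have h9 : (a : Covector E₁) (fun _ => mfd I I₁ p₁ x (mfd I₁ I ι (p₁ x) u)) +
        (b : Covector E₂) (fun _ => mfd I I₂ p₂ x (mfd I₁ I ι (p₁ x) u)) = 0 := h7
      rw [h8.1, h8.2] at h9
      exact (add_zero _).symm.trans ((congrArg (_ + ·) (Covector.map_zero (V := E₂) b).symm).trans h9)
    rw [mem_sumBundle]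
    exact ⟨0, Submodule.zero_mem _, b, trivial, by rw [← ha0, hab]⟩

theorem isDarbouxPair (h : IsSplitQuotient I I₁ I₂ I' p₁ p₂ q W₁ W₂) :
    IsDarbouxPair I' (quotientSum I I₁ I₂ I' p₁ p₂ q W₁ (fun _ => ⊤))
      (quotientSum I I₁ I₂ I' p₁ p₂ q (fun _ => ⊥) (fun _ => ⊤))
      (quotientSum I I₁ I₂ I' p₁ p₂ q (fun _ => ⊤) W₂)
      (quotientSum I I₁ I₂ I' p₁ p₂ q (fun _ => ⊤) (fun _ => ⊥)) where
  pfaffian₁ := h.isPfaffian_top₂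
  pfaffian₂ := by
    have := h.symm.isPfaffian_top₂
    simpa only [quotientSum_symm p₁ p₂ q] using this
  largest₁ := h.isLargestIntegrable
  largest₂ := by
    have := h.symm.isLargestIntegrable
    simpa only [quotientSum_symm p₁ p₂ q] using this
  sup₁ := h.sup_eq_top
  sup₂ := h.sup_eq_top'
  inf := h.inf_eq_bot
  structure_eq U hU φ hφ y hy := by
    refine mem_Lambda2_sup (E := E') (h.quotientSum_top₂_sup_top₁ y) fun u hu v hv => ?_
    have h1 := isSectionAt_of_mem_sections hU hy hφ
    exact h.bil_extd_eq_zero (h1.mono fun z => (h.inf_eq z).le) hu hv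

end IsSplitQuotient

end DarbouxPairs

section AnnihilatorsOfIntersections

variable {E : Type*} [NormedAddCommGroup E] [NormedSpace ℝ E] [FiniteDimensional ℝ E]

theorem annSub_inf_le (A B : Submodule ℝ (Covector E)) : annSub (A ⊓ B) ≤ annSub A ⊔ annSub B := by
  refine fun v hv => mem_of_coann fun c hc => hv c ⟨mem_of_annSub fun u hu => ?_, mem_of_annSub fun u hu => ?_⟩
  · exact mem_coann.1 hc u (Submodule.mem_sup_left hu)
  · exact mem_coann.1 hc u (Submodule.mem_sup_right hu)

theorem bil_add_add_of_eq_zero {ρ : E [⋀^Fin 2]→L[ℝ] ℝ} {a b c d : E} (hb : bil ρ b = 0)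
    (hd : bil ρ a d = 0) : bil ρ (a + b) (c + d) = bil ρ a c := by
  rw [(bil ρ).map_add, hb, add_zero, (bil ρ a).map_add, hd, add_zero]

end AnnihilatorsOfIntersections

theorem finrank_mono_of_finiteDimensional {V : Type*} [AddCommGroup V] [Module ℝ V]
    (_ : FiniteDimensional ℝ V) {A B : Submodule ℝ V} (h : A ≤ B) :
    Module.finrank ℝ A ≤ Module.finrank ℝ B := Submodule.finrank_mono h

theorem finrank_sup_add_finrank_inf {V : Type*} [AddCommGroup V] [Module ℝ V]
    (_ : FiniteDimensional ℝ V) (A B : Submodule ℝ V) :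
    Module.finrank ℝ ↥(A ⊔ B) + Module.finrank ℝ ↥(A ⊓ B) = Module.finrank ℝ A + Module.finrank ℝ B :=
  Submodule.finrank_sup_add_finrank_inf_eq A B

theorem linearIndependent_of_span_eq_top {V : Type*} [AddCommGroup V] [Module ℝ V]
    (_ : FiniteDimensional ℝ V) {ι : Type*} [Fintype ι] {b : ι → V}
    (h : Submodule.span ℝ (range b) = ⊤) (hc : Fintype.card ι = Module.finrank ℝ V) :
    LinearIndependent ℝ b := linearIndependent_of_top_le_span_of_card_eq_finrank h.ge hc

section CoframeSums

variable {V : Type*} [AddCommGroup V] [Module ℝ V] {α β γ : Type*} [Fintype α] [Fintype β] [Fintype γ]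
  {f : α ⊕ β ⊕ γ → ℝ} (e : α ⊕ β ⊕ γ → V)

theorem sum_elim_left_right (h : ∀ i, f (Sum.inl i) = 0) (h' : ∀ i, f (Sum.inr (Sum.inr i)) = 0) :
    ∑ i, f i • e i = ∑ i, f (Sum.inr (Sum.inl i)) • e (Sum.inr (Sum.inl i)) := by
  simp [Fintype.sum_sum_type, h, h']

theorem sum_elim_right_right (h : ∀ i, f (Sum.inl i) = 0) (h' : ∀ i, f (Sum.inr (Sum.inl i)) = 0) :
    ∑ i, f i • e i = ∑ i, f (Sum.inr (Sum.inr i)) • e (Sum.inr (Sum.inr i)) := by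
  simp [Fintype.sum_sum_type, h, h']

end CoframeSums

section AdaptedCoframes

open Filter Topology Module

variable {E : Type*} [NormedAddCommGroup E] [NormedSpace ℝ E] [FiniteDimensional ℝ E]
  {H : Type*} [TopologicalSpace H] {I : ModelWithCorners ℝ E H} [I.Boundaryless]
  {M : Type*} [TopologicalSpace M] [ChartedSpace H M] [IsManifold I ∞ M]
  {E₁ : Type*} [NormedAddCommGroup E₁] [NormedSpace ℝ E₁] [FiniteDimensional ℝ E₁]
  {H₁ : Type*} [TopologicalSpace H₁] {I₁ : ModelWithCorners ℝ E₁ H₁} [I₁.Boundaryless]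
  {M₁ : Type*} [TopologicalSpace M₁] [ChartedSpace H₁ M₁] [IsManifold I₁ ∞ M₁]
  {E₂ : Type*} [NormedAddCommGroup E₂] [NormedSpace ℝ E₂] [FiniteDimensional ℝ E₂]
  {H₂ : Type*} [TopologicalSpace H₂] {I₂ : ModelWithCorners ℝ E₂ H₂} [I₂.Boundaryless]
  {M₂ : Type*} [TopologicalSpace M₂] [ChartedSpace H₂ M₂] [IsManifold I₂ ∞ M₂]
  {E' : Type*} [NormedAddCommGroup E'] [NormedSpace ℝ E'] [FiniteDimensional ℝ E']
  {H' : Type*} [TopologicalSpace H'] {I' : ModelWithCorners ℝ E' H'} [I'.Boundaryless]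
  {N : Type*} [TopologicalSpace N] [ChartedSpace H' N] [IsManifold I' ∞ N]

/-- On the open set `V`, the `θ` are a frame of `(W₁ ⊕ W₂)/G`; together with sections `σ₁` of
`(0 ⊕ Λ¹(M₂))/G`, resp. `σ₂` of `(Λ¹(M₁) ⊕ 0)/G`, they are frames of `(W₁ ⊕ Λ¹(M₂))/G`, resp.
`(Λ¹(M₁) ⊕ W₂)/G`; and `Ω₁`, `Ω₂` are the components of `dθ` in `Λ²(σ₁)` and `Λ²(σ₂)`. -/
structure IsAdaptedCoframe (I : ModelWithCorners ℝ E H) (I₁ : ModelWithCorners ℝ E₁ H₁)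
    (I₂ : ModelWithCorners ℝ E₂ H₂) (I' : ModelWithCorners ℝ E' H') (p₁ : M → M₁) (p₂ : M → M₂)
    (q : M → N) (W₁ : CoField I₁ M₁) (W₂ : CoField I₂ M₂) (V : Set N) {r m n : ℕ}
    (θ : Fin r → DForm I' N 1) (σ₁ : Fin m → DForm I' N 1) (σ₂ : Fin n → DForm I' N 1)
    (Ω₁ Ω₂ : Fin r → DForm I' N 2) : Prop where
  isOpen : IsOpen V
  frame : ∀ y ∈ V, IsFrameAt I' (quotientSum I I₁ I₂ I' p₁ p₂ q W₁ W₂) y θ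
  frame₁ : ∀ y ∈ V, IsFrameAt I' (quotientSum I I₁ I₂ I' p₁ p₂ q W₁ fun _ => ⊤) y (Sum.elim θ σ₁)
  frame₂ : ∀ y ∈ V, IsFrameAt I' (quotientSum I I₁ I₂ I' p₁ p₂ q (fun _ => ⊤) W₂) y (Sum.elim θ σ₂)
  section₁ : ∀ i, ∀ y ∈ V,
    IsSectionAt I' (quotientSum I I₁ I₂ I' p₁ p₂ q (fun _ => ⊥) fun _ => ⊤) y (σ₁ i)
  section₂ : ∀ i, ∀ y ∈ V,
    IsSectionAt I' (quotientSum I I₁ I₂ I' p₁ p₂ q (fun _ => ⊤) fun _ => ⊥) y (σ₂ i)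
  smooth₁ : ∀ k, ∀ y ∈ V, SmoothAt I' (Ω₁ k) y
  smooth₂ : ∀ k, ∀ y ∈ V, SmoothAt I' (Ω₂ k) y
  lambda₁ : ∀ k, ∀ y ∈ V, Ω₁ k y ∈ Lambda2 (Submodule.span ℝ (range fun i => σ₁ i y))
  lambda₂ : ∀ k, ∀ y ∈ V, Ω₂ k y ∈ Lambda2 (Submodule.span ℝ (range fun i => σ₂ i y))
  bil₁ : ∀ k, ∀ y ∈ V, ∀ u ∈ annSub (quotientSum I I₁ I₂ I' p₁ p₂ q (fun _ => ⊤) W₂ y),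
    ∀ v ∈ annSub (quotientSum I I₁ I₂ I' p₁ p₂ q (fun _ => ⊤) W₂ y),
    bil (Ω₁ k y) u v = bil (extd I' (θ k) y) u v
  bil₂ : ∀ k, ∀ y ∈ V, ∀ u ∈ annSub (quotientSum I I₁ I₂ I' p₁ p₂ q W₁ (fun _ => ⊤) y),
    ∀ v ∈ annSub (quotientSum I I₁ I₂ I' p₁ p₂ q W₁ (fun _ => ⊤) y),
    bil (Ω₂ k y) u v = bil (extd I' (θ k) y) u v

variable {p₁ : M → M₁} {p₂ : M → M₂} {q : M → N} {W₁ : CoField I₁ M₁} {W₂ : CoField I₂ M₂}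

namespace IsAdaptedCoframe

variable {V : Set N} {r m n : ℕ} {θ : Fin r → DForm I' N 1} {σ₁ : Fin m → DForm I' N 1}
  {σ₂ : Fin n → DForm I' N 1} {Ω₁ Ω₂ : Fin r → DForm I' N 2}

theorem symm (h : IsAdaptedCoframe I I₁ I₂ I' p₁ p₂ q W₁ W₂ V θ σ₁ σ₂ Ω₁ Ω₂) :
    IsAdaptedCoframe I I₂ I₁ I' p₂ p₁ q W₂ W₁ V θ σ₂ σ₁ Ω₂ Ω₁ := by
  constructor
  all_goals try simp only [quotientSum_symm p₁ p₂ q]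
  exacts [h.isOpen, h.frame, h.frame₂, h.frame₁, h.section₂, h.section₁, h.smooth₂, h.smooth₁,
    h.lambda₂, h.lambda₁, h.bil₂, h.bil₁]

theorem mono (h : IsAdaptedCoframe I I₁ I₂ I' p₁ p₂ q W₁ W₂ V θ σ₁ σ₂ Ω₁ Ω₂) {V' : Set N}
    (hV' : IsOpen V') (hV : V' ⊆ V) : IsAdaptedCoframe I I₁ I₂ I' p₁ p₂ q W₁ W₂ V' θ σ₁ σ₂ Ω₁ Ω₂ where
  isOpen := hV'
  frame y hy := h.frame y (hV hy)
  frame₁ y hy := h.frame₁ y (hV hy)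
  frame₂ y hy := h.frame₂ y (hV hy)
  section₁ i y hy := h.section₁ i y (hV hy)
  section₂ i y hy := h.section₂ i y (hV hy)
  smooth₁ k y hy := h.smooth₁ k y (hV hy)
  smooth₂ k y hy := h.smooth₂ k y (hV hy)
  lambda₁ k y hy := h.lambda₁ k y (hV hy)
  lambda₂ k y hy := h.lambda₂ k y (hV hy)
  bil₁ k y hy := h.bil₁ k y (hV hy)
  bil₂ k y hy := h.bil₂ k y (hV hy)

theorem bil_eq_zero₂ (h : IsAdaptedCoframe I I₁ I₂ I' p₁ p₂ q W₁ W₂ V θ σ₁ σ₂ Ω₁ Ω₂) (k : Fin r) {y : N}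
    (hy : y ∈ V) {u : TangentSpace I' y}
    (hu : u ∈ annSub (quotientSum I I₁ I₂ I' p₁ p₂ q (fun _ => ⊤) W₂ y)) (v : TangentSpace I' y) :
    bil (Ω₂ k y) u v = 0 := by
  refine bil_eq_zero_of_mem_Lambda2 (h.lambda₂ k y hy) (mem_annSub_span.2 ?_) v
  rintro _ ⟨i, rfl⟩
  exact hu _ ((h.frame₂ y hy).isSectionAt (Sum.inr i)).mem

end IsAdaptedCoframe

namespace IsSplitQuotient

theorem exists_add (h : IsSplitQuotient I I₁ I₂ I' p₁ p₂ q W₁ W₂) {x : M} {u : TangentSpace I x}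
    (hu : u ∈ annSub (sumBundle I I₁ I₂ p₁ p₂ W₁ W₂ x)) :
    ∃ u₁ ∈ annSub (sumBundle I I₁ I₂ p₁ p₂ W₁ (fun _ => ⊤) x),
      ∃ u₂ ∈ annSub (sumBundle I I₁ I₂ p₁ p₂ (fun _ => ⊤) W₂ x), u₁ + u₂ = u := by
  have h1 : mfderiv I I' q x u ∈ annSub (quotientSum I I₁ I₂ I' p₁ p₂ q W₁ W₂ (q x)) :=
    mfderiv_mem_annSub hu
  rw [← h.inf_eq] at h1
  obtain ⟨a, ha, b, hb, hab⟩ := Submodule.mem_sup.1 (annSub_inf_le (E := E') _ _ h1)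
  obtain ⟨u₁, hu₁, rfl⟩ := exists_mem_annSub_of_quotientBundle h.descends_top₂ ha
  obtain ⟨u₂, hu₂, rfl⟩ := exists_mem_annSub_of_quotientBundle h.descends_top₁ hb
  refine ⟨u₁, hu₁, u₂, hu₂, ?_⟩
  have hab' : mfderiv I I' q x (u₁ + u₂) = mfderiv I I' q x u := (map_add (mfd I I' q x) u₁ u₂).trans hab
  refine sub_eq_zero.1 (h.transverse₁ x _ (mfderiv_sub_eq_zero hab') ?_)
  have h2 : mfderiv I I₁ p₁ x (u₁ + u₂ - u) =
      mfderiv I I₁ p₁ x u₁ + mfderiv I I₁ p₁ x u₂ - mfderiv I I₁ p₁ x u := by rw [map_sub, map_add]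
  rw [h2]
  refine Submodule.sub_mem _ (Submodule.add_mem _ (mem_annSub_sumBundle.1 hu₁).1 ?_)
    (mem_annSub_sumBundle.1 hu).1
  exact annSub_anti le_top (mem_annSub_sumBundle.1 hu₂).1

/-- The components of the structure equations of the quotient are those of `W₁` and `W₂`. -/
theorem bil_component₂ (h : IsSplitQuotient I I₁ I₂ I' p₁ p₂ q W₁ W₂) {V : Set N} {r m n : ℕ}
    {θ : Fin r → DForm I' N 1} {σ₁ : Fin m → DForm I' N 1} {σ₂ : Fin n → DForm I' N 1}
    {Ω₁ Ω₂ : Fin r → DForm I' N 2} (hV : IsAdaptedCoframe I I₁ I₂ I' p₁ p₂ q W₁ W₂ V θ σ₁ σ₂ Ω₁ Ω₂)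
    {x : M} (hx : q x ∈ V) (k : Fin r) {θ₁ : DForm I₁ M₁ 1} (h₁ : IsSectionAt I₁ W₁ (p₁ x) θ₁)
    {θ₂ : DForm I₂ M₂ 1} (h₂ : IsSectionAt I₂ W₂ (p₂ x) θ₂)
    (heq : pullback I I' q (θ k) x = pullback I I₁ p₁ θ₁ x + pullback I I₂ p₂ θ₂ x) {u v : TangentSpace I x}
    (hu : u ∈ annSub (sumBundle I I₁ I₂ p₁ p₂ W₁ W₂ x))
    (hv : v ∈ annSub (sumBundle I I₁ I₂ p₁ p₂ W₁ W₂ x)) :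
    bil (Ω₂ k (q x)) (mfderiv I I' q x u) (mfderiv I I' q x v) =
      bil (extd I₁ θ₁ (p₁ x)) (mfderiv I I₁ p₁ x u) (mfderiv I I₁ p₁ x v) := by
  obtain ⟨u₁, hu₁, u₂, hu₂, rfl⟩ := h.exists_add hu
  obtain ⟨v₁, hv₁, v₂, hv₂, rfl⟩ := h.exists_add hv
  have e1 : mfderiv I I₁ p₁ x u₂ = 0 := eq_zero_of_mem_annSub_top (E := E₁) (mem_annSub_sumBundle.1 hu₂).1
  have e2 : mfderiv I I₁ p₁ x v₂ = 0 := eq_zero_of_mem_annSub_top (E := E₁) (mem_annSub_sumBundle.1 hv₂).1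
  have e3 : mfderiv I I₂ p₂ x u₁ = 0 := eq_zero_of_mem_annSub_top (E := E₂) (mem_annSub_sumBundle.1 hu₁).2
  have key := h.bil_extd_eq_add ((hV.frame _ hx).isSectionAt k) h₁ h₂ heq
    (annSub_anti (sumBundle_mono (fun _ => le_rfl) (fun _ => le_top) x) hu₁)
    (annSub_anti (sumBundle_mono (fun _ => le_rfl) (fun _ => le_top) x) hv₁)
  rw [e3, map_zero, LinearMap.zero_apply, add_zero,
    ← hV.bil₂ k _ hx _ (mfderiv_mem_annSub hu₁) _ (mfderiv_mem_annSub hv₁)] at key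
  have k1 : bil (Ω₂ k (q x)) (mfderiv I I' q x u₂) = 0 := LinearMap.ext fun w =>
    hV.bil_eq_zero₂ k hx (mfderiv_mem_annSub hu₂) w
  have k2 : bil (Ω₂ k (q x)) (mfderiv I I' q x u₁) (mfderiv I I' q x v₂) = 0 := by
    rw [bil_swap, hV.bil_eq_zero₂ k hx (mfderiv_mem_annSub hv₂), neg_zero]
  have c1 : mfderiv I I₁ p₁ x (u₁ + u₂) = mfderiv I I₁ p₁ x u₁ :=
    (map_add _ _ _).trans ((congrArg (_ + ·) e1).trans (add_zero _))
  have c2 : mfderiv I I₁ p₁ x (v₁ + v₂) = mfderiv I I₁ p₁ x v₁ :=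
    (map_add _ _ _).trans ((congrArg (_ + ·) e2).trans (add_zero _))
  rw [c1, c2, ← key]
  have d1 : mfderiv I I' q x (u₁ + u₂) = mfderiv I I' q x u₁ + mfderiv I I' q x u₂ := map_add _ _ _
  have d2 : mfderiv I I' q x (v₁ + v₂) = mfderiv I I' q x v₁ + mfderiv I I' q x v₂ := map_add _ _ _
  rw [d1, d2]
  exact bil_add_add_of_eq_zero (E := E') k1 k2

theorem finrank_add_finrank (h : IsSplitQuotient I I₁ I₂ I' p₁ p₂ q W₁ W₂) (y : N) :
    finrank ℝ (Covector E') + finrank ℝ (quotientSum I I₁ I₂ I' p₁ p₂ q W₁ W₂ y) =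
    finrank ℝ (quotientSum I I₁ I₂ I' p₁ p₂ q W₁ (fun _ => ⊤) y) +
      finrank ℝ (quotientSum I I₁ I₂ I' p₁ p₂ q (fun _ => ⊤) W₂ y) := by
  have h1 := finrank_sup_add_finrank_inf (V := Covector E') inferInstance
    (quotientSum I I₁ I₂ I' p₁ p₂ q W₁ (fun _ => ⊤) y) (quotientSum I I₁ I₂ I' p₁ p₂ q (fun _ => ⊤) W₂ y)
  have h2 : finrank ℝ (⊤ : Submodule ℝ (Covector E')) = finrank ℝ (Covector E') := _root_.finrank_top ℝ _
  rw [← h2]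
  refine Eq.trans ?_ h1
  exact congrArg₂ (fun A B : Submodule ℝ (Covector E') => finrank ℝ A + finrank ℝ B)
    (h.quotientSum_top₂_sup_top₁ y).symm (h.inf_eq y).symm

theorem exists_isAdaptedCoframe (h : IsSplitQuotient I I₁ I₂ I' p₁ p₂ q W₁ W₂) (y₀ : N) :
    ∃ (V : Set N) (θ : Fin (finrank ℝ (quotientSum I I₁ I₂ I' p₁ p₂ q W₁ W₂ y₀)) → DForm I' N 1)
      (σ₁ : Fin (finrank ℝ (quotientSum I I₁ I₂ I' p₁ p₂ q W₁ (fun _ => ⊤) y₀) -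
        finrank ℝ (quotientSum I I₁ I₂ I' p₁ p₂ q W₁ W₂ y₀)) → DForm I' N 1)
      (σ₂ : Fin (finrank ℝ (quotientSum I I₁ I₂ I' p₁ p₂ q (fun _ => ⊤) W₂ y₀) -
        finrank ℝ (quotientSum I I₁ I₂ I' p₁ p₂ q W₁ W₂ y₀)) → DForm I' N 1)
      (Ω₁ Ω₂ : Fin (finrank ℝ (quotientSum I I₁ I₂ I' p₁ p₂ q W₁ W₂ y₀)) → DForm I' N 2),
      y₀ ∈ V ∧ IsAdaptedCoframe I I₁ I₂ I' p₁ p₂ q W₁ W₂ V θ σ₁ σ₂ Ω₁ Ω₂ ∧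
      ∀ y ∈ V, IsFrameAt I' (fun _ => ⊤) y (Sum.elim θ (Sum.elim σ₁ σ₂)) := by
  have hD := h.isPfaffian.isSubbundleAt (mem_univ y₀)
  have hU₁ := h.isPfaffian_top₂.isSubbundleAt (mem_univ y₀)
  have hU₂ : IsSubbundleAt I' (quotientSum I I₁ I₂ I' p₁ p₂ q (fun _ => ⊤) W₂) y₀ := by
    have := h.symm.isPfaffian_top₂.isSubbundleAt (mem_univ y₀)
    simpa only [quotientSum_symm p₁ p₂ q] using this
  have hF₁ := h.isPfaffian₂.isSubbundleAt (mem_univ y₀)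
  have hF₂ : IsSubbundleAt I' (quotientSum I I₁ I₂ I' p₁ p₂ q (fun _ => ⊤) (fun _ => ⊥)) y₀ := by
    have := h.symm.isPfaffian₂.isSubbundleAt (mem_univ y₀)
    simpa only [quotientSum_symm p₁ p₂ q] using this
  have hle₁ : ∀ y, quotientSum I I₁ I₂ I' p₁ p₂ q W₁ W₂ y ≤
      quotientSum I I₁ I₂ I' p₁ p₂ q W₁ (fun _ => ⊤) y := fun y =>
    (h.inf_eq y).symm.le.trans inf_le_left
  have hle₂ : ∀ y, quotientSum I I₁ I₂ I' p₁ p₂ q W₁ W₂ y ≤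
      quotientSum I I₁ I₂ I' p₁ p₂ q (fun _ => ⊤) W₂ y := fun y =>
    (h.inf_eq y).symm.le.trans inf_le_right
  obtain ⟨θ, hθ⟩ := isSubbundleAt_of_extends hD.finrank_eq fun c hc => hD.exists_section hc
  obtain ⟨σ₁, hσ₁, hθ₁⟩ := hθ.exists_extension (fun c hc => hF₁.exists_section hc) hU₁.finrank_eq
    hle₁ (fun y => (h.sup_eq_top₂ y).le.trans' le_sup_right) (h.sup_eq_top₂ y₀)
  obtain ⟨σ₂, hσ₂, hθ₂⟩ := hθ.exists_extension (fun c hc => hF₂.exists_section hc) hU₂.finrank_eq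
    hle₂ (fun y => (h.sup_eq_top₁ y).le.trans' le_sup_right) (h.sup_eq_top₁ y₀)
  have hs : ∀ i, IsSectionAt I' (fun _ => ⊤) y₀ (Sum.elim θ (Sum.elim σ₁ σ₂) i) := by
    rintro (i | i | i)
    · exact (hθ.isSectionAt i).mono fun _ => le_top
    · exact (hσ₁ i).mono fun _ => le_top
    · exact (hσ₂ i).mono fun _ => le_top
  have hcard : Fintype.card (Fin (finrank ℝ (quotientSum I I₁ I₂ I' p₁ p₂ q W₁ W₂ y₀)) ⊕
      (Fin (finrank ℝ (quotientSum I I₁ I₂ I' p₁ p₂ q W₁ (fun _ => ⊤) y₀) -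
        finrank ℝ (quotientSum I I₁ I₂ I' p₁ p₂ q W₁ W₂ y₀)) ⊕
      Fin (finrank ℝ (quotientSum I I₁ I₂ I' p₁ p₂ q (fun _ => ⊤) W₂ y₀) -
        finrank ℝ (quotientSum I I₁ I₂ I' p₁ p₂ q W₁ W₂ y₀)))) = finrank ℝ (Covector E') := by
    simp only [Fintype.card_sum, Fintype.card_fin]
    have h1 := h.finrank_add_finrank y₀
    have h2 : finrank ℝ (quotientSum I I₁ I₂ I' p₁ p₂ q W₁ W₂ y₀) ≤
        finrank ℝ (quotientSum I I₁ I₂ I' p₁ p₂ q W₁ (fun _ => ⊤) y₀) :=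
      finrank_mono_of_finiteDimensional (V := Covector E') inferInstance (hle₁ y₀)
    have h3 : finrank ℝ (quotientSum I I₁ I₂ I' p₁ p₂ q W₁ W₂ y₀) ≤
        finrank ℝ (quotientSum I I₁ I₂ I' p₁ p₂ q (fun _ => ⊤) W₂ y₀) :=
      finrank_mono_of_finiteDimensional (V := Covector E') inferInstance (hle₂ y₀)
    omega
  have hli : LinearIndependent ℝ (fun i => Sum.elim θ (Sum.elim σ₁ σ₂) i y₀) := by
    refine linearIndependent_of_span_eq_top (V := Covector E') inferInstance ?_ hcard
    refine eq_top_iff.2 ((h.quotientSum_top₂_sup_top₁ y₀).symm.le.trans (sup_le ?_ ?_))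
    · refine hθ₁.self_of_nhds.2.2.symm.le.trans (Submodule.span_mono ?_)
      rintro _ ⟨i | i, rfl⟩
      · exact ⟨Sum.inl i, rfl⟩
      · exact ⟨Sum.inr (Sum.inl i), rfl⟩
    · refine hθ₂.self_of_nhds.2.2.symm.le.trans (Submodule.span_mono ?_)
      rintro _ ⟨i | i, rfl⟩
      · exact ⟨Sum.inl i, rfl⟩
      · exact ⟨Sum.inr (Sum.inr i), rfl⟩
  have hfr : IsFrameAt I' (fun _ => ⊤) y₀ (Sum.elim θ (Sum.elim σ₁ σ₂)) := by
    refine isFrameAt_of_linearIndependent hs hli (Eventually.of_forall fun y => ?_)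
    exact (finrank_le_of_finiteDimensional (V := Covector E') inferInstance _).trans hcard.symm.le
  obtain ⟨V₁, hV₁, hy₁, hsub, -, e, he, hdual⟩ :=
    exists_dual_fields (fun i => (hs i).eventually.mono fun y hy => hy.smoothAt) hli
  obtain ⟨V₂, hV₂, hy₂, hall⟩ := exists_open_of_eventually (hθ.eventually.and (hθ₁.eventually.and
    (hθ₂.eventually.and (hfr.eventually.and ((eventually_all.2 fun i => (hσ₁ i).eventually).and
      (eventually_all.2 fun i => (hσ₂ i).eventually))))))
  have hsp : ∀ y ∈ V₂, Submodule.span ℝ (range fun i => Sum.elim θ (Sum.elim σ₁ σ₂) i y) = ⊤ :=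
    fun y hy => (hall y hy).2.2.2.1.self_of_nhds.2.2
  have hsm : ∀ y ∈ V₁ ∩ V₂, ∀ {κ : Type} [Fintype κ] (ε : κ → Fin _ ⊕ Fin _ ⊕ Fin _) k,
      SmoothAt I' (fun y => project (extd I' (θ k) y) (fun a => Sum.elim θ (Sum.elim σ₁ σ₂) (ε a) y)
        fun a => e (ε a) y) y := by
    intro y hy κ _ ε k
    have h1 := (hall y hy.2).2.2.2.1.self_of_nhds.1
    refine SmoothAt.fun_sum fun a _ => SmoothAt.fun_sum fun b _ => SmoothAt.smul ?_
      ((h1 (ε a)).wedge (h1 (ε b)))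
    simp only [div_eq_mul_inv]
    refine ContMDiffAt.mul (contMDiffAt_bil (SmoothAt.extd ?_) (he _ y hy.1) (he _ y hy.1)
      (hsub hy.1)) contMDiffAt_const
    exact ((hall y hy.2).1.isSectionAt k).eventually.mono fun z hz => hz.smoothAt
  refine ⟨V₁ ∩ V₂, θ, σ₁, σ₂,
    fun k y => project (extd I' (θ k) y) (fun a => σ₁ a y) fun a => e (Sum.inr (Sum.inl a)) y,
    fun k y => project (extd I' (θ k) y) (fun a => σ₂ a y) fun a => e (Sum.inr (Sum.inr a)) y,
    ⟨hy₁, hy₂⟩, ?_, fun y hy => (hall y hy.2).2.2.2.1⟩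
  exact
    { isOpen := hV₁.inter hV₂
      frame := fun y hy => (hall y hy.2).1
      frame₁ := fun y hy => (hall y hy.2).2.1
      frame₂ := fun y hy => (hall y hy.2).2.2.1
      section₁ := fun i y hy => (hall y hy.2).2.2.2.2.1 i
      section₂ := fun i y hy => (hall y hy.2).2.2.2.2.2 i
      smooth₁ := fun k y hy => hsm y hy (fun a => Sum.inr (Sum.inl a)) k
      smooth₂ := fun k y hy => hsm y hy (fun a => Sum.inr (Sum.inr a)) k
      lambda₁ := fun k y _ => project_mem_Lambda2 _ _ _
      lambda₂ := fun k y _ => project_mem_Lambda2 _ _ _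
      bil₁ := fun k y hy u hu v hv => by
        have key : ∀ w ∈ annSub (quotientSum I I₁ I₂ I' p₁ p₂ q (fun _ => ⊤) W₂ y),
            w = ∑ a, σ₁ a y (fun _ => w) • e (Sum.inr (Sum.inl a)) y := fun w hw => by
          refine (eq_sum_of_coframe (E := E') (hdual y hy.1) (hsp y hy.2) w).trans ?_
          have h1 := (hall y hy.2).2.2.1
          have h2 : ∀ i, θ i y (fun _ => w) = 0 := fun i => hw _ (h1.isSectionAt (Sum.inl i)).mem
          have h3 : ∀ i, σ₂ i y (fun _ => w) = 0 := fun i => hw _ (h1.isSectionAt (Sum.inr i)).mem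
          exact sum_elim_left_right _ h2 h3
        exact (bil_project (extd I' (θ k) y) (fun a => σ₁ a y) _ u v).trans
          (congrArg₂ (fun u v => bil (extd I' (θ k) y) u v) (key u hu).symm (key v hv).symm)
      bil₂ := fun k y hy u hu v hv => by
        have key : ∀ w ∈ annSub (quotientSum I I₁ I₂ I' p₁ p₂ q W₁ (fun _ => ⊤) y),
            w = ∑ a, σ₂ a y (fun _ => w) • e (Sum.inr (Sum.inr a)) y := fun w hw => by
          refine (eq_sum_of_coframe (E := E') (hdual y hy.1) (hsp y hy.2) w).trans ?_
          have h1 := (hall y hy.2).2.1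
          have h2 : ∀ i, θ i y (fun _ => w) = 0 := fun i => hw _ (h1.isSectionAt (Sum.inl i)).mem
          have h3 : ∀ i, σ₁ i y (fun _ => w) = 0 := fun i => hw _ (h1.isSectionAt (Sum.inr i)).mem
          exact sum_elim_right_right _ h2 h3
        exact (bil_project (extd I' (θ k) y) (fun a => σ₂ a y) _ u v).trans
          (congrArg₂ (fun u v => bil (extd I' (θ k) y) u v) (key u hu).symm (key v hv).symm) }

end IsSplitQuotient
end AdaptedCoframes

section SumSystems

open Filter Topology Module

variable {E : Type*} [NormedAddCommGroup E] [NormedSpace ℝ E] [FiniteDimensional ℝ E]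
  {H : Type*} [TopologicalSpace H] {I : ModelWithCorners ℝ E H} [I.Boundaryless]
  {M : Type*} [TopologicalSpace M] [ChartedSpace H M] [IsManifold I ∞ M]
  {E₁ : Type*} [NormedAddCommGroup E₁] [NormedSpace ℝ E₁] [FiniteDimensional ℝ E₁]
  {H₁ : Type*} [TopologicalSpace H₁] {I₁ : ModelWithCorners ℝ E₁ H₁} [I₁.Boundaryless]
  {M₁ : Type*} [TopologicalSpace M₁] [ChartedSpace H₁ M₁] [IsManifold I₁ ∞ M₁]
  {E₂ : Type*} [NormedAddCommGroup E₂] [NormedSpace ℝ E₂] [FiniteDimensional ℝ E₂]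
  {H₂ : Type*} [TopologicalSpace H₂] {I₂ : ModelWithCorners ℝ E₂ H₂} [I₂.Boundaryless]
  {M₂ : Type*} [TopologicalSpace M₂] [ChartedSpace H₂ M₂] [IsManifold I₂ ∞ M₂]
  {E' : Type*} [NormedAddCommGroup E'] [NormedSpace ℝ E'] [FiniteDimensional ℝ E']
  {H' : Type*} [TopologicalSpace H'] {I' : ModelWithCorners ℝ E' H'} [I'.Boundaryless]
  {N : Type*} [TopologicalSpace N] [ChartedSpace H' N] [IsManifold I' ∞ N]

/-- The pullbacks of the sections of `W₁` and `W₂` and their exterior derivatives. -/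
def sumGens (I : ModelWithCorners ℝ E H) (I₁ : ModelWithCorners ℝ E₁ H₁)
    (I₂ : ModelWithCorners ℝ E₂ H₂) (p₁ : M → M₁) (p₂ : M → M₂) (W₁ : CoField I₁ M₁)
    (W₂ : CoField I₂ M₂) : FormSystem I M := fun U k =>
  (pullback I I₁ p₁ '' pfaffianGens I₁ W₁ (p₁ '' U) k) ∪
  (pullback I I₂ p₂ '' pfaffianGens I₂ W₂ (p₂ '' U) k)

/-- The differential system generated by the pullbacks of the systems generated by `W₁` and `W₂`. -/
def sumSystem (I : ModelWithCorners ℝ E H) (I₁ : ModelWithCorners ℝ E₁ H₁)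
    (I₂ : ModelWithCorners ℝ E₂ H₂) (p₁ : M → M₁) (p₂ : M → M₂) (W₁ : CoField I₁ M₁)
    (W₂ : CoField I₂ M₂) : FormSystem I M :=
  generated I fun U k =>
    (pullback I I₁ p₁ '' pfaffian I₁ W₁ (p₁ '' U) k) ∪ (pullback I I₂ p₂ '' pfaffian I₂ W₂ (p₂ '' U) k)

variable {p₁ : M → M₁} {p₂ : M → M₂} {q : M → N} {W₁ : CoField I₁ M₁} {W₂ : CoField I₂ M₂}

theorem restricts_sumGens (p₁ : M → M₁) (p₂ : M → M₂) (W₁ : CoField I₁ M₁) (W₂ : CoField I₂ M₂) :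
    Restricts (sumGens I I₁ I₂ p₁ p₂ W₁ W₂) := fun _ _ h k =>
  union_subset_union (image_mono (restricts_pfaffianGens W₁ _ _ (image_mono h) k))
    (image_mono (restricts_pfaffianGens W₂ _ _ (image_mono h) k))

theorem sumGens_symm (p₁ : M → M₁) (p₂ : M → M₂) (W₁ : CoField I₁ M₁) (W₂ : CoField I₂ M₂) :
    sumGens I I₂ I₁ p₂ p₁ W₂ W₁ = sumGens I I₁ I₂ p₁ p₂ W₁ W₂ :=
  funext fun _ => funext fun _ => union_comm _ _

theorem pfaffianGens_cases {W : CoField I M} {U : Set M} {p : ∀ k, DForm I M k → Prop}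
    (h1 : ∀ θ ∈ sections I W U, p 1 θ) (h2 : ∀ θ ∈ sections I W U, p 2 (extd I θ)) :
    ∀ k, ∀ φ ∈ pfaffianGens I W U k, p k φ :=
  gens12_cases h1 (by rintro _ ⟨θ, hθ, rfl⟩; exact h2 θ hθ)

theorem sumGens_cases {U : Set M} {p : ∀ k, DForm I M k → Prop}
    (h1 : ∀ θ ∈ sections I₁ W₁ (p₁ '' U), p 1 (pullback I I₁ p₁ θ))
    (h1' : ∀ θ ∈ sections I₁ W₁ (p₁ '' U), p 2 (pullback I I₁ p₁ (extd I₁ θ)))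
    (h2 : ∀ θ ∈ sections I₂ W₂ (p₂ '' U), p 1 (pullback I I₂ p₂ θ))
    (h2' : ∀ θ ∈ sections I₂ W₂ (p₂ '' U), p 2 (pullback I I₂ p₂ (extd I₂ θ))) :
    ∀ k, ∀ φ ∈ sumGens I I₁ I₂ p₁ p₂ W₁ W₂ U k, p k φ := by
  rintro k _ (⟨χ, hχ, rfl⟩ | ⟨χ, hχ, rfl⟩)
  · exact pfaffianGens_cases (p := fun k χ => p k (pullback I I₁ p₁ χ)) h1 h1' k χ hχ
  · exact pfaffianGens_cases (p := fun k χ => p k (pullback I I₂ p₂ χ)) h2 h2' k χ hχ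

theorem inGerm_pullback_section (hp : Continuous p₁) {x : M} {θ : DForm I₁ M₁ 1}
    (hθ : IsSectionAt I₁ W₁ (p₁ x) θ) :
    InGerm (sumGens I I₁ I₂ p₁ p₂ W₁ W₂) x 1 (pullback I I₁ p₁ θ) ∧
    InGerm (sumGens I I₁ I₂ p₁ p₂ W₁ W₂) x 2 (pullback I I₁ p₁ (extd I₁ θ)) := by
  obtain ⟨V, hV, hx, -, h⟩ := IsSectionAt.exists_mem_sections (ι := Unit) (fun _ => hθ) univ_mem
  have h' : θ ∈ sections I₁ W₁ (p₁ '' (p₁ ⁻¹' V)) := sections_mono (image_preimage_subset _ _) (h ())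
  exact ⟨InGerm.gen (hV.preimage hp) hx (Or.inl ⟨θ, h', rfl⟩),
    InGerm.gen (hV.preimage hp) hx (Or.inl ⟨_, ⟨θ, h', rfl⟩, rfl⟩)⟩

theorem inGerm_pullback_section' (hp : Continuous p₂) {x : M} {θ : DForm I₂ M₂ 1}
    (hθ : IsSectionAt I₂ W₂ (p₂ x) θ) :
    InGerm (sumGens I I₁ I₂ p₁ p₂ W₁ W₂) x 1 (pullback I I₂ p₂ θ) ∧
    InGerm (sumGens I I₁ I₂ p₁ p₂ W₁ W₂) x 2 (pullback I I₂ p₂ (extd I₂ θ)) := by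
  rw [← sumGens_symm p₁ p₂]
  exact inGerm_pullback_section hp hθ

theorem sumGens_extd (hp₁ : ContMDiff I I₁ ∞ p₁) (ho₁ : IsOpenMap p₁) {U : Set M} (hU : IsOpen U)
    {θ : DForm I₁ M₁ 1} (hθ : θ ∈ sections I₁ W₁ (p₁ '' U)) :
    (∀ x ∈ U, SmoothAt I (pullback I I₁ p₁ θ) x ∧ SmoothAt I (pullback I I₁ p₁ (extd I₁ θ)) x) ∧
    AlgIdeal I U (sumGens I I₁ I₂ p₁ p₂ W₁ W₂ U) 2 (extd I (pullback I I₁ p₁ θ)) ∧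
    AlgIdeal I U (sumGens I I₁ I₂ p₁ p₂ W₁ W₂ U) 3 (extd I (pullback I I₁ p₁ (extd I₁ θ))) := by
  have hs : ∀ x ∈ U, ∀ᶠ z in 𝓝 (p₁ x), SmoothAt I₁ θ z := fun x hx =>
    Filter.mem_of_superset ((ho₁ U hU).mem_nhds ⟨x, hx, rfl⟩) fun z hz => hθ.1 z hz
  refine ⟨fun x hx => ⟨(hs x hx).self_of_nhds.pullback (hp₁ x), (SmoothAt.extd (hs x hx)).pullback (hp₁ x)⟩,
    AlgIdeal.congr _ _ _ (fun x hx => (extd_pullback (hs x hx).self_of_nhds (hp₁ x)).symm)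
      (AlgIdeal.gen 2 _ (Or.inl ⟨_, ⟨θ, hθ, rfl⟩, rfl⟩)),
    AlgIdeal.congr _ _ _ (fun x hx => ?_) (AlgIdeal.zero 3)⟩
  rw [extd_pullback (SmoothAt.extd (hs x hx)) (hp₁ x)]
  refine Eq.symm ((pullback_congr_form (ψ := 0) (extd_extd (hs x hx))).trans ?_)
  exact map_zero (pullbackAt I I₁ p₁ 3 x)

theorem isDifferentialSystem_generated_sumGens (h : IsSplitting I I₁ I₂ p₁ p₂) :
    IsDifferentialSystem I (generated I (sumGens I I₁ I₂ p₁ p₂ W₁ W₂)) := by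
  have h1 : ∀ U, IsOpen U → ∀ θ ∈ sections I₁ W₁ (p₁ '' U), _ := fun U hU θ hθ =>
    sumGens_extd (I₂ := I₂) (p₂ := p₂) (W₂ := W₂) h.smooth₁ h.isOpenMap₁ hU hθ
  have h2 : ∀ U, IsOpen U → ∀ θ ∈ sections I₂ W₂ (p₂ '' U), _ := fun U hU θ hθ =>
    sumGens_extd (I₂ := I₁) (p₂ := p₁) (W₂ := W₁) h.smooth₂ h.isOpenMap₂ hU hθ
  rw [sumGens_symm p₁ p₂] at h2
  refine isDifferentialSystem_generated (restricts_sumGens p₁ p₂ W₁ W₂) ?_ ?_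
  · intro U hU
    exact sumGens_cases (p := fun k φ => ∀ x ∈ U, SmoothAt I φ x)
      (fun θ hθ x hx => ((h1 U hU θ hθ).1 x hx).1) (fun θ hθ x hx => ((h1 U hU θ hθ).1 x hx).2)
      (fun θ hθ x hx => ((h2 U hU θ hθ).1 x hx).1) (fun θ hθ x hx => ((h2 U hU θ hθ).1 x hx).2)
  · intro U hU
    exact sumGens_cases (p := fun k φ => AlgIdeal I U (sumGens I I₁ I₂ p₁ p₂ W₁ W₂ U) (k + 1) (extd I φ))
      (fun θ hθ => (h1 U hU θ hθ).2.1) (fun θ hθ => (h1 U hU θ hθ).2.2)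
      (fun θ hθ => (h2 U hU θ hθ).2.1) (fun θ hθ => (h2 U hU θ hθ).2.2)

theorem inGerm_pullback_pfaffian (hp : ContMDiff I I₁ ∞ p₁) {V : Set M₁} {k : ℕ}
    {χ : DForm I₁ M₁ k} (hχ : χ ∈ pfaffian I₁ W₁ V k) {x : M} (hx : p₁ x ∈ V) :
    InGerm (sumGens I I₁ I₂ p₁ p₂ W₁ W₂) x k (pullback I I₁ p₁ χ) := by
  obtain ⟨V', hV', hx', -, h⟩ := hχ.2 _ hx
  refine InGerm.pullback (S := pfaffianGens I₁ W₁) (restricts_sumGens p₁ p₂ W₁ W₂)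
    (Eventually.of_forall fun z => hp z) (fun U hU hxU => ?_) ⟨V', hV', hx', h⟩
  exact pfaffianGens_cases
    (fun θ hθ => (inGerm_pullback_section hp.continuous (isSectionAt_of_mem_sections hU hxU hθ)).1)
    fun θ hθ => (inGerm_pullback_section hp.continuous (isSectionAt_of_mem_sections hU hxU hθ)).2

theorem pfaffianGens_subset {W : CoField I M} {V : Set M} (hV : IsOpen V) (k : ℕ) :
    pfaffianGens I W V k ⊆ pfaffian I W V k := fun φ hφ => by
  rw [pfaffian_eq, mem_generated (restricts_pfaffianGens W) hV]
  refine ⟨fun x hx => ?_, fun x hx => InGerm.gen hV hx hφ⟩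
  have hs : ∀ θ ∈ sections I W V, ∀ᶠ z in 𝓝 x, SmoothAt I θ z := fun θ hθ =>
    Filter.mem_of_superset (hV.mem_nhds hx) fun z hz => hθ.1 z hz
  exact pfaffianGens_cases (p := fun k φ => SmoothAt I φ x) (fun θ hθ => (hs θ hθ).self_of_nhds)
    (fun θ hθ => SmoothAt.extd (hs θ hθ)) k φ hφ

theorem sumSystem_eq (h : IsSplitting I I₁ I₂ p₁ p₂) {U : Set M} (hU : IsOpen U) (k : ℕ) :
    sumSystem I I₁ I₂ p₁ p₂ W₁ W₂ U k = generated I (sumGens I I₁ I₂ p₁ p₂ W₁ W₂) U k := by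
  ext φ
  rw [mem_generated (restricts_sumGens p₁ p₂ W₁ W₂) hU]
  constructor
  · refine fun hφ => ⟨hφ.1, fun x hx => ?_⟩
    obtain ⟨V, hV, hxV, -, hφ⟩ := hφ.2 x hx
    refine hφ.inGerm hV hxV (restricts_sumGens p₁ p₂ W₁ W₂) ?_
    rintro k _ (⟨χ, hχ, rfl⟩ | ⟨χ, hχ, rfl⟩)
    · exact inGerm_pullback_pfaffian h.smooth₁ hχ ⟨x, hxV, rfl⟩
    · rw [← sumGens_symm p₁ p₂]
      exact inGerm_pullback_pfaffian h.smooth₂ hχ ⟨x, hxV, rfl⟩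
  · refine fun hφ => ⟨hφ.1, fun x hx => ?_⟩
    obtain ⟨V, hV, hxV, hφ⟩ := hφ.2 x hx
    refine ⟨V ∩ U, hV.inter hU, ⟨hxV, hx⟩, inter_subset_right, hφ.mono inter_subset_left fun k φ hφ => ?_⟩
    rcases restricts_sumGens p₁ p₂ W₁ W₂ _ _ (inter_subset_left (t := U)) k hφ with ⟨χ, hχ, rfl⟩ | ⟨χ, hχ, rfl⟩
    · exact Or.inl ⟨χ, pfaffianGens_subset (h.isOpenMap₁ _ (hV.inter hU)) k hχ, rfl⟩
    · exact Or.inr ⟨χ, pfaffianGens_subset (h.isOpenMap₂ _ (hV.inter hU)) k hχ, rfl⟩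

theorem IsDifferentialSystem.of_eq {𝓘 𝓙 : FormSystem I M} (h : IsDifferentialSystem I 𝓘)
    (he : ∀ U, IsOpen U → ∀ k, 𝓙 U k = 𝓘 U k) : IsDifferentialSystem I 𝓙 where
  smooth U hU k φ hφ := h.smooth U hU k φ (he U hU k ▸ hφ)
  congr U hU k φ hφ η hη := he U hU k ▸ h.congr U hU k φ (he U hU k ▸ hφ) η hη
  restrict U V hU hV hVU k := he U hU k ▸ he V hV k ▸ h.restrict U V hU hV hVU k
  glue U hU k φ hφ := he U hU k ▸ h.glue U hU k φ fun x hx => by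
    obtain ⟨V, hV, hxV, hVU, h⟩ := hφ x hx
    exact ⟨V, hV, hxV, hVU, he V hV k ▸ h⟩
  zero U hU k := he U hU k ▸ h.zero U hU k
  add U hU k φ hφ η hη := he U hU k ▸ h.add U hU k φ (he U hU k ▸ hφ) η (he U hU k ▸ hη)
  smul U hU k f hf φ hφ := he U hU k ▸ h.smul U hU k f hf φ (he U hU k ▸ hφ)
  wedge_mem U hU k l α hα φ hφ :=
    he U hU (k + l) ▸ h.wedge_mem U hU k l α hα φ (he U hU l ▸ hφ)
  extd_mem U hU k φ hφ := he U hU (k + 1) ▸ h.extd_mem U hU k φ (he U hU k ▸ hφ)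

end SumSystems

section Generation

open Filter Topology Module

variable {E : Type*} [NormedAddCommGroup E] [NormedSpace ℝ E] [FiniteDimensional ℝ E]
  {H : Type*} [TopologicalSpace H] {I : ModelWithCorners ℝ E H} [I.Boundaryless]
  {M : Type*} [TopologicalSpace M] [ChartedSpace H M] [IsManifold I ∞ M]
  {E₁ : Type*} [NormedAddCommGroup E₁] [NormedSpace ℝ E₁] [FiniteDimensional ℝ E₁]
  {H₁ : Type*} [TopologicalSpace H₁] {I₁ : ModelWithCorners ℝ E₁ H₁} [I₁.Boundaryless]
  {M₁ : Type*} [TopologicalSpace M₁] [ChartedSpace H₁ M₁] [IsManifold I₁ ∞ M₁]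
  {E₂ : Type*} [NormedAddCommGroup E₂] [NormedSpace ℝ E₂] [FiniteDimensional ℝ E₂]
  {H₂ : Type*} [TopologicalSpace H₂] {I₂ : ModelWithCorners ℝ E₂ H₂} [I₂.Boundaryless]
  {M₂ : Type*} [TopologicalSpace M₂] [ChartedSpace H₂ M₂] [IsManifold I₂ ∞ M₂]
  {E' : Type*} [NormedAddCommGroup E'] [NormedSpace ℝ E'] [FiniteDimensional ℝ E']
  {H' : Type*} [TopologicalSpace H'] {I' : ModelWithCorners ℝ E' H'} [I'.Boundaryless]
  {N : Type*} [TopologicalSpace N] [ChartedSpace H' N] [IsManifold I' ∞ N]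

variable {p₁ : M → M₁} {p₂ : M → M₂} {q : M → N} {W₁ : CoField I₁ M₁} {W₂ : CoField I₂ M₂}
  {V : Set N} {r m n : ℕ} {θ : Fin r → DForm I' N 1} {σ₁ : Fin m → DForm I' N 1}
  {σ₂ : Fin n → DForm I' N 1} {Ω₁ Ω₂ : Fin r → DForm I' N 2}

theorem IsSectionAt.pullback_left (hp : ContMDiff I I₁ ∞ p₁) {x : M} {β : DForm I₁ M₁ 1}
    (hβ : IsSectionAt I₁ W₁ (p₁ x) β) :
    IsSectionAt I (sumBundle I I₁ I₂ p₁ p₂ W₁ W₂) x (pullback I I₁ p₁ β) := by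
  filter_upwards [hp.continuous.continuousAt.eventually hβ] with z hz
  exact ⟨hz.1.pullback (hp z), pullback_left_mem_sumBundle hz.2⟩

theorem IsSectionAt.sum_const_smul {ι : Type*} [Fintype ι] {W : CoField I M} {x : M} {β : ι → DForm I M 1}
    (h : ∀ i, IsSectionAt I W x (β i)) (c : ι → ℝ) : IsSectionAt I W x (fun y => ∑ i, c i • β i y) :=
  IsSectionAt.sum_smul (a := fun i _ => c i) h (Eventually.of_forall fun _ _ => contMDiffAt_const)

theorem pullback_sum_const_smul {ι : Type*} [Fintype ι] (c : ι → ℝ) (β : ι → DForm I₁ M₁ 1) (x : M) :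
    pullback I I₁ p₁ (fun y => ∑ i, c i • β i y) x = ∑ i, c i • pullback I I₁ p₁ (β i) x :=
  pullback_sum_smul p₁ (fun i _ => c i) β x

namespace IsSplitQuotient

theorem bil_component_sum₂ (h : IsSplitQuotient I I₁ I₂ I' p₁ p₂ q W₁ W₂)
    (hV : IsAdaptedCoframe I I₁ I₂ I' p₁ p₂ q W₁ W₂ V θ σ₁ σ₂ Ω₁ Ω₂) {x : M} (hx : q x ∈ V) (k : Fin r)
    {κ₁ κ₂ : Type*} [Fintype κ₁] [Fintype κ₂] {β₁ : κ₁ → DForm I₁ M₁ 1} {β₂ : κ₂ → DForm I₂ M₂ 1}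
    (h₁ : ∀ i, IsSectionAt I₁ W₁ (p₁ x) (β₁ i)) (h₂ : ∀ i, IsSectionAt I₂ W₂ (p₂ x) (β₂ i))
    {c : κ₁ → ℝ} {d : κ₂ → ℝ} (heq : pullback I I' q (θ k) x =
      ∑ i, c i • pullback I I₁ p₁ (β₁ i) x + ∑ j, d j • pullback I I₂ p₂ (β₂ j) x)
    {u v : TangentSpace I x} (hu : u ∈ annSub (sumBundle I I₁ I₂ p₁ p₂ W₁ W₂ x))
    (hv : v ∈ annSub (sumBundle I I₁ I₂ p₁ p₂ W₁ W₂ x)) :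
    bil (Ω₂ k (q x)) (mfderiv I I' q x u) (mfderiv I I' q x v) =
      ∑ i, c i * bil (extd I₁ (β₁ i) (p₁ x)) (mfderiv I I₁ p₁ x u) (mfderiv I I₁ p₁ x v) := by
  rw [← pullback_sum_const_smul, ← pullback_sum_const_smul] at heq
  have h3 := IsSectionAt.sum_const_smul h₁ c
  rw [h.bil_component₂ hV hx k h3 (IsSectionAt.sum_const_smul h₂ d) heq hu hv]
  exact bil_extd_eq_sum (h.isSubbundleAt₁ _) h3 h₁ rfl (mem_annSub_sumBundle.1 hu).1
    (mem_annSub_sumBundle.1 hv).1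

theorem exists_component_coeff (h : IsSplitQuotient I I₁ I₂ I' p₁ p₂ q W₁ W₂)
    (hV : IsAdaptedCoframe I I₁ I₂ I' p₁ p₂ q W₁ W₂ V θ σ₁ σ₂ Ω₁ Ω₂) {x : M} (hx : q x ∈ V)
    {κ₁ κ₂ : Type*} [Fintype κ₁] [Fintype κ₂] {β₁ : κ₁ → DForm I₁ M₁ 1} {β₂ : κ₂ → DForm I₂ M₂ 1}
    (h₁ : IsFrameAt I₁ W₁ (p₁ x) β₁) (h₂ : IsFrameAt I₂ W₂ (p₂ x) β₂) :
    ∃ (a : Fin r → κ₁ → M → ℝ) (b : Fin r → κ₂ → M → ℝ), ∀ᶠ z in 𝓝 x,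
      (∀ k i, ContMDiffAt I 𝓘(ℝ, ℝ) ∞ (a k i) z) ∧
      ∀ k, pullback I I' q (θ k) z =
        ∑ i, a k i z • pullback I I₁ p₁ (β₁ i) z + ∑ j, b k j z • pullback I I₂ p₂ (β₂ j) z := by
  have hs : ∀ k, IsSectionAt I (sumBundle I I₁ I₂ p₁ p₂ W₁ W₂) x (pullback I I' q (θ k)) := fun k => by
    filter_upwards [h.smooth.continuous.continuousAt.eventually ((hV.frame _ hx).isSectionAt k)] with z hz
    exact ⟨hz.1.pullback (h.smooth z), hz.2 z rfl⟩
  choose c hc using fun k => (h.split.isFrameAt_sumBundle h₁ h₂).exists_coeff (hs k)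
  refine ⟨fun k i => c k (Sum.inl i), fun k j => c k (Sum.inr j), ?_⟩
  filter_upwards [eventually_all.2 hc] with z hz
  refine ⟨fun k i => (hz k).1 _, fun k => (hz k).2.trans ?_⟩
  rw [Fintype.sum_sum_type]
  rfl

/-- The exterior derivative of a section of `W₁` is a combination of the 2-forms `Ω₂`. -/
theorem exists_bil_extd_eq (h : IsSplitQuotient I I₁ I₂ I' p₁ p₂ q W₁ W₂)
    (hV : IsAdaptedCoframe I I₁ I₂ I' p₁ p₂ q W₁ W₂ V θ σ₁ σ₂ Ω₁ Ω₂) {x : M} (hx : q x ∈ V)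
    {β : DForm I₁ M₁ 1} (hβ : IsSectionAt I₁ W₁ (p₁ x) β) :
    ∃ f : Fin r → M → ℝ, ∀ᶠ z in 𝓝 x, (∀ k, ContMDiffAt I 𝓘(ℝ, ℝ) ∞ (f k) z) ∧
      ∀ u ∈ annSub (sumBundle I I₁ I₂ p₁ p₂ W₁ W₂ z), ∀ v ∈ annSub (sumBundle I I₁ I₂ p₁ p₂ W₁ W₂ z),
      bil (extd I₁ β (p₁ z)) (mfderiv I I₁ p₁ z u) (mfderiv I I₁ p₁ z v) =
        ∑ k, f k z * bil (Ω₂ k (q z)) (mfderiv I I' q z u) (mfderiv I I' q z v) := by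
  obtain ⟨r₁, β₁, h₁⟩ := h.isSubbundleAt₁ (p₁ x)
  obtain ⟨r₂, β₂, h₂⟩ := h.isSubbundleAt₂ (p₂ x)
  obtain ⟨a, b, hab⟩ := h.exists_component_coeff hV hx h₁ h₂
  let A : CoField I M := sumBundle I I₁ I₂ p₁ p₂ W₁ (fun _ => ⊥)
  have hA : IsSubbundleAt I A x := h.split.isSubbundleAt_sumBundle ⟨_, _, h₁⟩ (isSubbundleAt_bot _)
  have hs : ∀ k, IsSectionAt I A x (fun z => ∑ i, a k i z • pullback I I₁ p₁ (β₁ i) z) := fun k =>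
    IsSectionAt.sum_smul (fun i => (h₁.isSectionAt i).pullback_left h.split.smooth₁)
      (hab.mono fun z hz => hz.1 k)
  have hsp : Submodule.span ℝ (range fun k => ∑ i, a k i x • pullback I I₁ p₁ (β₁ i) x) = A x := by
    refine le_antisymm (Submodule.span_le.2 ?_) fun c hc => ?_
    · rintro _ ⟨k, rfl⟩
      exact (hs k).mem
    obtain ⟨a', ha', b', hb', rfl⟩ := mem_sumBundle.1 hc
    obtain ⟨c, hc, b'', hb'', heq⟩ := h.exists_covector x ha'
    rw [← (hV.frame _ hx).self_of_nhds.2.2] at hc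
    obtain ⟨t, rfl⟩ := (Submodule.mem_span_range_iff_exists_fun ℝ).1 hc
    have h3 : pullbackAt I I' q 1 x (∑ k, t k • θ k (q x)) = ∑ k, t k • pullback I I' q (θ k) x := by
      rw [map_sum]
      exact Finset.sum_congr rfl fun k _ => map_smul _ _ _
    have h4 : pullbackAt I I' q 1 x (∑ k, t k • θ k (q x)) =
        pullback I I₁ p₁ (fun y => ∑ k, t k • ∑ i, a k i x • β₁ i y) x +
        pullback I I₂ p₂ (fun y => ∑ k, t k • ∑ j, b k j x • β₂ j y) x := by
      rw [h3, pullback_sum_const_smul (β := fun k y => ∑ i, a k i x • β₁ i y),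
        pullback_sum_const_smul (β := fun k y => ∑ j, b k j x • β₂ j y), ← Finset.sum_add_distrib]
      refine Finset.sum_congr rfl fun k _ => ?_
      rw [pullback_sum_const_smul, pullback_sum_const_smul, ← smul_add, hab.self_of_nhds.2 k]
    have h5 := (h.split.pullback_add_eq (heq.symm.trans h4)).1
    have h6 : pullbackAt I I₁ p₁ 1 x a' = ∑ k, t k • ∑ i, a k i x • pullback I I₁ p₁ (β₁ i) x := by
      rw [h5]
      refine (pullback_sum_const_smul (p₁ := p₁) t (fun k y => ∑ i, a k i x • β₁ i y) x).trans ?_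
      exact Finset.sum_congr rfl fun k _ => congrArg (t k • ·) (pullback_sum_const_smul _ _ _)
    rw [h6, (Submodule.mem_bot ℝ).1 hb', map_zero, add_zero]
    exact Submodule.sum_mem _ fun k _ => Submodule.smul_mem _ _ (Submodule.subset_span ⟨k, rfl⟩)
  obtain ⟨f, hf⟩ := exists_coeff_of_span hA hs hsp (hβ.pullback_left (I := I) (I₂ := I₂) (p₂ := p₂)
    (W₂ := fun _ => ⊥) h.split.smooth₁)
  refine ⟨f, ?_⟩
  filter_upwards [hf, hab, h.split.smooth₁.continuous.continuousAt.eventually h₁.eventually,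
    h.split.smooth₂.continuous.continuousAt.eventually h₂.eventually,
    h.smooth.continuous.continuousAt.eventually (hV.isOpen.mem_nhds hx),
    h.split.smooth₁.continuous.continuousAt.eventually hβ.eventually] with z hfz habz h₁z h₂z hqz hβz
  refine ⟨hfz.1, fun u hu v hv => ?_⟩
  have h3 : pullback I I₁ p₁ β z =
      pullback I I₁ p₁ (fun y => ∑ i, (∑ k, f k z * a k i z) • β₁ i y) z := by
    rw [hfz.2, pullback_sum_const_smul]
    simp only [Finset.smul_sum, Finset.sum_smul, smul_smul]
    exact Finset.sum_comm
  have h4 : β (p₁ z) = ∑ i, (∑ k, f k z * a k i z) • β₁ i (p₁ z) :=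
    (h.split.pullback_add_eq (x := z) (b := 0) (b' := 0) (congrArg (· + _) h3)).1
  rw [bil_extd_eq_sum (h.isSubbundleAt₁ _) hβz (fun i => h₁z.isSectionAt i) h4
    (mem_annSub_sumBundle.1 hu).1 (mem_annSub_sumBundle.1 hv).1]
  simp only [Finset.sum_mul]
  rw [Finset.sum_comm]
  refine Finset.sum_congr rfl fun k _ => ?_
  rw [h.bil_component_sum₂ hV hqz k (fun i => h₁z.isSectionAt i) (fun j => h₂z.isSectionAt j)
    (habz.2 k) hu hv, Finset.mul_sum]
  exact Finset.sum_congr rfl fun i _ => mul_assoc _ _ _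

end IsSplitQuotient
end Generation

section Generation

open Filter Topology Module

variable {E : Type*} [NormedAddCommGroup E] [NormedSpace ℝ E] [FiniteDimensional ℝ E]
  {H : Type*} [TopologicalSpace H] {I : ModelWithCorners ℝ E H} [I.Boundaryless]
  {M : Type*} [TopologicalSpace M] [ChartedSpace H M] [IsManifold I ∞ M]
  {E₁ : Type*} [NormedAddCommGroup E₁] [NormedSpace ℝ E₁] [FiniteDimensional ℝ E₁]
  {H₁ : Type*} [TopologicalSpace H₁] {I₁ : ModelWithCorners ℝ E₁ H₁} [I₁.Boundaryless]
  {M₁ : Type*} [TopologicalSpace M₁] [ChartedSpace H₁ M₁] [IsManifold I₁ ∞ M₁]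
  {E₂ : Type*} [NormedAddCommGroup E₂] [NormedSpace ℝ E₂] [FiniteDimensional ℝ E₂]
  {H₂ : Type*} [TopologicalSpace H₂] {I₂ : ModelWithCorners ℝ E₂ H₂} [I₂.Boundaryless]
  {M₂ : Type*} [TopologicalSpace M₂] [ChartedSpace H₂ M₂] [IsManifold I₂ ∞ M₂]
  {E' : Type*} [NormedAddCommGroup E'] [NormedSpace ℝ E'] [FiniteDimensional ℝ E']
  {H' : Type*} [TopologicalSpace H'] {I' : ModelWithCorners ℝ E' H'} [I'.Boundaryless]
  {N : Type*} [TopologicalSpace N] [ChartedSpace H' N] [IsManifold I' ∞ N]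

theorem IsFrameAt.inGerm {ι : Type*} [Fintype ι] {W : CoField I M} {x : M} {θ : ι → DForm I M 1}
    (hθ : IsFrameAt I W x θ) {T : FormSystem I M} (hT : Restricts T)
    (hθT : ∀ i, InGerm T x 1 (θ i)) {φ : DForm I M 1} (hφ : IsSectionAt I W x φ) : InGerm T x 1 φ := by
  obtain ⟨a, ha⟩ := hθ.exists_coeff hφ
  exact InGerm.congr hT (ha.mono fun y hy => hy.2.symm)
    (InGerm.fun_sum hT fun i _ => InGerm.smul hT (ha.mono fun y hy => hy.1 i) (hθT i))

theorem IsFrameAt.inGerm_of_bil_eq_sum {ι : Type*} [Fintype ι] {W : CoField I M} {x : M}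
    {θ : ι → DForm I M 1} (hθ : IsFrameAt I W x θ) {T : FormSystem I M} (hT : Restricts T)
    (hθT : ∀ i, InGerm T x 1 (θ i)) {κ : Type*} [Fintype κ] {ρ : DForm I M 2} {η : κ → DForm I M 2}
    {f : κ → M → ℝ} (hη : ∀ k, InGerm T x 2 (η k))
    (hs : ∀ᶠ y in 𝓝 x, SmoothAt I ρ y ∧ ∀ k, SmoothAt I (η k) y)
    (hf : ∀ᶠ y in 𝓝 x, (∀ k, ContMDiffAt I 𝓘(ℝ, ℝ) ∞ (f k) y) ∧ ∀ u ∈ annSub (W y),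
      ∀ v ∈ annSub (W y), bil (ρ y) u v = ∑ k, f k y * bil (η k y) u v) : InGerm T x 2 ρ := by
  have hg : ∀ᶠ y in 𝓝 x, SmoothAt I (fun y => ρ y + ∑ k, (-f k y) • η k y) y ∧
      ∀ u ∈ annSub (W y), ∀ v ∈ annSub (W y), bil (ρ y + ∑ k, (-f k y) • η k y) u v = 0 := by
    filter_upwards [hs, hf] with y hy hy'
    refine ⟨hy.1.add (SmoothAt.fun_sum fun k _ => SmoothAt.smul (hy'.1 k).neg (hy.2 k)),
      fun u hu v hv => ?_⟩
    rw [bil_add_left, bil_sum_left, hy'.2 u hu v hv, ← Finset.sum_add_distrib]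
    refine Finset.sum_eq_zero fun k _ => ?_
    rw [bil_smul_left, neg_mul, add_neg_cancel]
  obtain ⟨α, hα⟩ := hθ.exists_wedge hg
  have h1 : InGerm T x 2 (fun y => ∑ i, wedge (α i y) (θ i y)) :=
    InGerm.fun_sum hT fun i _ => InGerm.wedge_mul (k := 1) (l := 1) hT (hα.mono fun y hy => hy.1 i) (hθT i)
  have h2 : InGerm T x 2 (fun y => ∑ k, f k y • η k y) :=
    InGerm.fun_sum hT fun k _ => InGerm.smul hT (hf.mono fun y hy => hy.1 k) (hη k)
  refine InGerm.congr hT (hα.mono fun y hy => ?_) (InGerm.add hT h1 h2)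
  refine (congrArg (· + ∑ k, f k y • η k y) hy.2.symm).trans ?_
  rw [add_assoc, ← Finset.sum_add_distrib]
  refine (congrArg (ρ y + ·) (Finset.sum_eq_zero fun k _ => ?_)).trans (add_zero _)
  rw [← add_smul, neg_add_cancel, zero_smul]

theorem bil_bundlePullback {s : N → M} {h : ∀ y : N, TangentSpace I' y →L[ℝ] TangentSpace I (s y)}
    (φ : DForm I M 2) (y : N) (u v : TangentSpace I' y) :
    bil (bundlePullback s h φ y) u v = bil (φ (s y)) (h y u) (h y v) := by
  rw [bil_apply, bil_apply]
  refine congrArg (φ (s y)) (funext fun i => ?_)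
  fin_cases i <;> rfl

theorem bil_congr_point (ρ : DForm I' N 2) {y y' : N} (h : y' = y) (u v : E') :
    ((bil (ρ y') : E' →ₗ[ℝ] E' →ₗ[ℝ] ℝ) u) v = ((bil (ρ y) : E' →ₗ[ℝ] E' →ₗ[ℝ] ℝ) u) v := by
  subst h
  rfl

theorem bundlePullback_pullback_eq {s : N → M} {h : ∀ y : N, TangentSpace I' y →L[ℝ] TangentSpace I (s y)}
    {q : M → N} {y : N} (hy : q (s y) = y) (hh : ∀ v : E', mfd I I' q (s y) (h y v) = v) {k : ℕ}
    (φ : DForm I' N k) : bundlePullback s h (pullback I I' q φ) y = φ y := by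
  have key : ∀ y', y' = y → ∀ v : Fin k → E', (φ y' : E' [⋀^Fin k]→L[ℝ] ℝ) v = (φ y : E' [⋀^Fin k]→L[ℝ] ℝ) v := by
    rintro _ rfl v
    rfl
  refine ContinuousAlternatingMap.ext fun v => Eq.trans ?_ (key _ hy v)
  exact congrArg (φ (q (s y)) : E' [⋀^Fin k]→L[ℝ] ℝ) (funext fun i => hh (v i))

variable {p₁ : M → M₁} {p₂ : M → M₂} {q : M → N} {W₁ : CoField I₁ M₁} {W₂ : CoField I₂ M₂}
  {V : Set N} {r m n : ℕ} {θ : Fin r → DForm I' N 1} {σ₁ : Fin m → DForm I' N 1}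
  {σ₂ : Fin n → DForm I' N 1} {Ω₁ Ω₂ : Fin r → DForm I' N 2}

namespace IsSplitQuotient

theorem inGerm_of_isSectionAt (h : IsSplitQuotient I I₁ I₂ I' p₁ p₂ q W₁ W₂) {x : M} {φ : DForm I M 1}
    (hφ : IsSectionAt I (sumBundle I I₁ I₂ p₁ p₂ W₁ W₂) x φ) :
    InGerm (sumGens I I₁ I₂ p₁ p₂ W₁ W₂) x 1 φ := by
  obtain ⟨r₁, β₁, h₁⟩ := h.isSubbundleAt₁ (p₁ x)
  obtain ⟨r₂, β₂, h₂⟩ := h.isSubbundleAt₂ (p₂ x)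
  refine (h.split.isFrameAt_sumBundle h₁ h₂).inGerm (restricts_sumGens p₁ p₂ W₁ W₂) ?_ hφ
  rintro (i | i)
  · exact (inGerm_pullback_section h.split.smooth₁.continuous (h₁.isSectionAt i)).1
  · exact (inGerm_pullback_section' h.split.smooth₂.continuous (h₂.isSectionAt i)).1

theorem inGerm_pullback_frame (h : IsSplitQuotient I I₁ I₂ I' p₁ p₂ q W₁ W₂)
    (hV : IsAdaptedCoframe I I₁ I₂ I' p₁ p₂ q W₁ W₂ V θ σ₁ σ₂ Ω₁ Ω₂) {x : M} (hx : q x ∈ V) (k : Fin r) :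
    InGerm (sumGens I I₁ I₂ p₁ p₂ W₁ W₂) x 1 (pullback I I' q (θ k)) := by
  refine h.inGerm_of_isSectionAt ?_
  filter_upwards [h.smooth.continuous.continuousAt.eventually ((hV.frame _ hx).isSectionAt k)] with z hz
  exact ⟨hz.1.pullback (h.smooth z), hz.2 z rfl⟩

theorem inGerm_pullback_component₂ (h : IsSplitQuotient I I₁ I₂ I' p₁ p₂ q W₁ W₂)
    (hV : IsAdaptedCoframe I I₁ I₂ I' p₁ p₂ q W₁ W₂ V θ σ₁ σ₂ Ω₁ Ω₂) {x : M} (hx : q x ∈ V) (k : Fin r) :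
    InGerm (sumGens I I₁ I₂ p₁ p₂ W₁ W₂) x 2 (pullback I I' q (Ω₂ k)) := by
  obtain ⟨r₁, β₁, h₁⟩ := h.isSubbundleAt₁ (p₁ x)
  obtain ⟨r₂, β₂, h₂⟩ := h.isSubbundleAt₂ (p₂ x)
  obtain ⟨a, b, hab⟩ := h.exists_component_coeff hV hx h₁ h₂
  have hfr := h.split.isFrameAt_sumBundle h₁ h₂
  refine hfr.inGerm_of_bil_eq_sum (restricts_sumGens p₁ p₂ W₁ W₂)
    (fun i => h.inGerm_of_isSectionAt (hfr.isSectionAt i))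
    (fun i => (inGerm_pullback_section h.split.smooth₁.continuous (h₁.isSectionAt i)).2)
    (f := fun i => a k i) ?_ ?_
  · filter_upwards [h.split.smooth₁.continuous.continuousAt.eventually h₁.eventually,
      h.smooth.continuous.continuousAt.eventually (hV.isOpen.mem_nhds hx)] with z h₁z hqz
    refine ⟨(hV.smooth₂ k _ hqz).pullback (h.smooth z), fun i => ?_⟩
    exact (SmoothAt.extd ((h₁z.isSectionAt i).eventually.mono fun w hw => hw.smoothAt)).pullback
      (h.split.smooth₁ z)
  · filter_upwards [hab, h.split.smooth₁.continuous.continuousAt.eventually h₁.eventually,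
      h.split.smooth₂.continuous.continuousAt.eventually h₂.eventually,
      h.smooth.continuous.continuousAt.eventually (hV.isOpen.mem_nhds hx)] with z habz h₁z h₂z hqz
    refine ⟨fun i => habz.1 k i, fun u hu v hv => ?_⟩
    rw [bil_pullback, h.bil_component_sum₂ hV hqz k (fun i => h₁z.isSectionAt i)
      (fun j => h₂z.isSectionAt j) (habz.2 k) hu hv]
    exact Finset.sum_congr rfl fun i _ => congrArg (_ * ·) (bil_pullback p₁ _ z u v).symm

theorem inGerm_bundlePullback (h : IsSplitQuotient I I₁ I₂ I' p₁ p₂ q W₁ W₂)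
    (hV : IsAdaptedCoframe I I₁ I₂ I' p₁ p₂ q W₁ W₂ V θ σ₁ σ₂ Ω₁ Ω₂) {x : M} (hx : q x ∈ V)
    {T : FormSystem I' N} (hT : Restricts T) (hθT : ∀ i, InGerm T (q x) 1 (θ i))
    (hΩT : ∀ k, InGerm T (q x) 2 (Ω₂ k)) {s : N → M}
    {l : ∀ y : N, TangentSpace I' y →L[ℝ] TangentSpace I (s y)} (hsx : s (q x) = x)
    (hl : SmoothBundleMapAt (I := I) (I' := I') s l (q x))
    (hlift : ∀ᶠ y in 𝓝 (q x), q (s y) = y ∧ (∀ v : E', mfd I I' q (s y) (l y v) = v) ∧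
      ∀ u ∈ annSub (quotientSum I I₁ I₂ I' p₁ p₂ q W₁ W₂ y),
        l y u ∈ annSub (sumBundle I I₁ I₂ p₁ p₂ W₁ W₂ (s y)))
    {β : DForm I₁ M₁ 1} (hβ : IsSectionAt I₁ W₁ (p₁ x) β) :
    InGerm T (q x) 1 (bundlePullback s l (pullback I I₁ p₁ β)) ∧
    InGerm T (q x) 2 (bundlePullback s l (pullback I I₁ p₁ (extd I₁ β))) := by
  have hst : Tendsto s (𝓝 (q x)) (𝓝 x) := by
    have := hl.self_of_nhds.1.continuousAt
    rwa [ContinuousAt, hsx] at this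
  have hβ' : ∀ᶠ z in 𝓝 x, IsSectionAt I₁ W₁ (p₁ z) β :=
    h.split.smooth₁.continuous.continuousAt.eventually hβ.eventually
  constructor
  · refine (hV.frame _ hx).inGerm hT hθT ?_
    filter_upwards [hl, hlift, hst.eventually hβ'] with y hy hy' hβy
    refine ⟨hy.2 1 _ (hβy.smoothAt.pullback (h.split.smooth₁ _)), mem_of_annSub (E := E') fun v hv => ?_⟩
    exact (mem_annSub_sumBundle.1 (hy'.2.2 v hv)).1 _ hβy.mem
  · obtain ⟨f, hf⟩ := h.exists_bil_extd_eq hV hx hβ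
    refine (hV.frame _ hx).inGerm_of_bil_eq_sum hT hθT hΩT (f := fun k y => f k (s y)) ?_ ?_
    · filter_upwards [hl, hst.eventually hβ', hV.isOpen.mem_nhds hx] with y hy hβy hyV
      refine ⟨hy.2 2 _ (SmoothAt.pullback (SmoothAt.extd (hβy.eventually.mono fun w hw => hw.smoothAt))
        (h.split.smooth₁ _)), fun k => hV.smooth₂ k y hyV⟩
    · filter_upwards [hl, hlift, hst.eventually hf] with y hy hy' hfy
      refine ⟨fun k => ContMDiffAt.comp y (hfy.1 k) hy.1, fun u hu v hv => ?_⟩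
      rw [bil_bundlePullback]
      refine (bil_pullback p₁ (extd I₁ β) (s y) _ _).trans
        ((hfy.2 _ (hy'.2.2 u hu) _ (hy'.2.2 v hv)).trans (Finset.sum_congr rfl fun k _ => ?_))
      refine congrArg (f k (s y) * ·) (Eq.trans ?_ (bil_congr_point (Ω₂ k) hy'.1 u v))
      exact congrArg₂ (fun a b : E' => ((bil (Ω₂ k (q (s y))) : E' →ₗ[ℝ] E' →ₗ[ℝ] ℝ) a) b)
        (hy'.2.1 u) (hy'.2.1 v)

theorem inGerm_of_pullback (h : IsSplitQuotient I I₁ I₂ I' p₁ p₂ q W₁ W₂)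
    (hV : IsAdaptedCoframe I I₁ I₂ I' p₁ p₂ q W₁ W₂ V θ σ₁ σ₂ Ω₁ Ω₂) {x : M} (hx : q x ∈ V)
    {T : FormSystem I' N} (hT : Restricts T) (hθT : ∀ i, InGerm T (q x) 1 (θ i))
    (hΩ₁ : ∀ k, InGerm T (q x) 2 (Ω₁ k)) (hΩ₂ : ∀ k, InGerm T (q x) 2 (Ω₂ k)) {k : ℕ} {φ : DForm I' N k}
    (hφ : InGerm (sumGens I I₁ I₂ p₁ p₂ W₁ W₂) x k (pullback I I' q φ)) : InGerm T (q x) k φ := by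
  obtain ⟨s, l, hsx, hl, hlift⟩ := exists_lift h.smooth h.submersion h.descends
    (h.split.isSubbundleAt_sumBundle (h.isSubbundleAt₁ _) (h.isSubbundleAt₂ _))
    (h.eq_zero_of_le₁ (fun _ => le_rfl) x)
  obtain ⟨U, hU, hxU, hφ⟩ := hφ
  refine InGerm.congr hT (hlift.mono fun y hy => bundlePullback_pullback_eq hy.1 hy.2.1 φ)
    (hφ.inGerm_bundlePullback hl hU (by rw [hsx]; exact hxU) hT ?_)
  have hs₁ : ∀ β ∈ sections I₁ W₁ (p₁ '' U), IsSectionAt I₁ W₁ (p₁ x) β := fun β hβ =>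
    isSectionAt_of_mem_sections (h.split.isOpenMap₁ U hU) ⟨x, hxU, rfl⟩ hβ
  have hs₂ : ∀ β ∈ sections I₂ W₂ (p₂ '' U), IsSectionAt I₂ W₂ (p₂ x) β := fun β hβ =>
    isSectionAt_of_mem_sections (h.split.isOpenMap₂ U hU) ⟨x, hxU, rfl⟩ hβ
  have hlift' := hlift
  rw [← sumBundle_symm p₁ p₂] at hlift'
  have k₁ := fun β hβ => h.inGerm_bundlePullback hV hx hT hθT hΩ₂ hsx hl hlift (hs₁ β hβ)
  have k₂ := fun β hβ => h.symm.inGerm_bundlePullback hV.symm hx hT hθT hΩ₁ hsx hl hlift' (hs₂ β hβ)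
  exact sumGens_cases (p := fun k ψ => InGerm T (q x) k (bundlePullback s l ψ)) (fun β hβ => (k₁ β hβ).1)
    (fun β hβ => (k₁ β hβ).2) (fun β hβ => (k₂ β hβ).1) fun β hβ => (k₂ β hβ).2

/-- The structure equations of the quotient system: some of the 2-forms may be omitted when they
vanish. -/
theorem algGeneratedOn (h : IsSplitQuotient I I₁ I₂ I' p₁ p₂ q W₁ W₂)
    (hV : IsAdaptedCoframe I I₁ I₂ I' p₁ p₂ q W₁ W₂ V θ σ₁ σ₂ Ω₁ Ω₂) {S : Set (DForm I' N 2)}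
    (hS : S ⊆ range Ω₁ ∪ range Ω₂) (hS₁ : ∀ k, Ω₁ k ∈ S ∨ ∀ y ∈ V, Ω₁ k y = 0)
    (hS₂ : ∀ k, Ω₂ k ∈ S ∨ ∀ y ∈ V, Ω₂ k y = 0) :
    AlgGeneratedOn I' V (quotientSystem I I' q (sumSystem I I₁ I₂ p₁ p₂ W₁ W₂)) (range θ) S := by
  intro U hU hUV k
  have hT : Restricts (fun _ : Set N => gens12 I' (range θ) S) := fun _ _ _ _ => subset_rfl
  have hz : ∀ {Ω : Fin r → DForm I' N 2}, (∀ k, Ω k ∈ S ∨ ∀ y ∈ V, Ω k y = 0) → ∀ k, ∀ y ∈ V,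
      InGerm (fun _ : Set N => gens12 I' (range θ) S) y 2 (Ω k) := fun hΩ k y hy => by
    rcases hΩ k with h1 | h1
    · exact InGerm.gen isOpen_univ (mem_univ _) h1
    · exact InGerm.congr hT (Filter.mem_of_superset (hV.isOpen.mem_nhds hy) fun z hz => (h1 z hz).symm)
        (InGerm.zero 2)
  ext φ
  rw [mem_generated hT hU]
  change (SmoothOn I' U φ ∧ pullback I I' q φ ∈ sumSystem I I₁ I₂ p₁ p₂ W₁ W₂ (q ⁻¹' U) k) ↔ _
  rw [sumSystem_eq h.split (hU.preimage h.smooth.continuous),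
    mem_generated (restricts_sumGens p₁ p₂ W₁ W₂) (hU.preimage h.smooth.continuous)]
  constructor
  · rintro ⟨h1, -, h2⟩
    refine ⟨h1, fun y hy => ?_⟩
    obtain ⟨x, rfl⟩ := h.surjective y
    exact h.inGerm_of_pullback hV (hUV hy) hT
      (fun i => InGerm.gen isOpen_univ (mem_univ _) (mem_range_self (f := θ) i))
      (fun k => hz hS₁ k _ (hUV hy)) (fun k => hz hS₂ k _ (hUV hy)) (h2 x hy)
  · rintro ⟨h1, h2⟩
    refine ⟨h1, fun x hx => SmoothAt.pullback (h1 _ hx) (h.smooth x), fun x hx => ?_⟩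
    refine InGerm.pullback (restricts_sumGens p₁ p₂ W₁ W₂) (Eventually.of_forall fun z => h.smooth z)
      (fun U' _ _ => gens12_cases ?_ ?_) (h2 _ hx)
    · rintro _ ⟨i, rfl⟩
      exact h.inGerm_pullback_frame hV (hUV hx) i
    · intro ρ hρ
      rcases hS hρ with ⟨k, rfl⟩ | ⟨k, rfl⟩
      · rw [← sumGens_symm p₁ p₂]
        exact h.symm.inGerm_pullback_component₂ hV.symm (hUV hx) k
      · exact h.inGerm_pullback_component₂ hV (hUV hx) k

theorem algGeneratedOn₁ (h : IsSplitQuotient I I₁ I₂ I' p₁ p₂ q W₁ W₂)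
    (hV : IsAdaptedCoframe I I₁ I₂ I' p₁ p₂ q W₁ W₂ V θ σ₁ σ₂ Ω₁ Ω₂) {S : Set (DForm I' N 2)}
    (hS : S ⊆ range Ω₂) (hS₂ : ∀ k, Ω₂ k ∈ S ∨ ∀ y ∈ V, Ω₂ k y = 0) :
    AlgGeneratedOn I' V (pfaffian I' (quotientSum I I₁ I₂ I' p₁ p₂ q W₁ fun _ => ⊤))
      (range θ ∪ range σ₁) S := by
  intro U hU hUV k
  let W : CoField I' N := quotientSum I I₁ I₂ I' p₁ p₂ q W₁ fun _ => ⊤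
  have hT : Restricts (fun _ : Set N => gens12 I' (range θ ∪ range σ₁) S) := fun _ _ _ _ => subset_rfl
  have hθT : ∀ y i, InGerm (fun _ : Set N => gens12 I' (range θ ∪ range σ₁) S) y 1 (Sum.elim θ σ₁ i) :=
    fun y i => InGerm.gen isOpen_univ (mem_univ _) (by
      rcases i with i | i
      · exact Or.inl ⟨i, rfl⟩
      · exact Or.inr ⟨i, rfl⟩)
  have hΩT : ∀ k, ∀ y ∈ V, InGerm (fun _ : Set N => gens12 I' (range θ ∪ range σ₁) S) y 2 (Ω₂ k) :=
    fun k y hy => by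
      rcases hS₂ k with h1 | h1
      · exact InGerm.gen isOpen_univ (mem_univ _) h1
      · exact InGerm.congr hT (Filter.mem_of_superset (hV.isOpen.mem_nhds hy) fun z hz => (h1 z hz).symm)
          (InGerm.zero 2)
  have hsec : ∀ φ y, IsSectionAt I' W y φ → InGerm (pfaffianGens I' W) y 1 φ ∧
      InGerm (pfaffianGens I' W) y 2 (extd I' φ) := fun φ y hφ => by
    obtain ⟨V', hV', hy, -, h1⟩ := IsSectionAt.exists_mem_sections (ι := Unit) (fun _ => hφ) univ_mem
    exact ⟨InGerm.gen hV' hy (h1 ()), InGerm.gen hV' hy ⟨φ, h1 (), rfl⟩⟩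
  have hsm : ∀ {φ : DForm I' N 1} {y}, IsSectionAt I' W y φ → SmoothAt I' (extd I' φ) y := fun hφ =>
    SmoothAt.extd (hφ.eventually.mono fun w hw => hw.smoothAt)
  ext φ
  rw [mem_generated hT hU, pfaffian_eq, mem_generated (restricts_pfaffianGens _) hU]
  refine and_congr_right fun _ => forall₂_congr fun y hy => ?_
  have hfr := hV.frame₁ y (hUV hy)
  constructor
  · rintro ⟨U', hU', hyU', h1⟩
    refine h1.inGerm hU' hyU' hT (pfaffianGens_cases (fun β hβ => ?_) fun β hβ => ?_)
    · exact hfr.inGerm hT (hθT y) (isSectionAt_of_mem_sections hU' hyU' hβ)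
    · have hβ' := isSectionAt_of_mem_sections hU' hyU' hβ
      obtain ⟨a, ha⟩ := hfr.exists_coeff hβ'
      refine hfr.inGerm_of_bil_eq_sum hT (hθT y) (fun k => hΩT k y (hUV hy))
        (f := fun k => a (Sum.inl k)) ?_ ?_
      · filter_upwards [hβ'.eventually, hV.isOpen.mem_nhds (hUV hy)] with z hz hzV
        exact ⟨hsm hz, fun k => hV.smooth₂ k z hzV⟩
      · filter_upwards [ha, hβ'.eventually, hV.isOpen.mem_nhds (hUV hy)] with z haz hz hzV
        refine ⟨fun k => haz.1 _, fun u hu v hv => ?_⟩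
        rw [bil_extd_eq_sum (h.isPfaffian_top₂.isSubbundleAt (mem_univ z)) hz
          (fun i => (hV.frame₁ z hzV).isSectionAt i) haz.2 hu hv, Fintype.sum_sum_type]
        have h2 : ∀ i, bil (extd I' (σ₁ i) z) u v = 0 := fun i => by
          obtain ⟨V', hV', hzV', -, h3⟩ := IsSectionAt.exists_mem_sections (ι := Unit)
            (fun _ => hV.section₁ i z hzV) univ_mem
          exact h.isLargestIntegrable.integrable V' hV' (subset_univ _) _ (h3 ()) z hzV' u
            (annSub_anti (h.isLargestIntegrable.le z) hu) v (annSub_anti (h.isLargestIntegrable.le z) hv)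
        simp only [Sum.elim_inl, Sum.elim_inr, h2, mul_zero, Finset.sum_const_zero, add_zero]
        exact Finset.sum_congr rfl fun k _ => congrArg (_ * ·) (hV.bil₂ k z hzV u hu v hv).symm
  · rintro ⟨U', hU', hyU', h1⟩
    refine h1.inGerm hU' hyU' (restricts_pfaffianGens _) (gens12_cases ?_ fun ρ hρ => ?_)
    · rintro _ (⟨i, rfl⟩ | ⟨i, rfl⟩)
      · exact (hsec _ y (hfr.isSectionAt (Sum.inl i))).1
      · exact (hsec _ y (hfr.isSectionAt (Sum.inr i))).1
    · obtain ⟨k, rfl⟩ := hS hρ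
      refine hfr.inGerm_of_bil_eq_sum (restricts_pfaffianGens _) (fun i => (hsec _ y (hfr.isSectionAt i)).1)
        (η := fun _ : Unit => extd I' (θ k)) (f := fun _ _ => 1)
        (fun _ => (hsec _ y (hfr.isSectionAt (Sum.inl k))).2) ?_ ?_
      · filter_upwards [hV.isOpen.mem_nhds (hUV hy)] with z hzV
        exact ⟨hV.smooth₂ k z hzV, fun _ => hsm ((hV.frame₁ z hzV).isSectionAt (Sum.inl k))⟩
      · filter_upwards [hV.isOpen.mem_nhds (hUV hy)] with z hzV
        refine ⟨fun _ => contMDiffAt_const, fun u hu v hv => ?_⟩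
        rw [Fintype.sum_unique, one_mul]
        exact hV.bil₂ k z hzV u hu v hv

end IsSplitQuotient
end Generation

section Decomposability

open Filter Topology Module

theorem Covector.apply_of_eq_zero {V : Type*} [AddCommGroup V] [Module ℝ V] [TopologicalSpace V]
    (c : Covector V) {v : V} (hv : v = 0) : c (fun _ => v) = 0 := by
  rw [hv, Covector.map_zero]

theorem two_le_of_mem_Lambda2 {V : Type*} [AddCommGroup V] [Module ℝ V] [TopologicalSpace V] {n : ℕ}
    {σ : Fin n → Covector V} {ρ : V [⋀^Fin 2]→L[ℝ] ℝ}
    (h : ρ ∈ Lambda2 (Submodule.span ℝ (range σ))) (h0 : ρ ≠ 0) : 2 ≤ n := by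
  by_contra hn
  obtain ⟨c, hc⟩ : ∃ c : Covector V, Submodule.span ℝ (range σ) ≤ Submodule.span ℝ {c} := by
    by_cases h1 : Nonempty (Fin n)
    · obtain ⟨i⟩ := h1
      refine ⟨σ i, Submodule.span_mono ?_⟩
      rintro _ ⟨j, rfl⟩
      rw [show j = i by ext; omega]
      rfl
    · rw [not_nonempty_iff] at h1
      exact ⟨0, by rw [range_eq_empty, Submodule.span_empty]; exact bot_le⟩
  have h2 : Lambda2 (Submodule.span ℝ (range σ)) ≤ ⊥ := by
    refine Submodule.span_le.2 ?_
    rintro _ ⟨a, ha, b, hb, rfl⟩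
    obtain ⟨s, rfl⟩ := Submodule.mem_span_singleton.1 (hc ha)
    obtain ⟨t, rfl⟩ := Submodule.mem_span_singleton.1 (hc hb)
    refine (Submodule.mem_bot ℝ).2 (bil_ext fun u v => ?_)
    rw [bil_wedge, bil_zero_left]
    change s * c (fun _ => u) * (t * c fun _ => v) - s * c (fun _ => v) * (t * c fun _ => u) = 0
    ring
  exact h0 ((Submodule.mem_bot ℝ).1 (h2 h))

variable {E : Type*} [NormedAddCommGroup E] [NormedSpace ℝ E] [FiniteDimensional ℝ E]
  {H : Type*} [TopologicalSpace H] {I : ModelWithCorners ℝ E H} [I.Boundaryless]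
  {M : Type*} [TopologicalSpace M] [ChartedSpace H M] [IsManifold I ∞ M]
  {E₁ : Type*} [NormedAddCommGroup E₁] [NormedSpace ℝ E₁] [FiniteDimensional ℝ E₁]
  {H₁ : Type*} [TopologicalSpace H₁] {I₁ : ModelWithCorners ℝ E₁ H₁} [I₁.Boundaryless]
  {M₁ : Type*} [TopologicalSpace M₁] [ChartedSpace H₁ M₁] [IsManifold I₁ ∞ M₁]
  {E₂ : Type*} [NormedAddCommGroup E₂] [NormedSpace ℝ E₂] [FiniteDimensional ℝ E₂]
  {H₂ : Type*} [TopologicalSpace H₂] {I₂ : ModelWithCorners ℝ E₂ H₂} [I₂.Boundaryless]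
  {M₂ : Type*} [TopologicalSpace M₂] [ChartedSpace H₂ M₂] [IsManifold I₂ ∞ M₂]
  {E' : Type*} [NormedAddCommGroup E'] [NormedSpace ℝ E'] [FiniteDimensional ℝ E']
  {H' : Type*} [TopologicalSpace H'] {I' : ModelWithCorners ℝ E' H'} [I'.Boundaryless]
  {N : Type*} [TopologicalSpace N] [ChartedSpace H' N] [IsManifold I' ∞ N]

theorem exists_nonvanishing_subfamily {r k : ℕ} (Ω : Fin r → DForm I M k) (x : M) :
    ∃ (s : ℕ) (e : Fin s → Fin r), (∀ a, ¬ ∀ᶠ y in 𝓝 x, Ω (e a) y = 0) ∧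
      ∃ V, IsOpen V ∧ x ∈ V ∧ ∀ i, i ∈ range e ∨ ∀ y ∈ V, Ω i y = 0 := by
  classical
  let e := (Fintype.equivFin {i // ¬ ∀ᶠ y in 𝓝 x, Ω i y = 0}).symm
  have h : ∀ᶠ y in 𝓝 x, ∀ i, (∀ᶠ y in 𝓝 x, Ω i y = 0) → Ω i y = 0 := by
    refine eventually_all.2 fun i => ?_
    by_cases hi : ∀ᶠ y in 𝓝 x, Ω i y = 0
    · exact hi.mono fun y hy _ => hy
    · exact Eventually.of_forall fun y hi' => absurd hi' hi
  obtain ⟨V, hV, hx, h⟩ := exists_open_of_eventually h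
  refine ⟨_, fun a => (e a).1, fun a => (e a).2, V, hV, hx, fun i => ?_⟩
  by_cases hi : ∀ᶠ y in 𝓝 x, Ω i y = 0
  · exact Or.inr fun y hy => h y hy i hi
  · exact Or.inl ⟨e.symm ⟨i, hi⟩, by simp⟩

theorem exists_ne_zero_of_not_eventually {k : ℕ} {φ : DForm I M k} {x : M}
    (h : ¬ ∀ᶠ y in 𝓝 x, φ y = 0) (V : Set M) (hV : IsOpen V) (hx : x ∈ V) : ∃ y ∈ V, φ y ≠ 0 := by
  by_contra! h'
  exact h (Filter.mem_of_superset (hV.mem_nhds hx) h')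

variable {p₁ : M → M₁} {p₂ : M → M₂} {q : M → N} {W₁ : CoField I₁ M₁} {W₂ : CoField I₂ M₂}
  {V : Set N} {r m n : ℕ} {θ : Fin r → DForm I' N 1} {σ₁ : Fin m → DForm I' N 1}
  {σ₂ : Fin n → DForm I' N 1} {Ω₁ Ω₂ : Fin r → DForm I' N 2}

namespace IsSplitQuotient

/-- As `W₁` is nowhere integrable, the components of the structure equations do not all vanish. -/
theorem exists_component_ne_zero₂ (h : IsSplitQuotient I I₁ I₂ I' p₁ p₂ q W₁ W₂)
    (hV : IsAdaptedCoframe I I₁ I₂ I' p₁ p₂ q W₁ W₂ V θ σ₁ σ₂ Ω₁ Ω₂) {y₀ : N} (hy₀ : y₀ ∈ V) :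
    ∃ k, ¬ ∀ᶠ y in 𝓝 y₀, Ω₂ k y = 0 := by
  by_contra! hall
  obtain ⟨V', hV', hy', h0⟩ := exists_open_of_eventually
    ((eventually_all.2 hall).and (hV.isOpen.mem_nhds hy₀))
  obtain ⟨x, rfl⟩ := h.surjective y₀
  obtain ⟨ι, hι, hx, h1, h2⟩ := h.split.slice₁ x
  have hc : Continuous fun z => q (ι z) := h.smooth.continuous.comp hι.continuous
  let U : Set M₁ := (fun z => q (ι z)) ⁻¹' V'
  have hU : IsOpen U := hV'.preimage hc
  have hxU : p₁ x ∈ U := by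
    change q (ι (p₁ x)) ∈ V'
    rw [hx]
    exact hy'
  obtain ⟨d, hd⟩ := IsSubbundleOn.exists_finrank h.pfaffian₁
  have hsub : IsSubbundleOn I₁ U W₁ := isSubbundleOn_of_extends hU d (fun z _ => hd z (mem_univ z))
    fun z _ c hc => (h.isSubbundleAt₁ z).exists_section hc
  have hint : IsIntegrableOn I₁ U W₁ := by
    intro U' hU' hU'U β hβ z hz u hu v hv
    have hβ' : IsSectionAt I₁ W₁ (p₁ (ι z)) β := by
      rw [h1 z]
      exact isSectionAt_of_mem_sections hU' hz hβ
    obtain ⟨f, hf⟩ := h.exists_bil_extd_eq hV (h0 _ (hU'U hz)).2 hβ'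
    have hann : ∀ w ∈ annSub (W₁ z), (mfd I₁ I ι z w : E) ∈
        (annSub (sumBundle I I₁ I₂ p₁ p₂ W₁ W₂ (ι z)) : Submodule ℝ (TangentSpace I (ι z))) := fun w hw => by
      have h3 := h.split.mfd_slice hι h1 h2 z w
      have h4 : ∀ z', z' = z → ∀ c ∈ W₁ z', (c : Covector E₁) (fun _ => w) = 0 := by
        rintro _ rfl c hc
        exact hw c hc
      refine mem_annSub_sumBundle.2 ⟨fun c hc => ?_, fun c hc => ?_⟩
      · exact (congrArg (fun w : E₁ => (c : Covector E₁) fun _ => w) h3.1).trans (h4 _ (h1 z) c hc)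
      · have h5 : ∀ (c : Covector E₂) (w : E₂), w = 0 → c (fun _ => w) = 0 := fun c _ hw =>
          c.apply_of_eq_zero hw
        exact h5 c _ h3.2
    have h5 := hf.self_of_nhds.2 _ (hann u hu) _ (hann v hv)
    rw [Finset.sum_eq_zero fun k _ => by
      rw [(h0 _ (hU'U hz)).1 k, bil_zero_left, mul_zero]] at h5
    refine Eq.trans ?_ h5
    refine (bil_congr_point (extd I₁ β) (h1 z) u v).symm.trans ?_
    exact congrArg₂ (fun a b : E₁ => ((bil (extd I₁ β (p₁ (ι z))) : E₁ →ₗ[ℝ] E₁ →ₗ[ℝ] ℝ) a) b)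
      (h.split.mfd_slice hι h1 h2 z u).1.symm (h.split.mfd_slice hι h1 h2 z v).1.symm
  exact h.ne_bot₁ (p₁ x)
    (le_bot_iff.1 (h.largest₁.largest U hU W₁ hsub hint (fun _ _ => le_rfl) _ hxU))

theorem two_le_of_isAdaptedCoframe (h : IsSplitQuotient I I₁ I₂ I' p₁ p₂ q W₁ W₂)
    (hV : IsAdaptedCoframe I I₁ I₂ I' p₁ p₂ q W₁ W₂ V θ σ₁ σ₂ Ω₁ Ω₂) (hne : V.Nonempty) : 2 ≤ n := by
  obtain ⟨y₀, hy₀⟩ := hne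
  obtain ⟨k, hk⟩ := h.exists_component_ne_zero₂ hV hy₀
  obtain ⟨y, hy, hk⟩ := exists_ne_zero_of_not_eventually hk V hV.isOpen hy₀
  exact two_le_of_mem_Lambda2 (hV.lambda₂ k y hy) hk

theorem isDecomposable (h : IsSplitQuotient I I₁ I₂ I' p₁ p₂ q W₁ W₂) :
    ∃ m n, IsDecomposable I' m n (quotientSystem I I' q (sumSystem I I₁ I₂ p₁ p₂ W₁ W₂))
      (pfaffian I' (quotientSum I I₁ I₂ I' p₁ p₂ q W₁ fun _ => ⊤))
      (pfaffian I' (quotientSum I I₁ I₂ I' p₁ p₂ q (fun _ => ⊤) W₂)) := by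
  have hdiff : IsDifferentialSystem I' (quotientSystem I I' q (sumSystem I I₁ I₂ p₁ p₂ W₁ W₂)) :=
    isDifferentialSystem_quotientSystem h.smooth
      ((isDifferentialSystem_generated_sumGens h.split).of_eq fun U hU k => sumSystem_eq h.split hU k)
  rcases isEmpty_or_nonempty N with hN | ⟨⟨y₀⟩⟩
  · exact ⟨2, 2, le_rfl, le_rfl, hdiff, fun y => hN.elim y⟩
  obtain ⟨d, hd⟩ := h.isPfaffian.exists_finrank
  obtain ⟨d₁, hd₁⟩ := h.isPfaffian_top₂.exists_finrank
  obtain ⟨d₂, hd₂⟩ := IsSubbundleOn.exists_finrank h.symm.isPfaffian_top₂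
  rw [quotientSum_symm p₁ p₂ q] at hd₂
  have key : ∀ y₀ : N, ∃ (V : Set N) (θ : Fin d → DForm I' N 1) (σ₁ : Fin (d₁ - d) → DForm I' N 1)
      (σ₂ : Fin (d₂ - d) → DForm I' N 1) (Ω₁ Ω₂ : Fin d → DForm I' N 2),
      y₀ ∈ V ∧ IsAdaptedCoframe I I₁ I₂ I' p₁ p₂ q W₁ W₂ V θ σ₁ σ₂ Ω₁ Ω₂ ∧
      ∀ y ∈ V, IsFrameAt I' (fun _ => ⊤) y (Sum.elim θ (Sum.elim σ₁ σ₂)) := fun y₀ => by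
    have := h.exists_isAdaptedCoframe y₀
    rwa [hd y₀ (mem_univ _), hd₁ y₀ (mem_univ _), hd₂ y₀ (mem_univ _)] at this
  obtain ⟨V₀, _, _, _, _, _, hy₀, hV₀, -⟩ := key y₀
  refine ⟨d₁ - d, d₂ - d, h.symm.two_le_of_isAdaptedCoframe hV₀.symm ⟨y₀, hy₀⟩,
    h.two_le_of_isAdaptedCoframe hV₀ ⟨y₀, hy₀⟩, hdiff, fun y => ?_⟩
  obtain ⟨V, θ, σ₁, σ₂, Ω₁, Ω₂, hy, hV, hfr⟩ := key y
  obtain ⟨s, e₁, he₁, V₁, hV₁, hy₁, hz₁⟩ := exists_nonvanishing_subfamily Ω₁ y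
  obtain ⟨t, e₂, he₂, V₂, hV₂, hy₂, hz₂⟩ := exists_nonvanishing_subfamily Ω₂ y
  have hU : IsAdaptedCoframe I I₁ I₂ I' p₁ p₂ q W₁ W₂ (V ∩ (V₁ ∩ V₂)) θ σ₁ σ₂ Ω₁ Ω₂ :=
    hV.mono (hV.isOpen.inter (hV₁.inter hV₂)) inter_subset_left
  have hyU : y ∈ V ∩ (V₁ ∩ V₂) := ⟨hy, hy₁, hy₂⟩
  have hpos : ∀ {Ω : Fin d → DForm I' N 2} {s : ℕ} {e : Fin s → Fin d} {V' : Set N}, IsOpen V' → y ∈ V' →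
      (∀ i, i ∈ range e ∨ ∀ y ∈ V', Ω i y = 0) → (∃ k, ¬ ∀ᶠ y in 𝓝 y, Ω k y = 0) → 1 ≤ s := by
    rintro Ω s e V' hV' hy' hz ⟨k, hk⟩
    rcases hz k with ⟨a, -⟩ | hk'
    · exact Nat.one_le_iff_ne_zero.2 fun hs => (hs ▸ a).elim0
    · exact absurd (Filter.mem_of_superset (hV'.mem_nhds hy') hk') hk
  have hz₁' : ∀ k, Ω₁ k ∈ range (fun a => Ω₁ (e₁ a)) ∨ ∀ y ∈ V ∩ (V₁ ∩ V₂), Ω₁ k y = 0 := fun k =>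
    (hz₁ k).imp (fun ⟨a, ha⟩ => ⟨a, congrArg Ω₁ ha⟩) fun hk y hy => hk y hy.2.1
  have hz₂' : ∀ k, Ω₂ k ∈ range (fun a => Ω₂ (e₂ a)) ∨ ∀ y ∈ V ∩ (V₁ ∩ V₂), Ω₂ k y = 0 := fun k =>
    (hz₂ k).imp (fun ⟨a, ha⟩ => ⟨a, congrArg Ω₂ ha⟩) fun hk y hy => hk y hy.2.2
  have hr₁ : range (fun a => Ω₁ (e₁ a)) ⊆ range Ω₁ := range_subset_iff.2 fun a => mem_range_self _
  have hr₂ : range (fun a => Ω₂ (e₂ a)) ⊆ range Ω₂ := range_subset_iff.2 fun a => mem_range_self _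
  refine ⟨V ∩ (V₁ ∩ V₂), hU.isOpen, hyU, d, s, t, hpos hV₁ hy₁ hz₁ (h.symm.exists_component_ne_zero₂ hV.symm hy),
    hpos hV₂ hy₂ hz₂ (h.exists_component_ne_zero₂ hV hy), θ, σ₁, σ₂, fun a => Ω₁ (e₁ a), fun a => Ω₂ (e₂ a),
    fun i z hz => (hfr z hz.1).self_of_nhds.1 (Sum.inl i),
    fun i z hz => (hfr z hz.1).self_of_nhds.1 (Sum.inr (Sum.inl i)),
    fun i z hz => (hfr z hz.1).self_of_nhds.1 (Sum.inr (Sum.inr i)),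
    fun a z hz => hU.smooth₁ _ z hz, fun a z hz => hU.smooth₂ _ z hz, fun z hz => ?_,
    fun a z hz => hU.lambda₁ _ z hz, fun a z hz => hU.lambda₂ _ z hz,
    fun a => exists_ne_zero_of_not_eventually (he₁ a), fun a => exists_ne_zero_of_not_eventually (he₂ a),
    h.algGeneratedOn hU (union_subset_union hr₁ hr₂) (fun k => (hz₁' k).imp_left Or.inl)
      (fun k => (hz₂' k).imp_left Or.inr), h.algGeneratedOn₁ hU hr₂ hz₂', ?_⟩
  · have h1 := (hfr z hz.1).self_of_nhds.2
    have h2 : (fun i => Sum.elim θ (Sum.elim σ₁ σ₂) i z) =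
        Sum.elim (fun i => θ i z) (Sum.elim (fun i => σ₁ i z) fun i => σ₂ i z) := by
      funext i
      rcases i with i | i | i <;> rfl
    rwa [h2] at h1
  · rw [← quotientSum_symm p₁ p₂ q]
    exact h.symm.algGeneratedOn₁ hU.symm hr₁ hz₁'

theorem isDecomposableDarbouxIntegrable (h : IsSplitQuotient I I₁ I₂ I' p₁ p₂ q W₁ W₂) :
    IsDecomposableDarbouxIntegrable I' (quotientSystem I I' q (sumSystem I I₁ I₂ p₁ p₂ W₁ W₂))
      (quotientSum I I₁ I₂ I' p₁ p₂ q W₁ fun _ => ⊤) (quotientSum I I₁ I₂ I' p₁ p₂ q (fun _ => ⊤) W₂) :=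
  ⟨h.isDecomposable, _, _, h.isDarbouxPair⟩

end IsSplitQuotient
end Decomposability

section Products

variable {EG : Type*} [NormedAddCommGroup EG] [NormedSpace ℝ EG] [FiniteDimensional ℝ EG]
  {G : Type*} [TopologicalSpace G] [ChartedSpace EG G] [Group G] [LieGroup 𝓘(ℝ, EG) ∞ G]
  {E₁ : Type*} [NormedAddCommGroup E₁] [NormedSpace ℝ E₁] [FiniteDimensional ℝ E₁]
  {H₁ : Type*} [TopologicalSpace H₁] {I₁ : ModelWithCorners ℝ E₁ H₁} [I₁.Boundaryless]
  {M₁ : Type*} [TopologicalSpace M₁] [ChartedSpace H₁ M₁] [IsManifold I₁ ∞ M₁] [MulAction G M₁]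
  {E₂ : Type*} [NormedAddCommGroup E₂] [NormedSpace ℝ E₂] [FiniteDimensional ℝ E₂]
  {H₂ : Type*} [TopologicalSpace H₂] {I₂ : ModelWithCorners ℝ E₂ H₂} [I₂.Boundaryless]
  {M₂ : Type*} [TopologicalSpace M₂] [ChartedSpace H₂ M₂] [IsManifold I₂ ∞ M₂] [MulAction G M₂]
  {E' : Type*} [NormedAddCommGroup E'] [NormedSpace ℝ E'] [FiniteDimensional ℝ E']
  {H' : Type*} [TopologicalSpace H'] {I' : ModelWithCorners ℝ E' H'} [I'.Boundaryless]
  {N : Type*} [TopologicalSpace N] [ChartedSpace H' N] [IsManifold I' ∞ N]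

theorem isSplitting_prod : IsSplitting (I₁.prod I₂) I₁ I₂ (Prod.fst : M₁ × M₂ → M₁) Prod.snd where
  smooth₁ := contMDiff_fst
  smooth₂ := contMDiff_snd
  isOpenMap₁ := isOpenMap_fst
  isOpenMap₂ := isOpenMap_snd
  eq_zero x v h1 h2 := by
    rw [mfderiv_fst] at h1
    rw [mfderiv_snd] at h2
    exact Prod.ext h1 h2
  slice₁ x := ⟨fun z => (z, x.2), contMDiff_id.prodMk contMDiff_const, rfl, fun _ => rfl, fun _ => rfl⟩
  slice₂ x := ⟨fun z => (x.1, z), contMDiff_const.prodMk contMDiff_id, rfl, fun _ => rfl, fun _ => rfl⟩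

theorem preserves_sumBundle_prod (h₁ : IsSmoothAction 𝓘(ℝ, EG) G I₁ M₁)
    (h₂ : IsSmoothAction 𝓘(ℝ, EG) G I₂ M₂) (h : IsSmoothAction 𝓘(ℝ, EG) G (I₁.prod I₂) (M₁ × M₂))
    {A : CoField I₁ M₁} {B : CoField I₂ M₂} (hA : Preserves G I₁ A) (hB : Preserves G I₂ B) :
    Preserves G (I₁.prod I₂) (sumBundle (I₁.prod I₂) I₁ I₂ Prod.fst Prod.snd A B) := by
  intro g x φ hφ
  obtain ⟨a, ha, b, hb, rfl⟩ := mem_sumBundle.1 hφ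
  have d1 : ∀ y : M₁ × M₂, MDifferentiableAt (I₁.prod I₂) I₁ Prod.fst y := fun y => mdifferentiableAt_fst
  have d2 : ∀ y : M₁ × M₂, MDifferentiableAt (I₁.prod I₂) I₂ Prod.snd y := fun y => mdifferentiableAt_snd
  have d := ((h.smul g) x).mdifferentiableAt (n := ∞) (by simp)
  have e1 := (pullbackAt_comp (I := I₁.prod I₂) (d1 (g • x)) d a).symm.trans
    (pullbackAt_comp (I := I₁.prod I₂) (((h₁.smul g) x.1).mdifferentiableAt (n := ∞) (by simp)) (d1 x) a)
  have e2 := (pullbackAt_comp (I := I₁.prod I₂) (d2 (g • x)) d b).symm.trans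
    (pullbackAt_comp (I := I₁.prod I₂) (((h₂.smul g) x.2).mdifferentiableAt (n := ∞) (by simp)) (d2 x) b)
  refine mem_sumBundle.2 ⟨_, hA g x.1 a ha, _, hB g x.2 b hb, ?_⟩
  rw [map_add]
  exact (congrArg₂ (· + ·) e1 e2).symm

theorem preserves_top : Preserves G I₁ (fun _ : M₁ => ⊤) := fun _ _ _ _ => trivial

theorem preserves_bot : Preserves G I₁ (fun _ : M₁ => ⊥) := fun g x φ hφ => by
  rw [(Submodule.mem_bot ℝ).1 hφ, map_zero]
  exact Submodule.zero_mem _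

theorem isSplitQuotient_prod [T2Space G] [SecondCountableTopology G] {W₁ : CoField I₁ M₁}
    {W₂ : CoField I₂ M₂} {q : M₁ × M₂ → N} (hW₁ : IsPfaffian I₁ W₁) (hW₂ : IsPfaffian I₂ W₂)
    (hn₁ : ∀ x, W₁ x ≠ ⊥) (hn₂ : ∀ x, W₂ x ≠ ⊥) (hl₁ : IsLargestIntegrable I₁ W₁ (fun _ => ⊥))
    (hl₂ : IsLargestIntegrable I₂ W₂ (fun _ => ⊥)) (h₁ : IsSmoothAction 𝓘(ℝ, EG) G I₁ M₁)
    (h₂ : IsSmoothAction 𝓘(ℝ, EG) G I₂ M₂) (hf₁ : IsFreeAction G M₁) (hf₂ : IsFreeAction G M₂)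
    (hp₁ : Preserves G I₁ W₁) (hp₂ : Preserves G I₂ W₂) (ht₁ : IsTransverse 𝓘(ℝ, EG) G I₁ W₁)
    (ht₂ : IsTransverse 𝓘(ℝ, EG) G I₂ W₂) (hq : IsRegularQuotient 𝓘(ℝ, EG) G (I₁.prod I₂) I' q) :
    IsSplitQuotient (I₁.prod I₂) I₁ I₂ I' Prod.fst Prod.snd q W₁ W₂ := by
  have hD : ∀ {A : CoField I₁ M₁} {B : CoField I₂ M₂}, Preserves G I₁ A → Preserves G I₂ B →
      Descends (I₁.prod I₂) I' q (sumBundle (I₁.prod I₂) I₁ I₂ Prod.fst Prod.snd A B) :=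
    fun hA hB => (preserves_sumBundle_prod h₁ h₂ hq.smooth_action hA hB).descends hq
  have hzero : ∀ (x : M₁ × M₂) (ξ : TangentSpace 𝓘(ℝ, EG) (1 : G)), ξ = 0 →
      infGen 𝓘(ℝ, EG) G (I₁.prod I₂) ξ x = 0 := by
    rintro x _ rfl
    exact map_zero (mfd 𝓘(ℝ, EG) (I₁.prod I₂) (fun g : G => g • x) 1)
  exact
    { split := isSplitting_prod
      smooth := hq.smooth
      submersion := hq.submersion
      surjective := hq.surjective
      pfaffian₁ := hW₁
      pfaffian₂ := hW₂
      ne_bot₁ := hn₁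
      ne_bot₂ := hn₂
      largest₁ := hl₁
      largest₂ := hl₂
      descends := hD hp₁ hp₂
      descends_top₁ := hD preserves_top hp₂
      descends_top₂ := hD hp₁ preserves_top
      descends₁ := hD preserves_top preserves_bot
      descends₂ := hD preserves_bot preserves_top
      transverse₁ := fun x v hv hv' => by
        obtain ⟨ξ, rfl⟩ := exists_infGen_eq hq x hv
        rw [mfderiv_fst, infGen_prod h₁ h₂ ξ x] at hv'
        exact hzero x ξ (eq_zero_of_infGen_eq_zero h₁ hf₁ (ht₁ x.1 ξ hv'))
      transverse₂ := fun x v hv hv' => by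
        obtain ⟨ξ, rfl⟩ := exists_infGen_eq hq x hv
        rw [mfderiv_snd, infGen_prod h₁ h₂ ξ x] at hv'
        exact hzero x ξ (eq_zero_of_infGen_eq_zero h₂ hf₂ (ht₂ x.2 ξ hv')) }

end Products

end EDS

end

theorem corollary3p4
    -- a Lie group
    {EG : Type*} [NormedAddCommGroup EG] [NormedSpace ℝ EG] [FiniteDimensional ℝ EG]
    {G : Type*} [TopologicalSpace G] [ChartedSpace EG G] [Group G] [LieGroup 𝓘(ℝ, EG) ∞ G]
    [T2Space G] [SecondCountableTopology G]
    -- a manifold with an action of the Lie group, and its orbit space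
    {E : Type*} [NormedAddCommGroup E] [NormedSpace ℝ E] [FiniteDimensional ℝ E]
    {H : Type*} [TopologicalSpace H] (I : ModelWithCorners ℝ E H) [I.Boundaryless]
    {M : Type*} [TopologicalSpace M] [ChartedSpace H M] [IsManifold I ∞ M]
    [T2Space M] [SecondCountableTopology M] [MulAction G M]
    {EB : Type*} [NormedAddCommGroup EB] [NormedSpace ℝ EB] [FiniteDimensional ℝ EB]
    {B : Type*} [TopologicalSpace B] [ChartedSpace EB B] [IsManifold 𝓘(ℝ, EB) ∞ B] [T2Space B]
    -- two manifolds with actions of the Lie group, and the orbit space of their product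
    {E₁ : Type*} [NormedAddCommGroup E₁] [NormedSpace ℝ E₁] [FiniteDimensional ℝ E₁]
    {M₁ : Type*} [TopologicalSpace M₁] [ChartedSpace E₁ M₁] [IsManifold 𝓘(ℝ, E₁) ∞ M₁]
    [T2Space M₁] [SecondCountableTopology M₁] [MulAction G M₁]
    {E₂ : Type*} [NormedAddCommGroup E₂] [NormedSpace ℝ E₂] [FiniteDimensional ℝ E₂]
    {M₂ : Type*} [TopologicalSpace M₂] [ChartedSpace E₂ M₂] [IsManifold 𝓘(ℝ, E₂) ∞ M₂]
    [T2Space M₂] [SecondCountableTopology M₂] [MulAction G M₂]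
    {EQ : Type*} [NormedAddCommGroup EQ] [NormedSpace ℝ EQ] [FiniteDimensional ℝ EQ]
    {Q : Type*} [TopologicalSpace Q] [ChartedSpace EQ Q] [IsManifold 𝓘(ℝ, EQ) ∞ Q] [T2Space Q] :
    -- the quotient of `𝓦₁ + 𝓦₂` is decomposable and Darboux integrable
    (∀ (W₁ : EDS.CoField 𝓘(ℝ, E₁) M₁) (W₂ : EDS.CoField 𝓘(ℝ, E₂) M₂) (q : M₁ × M₂ → Q),
      EDS.IsPfaffian 𝓘(ℝ, E₁) W₁ → EDS.IsPfaffian 𝓘(ℝ, E₂) W₂ →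
      (∀ x, W₁ x ≠ ⊥) → (∀ x, W₂ x ≠ ⊥) →
      EDS.IsLargestIntegrable 𝓘(ℝ, E₁) W₁ (fun _ => ⊥) →
      EDS.IsLargestIntegrable 𝓘(ℝ, E₂) W₂ (fun _ => ⊥) →
      EDS.IsSmoothAction 𝓘(ℝ, EG) G 𝓘(ℝ, E₁) M₁ → EDS.IsSmoothAction 𝓘(ℝ, EG) G 𝓘(ℝ, E₂) M₂ →
      EDS.IsFreeAction G M₁ → EDS.IsFreeAction G M₂ →
      EDS.Preserves G 𝓘(ℝ, E₁) W₁ → EDS.Preserves G 𝓘(ℝ, E₂) W₂ →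
      EDS.IsTransverse 𝓘(ℝ, EG) G 𝓘(ℝ, E₁) W₁ → EDS.IsTransverse 𝓘(ℝ, EG) G 𝓘(ℝ, E₂) W₂ →
      EDS.IsRegularQuotient 𝓘(ℝ, EG) G (𝓘(ℝ, E₁).prod 𝓘(ℝ, E₂)) 𝓘(ℝ, EQ) q →
      EDS.IsDecomposableDarbouxIntegrable 𝓘(ℝ, EQ)
        (EDS.quotientSystem (𝓘(ℝ, E₁).prod 𝓘(ℝ, E₂)) 𝓘(ℝ, EQ) q
          (EDS.directSum 𝓘(ℝ, E₁) 𝓘(ℝ, E₂)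
            (EDS.pfaffian 𝓘(ℝ, E₁) W₁) (EDS.pfaffian 𝓘(ℝ, E₂) W₂)))
        (EDS.quotientBundle (𝓘(ℝ, E₁).prod 𝓘(ℝ, E₂)) 𝓘(ℝ, EQ) q
          (EDS.directSumBundle 𝓘(ℝ, E₁) 𝓘(ℝ, E₂) W₁ (fun _ => ⊤)))
        (EDS.quotientBundle (𝓘(ℝ, E₁).prod 𝓘(ℝ, E₂)) 𝓘(ℝ, EQ) q
          (EDS.directSumBundle 𝓘(ℝ, E₁) 𝓘(ℝ, E₂) (fun _ => ⊤) W₂))) ∧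
    -- the quotient of `𝓦₁ ⊞ 𝓦₂`, for a Darboux pair
    (∀ (W₁ F₁ W₂ F₂ : EDS.CoField I M) (q : M → B),
      EDS.IsDarbouxPair I W₁ F₁ W₂ F₂ →
      EDS.IsRegularQuotient 𝓘(ℝ, EG) G I 𝓘(ℝ, EB) q →
      EDS.Preserves G I W₁ → EDS.Preserves G I W₂ →
      EDS.IsTransverse 𝓘(ℝ, EG) G I (fun x => F₁ x ⊓ W₂ x) →
      EDS.IsTransverse 𝓘(ℝ, EG) G I (fun x => W₁ x ⊓ F₂ x) →
      ∀ U, IsOpen U →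
        EDS.quotientSystem I 𝓘(ℝ, EB) q (EDS.boxSum I (EDS.pfaffian I W₁) (EDS.pfaffian I W₂)) U =
        EDS.boxSum 𝓘(ℝ, EB)
          (EDS.quotientSystem I 𝓘(ℝ, EB) q (EDS.pfaffian I W₁))
          (EDS.quotientSystem I 𝓘(ℝ, EB) q (EDS.pfaffian I W₂)) U) := by
  exact
    ⟨fun W₁ W₂ q hW₁ hW₂ hn₁ hn₂ hl₁ hl₂ h₁ h₂ hf₁ hf₂ hp₁ hp₂ ht₁ ht₂ hq =>
      (EDS.isSplitQuotient_prod hW₁ hW₂ hn₁ hn₂ hl₁ hl₂ h₁ h₂ hf₁ hf₂ hp₁ hp₂ ht₁ ht₂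
        hq).isDecomposableDarbouxIntegrable,
      fun W₁ F₁ W₂ F₂ q hW hq h₁ h₂ ht₁ ht₂ U _ => hW.quotientSystem_boxSum hq h₁ h₂ ht₁ ht₂ U⟩
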